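/- Let $n\ge 1$. An \emph{even asymptotically hyperbolic} space is a compact $n$-manifold with boundary $\overline X$, with interior $X$ carrying a Riemannian metric $g=\hat g/x^2$, where $x$ is a boundary defining function, $\hat g$ is a smooth Riemannian metric on $\overline X$ with $\hat g(dx,dx)=1$ on $Y=\partial\overline X$, and in a product decomposition $[0,\varepsilon)_x\times Y$ near the boundary $g=\frac{dx^2+h(x^2,y,dy)}{x^2}$ with $h(\mu,y,dy)$ a family of Riemannian metrics on $Y$ that is smooth in $(\mu,y)$ up to $\mu=0$. An \emph{even asymptotically de Sitter} space is defined in the same way with $g$, $\hat g$ Lorentzian of signature $(1,n-1)$ and $g=\frac{dx^2-h(x^2,y,dy)}{x^2}$ near the boundary, where moreover $\partial\overline X=Y_+\sqcup Y_-$ with $Y_\pm$ unions of connected components, and every maximally extended null geodesic of $g$ in $X$ is defined over $\mathbb R$ and tends to $Y_+$ as the parameter tends to $+\infty$ and to $Y_-$ as it tends to $-\infty$, or vice versa. The even version $\overline X_{\mathrm{even}}$ is $\overline X$ with the smooth structure near the boundary changed so that $(x^2,y)$ are smooth coordinates. Put $P_\sigma=-\Delta_g+\sigma^2+\left(\frac{n-1}2\right)^2$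 in the asymptotically hyperbolic case ($\Delta_g\ge0$) and $P_\sigma=\Box_g-\sigma^2-\left(\frac{n-1}2\right)^2$ in the asymptotically de Sitter case, where $\Delta_g$, resp. $\Box_g$, is $-\operatorname{div}\operatorname{grad}$ for $g$. Let even asymptotically hyperbolic spaces $(X_\pm,g_\pm)$ with $\partial\overline{X_\pm}=Y_\pm$ and a space $(X_0,g_0)$ with $\partial\overline{X_0}=Y_+\sqcup Y_-$ that is even asymptotically de Sitter, or two copies of such a space, be given, with their boundary defining functions $x_\bullet$ and product decompositions. Say that they \emph{fit together} if there are a compact manifold without boundary $$\tilde X=\overline{X_{+,\mathrm{even}}}\cup\overline{X_{0,\mathrm{even}}}\cup\overline{X_{-,\mathrm{even}}},$$ in which $\partial\overline{X_\pm}$ is identified with the part $Y_\pm$ of $\partial\overline{X_0}$ and the smooth structure near $Y_\pm$ is given by the product decompositions with $\mu=x_\pm^2$ on $\overline{X_\pm}$ and $\mu=-x_0^2$ on $\overline{X_0}$, and, for every $\sigma\in\mathbb C$, a differential operator $\tilde P_\sigma$ of order at most $2$ with smooth coefficients on $\tilde X$ whose restriction to each of $X_+,X_0,X_-$ is $$x_\bullet^{\imath\sigma-(n-1)/2-2}\,P_\sigma\,x_\bullet^{-\imath\sigma+(n-1)/2}.$$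 Then: (1) For every even asymptotically hyperbolic space $(X_+,g_+)$ there are an even asymptotically de Sitter space $(X_0,g_0)$ and an even asymptotically hyperbolic space $(X_-,g_-)$ such that $X_+,X_0,X_-$ fit together. (2) Let $(X_0,g_0)$ be an even asymptotically de Sitter space with boundary $Y_+\sqcup Y_-$. If $Y_\pm$ are the boundaries of compact manifolds $\overline{X_\pm}$, with chosen product decompositions near the boundary, then there are even asymptotically hyperbolic metrics $g_\pm$ on $X_\pm$ (with respect to these product decompositions) such that $X_+,X_0,X_-$ fit together. In any case there are even asymptotically hyperbolic spaces $(X_\pm,g_\pm)$, with boundaries two copies of $Y_\pm$, such that $X_+$, two copies of $X_0$, and $X_-$ fit together. -/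

import Mathlib

open Set Filter Topology
open scoped Manifold ContDiff Bundle

universe u

noncomputable section

/-! ### Manifolds

Throughout, `n = m + 1` is the dimension of the spaces under consideration and `m = n - 1` is the
dimension of their boundaries. -/

/-- A compact smooth (Hausdorff) manifold without boundary of dimension `d`. -/
structure ClosedManifold (d : ℕ) : Type (u + 1) where
  carrier : Type u
  [top : TopologicalSpace carrier]
  [charted : ChartedSpace (EuclideanSpace ℝ (Fin d)) carrier]
  [smooth : IsManifold (𝓡 d) ∞ carrier]
  [t2 : T2Space carrier]
  [compact : CompactSpace carrier]

/-- A compact smooth (Hausdorff) manifold with (possibly empty) boundary, of dimension `m + 1`. -/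
structure CompactManifoldWithBoundary (m : ℕ) : Type (u + 1) where
  carrier : Type u
  [top : TopologicalSpace carrier]
  [charted : ChartedSpace (EuclideanHalfSpace (m + 1)) carrier]
  [smooth : IsManifold (𝓡∂ (m + 1)) ∞ carrier]
  [t2 : T2Space carrier]
  [compact : CompactSpace carrier]

attribute [instance] ClosedManifold.top ClosedManifold.charted ClosedManifold.smooth
  ClosedManifold.t2 ClosedManifold.compact
attribute [instance] CompactManifoldWithBoundary.top CompactManifoldWithBoundary.charted
  CompactManifoldWithBoundary.smooth CompactManifoldWithBoundary.t2
  CompactManifoldWithBoundary.compact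

instance (d : ℕ) : CoeSort (ClosedManifold.{u} d) (Type u) := ⟨ClosedManifold.carrier⟩
instance (m : ℕ) : CoeSort (CompactManifoldWithBoundary.{u} m) (Type u) :=
  ⟨CompactManifoldWithBoundary.carrier⟩

/-- The coordinate space `ℝ^d`. -/
abbrev Eucl (d : ℕ) := EuclideanSpace ℝ (Fin d)

variable {m : ℕ}

/-- The interior of a compact manifold with boundary. -/
def CompactManifoldWithBoundary.interiorSet (X : CompactManifoldWithBoundary.{u} m) : Set X :=
  (𝓡∂ (m + 1)).interior X

/-- The boundary of a compact manifold with boundary. -/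
def CompactManifoldWithBoundary.boundarySet (X : CompactManifoldWithBoundary.{u} m) : Set X :=
  (𝓡∂ (m + 1)).boundary X

/-- A product decomposition of `X` near a union of boundary components: a diffeomorphism `φ` of
`[0, ε) × Y` onto an open subset of `X`, taking `{0} × Y` to the part of the boundary of `X` that
lies in this open set. -/
structure Collar (X : CompactManifoldWithBoundary.{u} m) (Y : ClosedManifold.{u} m) where
  ε : ℝ
  ε_pos : 0 < ε
  φ : PartialEquiv (ℝ × Y) X
  source_eq : φ.source = Ico 0 ε ×ˢ univ
  open_target : IsOpen φ.target
  smooth : ContMDiffOn (𝓘(ℝ, ℝ).prod (𝓡 m)) (𝓡∂ (m + 1)) ∞ φ φ.source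
  smooth_symm : ContMDiffOn (𝓡∂ (m + 1)) (𝓘(ℝ, ℝ).prod (𝓡 m)) ∞ φ.symm φ.target
  boundary_eq : φ.target ∩ X.boundarySet = φ '' ({0} ×ˢ univ)

/-- The part `φ ({0} × Y)` of the boundary. -/
def Collar.base {X : CompactManifoldWithBoundary.{u} m} {Y : ClosedManifold.{u} m}
    (c : Collar X Y) : Set X :=
  c.φ '' ({0} ×ˢ univ)

/-! ### Metrics -/

/-- A field of bilinear forms on the tangent spaces of `X`. -/
abbrev BilinField (X : CompactManifoldWithBoundary.{u} m) : Type u :=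
  ∀ p : X, TangentSpace (𝓡∂ (m + 1)) p →L[ℝ] TangentSpace (𝓡∂ (m + 1)) p →L[ℝ] ℝ

/-- A one-parameter family of fields of bilinear forms on the tangent spaces of `Y`. -/
abbrev BilinFamily (Y : ClosedManifold.{u} m) : Type u :=
  ℝ → ∀ y : Y, TangentSpace (𝓡 m) y →L[ℝ] TangentSpace (𝓡 m) y →L[ℝ] ℝ

/-- Smoothness, up to the boundary, of a field of bilinear forms. -/
def BilinField.Smooth {X : CompactManifoldWithBoundary.{u} m} (g : BilinField X) : Prop :=
  ContMDiff (𝓡∂ (m + 1))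
    ((𝓡∂ (m + 1)).prod 𝓘(ℝ, Eucl (m + 1) →L[ℝ] Eucl (m + 1) →L[ℝ] ℝ)) ∞
    (fun p : X => Bundle.TotalSpace.mk' (Eucl (m + 1) →L[ℝ] Eucl (m + 1) →L[ℝ] ℝ)
      (E := fun p : X => TangentSpace (𝓡∂ (m + 1)) p →L[ℝ]
        TangentSpace (𝓡∂ (m + 1)) p →L[ℝ] ℝ) p (g p))

/-- Joint smoothness on `[0, δ) × Y` of a family of fields of bilinear forms on `Y`. -/
def BilinFamily.SmoothOn {Y : ClosedManifold.{u} m} (h : BilinFamily Y) (δ : ℝ) : Prop :=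
  ContMDiffOn (𝓘(ℝ, ℝ).prod (𝓡 m))
    ((𝓡 m).prod 𝓘(ℝ, Eucl m →L[ℝ] Eucl m →L[ℝ] ℝ)) ∞
    (fun q : ℝ × Y => Bundle.TotalSpace.mk' (Eucl m →L[ℝ] Eucl m →L[ℝ] ℝ)
      (E := fun y : Y => TangentSpace (𝓡 m) y →L[ℝ] TangentSpace (𝓡 m) y →L[ℝ] ℝ)
      q.2 (h q.1 q.2)) (Ico 0 δ ×ˢ univ)

/-- Symmetric and positive definite. -/
def IsPosDefForm {V : Type*} [AddCommGroup V] [Module ℝ V] [TopologicalSpace V]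
    (b : V →L[ℝ] V →L[ℝ] ℝ) : Prop :=
  (∀ v w, b v w = b w v) ∧ ∀ v, v ≠ 0 → 0 < b v v

/-- Symmetric, nondegenerate, of signature `(1, n - 1)`: positive on some vector, and negative
definite on its orthogonal complement. -/
def IsLorentzForm {V : Type*} [AddCommGroup V] [Module ℝ V] [TopologicalSpace V]
    (b : V →L[ℝ] V →L[ℝ] ℝ) : Prop :=
  (∀ v w, b v w = b w v) ∧
    ∃ v, 0 < b v v ∧ ∀ w, b v w = 0 → w ≠ 0 → b w w < 0

/-- `x` is a boundary defining function. -/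
structure IsBoundaryDefining {X : CompactManifoldWithBoundary.{u} m} (x : X → ℝ) : Prop where
  smooth : ContMDiff (𝓡∂ (m + 1)) 𝓘(ℝ, ℝ) ∞ x
  nonneg : ∀ p, 0 ≤ x p
  zero_iff : ∀ p, x p = 0 ↔ p ∈ X.boundarySet
  deriv_ne : ∀ p ∈ X.boundarySet, mfderiv (𝓡∂ (m + 1)) 𝓘(ℝ, ℝ) x p ≠ 0

/-- `b̂(dx, dx) = 1` at `p`, in the dual metric of `b̂`: the `b̂`-gradient `v` of `x` at `p`
satisfies `b̂(v, v) = 1`. -/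
def UnitDifferentialAt {X : CompactManifoldWithBoundary.{u} m} (ghat : BilinField X) (x : X → ℝ)
    (p : X) : Prop :=
  ∃ v : TangentSpace (𝓡∂ (m + 1)) p,
    (∀ w, ghat p v w = (mfderiv (𝓡∂ (m + 1)) 𝓘(ℝ, ℝ) x p w : ℝ)) ∧ ghat p v v = 1

/-- The metric `g` on the interior of `X` has the form `g = ĝ / x²` with `ĝ` smooth up to the
boundary, pointwise of the type `Sig`, and `ĝ(dx, dx) = 1` on the boundary. -/
def IsConformallyCompact {X : CompactManifoldWithBoundary.{u} m}
    (Sig : ∀ p : X, (TangentSpace (𝓡∂ (m + 1)) p →L[ℝ] TangentSpace (𝓡∂ (m + 1)) p →L[ℝ] ℝ) → Prop)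
    (g : BilinField X) (x : X → ℝ) : Prop :=
  IsBoundaryDefining x ∧ ∃ ghat : BilinField X, ghat.Smooth ∧ (∀ p, Sig p (ghat p)) ∧
    (∀ p ∈ X.interiorSet, g p = ((x p) ^ 2)⁻¹ • ghat p) ∧
    ∀ p ∈ X.boundarySet, UnitDifferentialAt ghat x p

/-- In the product decomposition `c` the function `x` is the first coordinate and
`g = (dx² + τ h(x², y, dy)) / x²` near the boundary, where `μ ↦ h(μ)` is a smooth family, up to
`μ = 0`, of Riemannian metrics on `Y` (`τ = 1` in the Riemannian and `τ = -1` in the Lorentzian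
case). -/
def IsEvenNear {X : CompactManifoldWithBoundary.{u} m} {Y : ClosedManifold.{u} m} (τ : ℝ)
    (c : Collar X Y) (g : BilinField X) (x : X → ℝ) : Prop :=
  ∃ δ : ℝ, 0 < δ ∧ δ ≤ c.ε ∧ (∀ s ∈ Ico 0 δ, ∀ y : Y, x (c.φ (s, y)) = s) ∧
    ∃ h : BilinFamily Y, h.SmoothOn (δ ^ 2) ∧
      (∀ r ∈ Ico 0 (δ ^ 2), ∀ y : Y, IsPosDefForm (h r y)) ∧
      ∀ s ∈ Ioo 0 δ, ∀ (y : Y) (a a' : ℝ) (v v' : TangentSpace (𝓡 m) y),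
        g (c.φ (s, y))
          (mfderiv (𝓘(ℝ, ℝ).prod (𝓡 m)) (𝓡∂ (m + 1)) c.φ (s, y) (a, v))
          (mfderiv (𝓘(ℝ, ℝ).prod (𝓡 m)) (𝓡∂ (m + 1)) c.φ (s, y) (a', v'))
        = (a * a' + τ * h (s ^ 2) y v v') / s ^ 2

/-- The metric `g` in the chart at `p`, as a bilinear form at the point `z` of the chart. -/
def chartForm {X : CompactManifoldWithBoundary.{u} m} (g : BilinField X) (p : X)
    (z v w : Eucl (m + 1)) : ℝ :=
  g ((extChartAt (𝓡∂ (m + 1)) p).symm z)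
    (mfderiv 𝓘(ℝ, Eucl (m + 1)) (𝓡∂ (m + 1)) (extChartAt (𝓡∂ (m + 1)) p).symm z v)
    (mfderiv 𝓘(ℝ, Eucl (m + 1)) (𝓡∂ (m + 1)) (extChartAt (𝓡∂ (m + 1)) p).symm z w)

/-! ### Null geodesics and the dynamical condition -/

/-- `γ` is a null geodesic of `g`, defined on `J`, in the interior of `X`: a smooth curve with
nonvanishing null velocity which satisfies the geodesic equation in its Euler-Lagrange form
`d/dt (g(z', w)) = ½ (∂_w g)(z', z')`, for all constant coordinate vectors `w`. (Equivalently
`(z, g(z', ·))` is an integral curve, up to a constant factor in the parameter, of the Hamilton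
vector field of the dual metric function, in its characteristic set.) -/
def IsNullGeodesicOn {X : CompactManifoldWithBoundary.{u} m} (g : BilinField X) (γ : ℝ → X)
    (J : Set ℝ) : Prop :=
  ContMDiffOn 𝓘(ℝ, ℝ) (𝓡∂ (m + 1)) ∞ γ J ∧ ∀ t ∈ J, γ t ∈ X.interiorSet ∧
    let z : ℝ → Eucl (m + 1) := fun t' => extChartAt (𝓡∂ (m + 1)) (γ t) (γ t')
    deriv z t ≠ 0 ∧ chartForm g (γ t) (z t) (deriv z t) (deriv z t) = 0 ∧
      ∀ w : Eucl (m + 1),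
        HasDerivAt (fun t' => chartForm g (γ t) (z t') (deriv z t') w)
          ((1 / 2) * fderiv ℝ (fun z' => chartForm g (γ t) z' (deriv z t) (deriv z t)) (z t) w) t

/-- `γ` is a null geodesic on the nonempty open interval `J`, and cannot be extended to a null
geodesic on a larger open interval. -/
def IsMaximalNullGeodesic {X : CompactManifoldWithBoundary.{u} m} (g : BilinField X) (γ : ℝ → X)
    (J : Set ℝ) : Prop :=
  J.Nonempty ∧ IsOpen J ∧ J.OrdConnected ∧ IsNullGeodesicOn g γ J ∧
    ∀ (J' : Set ℝ) (γ' : ℝ → X), IsOpen J' → J'.OrdConnected → J ⊆ J' →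
      IsNullGeodesicOn g γ' J' → EqOn γ γ' J → J' = J

/-- All (maximally extended) null geodesics of `g` are defined over `ℝ`, and tend to `A` as the
parameter tends to `+∞` and to `B` as it tends to `-∞`, or vice versa. -/
def NullGeodesicsConnect {X : CompactManifoldWithBoundary.{u} m} (g : BilinField X)
    (A B : Set X) : Prop :=
  ∀ (J : Set ℝ) (γ : ℝ → X), IsMaximalNullGeodesic g γ J → J = univ ∧
    ((Tendsto γ atTop (𝓝ˢ A) ∧ Tendsto γ atBot (𝓝ˢ B)) ∨
      (Tendsto γ atTop (𝓝ˢ B) ∧ Tendsto γ atBot (𝓝ˢ A)))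

/-! ### Asymptotically hyperbolic and asymptotically de Sitter spaces -/

/-- `(X, g)` is an even asymptotically hyperbolic space with boundary `Y`, boundary defining
function `x` and product decomposition `c` near the boundary. -/
structure IsEvenAsymptoticallyHyperbolic {X : CompactManifoldWithBoundary.{u} m}
    {Y : ClosedManifold.{u} m} (c : Collar X Y) (g : BilinField X) (x : X → ℝ) : Prop where
  conformallyCompact : IsConformallyCompact (fun _ b => IsPosDefForm b) g x
  boundary_eq : X.boundarySet = c.base
  even : IsEvenNear 1 c g x

/-- `(X, g)` is an even asymptotically de Sitter space with boundary the disjoint union of `Y₊`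
and `Y₋`, boundary defining function `x` and product decompositions `cP` near `Y₊` and `cM` near
`Y₋`. -/
structure IsEvenAsymptoticallyDeSitter {X : CompactManifoldWithBoundary.{u} m}
    {YP YM : ClosedManifold.{u} m} (cP : Collar X YP) (cM : Collar X YM) (g : BilinField X)
    (x : X → ℝ) : Prop where
  conformallyCompact : IsConformallyCompact (fun _ b => IsLorentzForm b) g x
  boundary_eq : X.boundarySet = cP.base ∪ cM.base
  disjoint : Disjoint cP.base cM.base
  even_plus : IsEvenNear (-1) cP g x
  even_minus : IsEvenNear (-1) cM g x
  dynamics : NullGeodesicsConnect g cP.base cM.base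

/-! ### The spectral families -/

/-- The `i`-th partial derivative. -/
def pderivC {d : ℕ} (i : Fin d) (f : Eucl d → ℂ) (z : Eucl d) : ℂ :=
  fderiv ℝ f z (EuclideanSpace.single i 1)

/-- The coefficient matrix of `g` in the chart at `p`. -/
def chartMatrix {X : CompactManifoldWithBoundary.{u} m} (g : BilinField X) (p : X)
    (z : Eucl (m + 1)) : Matrix (Fin (m + 1)) (Fin (m + 1)) ℝ :=
  Matrix.of fun i j => chartForm g p z (EuclideanSpace.single i 1) (EuclideanSpace.single j 1)

/-- `-|det G|^{-1/2} ∑ᵢⱼ ∂ᵢ (|det G|^{1/2} G^{ij} ∂ⱼ f)`. -/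
def coordLaplacian {d : ℕ} (G : Eucl d → Matrix (Fin d) (Fin d) ℝ) (f : Eucl d → ℂ)
    (z : Eucl d) : ℂ :=
  -(((√|(G z).det|)⁻¹ : ℝ) : ℂ) * ∑ i, pderivC i (fun z' =>
    ((√|(G z').det| : ℝ) : ℂ) * ∑ j, (((G z')⁻¹ i j : ℝ) : ℂ) * pderivC j f z') z

/-- `-div grad` of the metric `g`, at interior points of `X`. This is the (positive) Laplacian
`Δ` if `g` is Riemannian, and the d'Alembertian `□` if `g` is Lorentzian. The defining formula does
not depend on the coordinates; those of the chart at `p` are used at `p`. -/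
def laplacian {X : CompactManifoldWithBoundary.{u} m} (g : BilinField X) (u : X → ℂ) (p : X) : ℂ :=
  coordLaplacian (chartMatrix g p) (fun z => u ((extChartAt (𝓡∂ (m + 1)) p).symm z))
    (extChartAt (𝓡∂ (m + 1)) p p)

/-- `P_σ = -Δ + σ² + ((n - 1) / 2)²`, for asymptotically hyperbolic spaces. -/
def specHyp {X : CompactManifoldWithBoundary.{u} m} (g : BilinField X) (σ : ℂ) (u : X → ℂ)
    (p : X) : ℂ :=
  -laplacian g u p + (σ ^ 2 + ((m : ℂ) / 2) ^ 2) * u p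

/-- `P_σ = □ - σ² - ((n - 1) / 2)²`, for asymptotically de Sitter spaces. -/
def specDS {X : CompactManifoldWithBoundary.{u} m} (g : BilinField X) (σ : ℂ) (u : X → ℂ)
    (p : X) : ℂ :=
  laplacian g u p - (σ ^ 2 + ((m : ℂ) / 2) ^ 2) * u p

/-- `x^{iσ - (n-1)/2 - 2} P x^{-iσ + (n-1)/2}`. -/
def conjugated {X : CompactManifoldWithBoundary.{u} m} (P : (X → ℂ) → X → ℂ) (x : X → ℝ) (σ : ℂ)
    (u : X → ℂ) (p : X) : ℂ :=
  ((x p : ℝ) : ℂ) ^ (Complex.I * σ - (m : ℂ) / 2 - 2) *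
    P (fun q => ((x q : ℝ) : ℂ) ^ (-(Complex.I * σ) + (m : ℂ) / 2) * u q) p

/-! ### The global space and differential operators on it -/

/-- Smooth complex valued functions. -/
abbrev SmoothFun {d : ℕ} (M : ClosedManifold.{u} d) : Type u :=
  C^∞⟮𝓡 d, M; 𝓘(ℝ, ℂ), ℂ⟯

/-- `P` is a differential operator of order at most two with smooth complex coefficients: in
each chart, `P = ∑ a_{ij} ∂ᵢ ∂ⱼ + ∑ bᵢ ∂ᵢ + c`. -/
def IsDiffOpTwo {d : ℕ} {M : ClosedManifold.{u} d} (P : SmoothFun M →ₗ[ℝ] SmoothFun M) : Prop :=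
  ∀ p : M, ∃ (a : Fin d → Fin d → Eucl d → ℂ) (b : Fin d → Eucl d → ℂ) (c : Eucl d → ℂ),
    (∀ i j, ContDiffOn ℝ ∞ (a i j) (extChartAt (𝓡 d) p).target) ∧
    (∀ i, ContDiffOn ℝ ∞ (b i) (extChartAt (𝓡 d) p).target) ∧
    ContDiffOn ℝ ∞ c (extChartAt (𝓡 d) p).target ∧
    ∀ u : SmoothFun M, ∀ z ∈ (extChartAt (𝓡 d) p).target,
      let f : Eucl d → ℂ := fun z' => u ((extChartAt (𝓡 d) p).symm z')
      P u ((extChartAt (𝓡 d) p).symm z) =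
        ∑ i, ∑ j, a i j z * pderivC i (pderivC j f) z + ∑ i, b i z * pderivC i f z + c z * f z

/-- Near their common boundary `Y` the even versions of `X` (on the side `μ ≥ 0`) and of `X'` (on
the side `μ ≤ 0`) are smoothly glued in `Xt` using the product decompositions `c` and `c'`: there
are smooth coordinates `Φ : (-δ, δ) × Y → Xt`, a diffeomorphism onto an open set, in which
`μ = x²` on `X` and `μ = -x²` on `X'`. -/
def EvenGluing {X X' : CompactManifoldWithBoundary.{u} m} {Y : ClosedManifold.{u} m}
    {Xt : ClosedManifold.{u} (m + 1)} (c : Collar X Y) (c' : Collar X' Y) (ι : X → Xt)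
    (ι' : X' → Xt) : Prop :=
  ∃ δ : ℝ, 0 < δ ∧ δ ≤ c.ε ^ 2 ∧ δ ≤ c'.ε ^ 2 ∧
    ∃ Φ : PartialDiffeomorph (𝓘(ℝ, ℝ).prod (𝓡 m)) (𝓡 (m + 1)) (ℝ × Y) Xt ∞,
      Φ.source = Ioo (-δ) δ ×ˢ univ ∧
      ∀ s : ℝ, 0 ≤ s → s ^ 2 < δ → ∀ y : Y,
        Φ (s ^ 2, y) = ι (c.φ (s, y)) ∧ Φ (-s ^ 2, y) = ι' (c'.φ (s, y))

/-- `ι` embeds `X` topologically in `Xt`, and the interior of `X` diffeomorphically onto an open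
subset. -/
structure IsPieceEmbedding {X : CompactManifoldWithBoundary.{u} m}
    {Xt : ClosedManifold.{u} (m + 1)} (ι : X → Xt) : Prop where
  embedding : IsEmbedding ι
  interior : ∀ p ∈ X.interiorSet, IsLocalDiffeomorphAt (𝓡∂ (m + 1)) (𝓡 (m + 1)) ∞ ι p

/-- `Xt = X₊,even ∪ X₀,even ∪ X₋,even`, with `∂X₊` identified with the boundary part `Y₊` of `X₀`,
and `∂X₋` with the boundary part `Y₋`, using the given product decompositions. -/
structure IsGlobalSpace {XP X0 XM : CompactManifoldWithBoundary.{u} m}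
    {YP YM : ClosedManifold.{u} m} {Xt : ClosedManifold.{u} (m + 1)}
    (cP : Collar XP YP) (c0P : Collar X0 YP) (c0M : Collar X0 YM) (cM : Collar XM YM)
    (ιP : XP → Xt) (ι0 : X0 → Xt) (ιM : XM → Xt) : Prop where
  pieceP : IsPieceEmbedding ιP
  piece0 : IsPieceEmbedding ι0
  pieceM : IsPieceEmbedding ιM
  cover : range ιP ∪ range ι0 ∪ range ιM = univ
  interP0 : range ιP ∩ range ι0 = ιP '' cP.base
  interM0 : range ιM ∩ range ι0 = ιM '' cM.base
  interPM : Disjoint (range ιP) (range ιM)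
  glueP : EvenGluing cP c0P ιP ι0
  glueM : EvenGluing cM c0M ιM ι0

/-- The restriction of `Pt` to the interior of the piece `X` is the operator `Q`. -/
def RestrictsTo {X : CompactManifoldWithBoundary.{u} m} {Xt : ClosedManifold.{u} (m + 1)}
    (Pt : SmoothFun Xt →ₗ[ℝ] SmoothFun Xt) (ι : X → Xt) (Q : (X → ℂ) → X → ℂ) : Prop :=
  ∀ u : SmoothFun Xt, ∀ p ∈ X.interiorSet, Pt u (ι p) = Q (fun q => u (ι q)) p

/-- There is a closed manifold `X̃ = X₊,even ∪ X₀,even ∪ X₋,even` and, for every `σ`, a differential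
operator `P̃_σ ∈ Diff²(X̃)` which restricts on each piece to the conjugated spectral family. -/
def HasGlobalOperator {XP X0 XM : CompactManifoldWithBoundary.{u} m}
    {YP YM : ClosedManifold.{u} m}
    (cP : Collar XP YP) (gP : BilinField XP) (xP : XP → ℝ)
    (c0P : Collar X0 YP) (c0M : Collar X0 YM) (g0 : BilinField X0) (x0 : X0 → ℝ)
    (cM : Collar XM YM) (gM : BilinField XM) (xM : XM → ℝ) : Prop :=
  ∃ (Xt : ClosedManifold.{u} (m + 1)) (ιP : XP → Xt) (ι0 : X0 → Xt) (ιM : XM → Xt),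
    IsGlobalSpace cP c0P c0M cM ιP ι0 ιM ∧
    ∀ σ : ℂ, ∃ Pt : SmoothFun Xt →ₗ[ℝ] SmoothFun Xt, IsDiffOpTwo Pt ∧
      RestrictsTo Pt ιP (conjugated (specHyp gP σ) xP σ) ∧
      RestrictsTo Pt ι0 (conjugated (specDS g0 σ) x0 σ) ∧
      RestrictsTo Pt ιM (conjugated (specHyp gM σ) xM σ)

/-! ### Two copies of a space -/

/-- The disjoint union of two copies of a closed manifold. -/
def ClosedManifold.double {d : ℕ} (Y : ClosedManifold.{u} d) : ClosedManifold.{u} d where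
  carrier := Y ⊕ Y

/-- The disjoint union of two copies of a compact manifold with boundary. -/
def CompactManifoldWithBoundary.double (X : CompactManifoldWithBoundary.{u} m) :
    CompactManifoldWithBoundary.{u} m where
  carrier := X ⊕ X

/-- The map of two copies of `X` to `X` that is the identity on each copy. -/
def CompactManifoldWithBoundary.fold (X : CompactManifoldWithBoundary.{u} m) : X.double → X :=
  Sum.elim id id

/-- The metric on two copies of `X` that is `g` on each copy. -/
def BilinField.double {X : CompactManifoldWithBoundary.{u} m} (g : BilinField X) :
    BilinField X.double :=
  fun p => (ContinuousLinearMap.precomp ℝ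
    (mfderiv (𝓡∂ (m + 1)) (𝓡∂ (m + 1)) X.fold p)).comp
    ((g (X.fold p)).comp (mfderiv (𝓡∂ (m + 1)) (𝓡∂ (m + 1)) X.fold p))

theorem BilinField.double_apply {X : CompactManifoldWithBoundary.{u} m} (g : BilinField X)
    (p : X.double) (v w : TangentSpace (𝓡∂ (m + 1)) p) :
    g.double p v w = g (X.fold p) (mfderiv (𝓡∂ (m + 1)) (𝓡∂ (m + 1)) X.fold p v)
      (mfderiv (𝓡∂ (m + 1)) (𝓡∂ (m + 1)) X.fold p w) := rfl

theorem CompactManifoldWithBoundary.fold_smooth {X : CompactManifoldWithBoundary.{u} m} :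
    ContMDiff (𝓡∂ (m + 1)) (𝓡∂ (m + 1)) ∞ X.fold :=
  ContMDiff.sumElim contMDiff_id contMDiff_id

theorem Collar.double_smooth {X : CompactManifoldWithBoundary.{u} m} {Y : ClosedManifold.{u} m}
    (c : Collar X Y) :
    ContMDiffOn (𝓘(ℝ, ℝ).prod (𝓡 m)) (𝓡∂ (m + 1)) ∞
      (fun q : ℝ × (Y ⊕ Y) =>
        (Sum.map (fun y => c.φ (q.1, y)) (fun y => c.φ (q.1, y)) q.2 : X ⊕ X))
      (Ico 0 c.ε ×ˢ univ) := by
  have hfold : ContMDiff (𝓘(ℝ, ℝ).prod (𝓡 m)) (𝓘(ℝ, ℝ).prod (𝓡 m)) ∞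
      (fun q : ℝ × (Y ⊕ Y) => ((q.1, Sum.elim id id q.2) : ℝ × Y)) :=
    contMDiff_fst.prodMk ((ContMDiff.sumElim contMDiff_id contMDiff_id).comp contMDiff_snd)
  have hmain : ContMDiffOn (𝓘(ℝ, ℝ).prod (𝓡 m)) (𝓡∂ (m + 1)) ∞
      (fun q : ℝ × (Y ⊕ Y) => c.φ (q.1, Sum.elim id id q.2)) (Ico 0 c.ε ×ˢ univ) := by
    refine c.smooth.comp hfold.contMDiffOn ?_
    intro q hq
    rw [mem_preimage, c.source_eq]
    exact ⟨hq.1, trivial⟩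
  rintro ⟨s, y | y⟩ hs
  · refine ((ContMDiff.inl (M' := X) (n := ∞) (I := 𝓡∂ (m + 1)) _).comp_contMDiffWithinAt _
      (hmain (s, Sum.inl y) hs)).congr_of_eventuallyEq (Filter.Eventually.filter_mono inf_le_left ?_) rfl
    have : ∀ᶠ q : ℝ × (Y ⊕ Y) in 𝓝 (s, Sum.inl y), q.2 ∈ range (Sum.inl : Y → Y ⊕ Y) :=
      continuous_snd.continuousAt.eventually (isOpen_range_inl.mem_nhds ⟨y, rfl⟩)
    filter_upwards [this]
    rintro ⟨s', _⟩ ⟨y', rfl⟩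
    rfl
  · refine ((ContMDiff.inr (M := X) (n := ∞) (I := 𝓡∂ (m + 1)) _).comp_contMDiffWithinAt _
      (hmain (s, Sum.inr y) hs)).congr_of_eventuallyEq (Filter.Eventually.filter_mono inf_le_left ?_) rfl
    have : ∀ᶠ q : ℝ × (Y ⊕ Y) in 𝓝 (s, Sum.inr y), q.2 ∈ range (Sum.inr : Y → Y ⊕ Y) :=
      continuous_snd.continuousAt.eventually (isOpen_range_inr.mem_nhds ⟨y, rfl⟩)
    filter_upwards [this]
    rintro ⟨s', _⟩ ⟨y', rfl⟩
    rfl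

theorem Collar.double_smooth_symm {X : CompactManifoldWithBoundary.{u} m}
    {Y : ClosedManifold.{u} m} (c : Collar X Y) :
    ContMDiffOn (𝓡∂ (m + 1)) (𝓘(ℝ, ℝ).prod (𝓡 m)) ∞
      (fun p : X ⊕ X => (Sum.elim
        (fun p => ((c.φ.symm p).1, (Sum.inl (c.φ.symm p).2 : Y ⊕ Y)))
        (fun p => ((c.φ.symm p).1, (Sum.inr (c.φ.symm p).2 : Y ⊕ Y))) p : ℝ × (Y ⊕ Y)))
      ((Sum.elim id id : X ⊕ X → X) ⁻¹' c.φ.target) := by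
  have hfold : ContMDiff (𝓡∂ (m + 1)) (𝓡∂ (m + 1)) ∞ (Sum.elim id id : X ⊕ X → X) :=
    ContMDiff.sumElim contMDiff_id contMDiff_id
  have hmain : ContMDiffOn (𝓡∂ (m + 1)) (𝓘(ℝ, ℝ).prod (𝓡 m)) ∞
      (fun p : X ⊕ X => c.φ.symm (Sum.elim id id p))
      ((Sum.elim id id : X ⊕ X → X) ⁻¹' c.φ.target) :=
    c.smooth_symm.comp hfold.contMDiffOn (fun _ h => h)
  have h1 : ContMDiff (𝓘(ℝ, ℝ).prod (𝓡 m)) (𝓘(ℝ, ℝ).prod (𝓡 m)) ∞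
      (fun q : ℝ × Y => ((q.1, Sum.inl q.2) : ℝ × (Y ⊕ Y))) :=
    contMDiff_fst.prodMk (ContMDiff.inl.comp contMDiff_snd)
  have h2 : ContMDiff (𝓘(ℝ, ℝ).prod (𝓡 m)) (𝓘(ℝ, ℝ).prod (𝓡 m)) ∞
      (fun q : ℝ × Y => ((q.1, Sum.inr q.2) : ℝ × (Y ⊕ Y))) :=
    contMDiff_fst.prodMk (ContMDiff.inr.comp contMDiff_snd)
  rintro (p | p) hp
  · refine ((h1 _).comp_contMDiffWithinAt _ (hmain (Sum.inl p) hp)).congr_of_eventuallyEq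
      (Filter.Eventually.filter_mono inf_le_left ?_) rfl
    filter_upwards [isOpen_range_inl.mem_nhds ⟨p, rfl⟩]
    rintro _ ⟨p', rfl⟩
    rfl
  · refine ((h2 _).comp_contMDiffWithinAt _ (hmain (Sum.inr p) hp)).congr_of_eventuallyEq
      (Filter.Eventually.filter_mono inf_le_left ?_) rfl
    filter_upwards [isOpen_range_inr.mem_nhds ⟨p, rfl⟩]
    rintro _ ⟨p', rfl⟩
    rfl

theorem CompactManifoldWithBoundary.mem_boundarySet_double
    (X : CompactManifoldWithBoundary.{u} m) (p : X.double) :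
    p ∈ X.double.boundarySet ↔ X.fold p ∈ X.boundarySet := by
  have h : X.double.boundarySet = (Sum.inl '' X.boundarySet ∪ Sum.inr '' X.boundarySet :
      Set (X ⊕ X)) := ModelWithCorners.boundary_disjointUnion
  rw [h]
  rcases p with p | p
  · constructor
    · rintro (⟨q, hq, he⟩ | ⟨q, hq, he⟩)
      · cases he; exact hq
      · cases he
    · exact fun hp => Or.inl ⟨p, hp, rfl⟩
  · constructor
    · rintro (⟨q, hq, he⟩ | ⟨q, hq, he⟩)
      · cases he
      · cases he; exact hq
    · exact fun hp => Or.inr ⟨p, hp, rfl⟩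

/-- The product decomposition of two copies of `X` which is the given one on each copy. -/
def Collar.double {X : CompactManifoldWithBoundary.{u} m} {Y : ClosedManifold.{u} m}
    (c : Collar X Y) : Collar X.double Y.double where
  ε := c.ε
  ε_pos := c.ε_pos
  φ :=
    { toFun := fun q => Sum.map (fun y => c.φ (q.1, y)) (fun y => c.φ (q.1, y)) (q.2 : Y ⊕ Y)
      invFun := fun p => Sum.elim (fun p => ((c.φ.symm p).1, (Sum.inl (c.φ.symm p).2 : Y ⊕ Y)))
        (fun p => ((c.φ.symm p).1, (Sum.inr (c.φ.symm p).2 : Y ⊕ Y))) (p : X ⊕ X)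
      source := Ico 0 c.ε ×ˢ univ
      target := X.fold ⁻¹' c.φ.target
      map_source' := by
        rintro ⟨s, y | y⟩ hs
        · exact c.φ.map_source (by rw [c.source_eq]; exact ⟨hs.1, trivial⟩)
        · exact c.φ.map_source (by rw [c.source_eq]; exact ⟨hs.1, trivial⟩)
      map_target' := by
        rintro (p | p) hp
        · have := c.φ.map_target hp
          rw [c.source_eq] at this
          exact ⟨this.1, trivial⟩
        · have := c.φ.map_target hp
          rw [c.source_eq] at this
          exact ⟨this.1, trivial⟩
      left_inv' := by
        rintro ⟨s, y | y⟩ hs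
        · have h := c.φ.left_inv (x := (s, y)) (by rw [c.source_eq]; exact ⟨hs.1, trivial⟩)
          simp [h]
        · have h := c.φ.left_inv (x := (s, y)) (by rw [c.source_eq]; exact ⟨hs.1, trivial⟩)
          simp [h]
      right_inv' := by
        rintro (p | p) hp
        · exact congrArg Sum.inl (c.φ.right_inv hp)
        · exact congrArg Sum.inr (c.φ.right_inv hp) }
  source_eq := rfl
  open_target := c.open_target.preimage CompactManifoldWithBoundary.fold_smooth.continuous
  smooth := c.double_smooth
  smooth_symm := c.double_smooth_symm
  boundary_eq := by
    ext p
    rw [mem_inter_iff, X.mem_boundarySet_double]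
    have key : ∀ q : X, q ∈ c.φ.target ∧ q ∈ X.boundarySet ↔ ∃ y : Y, c.φ (0, y) = q := by
      intro q
      rw [← mem_inter_iff, c.boundary_eq]
      constructor
      · rintro ⟨⟨s, y⟩, ⟨rfl, -⟩, rfl⟩
        exact ⟨y, rfl⟩
      · rintro ⟨y, rfl⟩
        exact ⟨(0, y), ⟨rfl, trivial⟩, rfl⟩
    rcases p with p | p
    · refine (key p).trans ⟨?_, ?_⟩
      · rintro ⟨y, rfl⟩
        exact ⟨(0, Sum.inl y), ⟨rfl, trivial⟩, rfl⟩
      · rintro ⟨⟨s, y | y⟩, ⟨rfl, -⟩, he⟩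
        · exact ⟨y, Sum.inl_injective he⟩
        · cases he
    · refine (key p).trans ⟨?_, ?_⟩
      · rintro ⟨y, rfl⟩
        exact ⟨(0, Sum.inr y), ⟨rfl, trivial⟩, rfl⟩
      · rintro ⟨⟨s, y | y⟩, ⟨rfl, -⟩, he⟩
        · cases he
        · exact ⟨y, Sum.inr_injective he⟩

end

noncomputable section

open Finset (sum_congr mul_sum sum_comm sum_add_distrib sum_mul)
open Function (Injective Bijective Surjective)
variable {m : ℕ}
/-- The model of compact manifolds with boundary. -/
local notation "𝓑" => 𝓡∂ (m + 1)
/-- The model of products of an interval and a boundary. -/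
local notation "𝓒" => ModelWithCorners.prod 𝓘(ℝ, ℝ) (𝓡 m)
/-- The model of the global space. -/
local notation "𝓢" => 𝓡 (m + 1)
/-- The coordinate space of manifolds with boundary. -/
local notation "𝔼" => Eucl (m + 1)

/-! ### Extension of smooth functions across a hypersurface -/

theorem exists_vandermonde_dual (N : ℕ) : ∃ c : Fin (N + 1) → ℝ,
    ∀ j : Fin (N + 1), ∑ k, c k * (-((k : ℝ) + 1)) ^ (j : ℕ) = if (j : ℕ) = N then 1 else 0 := by
  set v : Fin (N + 1) → ℝ := fun k => -((k : ℝ) + 1)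
  have hv : Injective v := by
    intro k l h
    have : (k : ℝ) = l := by simpa [v] using h
    exact Fin.ext (by exact_mod_cast this)
  have hdet : IsUnit (Matrix.vandermonde v).det :=
    (Matrix.det_vandermonde_ne_zero_iff.2 hv).isUnit
  refine ⟨Matrix.vecMul (fun j : Fin (N + 1) => if (j : ℕ) = N then 1 else 0) (Matrix.vandermonde v)⁻¹, fun j => ?_⟩
  have h : Matrix.vecMul (Matrix.vecMul (fun j : Fin (N + 1) => if (j : ℕ) = N then (1 : ℝ) else 0)
      (Matrix.vandermonde v)⁻¹) (Matrix.vandermonde v) j = if (j : ℕ) = N then 1 else 0 := by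
    rw [Matrix.vecMul_vecMul, Matrix.nonsing_inv_mul _ hdet, Matrix.vecMul_one]
  rw [← h]
  simp only [Matrix.vecMul, dotProduct, Matrix.vandermonde_apply, v]

/-- The recursion that determines the weights of the blocks in the reflection coefficients. -/
def reflectionWeight (A : ℕ → ℝ) (μ : ℕ → ℕ → ℝ) : ℕ → ℝ
  | j => 1 - ∑ N : Fin j, reflectionWeight A μ N *
      (1 + |reflectionWeight A μ N| * A N * 2 ^ (N : ℕ)) ^ (j - N : ℕ) * μ N j

theorem exists_reflection_coeffs : ∃ (a b : (Σ N : ℕ, Fin (N + 1)) → ℝ), (∀ k, 0 < b k) ∧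
    (∀ j : ℕ, Summable fun k => |a k| * b k ^ j) ∧ ∀ j : ℕ, ∑' k, a k * (-b k) ^ j = 1 := by
  choose c hc using exists_vandermonde_dual
  set A : ℕ → ℝ := fun N => ∑ k : Fin (N + 1), |c N k| * ((k : ℝ) + 1) ^ N with hA
  set μ : ℕ → ℕ → ℝ := fun N j => ∑ k : Fin (N + 1), c N k * (-((k : ℝ) + 1)) ^ j with hμ
  have hA0 : ∀ N, 0 ≤ A N := fun N => Finset.sum_nonneg fun k _ => by positivity
  set r := reflectionWeight A μ with hr
  set l : ℕ → ℝ := fun N => 1 + |r N| * A N * 2 ^ N with hl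
  have hl1 : ∀ N, 1 ≤ l N := fun N => by
    have := hA0 N
    have : 0 ≤ |r N| * A N * 2 ^ N := by positivity
    simp only [hl]; linarith
  have hrec : ∀ j, r j = 1 - ∑ N ∈ Finset.range j, r N * l N ^ (j - N) * μ N j := by
    intro j
    rw [hr, reflectionWeight, Finset.sum_range]
  have hsum : ∀ j : ℕ, Summable fun k : Σ N : ℕ, Fin (N + 1) =>
      |r k.1 * (l k.1 ^ k.1)⁻¹ * c k.1 k.2| * (l k.1 * ((k.2 : ℝ) + 1)) ^ j := by
    intro j
    refine (summable_sigma_of_nonneg fun k => ?_).2 ⟨fun N => Summable.of_finite, ?_⟩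
    · have := hl1 k.1; positivity
    refine Summable.of_norm_bounded_eventually_nat (g := fun N => (1 / 2 : ℝ) ^ N)
      (summable_geometric_of_lt_one (by norm_num) (by norm_num)) ?_
    filter_upwards [eventually_gt_atTop j] with N hN
    have hlN := hl1 N
    have hl0 : 0 < l N := by linarith
    rw [tsum_fintype, Real.norm_of_nonneg (Finset.sum_nonneg fun k _ => by positivity)]
    have h1 : ∀ k : Fin (N + 1), |r N * (l N ^ N)⁻¹ * c N k| * (l N * ((k : ℝ) + 1)) ^ j ≤
        |r N| * (l N)⁻¹ * (|c N k| * ((k : ℝ) + 1) ^ N) := by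
      intro k
      rw [abs_mul, abs_mul, mul_pow, abs_of_pos (by positivity : 0 < (l N ^ N)⁻¹)]
      have h2 : (l N ^ N)⁻¹ * l N ^ j ≤ (l N)⁻¹ := by
        rw [inv_mul_le_iff₀ (by positivity), ← div_eq_mul_inv, le_div_iff₀ hl0, ← pow_succ]
        exact pow_le_pow_right₀ hlN hN
      have h3 : ((k : ℝ) + 1) ^ j ≤ ((k : ℝ) + 1) ^ N :=
        pow_le_pow_right₀ (by have : (0 : ℝ) ≤ k := by positivity
                              linarith) hN.le
      calc |r N| * (l N ^ N)⁻¹ * |c N k| * (l N ^ j * ((k : ℝ) + 1) ^ j)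
          = |r N| * ((l N ^ N)⁻¹ * l N ^ j) * (|c N k| * ((k : ℝ) + 1) ^ j) := by ring
        _ ≤ _ := by gcongr
    refine (Finset.sum_le_sum fun k _ => h1 k).trans ?_
    rw [← mul_sum, mul_assoc, mul_comm (l N)⁻¹, ← mul_assoc, ← div_eq_mul_inv, div_le_iff₀ hl0]
    change |r N| * A N ≤ _
    have : (1 / 2 : ℝ) ^ N * l N = (1 / 2) ^ N + |r N| * A N := by
      simp only [hl, mul_add, mul_one]
      congr 1
      rw [mul_comm, mul_assoc, ← mul_pow]; norm_num
    rw [this]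
    have : (0 : ℝ) < (1 / 2) ^ N := by positivity
    linarith
  refine ⟨fun k => r k.1 * (l k.1 ^ k.1)⁻¹ * c k.1 k.2, fun k => l k.1 * ((k.2 : ℝ) + 1),
    fun k => ?_, hsum, fun j => ?_⟩
  · have := hl1 k.1
    have : 0 < l k.1 := by linarith
    positivity
  have hs : Summable fun k : Σ N : ℕ, Fin (N + 1) =>
      r k.1 * (l k.1 ^ k.1)⁻¹ * c k.1 k.2 * (-(l k.1 * ((k.2 : ℝ) + 1))) ^ j := by
    refine Summable.of_norm ((hsum j).congr fun k => ?_)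
    have := hl1 k.1
    have : 0 < l k.1 := by linarith
    rw [norm_mul, norm_pow, Real.norm_eq_abs, Real.norm_eq_abs, abs_neg,
      abs_of_pos (by positivity : 0 < l k.1 * ((k.2 : ℝ) + 1))]
  rw [Summable.tsum_sigma' (fun N => Summable.of_finite) hs]
  have hblock : ∀ N, ∑' k : Fin (N + 1), r N * (l N ^ N)⁻¹ * c N k * (-(l N * ((k : ℝ) + 1))) ^ j =
      r N * ((l N ^ N)⁻¹ * l N ^ j) * μ N j := by
    intro N
    rw [tsum_fintype, hμ, mul_sum]
    refine sum_congr rfl fun k _ => ?_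
    rw [← mul_neg, mul_pow]; ring
  simp only [hblock]
  have hμ0 : ∀ N, j < N → μ N j = 0 := fun N hN => by
    exact (hc N ⟨j, by omega⟩).trans (if_neg hN.ne)
  have hμ1 : μ j j = 1 := (hc j ⟨j, by omega⟩).trans (if_pos rfl)
  have hl0 : ∀ N, l N ≠ 0 := fun N => by have := hl1 N; positivity
  rw [tsum_eq_sum (s := Finset.range (j + 1)) (fun N hN => by
    rw [hμ0 N (by simpa using hN), mul_zero]), Finset.sum_range_succ, hμ1,
    inv_mul_cancel₀ (pow_ne_zero _ (hl0 j)), mul_one, mul_one]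
  conv_lhs => rw [hrec j]
  have : ∀ N ∈ Finset.range j, r N * ((l N ^ N)⁻¹ * l N ^ j) * μ N j =
      r N * l N ^ (j - N) * μ N j := by
    intro N hN
    have hN : N ≤ j := (Finset.mem_range.1 hN).le
    rw [pow_sub₀ _ (hl0 N) hN, mul_comm (l N ^ j)]
  rw [sum_congr rfl this]
  ring

/-- A smooth function on `[0, ∞)` is extended to `(-∞, 0)` by a weighted sum of its reflections. -/
def reflExtend {κ W : Type*} [AddCommMonoid W] [Module ℝ W] [TopologicalSpace W] (a b : κ → ℝ)
    (f : ℝ → W) (t : ℝ) : W :=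
  open Classical in if 0 ≤ t then f t else ∑' k, a k • f (-(b k * t))

section reflExtend

variable {κ E W : Type} [NormedAddCommGroup E] [NormedSpace ℝ E] [NormedAddCommGroup W]
  [NormedSpace ℝ W] {c : κ → W →L[ℝ] W} {b : κ → ℝ} {U : Set E} {F : ℝ × E → W} {T : ℝ}

/-- The dilated reflection `(t, z) ↦ (-r t, z)`. -/
def reflMap (r : ℝ) : ℝ × E →L[ℝ] ℝ × E :=
  ((-r) • ContinuousLinearMap.fst ℝ ℝ E).prod (ContinuousLinearMap.snd ℝ ℝ E)

/-- The extension by a sum of reflections that are weighted by operators. -/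
def opExtend (c : κ → W →L[ℝ] W) (b : κ → ℝ) (F : ℝ × E → W) (q : ℝ × E) : W :=
  open Classical in if 0 ≤ q.1 then F q else ∑' k, c k (F (reflMap (b k) q))

/-- The weights by which the derivative is extended. -/
def derivWeight (c : κ → W →L[ℝ] W) (b : κ → ℝ) (k : κ) : (ℝ × E →L[ℝ] W) →L[ℝ] ℝ × E →L[ℝ] W :=
  (ContinuousLinearMap.compL ℝ (ℝ × E) W W (c k)).comp
    ((ContinuousLinearMap.compL ℝ (ℝ × E) (ℝ × E) W).flip (reflMap (b k)))

/-- Weights whose moments make all derivatives match. -/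
structure IsReflFamily (c : κ → W →L[ℝ] W) (b : κ → ℝ) : Prop where
  pos : ∀ k, 0 < b k
  summable : ∀ j : ℕ, Summable fun k => ‖c k‖ * b k ^ j
  hasSum : ∀ (j : ℕ) (w : W), HasSum (fun k => (-b k) ^ j • c k w) w

theorem norm_reflMap_le {r : ℝ} (hr : 0 < r) : ‖(reflMap r : ℝ × E →L[ℝ] ℝ × E)‖ ≤ r + 1 := by
  refine ContinuousLinearMap.opNorm_le_bound _ (by linarith) fun v => max_le ?_ ?_
  · have := norm_fst_le v
    simp [reflMap, abs_of_pos hr] at this ⊢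
    nlinarith [norm_nonneg v]
  · have := norm_snd_le v
    simp [reflMap]
    nlinarith [norm_nonneg v]

theorem IsReflFamily.deriv [CompleteSpace W] (h : IsReflFamily c b) :
    IsReflFamily (derivWeight (E := E) c b) b := by
  have hs : ∀ j : ℕ, Summable fun k => ‖derivWeight (E := E) c b k‖ * b k ^ j := fun j => by
    refine .of_nonneg_of_le (fun k => have := h.pos k; by positivity) (fun k => ?_)
      ((h.summable (j + 1)).add (h.summable j))
    have := h.pos k
    have : ‖derivWeight (E := E) c b k‖ ≤ ‖c k‖ * (b k + 1) := by
      refine ContinuousLinearMap.opNorm_le_bound _ (by positivity) fun L => ?_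
      refine (ContinuousLinearMap.opNorm_comp_le (c k) (L.comp _)).trans ?_
      rw [mul_assoc, mul_comm _ ‖L‖]
      gcongr
      exact (ContinuousLinearMap.opNorm_comp_le _ _).trans (by gcongr; exact norm_reflMap_le (h.pos k))
    calc _ ≤ ‖c k‖ * (b k + 1) * b k ^ j := by gcongr
      _ = _ := by ring
  refine ⟨h.pos, hs, fun j L => ?_⟩
  have hL : Summable fun k => (-b k) ^ j • derivWeight c b k L := by
    refine .of_norm_bounded ((hs j).mul_right ‖L‖) fun k => ?_
    rw [norm_smul, norm_pow, norm_neg, Real.norm_of_nonneg (h.pos k).le, mul_comm ‖_‖ (_ ^ j), mul_assoc]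
    have := h.pos k
    gcongr
    exact (derivWeight (E := E) c b k).le_opNorm L
  refine hL.hasSum_iff.2 (ContinuousLinearMap.ext fun v =>
    ((ContinuousLinearMap.apply ℝ W v).hasSum hL.hasSum).unique ?_)
  have := (h.hasSum (j + 1) (L (v.1, 0))).add (h.hasSum j (L (0, v.2)))
  rw [← map_add] at this
  convert this using 1
  · ext k
    have : reflMap (b k) v = (-b k) • (v.1, (0 : E)) + (0, v.2) := by simp [reflMap]
    change (-b k) ^ j • c k (L (reflMap (b k) v)) = _
    rw [this, map_add, map_smul, map_add, map_smul, pow_succ, mul_smul, smul_add]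
  · simp

set_option linter.unusedSectionVars false in
theorem exists_local_bound [ProperSpace E] (hU : IsOpen U) (hF : ContinuousOn F (Ici 0 ×ˢ U))
    (hT : ∀ q ∈ Ici 0 ×ˢ U, T < q.1 → F q = 0) {z : E} (hz : z ∈ U) :
    ∃ ρ > 0, ∃ C, Metric.closedBall z ρ ⊆ U ∧ ∀ q ∈ Ici 0 ×ˢ Metric.closedBall z ρ, ‖F q‖ ≤ C := by
  obtain ⟨ρ, hρ, hsub⟩ := Metric.nhds_basis_closedBall.mem_iff.1 (hU.mem_nhds hz)
  obtain ⟨C, hC⟩ := (isCompact_Icc.prod (isCompact_closedBall z ρ)).exists_bound_of_continuousOn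
    (hF.mono (prod_mono (Icc_subset_Ici_self (a := T)) hsub))
  refine ⟨ρ, hρ, max C 0, hsub, fun q hq => ?_⟩
  rcases lt_or_ge T q.1 with h | h
  · rw [hT q ⟨hq.1, hsub hq.2⟩ h, norm_zero]; exact le_max_right _ _
  · exact (hC q ⟨⟨hq.1, h⟩, hq.2⟩).trans (le_max_left _ _)

theorem opExtend_of_nonneg {q : ℝ × E} (hq : 0 ≤ q.1) : opExtend c b F q = F q := if_pos hq

theorem IsReflFamily.opExtend_of_nonpos (h : IsReflFamily c b) {q : ℝ × E} (hq : q.1 ≤ 0) :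
    opExtend c b F q = ∑' k, c k (F (reflMap (b k) q)) := by
  rcases hq.eq_or_lt with h0 | h0
  · rw [opExtend_of_nonneg h0.ge]
    have (k : κ) : reflMap (b k) q = q := Prod.ext (by simp [reflMap, h0]) rfl
    simpa [this] using (h.hasSum 0 (F q)).tsum_eq.symm
  · exact if_neg h0.not_ge

theorem IsReflFamily.mapsTo (h : IsReflFamily c b) (k : κ) (V : Set E) :
    MapsTo (reflMap (b k)) (Iic 0 ×ˢ V) (Ici 0 ×ˢ V) := fun q hq =>
  ⟨by have := mul_nonpos_of_nonneg_of_nonpos (h.pos k).le hq.1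
      simpa [reflMap] using this, hq.2⟩

variable [ProperSpace E] [CompleteSpace W]

theorem IsReflFamily.continuousOn (h : IsReflFamily c b) (hU : IsOpen U)
    (hF : ContinuousOn F (Ici 0 ×ˢ U)) (hT : ∀ q ∈ Ici 0 ×ˢ U, T < q.1 → F q = 0) :
    ContinuousOn (opExtend c b F) (univ ×ˢ U) := by
  have hl : ContinuousOn (opExtend c b F) (Iic 0 ×ˢ U) := by
    refine .congr (f := fun q => ∑' k, c k (F (reflMap (b k) q))) (fun q hq => ?_)
      fun q hq => h.opExtend_of_nonpos hq.1
    obtain ⟨ρ, hρ, C, hsub, hC⟩ := exists_local_bound hU hF hT hq.2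
    refine (continuousOn_tsum (s := Iic 0 ×ˢ Metric.closedBall q.2 ρ) (u := fun k => ‖c k‖ * C)
      (fun k => (c k).continuous.comp_continuousOn ((hF.mono (prod_mono subset_rfl hsub)).comp
        (reflMap (b k)).continuous.continuousOn (h.mapsTo k _)))
      (by simpa using (h.summable 0).mul_right C)
      fun k q' hq' => (c k).le_opNorm_of_le (hC _ (h.mapsTo k _ hq')) :
        ContinuousOn _ _).continuousWithinAt ⟨hq.1, Metric.mem_closedBall_self hρ.le⟩
        |>.mono_of_mem_nhdsWithin ?_
    exact mem_nhdsWithin_iff_exists_mem_nhds_inter.2 ⟨univ ×ˢ Metric.closedBall q.2 ρ,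
      prod_mem_nhds univ_mem (Metric.closedBall_mem_nhds _ hρ), fun q' hq' => ⟨hq'.2.1, hq'.1.2⟩⟩
  have hr : ContinuousOn (opExtend c b F) (Ici 0 ×ˢ U) :=
    hF.congr fun q hq => opExtend_of_nonneg hq.1
  have hc : IsClosed (Iic 0 ×ˢ univ : Set (ℝ × E)) := isClosed_Iic.prod isClosed_univ
  intro q hq
  rw [show (univ ×ˢ U : Set (ℝ × E)) = Iic 0 ×ˢ U ∪ Ici 0 ×ˢ U by
    rw [← union_prod, Iic_union_Ici], continuousWithinAt_union]
  constructor
  · by_cases h0 : q.1 ≤ 0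
    · exact hl q ⟨h0, hq.2⟩
    · exact continuousWithinAt_of_notMem_closure fun hq => h0
        (closure_minimal (prod_mono subset_rfl (subset_univ U)) hc hq).1
  · by_cases h0 : 0 ≤ q.1
    · exact hr q ⟨h0, hq.2⟩
    · exact continuousWithinAt_of_notMem_closure fun hq => h0
        (closure_minimal (prod_mono subset_rfl (subset_univ U))
          (isClosed_Ici.prod isClosed_univ) hq).1

/-- The derivative of the extension is the extension of the derivative. -/
theorem IsReflFamily.hasFDerivAt (h : IsReflFamily c b) (hU : IsOpen U)
    (hF : ContDiffOn ℝ 1 F (Ici 0 ×ˢ U)) (hT : ∀ q ∈ Ici 0 ×ˢ U, T < q.1 → F q = 0)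
    {F' : ℝ × E → ℝ × E →L[ℝ] W} (hF'c : ContinuousOn F' (Ici 0 ×ˢ U))
    (hF' : ∀ q ∈ Ici 0 ×ˢ U, HasFDerivWithinAt F (F' q) (Ici 0 ×ˢ U) q)
    (hT' : ∀ q ∈ Ici 0 ×ˢ U, T < q.1 → F' q = 0)
    {q : ℝ × E} (hq : q ∈ (univ ×ˢ U : Set (ℝ × E))) :
    HasFDerivAt (opExtend c b F) (opExtend (derivWeight c b) b F' q) q := by
  set D := opExtend (derivWeight c b) b F'
  have hcont := h.continuousOn hU hF.continuousOn hT
  have hDc : ContinuousOn D (univ ×ˢ U) := h.deriv.continuousOn hU hF'c hT'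
  have hneg : ∀ q ∈ (Iio 0 ×ˢ U : Set (ℝ × E)), HasFDerivAt (opExtend c b F) (D q) q := by
    intro q hq
    obtain ⟨ρ₁, h₁, C₁, -, hC₁⟩ := exists_local_bound hU hF.continuousOn hT hq.2
    obtain ⟨ρ, hρ, C, hsub, hC⟩ := exists_local_bound hU hF'c hT' hq.2
    set S : Set (ℝ × E) := Iio 0 ×ˢ Metric.ball q.2 ρ with hS
    have hSo : IsOpen S := isOpen_Iio.prod Metric.isOpen_ball
    have hqS : q ∈ S := ⟨hq.1, Metric.mem_ball_self hρ⟩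
    have hSm : ∀ k, ∀ q' ∈ S, reflMap (b k) q' ∈ Ici 0 ×ˢ Metric.closedBall q.2 ρ := fun k q' hq' =>
      h.mapsTo k _ ⟨mem_Iic.2 (le_of_lt hq'.1), Metric.ball_subset_closedBall hq'.2⟩
    have hts := hasFDerivAt_tsum_of_isPreconnected (u := fun k => ‖derivWeight (E := E) c b k‖ * C)
      (f := fun k (q : ℝ × E) => c k (F (reflMap (b k) q)))
      (f' := fun k (q : ℝ × E) => derivWeight c b k (F' (reflMap (b k) q))) (x₀ := q) (x := q)
      (by simpa using ((h.deriv (E := E)).summable 0).mul_right C) hSo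
      ((convex_Iio 0).prod (convex_ball _ _)).isPreconnected (fun k q' hq' => by
        have h0 : 0 < (reflMap (b k) q').1 := by
          have := mul_neg_of_pos_of_neg (h.pos k) hq'.1
          simpa [reflMap] using this
        have h1 := hsub (hSm k q' hq').2
        exact (c k).hasFDerivAt.comp q' (((hF' _ ⟨h0.le, h1⟩).hasFDerivAt (prod_mem_nhds
          (Ici_mem_nhds h0) (hU.mem_nhds h1))).comp q' (reflMap (E := E) (b k)).hasFDerivAt))
      (fun k q' hq' => ContinuousLinearMap.le_opNorm_of_le _ (hC _ (hSm k q' hq'))) hqS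
      (.of_norm_bounded (g := fun k => ‖c k‖ * C₁) (by simpa using (h.summable 0).mul_right C₁)
        fun k => (c k).le_opNorm_of_le (hC₁ _ (h.mapsTo k _
          ⟨mem_Iic.2 (le_of_lt hq.1), Metric.mem_closedBall_self h₁.le⟩))) hqS
    rw [← (h.deriv (E := E)).opExtend_of_nonpos (le_of_lt hq.1)] at hts
    refine hts.congr_of_eventuallyEq ?_
    filter_upwards [hSo.mem_nhds hqS] with q' hq' using h.opExtend_of_nonpos (le_of_lt hq'.1)
  have hr : 0 ≤ q.1 → HasFDerivWithinAt (opExtend c b F) (D q) (Ici 0 ×ˢ U) q := fun h0 => by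
    rw [show D q = F' q from opExtend_of_nonneg h0]
    exact (hF' q ⟨h0, hq.2⟩).congr (fun q' hq' => opExtend_of_nonneg hq'.1) (opExtend_of_nonneg h0)
  rcases lt_trichotomy q.1 0 with h0 | h0 | h0
  · exact hneg q ⟨h0, hq.2⟩
  · obtain ⟨ρ, hρ, hsub⟩ := Metric.nhds_basis_closedBall.mem_iff.1 (hU.mem_nhds hq.2)
    set S : Set (ℝ × E) := Iio 0 ×ˢ Metric.ball q.2 ρ with hS
    have hSU : S ⊆ Iio 0 ×ˢ U := prod_mono subset_rfl (Metric.ball_subset_closedBall.trans hsub)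
    have hclS : closure S ⊆ univ ×ˢ U := by
      rw [hS, closure_prod_eq]
      exact prod_mono (subset_univ _) (Metric.closure_ball_subset_closedBall.trans hsub)
    have hl := hasFDerivWithinAt_closure_of_tendsto_fderiv (s := S) (x := q) (f' := D q)
      (fun q' hq' => (hneg q' (hSU hq')).differentiableAt.differentiableWithinAt)
      ((convex_Iio 0).prod (convex_ball _ _)) (isOpen_Iio.prod Metric.isOpen_ball)
      (fun y hy => (hcont y (hclS hy)).mono (subset_closure.trans hclS))
      (((hDc q hq).mono_left (nhdsWithin_mono _ (subset_closure.trans hclS))).congr' (by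
        filter_upwards [self_mem_nhdsWithin] with q' hq' using (hneg q' (hSU hq')).fderiv.symm))
    refine (hl.union (hr h0.ge)).hasFDerivAt ?_
    filter_upwards [prod_mem_nhds univ_mem (Metric.ball_mem_nhds q.2 hρ)] with q' hq'
    rcases lt_or_ge q'.1 0 with h | h
    · exact Or.inl (subset_closure ⟨h, hq'.2⟩)
    · exact Or.inr ⟨h, hsub (Metric.ball_subset_closedBall hq'.2)⟩
  · exact (hr h0.le).hasFDerivAt (prod_mem_nhds (Ici_mem_nhds h0) (hU.mem_nhds hq.2))

end reflExtend

theorem IsReflFamily.contDiffOn_nat {κ : Type} {b : κ → ℝ} {E : Type} [NormedAddCommGroup E]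
    [NormedSpace ℝ E] [ProperSpace E] {U : Set E} (hU : IsOpen U) {T : ℝ} (n : ℕ) :
    ∀ {W : Type} [NormedAddCommGroup W] [NormedSpace ℝ W] [CompleteSpace W] {c : κ → W →L[ℝ] W}
      {F : ℝ × E → W}, IsReflFamily c b → ContDiffOn ℝ ∞ F (Ici 0 ×ˢ U) →
      (∀ q ∈ Ici 0 ×ˢ U, T < q.1 → F q = 0) → ContDiffOn ℝ n (opExtend c b F) (univ ×ˢ U) := by
  induction n with
  | zero => exact fun h hF hT => contDiffOn_zero.2 (h.continuousOn hU hF.continuousOn hT)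
  | succ n ih =>
    intro W _ _ _ c F h hF hT
    have hF' := hF.fderivWithin ((uniqueDiffOn_Ici 0).prod hU.uniqueDiffOn) (m := ∞) (by simp)
    have hT' : ∀ q ∈ Ici 0 ×ˢ U, T < q.1 → fderivWithin ℝ F (Ici 0 ×ˢ U) q = 0 := by
      intro q hq hqT
      have : F =ᶠ[𝓝[Ici 0 ×ˢ U] q] fun _ => 0 := by
        filter_upwards [self_mem_nhdsWithin, mem_nhdsWithin_of_mem_nhds
          (prod_mem_nhds (Ioi_mem_nhds hqT) univ_mem)] with q' h1 h2 using hT q' h1 h2.1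
      rw [this.fderivWithin_eq (hT q hq hqT), fderivWithin_fun_const]; rfl
    have hder := fun q hq => h.hasFDerivAt hU (hF.of_le (by simp)) hT hF'.continuousOn
      (fun q hq => (hF.differentiableOn (by simp) q hq).hasFDerivWithinAt) hT' (q := q) hq
    push_cast
    rw [contDiffOn_succ_iff_fderiv_of_isOpen (isOpen_univ.prod hU)]
    exact ⟨fun q hq => (hder q hq).differentiableAt.differentiableWithinAt, by simp,
      (ih h.deriv hF' hT').congr fun q hq => (hder q hq).fderiv⟩

/-- Extensions by reflection of smooth functions are smooth. -/
theorem contDiffOn_reflExtend {κ : Type} {a b : κ → ℝ} {E W : Type} [NormedAddCommGroup E]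
    [NormedSpace ℝ E] [ProperSpace E] [NormedAddCommGroup W] [NormedSpace ℝ W] [CompleteSpace W]
    (hb : ∀ k, 0 < b k) {U : Set E} (hU : IsOpen U) {F : ℝ × E → W} {T : ℝ}
    (ha : ∀ j : ℕ, Summable fun k => |a k| * b k ^ j)
    (hs : ∀ j : ℕ, ∑' k, a k * (-b k) ^ j = 1) (hF : ContDiffOn ℝ ∞ F (Ici 0 ×ˢ U))
    (hT : ∀ q : ℝ × E, T ≤ q.1 → F q = 0) :
    ContDiffOn ℝ ∞ (fun q : ℝ × E => reflExtend a b (fun s => F (s, q.2)) q.1) (univ ×ˢ U) := by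
  have h : IsReflFamily (fun k => a k • ContinuousLinearMap.id ℝ W) b := by
    refine ⟨hb, fun j => .of_norm_bounded (ha j) fun k => ?_, fun j w => ?_⟩
    · have := hb k
      rw [Real.norm_of_nonneg (by positivity), norm_smul, Real.norm_eq_abs]
      gcongr
      exact mul_le_of_le_one_right (abs_nonneg _) ContinuousLinearMap.norm_id_le
    · have : HasSum (fun k => a k * (-b k) ^ j) 1 := hs j ▸ (Summable.of_norm ((ha j).congr
        fun k => by simp [abs_of_pos (hb k)])).hasSum
      simpa [smul_smul, mul_comm] using this.smul_const w
  refine contDiffOn_infty.2 fun n => (h.contDiffOn_nat hU n hF fun q _ hq => hT q hq.le).congr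
    fun q _ => ?_
  simp [reflExtend, opExtend, reflMap]

/-! ### Smooth fields of bilinear forms -/

set_option linter.unusedSectionVars false

section Bilin

variable {E : Type*} [NormedAddCommGroup E] [NormedSpace ℝ E] [FiniteDimensional ℝ E]
  {H : Type*} [TopologicalSpace H] {I : ModelWithCorners ℝ E H}
  {M : Type*} [TopologicalSpace M] [ChartedSpace H M] [IsManifold I ∞ M]
  {E' : Type*} [NormedAddCommGroup E'] [NormedSpace ℝ E']
  {H' : Type*} [TopologicalSpace H'] {J : ModelWithCorners ℝ E' H'}
  {N : Type*} [TopologicalSpace N] [ChartedSpace H' N] [IsManifold J ∞ N]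

variable (I) in
/-- A map `f : N → M`, together with bilinear forms on the tangent spaces of `M` at the points
`f q`, seen as a map to the total space of the bundle of bilinear forms. -/
abbrev bilinAlong (f : N → M)
    (b : ∀ q : N, TangentSpace I (f q) →L[ℝ] TangentSpace I (f q) →L[ℝ] ℝ) :
    N → Bundle.TotalSpace (E →L[ℝ] E →L[ℝ] ℝ)
      (fun p : M => TangentSpace I p →L[ℝ] TangentSpace I p →L[ℝ] ℝ) :=
  fun q => Bundle.TotalSpace.mk' (E →L[ℝ] E →L[ℝ] ℝ)
    (E := fun p : M => TangentSpace I p →L[ℝ] TangentSpace I p →L[ℝ] ℝ) (f q) (b q)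

variable (I) in
/-- The frame at `x` given by the trivialization of the tangent bundle at `x₀`. -/
def tangentFrame (x₀ x : M) : E →L[ℝ] TangentSpace I x :=
  (trivializationAt E (TangentSpace I) x₀).symmL ℝ x

theorem contMDiffWithinAt_clm_apply_iff {F : Type*} [NormedAddCommGroup F] [NormedSpace ℝ F]
    {n : WithTop ℕ∞} {f : N → E →L[ℝ] F} {s : Set N} {x : N} :
    ContMDiffWithinAt J 𝓘(ℝ, E →L[ℝ] F) n f s x ↔
      ∀ v, ContMDiffWithinAt J 𝓘(ℝ, F) n (fun q => f q v) s x := by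
  refine ⟨fun h v => h.clm_apply contMDiffWithinAt_const, fun h => ?_⟩
  let d := Module.finrank ℝ E
  have hd : d = Module.finrank ℝ (Fin d → ℝ) := (Module.finrank_fin_fun ℝ).symm
  let e₁ := ContinuousLinearEquiv.ofFinrankEq hd
  let e₂ := (e₁.arrowCongr (1 : F ≃L[ℝ] F)).trans (ContinuousLinearEquiv.piRing (Fin d))
  rw [← Function.id_comp f, ← e₂.symm_comp_self]
  exact e₂.symm.contDiff.contMDiff.contMDiffAt.comp_contMDiffWithinAt x
    (contMDiffWithinAt_pi_space.mpr fun i => h _)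

theorem contMDiffWithinAt_bilinAlong_iff {f : N → M}
    {b : ∀ q : N, TangentSpace I (f q) →L[ℝ] TangentSpace I (f q) →L[ℝ] ℝ} {s : Set N} {q₀ : N} :
    ContMDiffWithinAt J (I.prod 𝓘(ℝ, E →L[ℝ] E →L[ℝ] ℝ)) ∞ (bilinAlong I f b) s q₀ ↔
      ContMDiffWithinAt J I ∞ f s q₀ ∧ ∀ v w, ContMDiffWithinAt J 𝓘(ℝ, ℝ) ∞
        (fun q => b q (tangentFrame I (f q₀) (f q) v) (tangentFrame I (f q₀) (f q) w)) s q₀ := by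
  rw [contMDiffWithinAt_hom_bundle]
  refine and_congr_right fun hf => ?_
  rw [contMDiffWithinAt_clm_apply_iff]
  refine forall_congr' fun v => ?_
  rw [contMDiffWithinAt_clm_apply_iff]
  refine forall_congr' fun w => ?_
  have hev : ∀ᶠ q in 𝓝[insert q₀ s] q₀,
      f q ∈ (trivializationAt E (TangentSpace I) (f q₀)).baseSet := by
    have : ContinuousWithinAt f (insert q₀ s) q₀ := hf.continuousWithinAt.insert
    exact this ((trivializationAt E (TangentSpace I) (f q₀)).open_baseSet.mem_nhds
      (FiberBundle.mem_baseSet_trivializationAt' (f q₀)))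
  have hEq : (fun q => (ContinuousLinearMap.inCoordinates E (TangentSpace I) (E →L[ℝ] ℝ)
      (fun x : M => TangentSpace I x →L[ℝ] ℝ) (f q₀) (f q) (f q₀) (f q) (b q) : E →L[ℝ] E →L[ℝ] ℝ) v w)
      =ᶠ[𝓝[insert q₀ s] q₀]
      fun q => b q (tangentFrame I (f q₀) (f q) v) (tangentFrame I (f q₀) (f q) w) := by
    filter_upwards [hev] with q hq
    exact inCoordinates_apply_eq₂ (F₃ := ℝ) (E₃ := Bundle.Trivial M ℝ) hq hq (mem_univ _) |>.trans
      (by simp [tangentFrame, Bundle.Trivialization.symmL_apply _ hq])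
  constructor
  · intro h
    exact ContMDiffWithinAt.congr_of_eventuallyEq h (hEq.symm.filter_mono
      (nhdsWithin_mono _ (subset_insert _ _))) (hEq.symm.self_of_nhdsWithin (mem_insert _ _))
  · intro h
    exact ContMDiffWithinAt.congr_of_eventuallyEq h (hEq.filter_mono
      (nhdsWithin_mono _ (subset_insert _ _))) (hEq.self_of_nhdsWithin (mem_insert _ _))

theorem tangentFrame_bijective {x₀ x : M} (hx : x ∈ (chartAt H x₀).source) :
    Bijective (tangentFrame I x₀ x) := by
  have hx' : x ∈ (trivializationAt E (TangentSpace I) x₀).baseSet := by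
    simpa [TangentBundle.trivializationAt_baseSet] using hx
  have := ((trivializationAt E (TangentSpace I) x₀).continuousLinearEquivAt ℝ x hx').symm.bijective
  rwa [Bundle.Trivialization.symm_continuousLinearEquivAt_eq] at this

theorem contMDiffAt_tangentFrame (x₀ : M) {x : M} (hx : x ∈ (chartAt H x₀).source) (v : E) :
    ContMDiffAt I I.tangent ∞ (fun y => (⟨y, tangentFrame I x₀ y v⟩ : TangentBundle I M)) x := by
  have hx' : x ∈ (trivializationAt E (TangentSpace I) x₀).baseSet := by
    simpa [TangentBundle.trivializationAt_baseSet] using hx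
  have h1 := (trivializationAt E (TangentSpace I) x₀).contMDiffAt_symmL (n := ∞) (𝕜 := ℝ)
    (IB := I) hx'
  have h2 : ContMDiffAt I (I.prod 𝓘(ℝ, E)) ∞
      (fun y : M => Bundle.TotalSpace.mk' E (E := Bundle.Trivial M E) y v) x :=
    Bundle.contMDiffAt_totalSpace.2 ⟨contMDiffAt_id, contMDiffAt_const⟩
  exact h1.clm_bundle_apply h2

/-- A bilinear form applied to two smooth vector fields along a map. -/
theorem ContMDiffWithinAt.bilinAlong_apply {f : N → M}
    {b : ∀ q : N, TangentSpace I (f q) →L[ℝ] TangentSpace I (f q) →L[ℝ] ℝ} {s : Set N} {q₀ : N}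
    (hb : ContMDiffWithinAt J (I.prod 𝓘(ℝ, E →L[ℝ] E →L[ℝ] ℝ)) ∞ (bilinAlong I f b) s q₀)
    {v w : ∀ q : N, TangentSpace I (f q)}
    (hv : ContMDiffWithinAt J I.tangent ∞ (fun q => (⟨f q, v q⟩ : TangentBundle I M)) s q₀)
    (hw : ContMDiffWithinAt J I.tangent ∞ (fun q => (⟨f q, w q⟩ : TangentBundle I M)) s q₀) :
    ContMDiffWithinAt J 𝓘(ℝ, ℝ) ∞ (fun q => b q (v q) (w q)) s q₀ := by
  have : ContMDiffWithinAt J (I.prod 𝓘(ℝ, ℝ)) ∞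
      (fun q ↦ Bundle.TotalSpace.mk' ℝ (E := Bundle.Trivial M ℝ) (f q) (b q (v q) (w q))) s q₀ := by
    apply ContMDiffWithinAt.clm_bundle_apply₂ (F₁ := E) (F₂ := E) hb hv hw
  simp only [Bundle.contMDiffWithinAt_totalSpace] at this
  exact this.2

/-- The image of a smooth vector field under the differential of a smooth map. -/
theorem ContMDiffOn.mfderiv_section {F : N → M} {U : Set N} (hU : IsOpen U)
    (hF : ContMDiffOn J I ∞ F U) {s : Set N} (hs : s ⊆ U) {q₀ : N} (hq : q₀ ∈ s)
    {v : ∀ q : N, TangentSpace J q}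
    (hv : ContMDiffWithinAt J J.tangent ∞ (fun q => (⟨q, v q⟩ : TangentBundle J N)) s q₀) :
    ContMDiffWithinAt J I.tangent ∞
      (fun q => (⟨F q, mfderiv J I F q (v q)⟩ : TangentBundle I M)) s q₀ := by
  have h := hF.contMDiffOn_tangentMapWithin (m := ∞) (by simp) hU.uniqueMDiffOn
  have h2 := (h ⟨q₀, v q₀⟩ (hs hq)).comp q₀ hv (fun q hq => hs hq)
  refine h2.congr (fun q hq => ?_) ?_
  · simp [tangentMapWithin, mfderivWithin_of_isOpen hU (hs hq)]
  · simp [tangentMapWithin, mfderivWithin_of_isOpen hU (hs hq)]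

/-- The pullback of a bilinear form under a linear map. -/
def bilinPull {V W : Type*} [AddCommGroup V] [Module ℝ V] [TopologicalSpace V] [AddCommGroup W]
    [Module ℝ W] [TopologicalSpace W] (b : W →L[ℝ] W →L[ℝ] ℝ) (L : V →L[ℝ] W) :
    V →L[ℝ] V →L[ℝ] ℝ :=
  (ContinuousLinearMap.precomp ℝ L).comp (b.comp L)

@[simp] theorem bilinPull_apply {V W : Type*} [AddCommGroup V] [Module ℝ V] [TopologicalSpace V]
    [AddCommGroup W] [Module ℝ W] [TopologicalSpace W] (b : W →L[ℝ] W →L[ℝ] ℝ) (L : V →L[ℝ] W)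
    (v w : V) : bilinPull b L v w = b (L v) (L w) := rfl

theorem contMDiffAt_bilinPull [FiniteDimensional ℝ E'] {F : N → M} {U : Set N} (hU : IsOpen U)
    (hF : ContMDiffOn J I ∞ F U)
    {b : ∀ q : N, TangentSpace I (F q) →L[ℝ] TangentSpace I (F q) →L[ℝ] ℝ} {q₀ : N} (hq : q₀ ∈ U)
    (hb : ContMDiffAt J (I.prod 𝓘(ℝ, E →L[ℝ] E →L[ℝ] ℝ)) ∞ (bilinAlong I F b) q₀) :
    ContMDiffAt J (J.prod 𝓘(ℝ, E' →L[ℝ] E' →L[ℝ] ℝ)) ∞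
      (bilinAlong J id fun q => bilinPull (b q) (mfderiv J I F q)) q₀ := by
  rw [← contMDiffWithinAt_univ, contMDiffWithinAt_bilinAlong_iff]
  refine ⟨contMDiffWithinAt_id, fun v w => ?_⟩
  have hs : ∀ v : E', ContMDiffWithinAt J I.tangent ∞ (fun q =>
      (⟨F q, mfderiv J I F q (tangentFrame J q₀ q v)⟩ : TangentBundle I M)) U q₀ := fun v =>
    hF.mfderiv_section hU subset_rfl hq
      (contMDiffAt_tangentFrame q₀ (mem_chart_source _ _) v).contMDiffWithinAt
  have := ContMDiffWithinAt.bilinAlong_apply (hb.contMDiffWithinAt (s := U)) (hs v) (hs w)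
  exact (this.contMDiffAt (hU.mem_nhds hq)).contMDiffWithinAt

/-- The differential of a real valued function, as a linear form. -/
def diffAt (J : ModelWithCorners ℝ E' H') (x : N → ℝ) (q : N) : TangentSpace J q →L[ℝ] ℝ :=
  mfderiv J 𝓘(ℝ, ℝ) x q

theorem ContMDiffOn.diffAt_section {x : N → ℝ} {U : Set N} (hU : IsOpen U)
    (hx : ContMDiffOn J 𝓘(ℝ, ℝ) ∞ x U) {q₀ : N} (hq : q₀ ∈ U) {v : ∀ q : N, TangentSpace J q}
    (hv : ContMDiffAt J J.tangent ∞ (fun q => (⟨q, v q⟩ : TangentBundle J N)) q₀) :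
    ContMDiffAt J 𝓘(ℝ, ℝ) ∞ (fun q => diffAt J x q (v q)) q₀ := by
  have h := (hx.mfderiv_section hU subset_rfl hq hv.contMDiffWithinAt).contMDiffAt (hU.mem_nhds hq)
  rw [Bundle.contMDiffAt_totalSpace] at h
  refine h.2.congr_of_eventuallyEq (Eventually.of_forall fun q => ?_)
  simp
  rfl

/-- The square `dx²` of the differential of a function. -/
def diffSq (J : ModelWithCorners ℝ E' H') (x : N → ℝ) (q : N) :
    TangentSpace J q →L[ℝ] TangentSpace J q →L[ℝ] ℝ :=
  (diffAt J x q).smulRight (diffAt J x q)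

theorem diffSq_apply (x : N → ℝ) (q : N) (v w : TangentSpace J q) :
    diffSq J x q v w = diffAt J x q v * diffAt J x q w := rfl

theorem contMDiffAt_diffSq [FiniteDimensional ℝ E'] {x : N → ℝ} {U : Set N}
    (hU : IsOpen U) (hx : ContMDiffOn J 𝓘(ℝ, ℝ) ∞ x U) {q₀ : N} (hq : q₀ ∈ U) :
    ContMDiffAt J (J.prod 𝓘(ℝ, E' →L[ℝ] E' →L[ℝ] ℝ)) ∞ (bilinAlong J id (diffSq J x)) q₀ := by
  rw [← contMDiffWithinAt_univ, contMDiffWithinAt_bilinAlong_iff]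
  refine ⟨contMDiffWithinAt_id, fun v w => ?_⟩
  have h := fun v => hx.diffAt_section hU hq
    (contMDiffAt_tangentFrame (I := J) q₀ (mem_chart_source _ _) v)
  exact ((h v).mul (h w)).contMDiffWithinAt

/-- In the image of a smooth map from a vector space, a smooth field of bilinear forms is given by
a smooth function. -/
theorem contDiffOn_param [FiniteDimensional ℝ E'] {ψ : E' → M} {V : Set E'} (hV : IsOpen V)
    (hψ : ContMDiffOn 𝓘(ℝ, E') I ∞ ψ V)
    {b : ∀ z : E', TangentSpace I (ψ z) →L[ℝ] TangentSpace I (ψ z) →L[ℝ] ℝ}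
    (hb : ContMDiffOn 𝓘(ℝ, E') (I.prod 𝓘(ℝ, E →L[ℝ] E →L[ℝ] ℝ)) ∞ (bilinAlong I ψ b) V) :
    ContDiffOn ℝ ∞ (fun z => (bilinPull (b z) (mfderiv 𝓘(ℝ, E') I ψ z) : E' →L[ℝ] E' →L[ℝ] ℝ))
      V := by
  rw [contDiffOn_clm_apply]
  intro v
  rw [contDiffOn_clm_apply]
  intro w
  rw [← contMDiffOn_iff_contDiffOn]
  intro z hz
  have hs : ∀ v : E', ContMDiffWithinAt 𝓘(ℝ, E') I.tangent ∞ (fun q =>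
      (⟨ψ q, mfderiv 𝓘(ℝ, E') I ψ q v⟩ : TangentBundle I M)) V z := fun v =>
    hψ.mfderiv_section hV subset_rfl hz (v := fun _ => v) (by
        refine (contMDiffAt_tangentFrame (I := 𝓘(ℝ, E')) z (mem_chart_source _ _) v).contMDiffWithinAt
          |>.congr (fun q _ => ?_) ?_
        · simp [tangentFrame]
          rfl
        · simp [tangentFrame]
          rfl)
  exact ContMDiffWithinAt.bilinAlong_apply (hb z hz) (hs v) (hs w)

end Bilin

/-! ### Extension of families of metrics -/

section LinearForms

variable {E : Type*} [NormedAddCommGroup E] [NormedSpace ℝ E] [FiniteDimensional ℝ E]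

instance bilinNormedAddCommGroup : NormedAddCommGroup (E →L[ℝ] E →L[ℝ] ℝ) :=
  ContinuousLinearMap.toNormedAddCommGroup

instance bilinSeminormedAddCommGroup : SeminormedAddCommGroup (E →L[ℝ] E →L[ℝ] ℝ) :=
  ContinuousLinearMap.toSeminormedAddCommGroup

instance bilinSeminormedAddGroup : SeminormedAddGroup (E →L[ℝ] E →L[ℝ] ℝ) :=
  bilinSeminormedAddCommGroup.toSeminormedAddGroup

instance bilinNormedSpace : NormedSpace ℝ (E →L[ℝ] E →L[ℝ] ℝ) :=
  ContinuousLinearMap.toNormedSpace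

theorem exists_pos_bound {B : E →L[ℝ] E →L[ℝ] ℝ} (hB : ∀ v, v ≠ 0 → 0 < B v v) :
    ∃ c > 0, ∀ v, c * ‖v‖ ^ 2 ≤ B v v := by
  have hc : Continuous fun v => B v v := B.continuous.clm_apply continuous_id
  by_cases hne : (Metric.sphere (0 : E) 1).Nonempty
  · obtain ⟨v₀, hv₀, hmin⟩ := (isCompact_sphere (0 : E) 1).exists_isMinOn hne hc.continuousOn
    have h0 : v₀ ≠ 0 := by rintro rfl; simp at hv₀
    refine ⟨B v₀ v₀, hB _ h0, fun v => ?_⟩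
    rcases eq_or_ne v 0 with rfl | hv
    · simp
    have hn : 0 < ‖v‖ := norm_pos_iff.2 hv
    have := hmin (a := ‖v‖⁻¹ • v) (by simp [norm_smul, hn.ne'])
    simp only [map_smul, smul_apply, smul_eq_mul, mem_ofPred_eq] at this
    rw [← mul_assoc, ← mul_inv, ← div_eq_inv_mul, le_div_iff₀ (by positivity)] at this
    simpa [sq] using this
  · refine ⟨1, one_pos, fun v => ?_⟩
    rcases eq_or_ne v 0 with rfl | hv
    · simp
    · exact absurd ⟨‖v‖⁻¹ • v, by simp [norm_smul, hv]⟩ hne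

theorem eventually_pos_of_pos {X : Type*} [TopologicalSpace X] {B : X → E →L[ℝ] E →L[ℝ] ℝ}
    {l : Filter X} {B₀ : E →L[ℝ] E →L[ℝ] ℝ} (hB : Tendsto B l (𝓝 B₀))
    (h0 : ∀ v, v ≠ 0 → 0 < B₀ v v) : ∀ᶠ q in l, ∀ v, v ≠ 0 → 0 < B q v v := by
  obtain ⟨c, hc, hcv⟩ := exists_pos_bound h0
  filter_upwards [hB (Metric.ball_mem_nhds B₀ hc)] with q hq v hv
  have h1 : ‖(B q - B₀) v v‖ ≤ ‖B q - B₀‖ * ‖v‖ * ‖v‖ := ContinuousLinearMap.le_opNorm₂ _ _ _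
  have h2 : ‖B q - B₀‖ < c := by simpa [dist_eq_norm] using hq
  have h3 : (B q - B₀) v v = B q v v - B₀ v v := by simp
  have hn : 0 < ‖v‖ := norm_pos_iff.2 hv
  have h4 : ‖B q - B₀‖ * ‖v‖ * ‖v‖ < c * ‖v‖ * ‖v‖ := by gcongr
  have h5 := hcv v
  rw [h3, Real.norm_eq_abs] at h1
  have h6 := neg_abs_le (B q v v - B₀ v v)
  nlinarith

theorem reflExtend_bilin_apply {κ : Type} {a b : κ → ℝ} (hb : ∀ k, 0 < b k)
    (ha : Summable fun k => |a k|) {f : ℝ → E →L[ℝ] E →L[ℝ] ℝ} {T : ℝ}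
    (hf : ∀ v w, ContinuousOn (fun s => f s v w) (Icc 0 T)) (hT : ∀ s, T ≤ s → f s = 0)
    (r : ℝ) (v w : E) : reflExtend a b f r v w = reflExtend a b (fun s => f s v w) r := by
  simp only [reflExtend]
  split_ifs with hr
  · rfl
  have hcont : ContinuousOn f (Icc 0 T) :=
    continuousOn_clm_apply.2 fun v => continuousOn_clm_apply.2 fun w => hf v w
  obtain ⟨C, hC⟩ := isCompact_Icc.exists_bound_of_continuousOn hcont
  have hC' : ∀ s, 0 ≤ s → ‖f s‖ ≤ max C 0 := fun s hs => by
    rcases le_total T s with h | h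
    · rw [hT s h, norm_zero]; exact le_max_right _ _
    · exact (hC s ⟨hs, h⟩).trans (le_max_left _ _)
  have hsm : Summable fun k => a k • f (-(b k * r)) := by
    refine Summable.of_norm_bounded (ha.mul_right (max C 0)) fun k => ?_
    rw [norm_smul, Real.norm_eq_abs]
    refine mul_le_mul_of_nonneg_left (hC' _ ?_) (abs_nonneg _)
    have := hb k; nlinarith
  exact ((ContinuousLinearMap.apply ℝ ℝ w).comp
    (ContinuousLinearMap.apply ℝ (E →L[ℝ] ℝ) v)).map_tsum hsm

end LinearForms

set_option linter.unusedSectionVars false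

section Families

/-- The family `h` of bilinear forms on `Y` is smooth on `S × Y`. -/
abbrev BilinFamily.SmoothOnSet {Y : ClosedManifold.{u} m} (h : BilinFamily Y) (S : Set ℝ) : Prop :=
  ContMDiffOn 𝓒 ((𝓡 m).prod 𝓘(ℝ, Eucl m →L[ℝ] Eucl m →L[ℝ] ℝ)) ∞
    (bilinAlong (𝓡 m) (fun q : ℝ × Y => q.2) fun q => h q.1 q.2) (S ×ˢ univ)

variable {E : Type*} [NormedAddCommGroup E] [NormedSpace ℝ E] [FiniteDimensional ℝ E]
  {H : Type*} [TopologicalSpace H] {I : ModelWithCorners ℝ E H}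
  {M : Type*} [TopologicalSpace M] [ChartedSpace H M] [IsManifold I ∞ M]
  {E' : Type*} [NormedAddCommGroup E'] [NormedSpace ℝ E']
  {H' : Type*} [TopologicalSpace H'] {J : ModelWithCorners ℝ E' H'}
  {N : Type*} [TopologicalSpace N] [ChartedSpace H' N] [IsManifold J ∞ N]

/-- A bilinear form expressed in the frame of a trivialization. -/
def frameForm (x₀ x : M) (b : TangentSpace I x →L[ℝ] TangentSpace I x →L[ℝ] ℝ) :
    E →L[ℝ] E →L[ℝ] ℝ :=
  bilinPull b (tangentFrame I x₀ x)

theorem ContMDiffWithinAt.frameForm {f : N → M}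
    {b : ∀ q : N, TangentSpace I (f q) →L[ℝ] TangentSpace I (f q) →L[ℝ] ℝ} {s : Set N} {q₀ : N}
    (hb : ContMDiffWithinAt J (I.prod 𝓘(ℝ, E →L[ℝ] E →L[ℝ] ℝ)) ∞ (bilinAlong I f b) s q₀) :
    ContMDiffWithinAt J 𝓘(ℝ, E →L[ℝ] E →L[ℝ] ℝ) ∞
      (fun q => _root_.frameForm (f q₀) (f q) (b q)) s q₀ := by
  rw [contMDiffWithinAt_clm_apply_iff]
  intro v
  rw [contMDiffWithinAt_clm_apply_iff]
  intro w
  exact (contMDiffWithinAt_bilinAlong_iff.1 hb).2 v w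

theorem frameForm_pos_iff {x₀ x : M} (hx : x ∈ (chartAt H x₀).source)
    {b : TangentSpace I x →L[ℝ] TangentSpace I x →L[ℝ] ℝ} :
    (∀ v, v ≠ 0 → 0 < frameForm x₀ x b v v) ↔ ∀ v, v ≠ 0 → 0 < b v v := by
  have hbij := tangentFrame_bijective (I := I) hx
  constructor
  · intro h v hv
    obtain ⟨w, rfl⟩ := hbij.2 v
    exact h w (by rintro rfl; simp at hv)
  · intro h v hv
    refine h _ fun h0 => hv (hbij.1 ?_)
    exact h0.trans (map_zero _).symm

/-- Positivity is an open condition. -/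
theorem eventually_pos_bilinAlong {f : N → M}
    {b : ∀ q : N, TangentSpace I (f q) →L[ℝ] TangentSpace I (f q) →L[ℝ] ℝ} {s : Set N} {q₀ : N}
    (hb : ContMDiffWithinAt J (I.prod 𝓘(ℝ, E →L[ℝ] E →L[ℝ] ℝ)) ∞ (bilinAlong I f b) s q₀)
    (h0 : ∀ v, v ≠ 0 → 0 < b q₀ v v) : ∀ᶠ q in 𝓝[s] q₀, ∀ v, v ≠ 0 → 0 < b q v v := by
  have h1 := eventually_pos_of_pos hb.frameForm.continuousWithinAt
    ((frameForm_pos_iff (mem_chart_source H (f q₀))).2 h0)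
  have h2 : ∀ᶠ q in 𝓝[s] q₀, f q ∈ (chartAt H (f q₀)).source :=
    (contMDiffWithinAt_bilinAlong_iff.1 hb).1.continuousWithinAt
      ((chartAt H (f q₀)).open_source.mem_nhds (mem_chart_source _ _))
  filter_upwards [h1, h2] with q hq1 hq2
  exact (frameForm_pos_iff hq2).1 hq1

theorem exists_cutoff {δ : ℝ} (hδ : 0 < δ) : ∃ χ : ℝ → ℝ, ContDiff ℝ ∞ χ ∧
    (∀ t ≤ δ / 3, χ t = 1) ∧ (∀ t, 2 * δ / 3 ≤ t → χ t = 0) := by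
  refine ⟨fun t => Real.smoothTransition (2 - 3 * t / δ), ?_, fun t ht => ?_, fun t ht => ?_⟩
  · exact Real.smoothTransition.contDiff.comp (by fun_prop)
  · refine Real.smoothTransition.one_of_one_le ?_
    have : 3 * t / δ ≤ 1 := by rw [div_le_iff₀ hδ]; linarith
    linarith
  · refine Real.smoothTransition.zero_of_nonpos ?_
    have : 2 ≤ 3 * t / δ := by rw [le_div_iff₀ hδ]; linarith
    linarith

/-- A bilinear form on a tangent space, as a bilinear form on the model space. -/
def toModelForm {x : M} (b : TangentSpace I x →L[ℝ] TangentSpace I x →L[ℝ] ℝ) :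
    E →L[ℝ] E →L[ℝ] ℝ := b

/-- A bilinear form on the model space, as a bilinear form on a tangent space. -/
def ofModelForm (x : M) (b : E →L[ℝ] E →L[ℝ] ℝ) :
    TangentSpace I x →L[ℝ] TangentSpace I x →L[ℝ] ℝ := b

/-- A smooth family of metrics on `[0, δ) × Y` extends to a smooth family on a neighbourhood of
`{0} × Y`. -/
theorem exists_family_extension {Y : ClosedManifold.{u} m} {h : BilinFamily Y} {δ : ℝ} (hδ : 0 < δ)
    (hs : h.SmoothOn δ) (hp : ∀ r ∈ Ico 0 δ, ∀ y : Y, IsPosDefForm (h r y)) :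
    ∃ δ' > 0, δ' ≤ δ ∧ ∃ h' : BilinFamily Y, h'.SmoothOnSet (Ioo (-δ') δ') ∧
      (∀ r ∈ Ico 0 δ', h' r = h r) ∧ ∀ r ∈ Ioo (-δ') δ', ∀ y : Y, IsPosDefForm (h' r y) := by
  obtain ⟨a, b, hb, ha, hsum⟩ := exists_reflection_coeffs
  obtain ⟨χ, hχs, hχ1, hχ0⟩ := exists_cutoff hδ
  have ha0 : Summable fun k => |a k| := by simpa using ha 0
  set h' : BilinFamily Y := fun r y =>
    ofModelForm y (reflExtend a b (fun s => χ s • toModelForm (h s y)) r) with hh'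
  have hloc : ∀ (y₀ : Y) (q : ℝ × Y), q ∈ (Ico 0 δ ×ˢ (chartAt (Eucl m) y₀).source : Set (ℝ × Y)) →
      ∀ v w, ContMDiffWithinAt 𝓒 𝓘(ℝ, ℝ) ∞ (fun q : ℝ × Y =>
        h q.1 q.2 (tangentFrame (𝓡 m) y₀ q.2 v) (tangentFrame (𝓡 m) y₀ q.2 w))
        (Ico 0 δ ×ˢ univ) q := by
    intro y₀ q hq v w
    refine ContMDiffWithinAt.bilinAlong_apply (hs q ⟨hq.1, trivial⟩) ?_ ?_
    · exact (contMDiffAt_tangentFrame y₀ hq.2 v).comp_contMDiffWithinAt q contMDiffWithinAt_snd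
    · exact (contMDiffAt_tangentFrame y₀ hq.2 w).comp_contMDiffWithinAt q contMDiffWithinAt_snd
  have heval : ∀ (y : Y) (v w : TangentSpace (𝓡 m) y) (r : ℝ),
      h' r y v w = reflExtend a b (fun s => χ s * h s y v w) r := by
    intro y v w r
    refine reflExtend_bilin_apply (E := Eucl m) (T := 2 * δ / 3) hb ha0 (fun v w => ?_)
      (fun s hs => by rw [hχ0 s hs, zero_smul]) r v w
    refine ContinuousOn.mul hχs.continuous.continuousOn ?_
    obtain ⟨v', hv'⟩ := (tangentFrame_bijective (I := 𝓡 m) (mem_chart_source (Eucl m) y)).2 v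
    obtain ⟨w', hw'⟩ := (tangentFrame_bijective (I := 𝓡 m) (mem_chart_source (Eucl m) y)).2 w
    intro s hs'
    have h1 := (hloc y (s, y) ⟨⟨hs'.1, by linarith [hs'.2]⟩, mem_chart_source _ _⟩ v'
      w').continuousWithinAt
    have h2 : ContinuousWithinAt (fun s : ℝ => (s, y)) (Icc 0 (2 * δ / 3)) s := by fun_prop
    have h3 := ContinuousWithinAt.comp (f := fun s : ℝ => (s, y)) h1 h2
      (fun t ht => ⟨⟨ht.1, by linarith [ht.2]⟩, trivial⟩)
    refine h3.congr (fun t _ => ?_) ?_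
    · simp only [Function.comp]; rw [hv', hw']; rfl
    · simp only [Function.comp]; rw [hv', hw']; rfl
  have hsm : h'.SmoothOnSet univ := by
    rintro ⟨r, y₀⟩ -
    rw [univ_prod_univ, contMDiffWithinAt_bilinAlong_iff]
    refine ⟨contMDiffWithinAt_snd, fun v w => ?_⟩
    simp only [heval]
    rw [contMDiffWithinAt_univ]
    set e := chartAt (Eucl m) y₀ with he
    set F : ℝ × Eucl m → ℝ := fun q => χ q.1 * h q.1 (e.symm q.2)
      (tangentFrame (𝓡 m) y₀ (e.symm q.2) v) (tangentFrame (𝓡 m) y₀ (e.symm q.2) w) with hF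
    have hFs : ContDiffOn ℝ ∞ F (Ici 0 ×ˢ e.target) := by
      rintro ⟨t, z⟩ ⟨ht, hz⟩
      rcases lt_or_ge t δ with htδ | htδ
      · have h1 := hloc y₀ (t, e.symm z) ⟨⟨ht, htδ⟩, e.map_target hz⟩ v w
        have h2 : ContMDiffWithinAt 𝓘(ℝ, ℝ × Eucl m) 𝓒 ∞
            (fun q : ℝ × Eucl m => (q.1, e.symm q.2)) (Ico 0 δ ×ˢ e.target) (t, z) := by
          refine ContMDiffWithinAt.prodMk ?_ ?_
          · exact (contDiff_fst.contMDiff _).contMDiffWithinAt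
          · have h3 : ContMDiffWithinAt 𝓘(ℝ, Eucl m) (𝓡 m) ∞ e.symm e.target z :=
              contMDiffOn_chart_symm (I := 𝓡 m) (x := y₀) z hz
            exact h3.comp (t, z) (contDiff_snd.contMDiff _).contMDiffWithinAt (fun q hq => hq.2)
        have h3 := (ContMDiffWithinAt.comp (t, z) h1 h2 fun (q : ℝ × Eucl m) hq =>
          (⟨hq.1, trivial⟩ : _ ∈ (Ico 0 δ ×ˢ univ : Set (ℝ × Y)))).contDiffWithinAt
        have h4 : ContDiffWithinAt ℝ ∞ F (Ico 0 δ ×ˢ e.target) (t, z) :=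
          ((hχs.comp contDiff_fst).contDiffWithinAt).mul h3
        refine h4.mono_of_mem_nhdsWithin ?_
        have : Iio δ ×ˢ (univ : Set (Eucl m)) ∈ 𝓝 (t, z) :=
          prod_mem_nhds (Iio_mem_nhds htδ) univ_mem
        filter_upwards [self_mem_nhdsWithin, mem_nhdsWithin_of_mem_nhds this] with q h1 h2
        exact ⟨⟨h1.1, h2.1⟩, h1.2⟩
      · refine (contDiffAt_const (c := (0 : ℝ))).congr_of_eventuallyEq ?_ |>.contDiffWithinAt
        have : Ioi (2 * δ / 3) ×ˢ (univ : Set (Eucl m)) ∈ 𝓝 (t, z) :=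
          prod_mem_nhds (Ioi_mem_nhds (by linarith)) univ_mem
        filter_upwards [this] with q hq
        simp only [hF, hχ0 q.1 (le_of_lt hq.1), zero_mul]
    have hext := contDiffOn_reflExtend (T := 2 * δ / 3) hb e.open_target ha hsum hFs
      (fun q hq => by simp only [hF, hχ0 q.1 hq, zero_mul])
    have hy₀ : e y₀ ∈ e.target := mem_chart_target _ _
    have h1 := ((hext (r, e y₀) ⟨trivial, hy₀⟩).contDiffAt
      (prod_mem_nhds univ_mem (e.open_target.mem_nhds hy₀))).contMDiffAt
    have h2 : ContMDiffAt 𝓒 𝓘(ℝ, ℝ × Eucl m) ∞ (fun q : ℝ × Y => (q.1, e q.2)) (r, y₀) := by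
      refine contMDiffAt_fst.prodMk_space ?_
      exact (contMDiffAt_of_mem_maximalAtlas (I := 𝓡 m) (n := ∞)
        (IsManifold.chart_mem_maximalAtlas y₀) (mem_chart_source _ y₀)).comp (r, y₀) contMDiffAt_snd
    refine (h1.comp (r, y₀) h2).congr_of_eventuallyEq ?_
    have : (univ : Set ℝ) ×ˢ e.source ∈ 𝓝 (r, y₀) :=
      prod_mem_nhds univ_mem (e.open_source.mem_nhds (mem_chart_source _ _))
    filter_upwards [this] with q hq
    let G : Y → ℝ → ℝ := fun y s =>
      χ s * h s y (tangentFrame (𝓡 m) y₀ y v) (tangentFrame (𝓡 m) y₀ y w)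
    change reflExtend a b (G q.2) q.1 = reflExtend a b (G (e.symm (e q.2))) q.1
    rw [e.left_inv hq.2]
  have hsymm : ∀ r y v w, h' r y v w = h' r y w v := by
    intro r y v w
    rw [heval, heval]
    have : ∀ s, 0 ≤ s → χ s * h s y v w = χ s * h s y w v := fun s hs => by
      rcases lt_or_ge s δ with h | h
      · rw [(hp s ⟨hs, h⟩ y).1]
      · rw [hχ0 s (by linarith), zero_mul, zero_mul]
    simp only [reflExtend]
    split_ifs with hr
    · exact this r hr
    · refine tsum_congr fun k => ?_
      rw [this _ (by have := hb k; nlinarith)]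
  have hnear : ∀ r ∈ Ico 0 (δ / 3), h' r = h r := by
    intro r hr
    funext y
    simp only [hh', reflExtend, if_pos hr.1, hχ1 r hr.2.le, one_smul]
    rfl
  have hpos : ∀ᶠ r in 𝓝 (0 : ℝ), ∀ y ∈ (univ : Set Y), ∀ v, v ≠ 0 → 0 < h' r y v v := by
    refine isCompact_univ.eventually_forall_of_forall_eventually fun y _ => ?_
    have h1 := eventually_pos_bilinAlong (hsm (0, y) ⟨trivial, trivial⟩) (fun v hv => by
      rw [hnear 0 ⟨le_rfl, by positivity⟩]
      exact (hp 0 ⟨le_rfl, hδ⟩ y).2 v hv)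
    rw [univ_prod_univ, nhdsWithin_univ] at h1
    exact h1
  obtain ⟨η, hη, hηp⟩ := Metric.eventually_nhds_iff.1 hpos
  refine ⟨min η (δ / 3), lt_min hη (by positivity), (min_le_right _ _).trans (by linarith), h',
    hsm.mono (prod_mono (subset_univ _) subset_rfl),
    fun r hr => hnear r ⟨hr.1, hr.2.trans_le (min_le_right _ _)⟩,
    fun r hr y => ⟨hsymm r y, fun v hv => hηp ?_ y trivial v hv⟩⟩
  rw [Real.dist_0_eq_abs, abs_lt]
  exact ⟨by linarith [hr.1, min_le_left η (δ / 3)], hr.2.trans_le (min_le_left _ _)⟩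

end Families

/-! ### Invariance of the Laplacian under changes of coordinates -/

section Piola

variable {d : ℕ} {E : Type*} [NormedAddCommGroup E] [NormedSpace ℝ E]

/-- The `i`-th coordinate vector. -/
abbrev coordVec {d : ℕ} (i : Fin d) : Eucl d := EuclideanSpace.single i 1

theorem hasFDerivAt_det {M : E → Matrix (Fin d) (Fin d) ℝ} {M' : Fin d → Fin d → E →L[ℝ] ℝ} {z : E}
    (hM : ∀ i j, HasFDerivAt (fun z => M z i j) (M' i j) z) :
    HasFDerivAt (fun z => (M z).det) (∑ i, ∑ j, (M z).adjugate j i • M' i j) z := by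
  let f : ContinuousMultilinearMap ℝ (fun _ : Fin d => Fin d → ℝ) ℝ :=
    { (Matrix.detRowAlternating (R := ℝ) (n := Fin d)).toMultilinearMap with
      cont := by
        change Continuous fun A : Matrix (Fin d) (Fin d) ℝ => A.det
        fun_prop }
  have h1 : HasFDerivAt (fun z => (fun i j => M z i j : Fin d → Fin d → ℝ))
      (ContinuousLinearMap.pi fun i => ContinuousLinearMap.pi fun j => M' i j) z :=
    hasFDerivAt_pi.2 fun i => hasFDerivAt_pi.2 fun j => hM i j
  have h2 := (f.hasFDerivAt (M z)).comp z h1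
  refine h2.congr_fderiv ?_
  ext v
  have h3 : (f.linearDeriv (M z)) (fun i j => M' i j v) =
      ∑ i, ((M z).updateRow i fun j => M' i j v).det :=
    ContinuousMultilinearMap.linearDeriv_apply f (M z) (fun i j => M' i j v)
  refine (h3 : _ = _).trans ?_
  simp only [sum_apply, smul_apply, smul_eq_mul]
  refine sum_congr rfl fun i _ => ?_
  rw [← Matrix.det_transpose, ← Matrix.updateCol_transpose, ← Matrix.cramer_apply,
    Matrix.cramer_eq_adjugate_mulVec, Matrix.mulVec, dotProduct]
  refine sum_congr rfl fun j _ => ?_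
  rw [← Matrix.adjugate_transpose, Matrix.transpose_apply]

theorem differentiableAt_det {M : E → Matrix (Fin d) (Fin d) ℝ} {z : E}
    (hM : ∀ i j, DifferentiableAt ℝ (fun z => M z i j) z) :
    DifferentiableAt ℝ (fun z => (M z).det) z :=
  (hasFDerivAt_det fun i j => (hM i j).hasFDerivAt).differentiableAt

theorem contDiffOn_det {n : WithTop ℕ∞} {M : E → Matrix (Fin d) (Fin d) ℝ} {s : Set E}
    (hM : ∀ i j, ContDiffOn ℝ n (fun z => M z i j) s) : ContDiffOn ℝ n (fun z => (M z).det) s := by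
  simp only [Matrix.det_apply']
  exact ContDiffOn.sum fun σ _ => contDiffOn_const.mul (contDiffOn_prod fun i _ => hM _ _)

theorem contDiffOn_adjugate {n : WithTop ℕ∞} {M : E → Matrix (Fin d) (Fin d) ℝ} {s : Set E}
    (hM : ∀ i j, ContDiffOn ℝ n (fun z => M z i j) s) (i j : Fin d) :
    ContDiffOn ℝ n (fun z => (M z).adjugate i j) s := by
  simp only [Matrix.adjugate_apply]
  refine contDiffOn_det fun a b => ?_
  simp only [Matrix.updateRow_apply]
  split_ifs
  exacts [contDiffOn_const, hM a b]

theorem differentiableAt_adjugate {M : E → Matrix (Fin d) (Fin d) ℝ} {z : E}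
    (hM : ∀ i j, DifferentiableAt ℝ (fun z => M z i j) z) (i j : Fin d) :
    DifferentiableAt ℝ (fun z => (M z).adjugate i j) z := by
  simp only [Matrix.adjugate_apply]
  refine differentiableAt_det fun a b => ?_
  simp only [Matrix.updateRow_apply]
  split_ifs
  exacts [differentiableAt_const _, hM a b]

theorem inv_apply_eq (A : Matrix (Fin d) (Fin d) ℝ) (i j : Fin d) :
    A⁻¹ i j = A.det⁻¹ * A.adjugate i j := by
  rw [Matrix.inv_def, Ring.inverse_eq_inv', Matrix.smul_apply, smul_eq_mul]

theorem contDiffOn_inv_apply {n : WithTop ℕ∞} {M : E → Matrix (Fin d) (Fin d) ℝ} {s : Set E}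
    (hM : ∀ i j, ContDiffOn ℝ n (fun z => M z i j) s) (hdet : ∀ z ∈ s, (M z).det ≠ 0)
    (i j : Fin d) : ContDiffOn ℝ n (fun z => (M z)⁻¹ i j) s := by
  simp only [inv_apply_eq]
  exact ((contDiffOn_det hM).inv hdet).mul (contDiffOn_adjugate hM i j)

/-- Piola's identity: the columns of the cofactor matrix of a Jacobi matrix are divergence free. -/
theorem piola_identity {M : Eucl d → Matrix (Fin d) (Fin d) ℝ} {z : Eucl d}
    (hM : ∀ i j, DifferentiableAt ℝ (fun z => M z i j) z)
    (hsymm : ∀ i a b, fderiv ℝ (fun z => M z a b) z (coordVec i) =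
      fderiv ℝ (fun z => M z a i) z (coordVec b))
    (hdet : (M z).det ≠ 0) (k : Fin d) :
    ∑ i, fderiv ℝ (fun z => (M z).adjugate i k) z (coordVec i) = 0 := by
  set v : Fin d → ℝ := fun k => ∑ i, fderiv ℝ (fun z => (M z).adjugate i k) z (coordVec i)
  have hadj := differentiableAt_adjugate hM
  have hkey : ∀ i b, ∑ a, (fderiv ℝ (fun z => (M z).adjugate i a) z (coordVec i) * M z a b +
      (M z).adjugate i a * fderiv ℝ (fun z => M z a b) z (coordVec i)) =
      if i = b then fderiv ℝ (fun z => (M z).det) z (coordVec i) else 0 := by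
    intro i b
    have h1 : (fun z => ∑ a, (M z).adjugate i a * M z a b) =
        fun z => if i = b then (M z).det else 0 := by
      funext z
      have := congrFun (congrFun (Matrix.adjugate_mul (M z)) i) b
      rw [Matrix.mul_apply] at this
      rw [this, Matrix.smul_apply, Matrix.one_apply]
      split_ifs <;> simp
    have h2 : HasFDerivAt (fun z => ∑ a, (M z).adjugate i a * M z a b)
        (∑ a, ((M z).adjugate i a • fderiv ℝ (fun z => M z a b) z +
          M z a b • fderiv ℝ (fun z => (M z).adjugate i a) z)) z :=
      HasFDerivAt.fun_sum fun a _ => (hadj i a).hasFDerivAt.mul (hM a b).hasFDerivAt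
    have h3 := congrArg (fun L => L (coordVec i)) h2.fderiv
    rw [h1] at h3
    have h4 : fderiv ℝ (fun z => if i = b then (M z).det else 0) z (coordVec i) =
        if i = b then fderiv ℝ (fun z => (M z).det) z (coordVec i) else 0 := by
      split_ifs <;> simp
    rw [← h4, h3]
    simp only [sum_apply, add_apply, smul_apply, smul_eq_mul]
    exact sum_congr rfl fun a _ => by ring
  have hv : Matrix.vecMul v (M z) = 0 := by
    funext b
    have h1 : ∑ i, ∑ a, (fderiv ℝ (fun z => (M z).adjugate i a) z (coordVec i) * M z a b +
        (M z).adjugate i a * fderiv ℝ (fun z => M z a b) z (coordVec i)) =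
        fderiv ℝ (fun z => (M z).det) z (coordVec b) := by
      simp only [hkey]
      simp
    rw [(hasFDerivAt_det fun i j => (hM i j).hasFDerivAt).fderiv] at h1
    simp only [sum_add_distrib, sum_apply, smul_apply, smul_eq_mul] at h1
    have h2 : ∑ i, ∑ a, (M z).adjugate i a * fderiv ℝ (fun z => M z a b) z (coordVec i) =
        ∑ a, ∑ i, (M z).adjugate i a * fderiv ℝ (fun z => M z a i) z (coordVec b) := by
      rw [sum_comm]
      exact sum_congr rfl fun a _ => sum_congr rfl fun i _ => by rw [hsymm i a b]
    rw [h2] at h1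
    have h3 : ∑ i, ∑ a, fderiv ℝ (fun z => (M z).adjugate i a) z (coordVec i) * M z a b = 0 := by
      linarith
    rw [Matrix.vecMul, dotProduct, Pi.zero_apply, ← h3, sum_comm]
    exact sum_congr rfl fun a _ => by rw [sum_mul]
  have := Matrix.eq_zero_of_vecMul_eq_zero hdet hv
  exact congrFun this k

end Piola

section CoordLaplacian

variable {d : ℕ}

/-- The Jacobi matrix of `θ`. -/
def jacobiMatrix (θ : Eucl d → Eucl d) (z : Eucl d) : Matrix (Fin d) (Fin d) ℝ :=
  Matrix.of fun k i => fderiv ℝ θ z (coordVec i) k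

theorem eucl_eq_sum (v : Eucl d) : v = ∑ k, v k • coordVec k := by
  ext j
  simp [Finset.sum_apply, coordVec, Pi.single_apply]

theorem pderivC_comp {f : Eucl d → ℂ} {θ : Eucl d → Eucl d} {z : Eucl d}
    (hf : DifferentiableAt ℝ f (θ z)) (hθ : DifferentiableAt ℝ θ z) (i : Fin d) :
    pderivC i (fun z => f (θ z)) z = ∑ k, (jacobiMatrix θ z k i : ℂ) * pderivC k f (θ z) := by
  have h1 : fderiv ℝ (fun z => f (θ z)) z = (fderiv ℝ f (θ z)).comp (fderiv ℝ θ z) :=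
    fderiv_comp z hf hθ
  rw [pderivC, h1, ContinuousLinearMap.comp_apply]
  conv_lhs => rw [eucl_eq_sum (fderiv ℝ θ z (EuclideanSpace.single i 1))]
  rw [map_sum]
  refine sum_congr rfl fun k _ => ?_
  rw [map_smul]
  simp [jacobiMatrix, pderivC, coordVec]

theorem contDiffAt_pderivC {f : Eucl d → ℂ} {n k : WithTop ℕ∞} {z : Eucl d}
    (hf : ContDiffAt ℝ n f z) (hk : k + 1 ≤ n) (i : Fin d) : ContDiffAt ℝ k (pderivC i f) z :=
  (hf.fderiv_right hk).clm_apply contDiffAt_const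

/-- The `i`-th partial derivative of a real valued function. -/
def pderivR (i : Fin d) (f : Eucl d → ℝ) (z : Eucl d) : ℝ := fderiv ℝ f z (coordVec i)

theorem pderivR_congr {i : Fin d} {f f' : Eucl d → ℝ} {z : Eucl d} (h : f =ᶠ[𝓝 z] f') :
    pderivR i f z = pderivR i f' z := by
  rw [pderivR, h.fderiv_eq, pderivR]

theorem ContDiffOn.pderivR {f : Eucl d → ℝ} {V : Set (Eucl d)} (hV : IsOpen V)
    (hf : ContDiffOn ℝ ∞ f V) (i : Fin d) : ContDiffOn ℝ ∞ (pderivR i f) V :=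
  (hf.fderiv_of_isOpen hV (by simp)).clm_apply contDiffOn_const

theorem pderivC_mul {f g : Eucl d → ℂ} {z : Eucl d} (hf : DifferentiableAt ℝ f z)
    (hg : DifferentiableAt ℝ g z) (i : Fin d) :
    pderivC i (fun z => f z * g z) z = pderivC i f z * g z + f z * pderivC i g z := by
  rw [pderivC, (hf.hasFDerivAt.fun_mul hg.hasFDerivAt).fderiv]
  simp [pderivC]
  ring

theorem pderivC_ofReal {f : Eucl d → ℝ} {z : Eucl d} (hf : DifferentiableAt ℝ f z) (i : Fin d) :
    pderivC i (fun z => (f z : ℂ)) z = (pderivR i f z : ℂ) := by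
  have h : HasFDerivAt (fun z => (f z : ℂ)) (Complex.ofRealCLM.comp (fderiv ℝ f z)) z :=
    Complex.ofRealCLM.hasFDerivAt.comp z hf.hasFDerivAt
  rw [pderivC, h.fderiv]
  rfl

theorem pderivC_sum {ι : Type*} {s : Finset ι} {f : ι → Eucl d → ℂ} {z : Eucl d}
    (hf : ∀ k ∈ s, DifferentiableAt ℝ (f k) z) (i : Fin d) :
    pderivC i (fun z => ∑ k ∈ s, f k z) z = ∑ k ∈ s, pderivC i (f k) z := by
  rw [pderivC, (HasFDerivAt.fun_sum fun k hk => (hf k hk).hasFDerivAt).fderiv, sum_apply]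
  rfl

theorem pderivC_add {f g : Eucl d → ℂ} {z : Eucl d} (hf : DifferentiableAt ℝ f z)
    (hg : DifferentiableAt ℝ g z) (i : Fin d) :
    pderivC i (fun z => f z + g z) z = pderivC i f z + pderivC i g z := by
  rw [pderivC, (hf.hasFDerivAt.fun_add hg.hasFDerivAt).fderiv]
  rfl

theorem pderivC_const_mul {f : Eucl d → ℂ} {c : ℂ} {i : Fin d} :
    pderivC i (fun z => c * f z) = fun z => c * pderivC i f z :=
  funext fun z => congrArg (fun L => L z (coordVec i)) (fderiv_const_smul_field (𝕜 := ℝ) c (f := f))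

theorem pderivC_congr {i : Fin d} {f f' : Eucl d → ℂ} {z : Eucl d} (h : f =ᶠ[𝓝 z] f') :
    pderivC i f z = pderivC i f' z := by
  rw [pderivC, h.fderiv_eq, pderivC]

theorem sqrt_abs_det_congr {J G : Matrix (Fin d) (Fin d) ℝ} :
    √|(J.transpose * G * J).det| = |J.det| * √|G.det| := by
  rw [Matrix.det_mul, Matrix.det_mul, Matrix.det_transpose,
    show J.det * G.det * J.det = J.det ^ 2 * G.det by ring, abs_mul, abs_pow, Real.sqrt_mul (by positivity),
    Real.sqrt_sq (abs_nonneg _)]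

theorem flux_congr {J G : Matrix (Fin d) (Fin d) ℝ} (hJ : J.det ≠ 0) (i k : Fin d) :
    √|(J.transpose * G * J).det| * ∑ j, (J.transpose * G * J)⁻¹ i j * J k j =
      ∑ l, SignType.sign J.det * J.adjugate i l * (√|G.det| * G⁻¹ l k) := by
  have hu : IsUnit J.det := isUnit_iff_ne_zero.2 hJ
  have hut : IsUnit J.transpose.det := by rwa [Matrix.det_transpose]
  have h1 : (J.transpose * G * J)⁻¹ * J.transpose = J⁻¹ * G⁻¹ := by
    rw [Matrix.mul_inv_rev, Matrix.mul_inv_rev, Matrix.mul_assoc, Matrix.mul_assoc,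
      Matrix.nonsing_inv_mul _ hut, Matrix.mul_one]
  have h2 : ∑ j, (J.transpose * G * J)⁻¹ i j * J k j = ∑ l, J⁻¹ i l * G⁻¹ l k := by
    have := congrFun (congrFun h1 i) k
    rwa [Matrix.mul_apply, Matrix.mul_apply] at this
  rw [h2, sqrt_abs_det_congr, mul_sum]
  refine sum_congr rfl fun l _ => ?_
  rw [inv_apply_eq, ← sign_mul_self J.det]
  field_simp

theorem coordLaplacian_comp {G G' : Eucl d → Matrix (Fin d) (Fin d) ℝ} {θ : Eucl d → Eucl d}
    {f : Eucl d → ℂ} {z : Eucl d} (hθ : ContDiffAt ℝ 2 θ z) (hJ : (jacobiMatrix θ z).det ≠ 0)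
    (hG : ∀ i j, ContDiffAt ℝ 1 (fun z => G z i j) (θ z)) (hdet : (G (θ z)).det ≠ 0)
    (hG' : ∀ᶠ z' in 𝓝 z, G' z' = (jacobiMatrix θ z').transpose * G (θ z') * jacobiMatrix θ z')
    (hf : ContDiffAt ℝ 2 f (θ z)) :
    coordLaplacian G' (fun z => f (θ z)) z = coordLaplacian G f (θ z) := by
  set J := jacobiMatrix θ with hJdef
  set s : ℝ := ((SignType.sign (J z).det : SignType) : ℝ) with hs
  have hθc : ContinuousAt θ z := hθ.continuousAt
  have hJd : ∀ k i, ContDiffAt ℝ 1 (fun z => J z k i) z := fun k i => by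
    have h1 : ContDiffAt ℝ 1 (fun z => fderiv ℝ θ z (coordVec i)) z :=
      (hθ.fderiv_right (by norm_num)).clm_apply contDiffAt_const
    exact contDiffAt_euclidean.1 h1 k
  have hJdiff : ∀ k i, DifferentiableAt ℝ (fun z => J z k i) z := fun k i =>
    (hJd k i).differentiableAt (by norm_num)
  have hJdet : DifferentiableAt ℝ (fun z => (J z).det) z := differentiableAt_det hJdiff
  have hsign : ∀ᶠ z' in 𝓝 z, (J z').det ≠ 0 ∧ ((SignType.sign (J z').det : SignType) : ℝ) = s := by
    rcases lt_or_gt_of_ne hJ with h | h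
    · filter_upwards [hJdet.continuousAt.eventually (gt_mem_nhds h)] with z' hz'
      exact ⟨hz'.ne, by rw [hs, sign_neg hz', sign_neg h]⟩
    · filter_upwards [hJdet.continuousAt.eventually (lt_mem_nhds h)] with z' hz'
      exact ⟨hz'.ne', by rw [hs, sign_pos hz', sign_pos h]⟩
  set W : Fin d → Eucl d → ℂ := fun k z' =>
    ((√|(G z').det| : ℝ) : ℂ) * ∑ j, (((G z')⁻¹ k j : ℝ) : ℂ) * pderivC j f z' with hW
  have hGdiff : ∀ i j, DifferentiableAt ℝ (fun z => G z i j) (θ z) := fun i j =>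
    (hG i j).differentiableAt (by norm_num)
  have hWd : ∀ k, DifferentiableAt ℝ (W k) (θ z) := by
    intro k
    have hdd : DifferentiableAt ℝ (fun z => (G z).det) (θ z) := differentiableAt_det hGdiff
    have h1 : DifferentiableAt ℝ (fun z' => √|(G z').det|) (θ z) :=
      (hdd.abs hdet).sqrt (abs_ne_zero.2 hdet)
    have h2 : ∀ j, DifferentiableAt ℝ (fun z' => (G z')⁻¹ k j) (θ z) := fun j => by
      simp only [inv_apply_eq]
      exact (hdd.inv hdet).mul (differentiableAt_adjugate hGdiff k j)
    refine (Complex.ofRealCLM.differentiableAt.comp _ h1).mul (DifferentiableAt.fun_sum fun j _ => ?_)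
    exact (Complex.ofRealCLM.differentiableAt.comp _ (h2 j)).mul
      ((contDiffAt_pderivC (k := 1) hf (by norm_num) j).differentiableAt (by norm_num))
  have hf_near : ∀ᶠ z' in 𝓝 z, DifferentiableAt ℝ f (θ z') :=
    hθc.eventually ((hf.eventually (by simp)).mono fun _ h => h.differentiableAt (by norm_num))
  have hθ_near : ∀ᶠ z' in 𝓝 z, DifferentiableAt ℝ θ z' :=
    (hθ.eventually (by simp)).mono fun _ h => h.differentiableAt (by norm_num)
  have hflux : ∀ i, (fun z' => ((√|(G' z').det| : ℝ) : ℂ) *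
      ∑ j, (((G' z')⁻¹ i j : ℝ) : ℂ) * pderivC j (fun z => f (θ z)) z') =ᶠ[𝓝 z]
      fun z' => ∑ l, ((s * (J z').adjugate i l : ℝ) : ℂ) * W l (θ z') := by
    intro i
    filter_upwards [hG', hsign, hf_near, hθ_near] with z' h1 h2 h3 h4
    have h5 := fun k => congrArg (fun r : ℝ => (r : ℂ)) (flux_congr (G := G (θ z')) h2.1 i k)
    simp only [pderivC_comp h3 h4]
    rw [h1]
    calc _ = ∑ k, ((√|((J z').transpose * G (θ z') * J z').det| *
          ∑ j, ((J z').transpose * G (θ z') * J z')⁻¹ i j * J z' k j : ℝ) : ℂ) *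
          pderivC k f (θ z') := by
          push_cast
          simp only [mul_sum, sum_mul]
          rw [sum_comm]
          refine sum_congr rfl fun k _ => sum_congr rfl fun j _ => ?_
          ring
      _ = ∑ k, ((∑ l, SignType.sign (J z').det * (J z').adjugate i l *
          (√|(G (θ z')).det| * (G (θ z'))⁻¹ l k) : ℝ) : ℂ) * pderivC k f (θ z') :=
          sum_congr rfl fun k _ => congrArg (· * _) (h5 k)
      _ = _ := by
          rw [h2.2, hW]
          push_cast
          simp only [mul_sum, sum_mul]
          rw [sum_comm]
          refine sum_congr rfl fun k _ => sum_congr rfl fun j _ => ?_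
          ring
  have hadj := differentiableAt_adjugate hJdiff
  have hθd : DifferentiableAt ℝ θ z := hθ.differentiableAt (by norm_num)
  have hdiv : ∑ i, pderivC i (fun z' => ((√|(G' z').det| : ℝ) : ℂ) *
      ∑ j, (((G' z')⁻¹ i j : ℝ) : ℂ) * pderivC j (fun z => f (θ z)) z') z =
      ((|(J z).det| : ℝ) : ℂ) * ∑ k, pderivC k (W k) (θ z) := by
    have h1 : ∀ i, pderivC i (fun z' => ((√|(G' z').det| : ℝ) : ℂ) *
        ∑ j, (((G' z')⁻¹ i j : ℝ) : ℂ) * pderivC j (fun z => f (θ z)) z') z =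
        ∑ l, (((s * fderiv ℝ (fun z => (J z).adjugate i l) z (coordVec i) : ℝ) : ℂ) * W l (θ z) +
          ((s * (J z).adjugate i l : ℝ) : ℂ) * ∑ k, (J z k i : ℂ) * pderivC k (W l) (θ z)) := by
      intro i
      have h3 := fun l => (hadj i l).const_mul s
      have h4 : ∀ l, DifferentiableAt ℝ (fun z => ((s * (J z).adjugate i l : ℝ) : ℂ)) z := fun l =>
        Complex.ofRealCLM.differentiableAt.comp z (h3 l)
      have h5 : ∀ l, DifferentiableAt ℝ (fun z => W l (θ z)) z := fun l => (hWd l).comp z hθd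
      rw [pderivC_congr (hflux i), pderivC_sum fun l _ => (h4 l).fun_mul (h5 l)]
      refine sum_congr rfl fun l _ => ?_
      rw [pderivC_mul (h4 l) (h5 l), pderivC_ofReal (h3 l), pderivC_comp (hWd l) hθd, pderivR,
        fderiv_const_mul (hadj i l)]
      simp [hJdef]
    have hsymm : ∀ i a b, fderiv ℝ (fun z => J z a b) z (coordVec i) =
        fderiv ℝ (fun z => J z a i) z (coordVec b) := by
      intro i a b
      have h3 : IsSymmSndFDerivAt ℝ θ z := hθ.isSymmSndFDerivAt (by simp)
      have h4 : ∀ b, fderiv ℝ (fun z => J z a b) z = (EuclideanSpace.proj a : Eucl d →L[ℝ] ℝ).comp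
            ((ContinuousLinearMap.apply ℝ (Eucl d) (coordVec b)).comp (fderiv ℝ (fderiv ℝ θ) z)) := by
        intro b
        have h5 := (hθ.fderiv_right (m := 1) le_rfl).differentiableAt one_ne_zero
        exact ((EuclideanSpace.proj a : Eucl d →L[ℝ] ℝ).hasFDerivAt.comp z
          ((ContinuousLinearMap.apply ℝ (Eucl d) (coordVec b)).hasFDerivAt.comp z
            h5.hasFDerivAt)).fderiv
      rw [h4, h4]
      exact congrArg (· a) (h3 _ _)
    simp only [h1, sum_add_distrib]
    have h6 : ∑ i, ∑ l, ((s * fderiv ℝ (fun z => (J z).adjugate i l) z (coordVec i) : ℝ) : ℂ) *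
        W l (θ z) = 0 := by
      rw [sum_comm]
      refine Finset.sum_eq_zero fun l _ => ?_
      rw [← sum_mul, ← Complex.ofReal_sum, ← mul_sum, piola_identity hJdiff hsymm hJ]
      simp
    have h7 : ∀ k l, ∑ i, J z k i * (J z).adjugate i l = if k = l then (J z).det else 0 := by
      intro k l
      have := congrFun (congrFun (Matrix.mul_adjugate (J z)) k) l
      rw [Matrix.mul_apply] at this
      rw [this, Matrix.smul_apply, Matrix.one_apply]
      split_ifs <;> simp
    rw [h6, zero_add]
    calc _ = ∑ l, ∑ k, ((s * ∑ i, J z k i * (J z).adjugate i l : ℝ) : ℂ) *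
          pderivC k (W l) (θ z) := by
          rw [sum_comm]
          refine sum_congr rfl fun l _ => ?_
          push_cast
          simp only [mul_sum, sum_mul]
          rw [sum_comm]
          refine sum_congr rfl fun k _ => sum_congr rfl fun i _ => ?_
          ring
      _ = _ := by
          simp only [h7]
          rw [mul_sum]
          refine sum_congr rfl fun l _ => ?_
          rw [Finset.sum_eq_single l]
          · rw [if_pos rfl, hs, sign_mul_self]
          · exact fun k _ hk => by simp [hk]
          · simp
  rw [coordLaplacian, hdiv, hG'.self_of_nhds, sqrt_abs_det_congr, coordLaplacian]
  have h8 : ((|(J z).det| : ℝ) : ℂ) ≠ 0 := by exact_mod_cast abs_ne_zero.2 hJ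
  push_cast
  rw [mul_inv]
  field_simp
  rfl

end CoordLaplacian

/-! ### The Laplacian in a parametrization -/

section Param

open scoped Matrix

variable {X : CompactManifoldWithBoundary.{u} m}

theorem CompactManifoldWithBoundary.isOpen_interiorSet (X : CompactManifoldWithBoundary.{u} m) :
    IsOpen X.interiorSet :=
  ModelWithCorners.isOpen_interior (n := ∞) (by simp)

theorem mem_interiorSet_iff {p : X} : p ∈ X.interiorSet ↔ p ∉ X.boundarySet := by
  rw [CompactManifoldWithBoundary.boundarySet, ← ModelWithCorners.compl_interior]
  exact not_not.symm

/-- `ψ` is a local diffeomorphism of the open set `V` to the interior of `X`. -/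
structure IsParamOn (ψ : 𝔼 → X) (V : Set 𝔼) : Prop where
  isOpen : IsOpen V
  smooth : ContMDiffOn 𝓘(ℝ, 𝔼) 𝓑 ∞ ψ V
  interior : ∀ z ∈ V, ψ z ∈ X.interiorSet
  exists_inv : ∀ z ∈ V, ∃ χ : X → 𝔼, ContMDiffAt 𝓑 𝓘(ℝ, 𝔼) ∞ χ (ψ z) ∧ ∀ᶠ w in 𝓝 z, χ (ψ w) = w

/-- Smoothness of a field of bilinear forms in the interior. -/
def BilinField.SmoothInterior (g : BilinField X) : Prop :=
  ContMDiffOn 𝓑 ((𝓑).prod 𝓘(ℝ, 𝔼 →L[ℝ] 𝔼 →L[ℝ] ℝ)) ∞ (bilinAlong 𝓑 id g) X.interiorSet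

/-- Nondegeneracy in the interior. -/
def BilinField.NondegInterior (g : BilinField X) : Prop :=
  ∀ p ∈ X.interiorSet, ∀ v, (∀ w, g p v w = 0) → v = 0

/-- The coefficient matrix of `g` in the parametrization `ψ`. -/
def paramMatrix (g : BilinField X) (ψ : 𝔼 → X) (z : 𝔼) : Matrix (Fin (m + 1)) (Fin (m + 1)) ℝ :=
  Matrix.of fun i j => g (ψ z) (mfderiv 𝓘(ℝ, 𝔼) 𝓑 ψ z (EuclideanSpace.single i 1))
    (mfderiv 𝓘(ℝ, 𝔼) 𝓑 ψ z (EuclideanSpace.single j 1))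

theorem paramMatrix_congr {g : BilinField X} {ψ ψ' : 𝔼 → X} {z : 𝔼}
    (h : ψ =ᶠ[𝓝 z] ψ') : paramMatrix g ψ z = paramMatrix g ψ' z := by
  ext i j
  simp only [paramMatrix, Matrix.of_apply]
  rw [h.mfderiv_eq]
  have := h.self_of_nhds
  congr 1
  rw [this]

theorem IsParamOn.mdifferentiableAt {ψ : 𝔼 → X} {V : Set 𝔼}
    (h : IsParamOn ψ V) {z : 𝔼} (hz : z ∈ V) :
    MDifferentiableAt 𝓘(ℝ, 𝔼) 𝓑 ψ z :=
  ((h.smooth z hz).contMDiffAt (h.isOpen.mem_nhds hz)).mdifferentiableAt (by simp)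

theorem mfderiv_injective_of_left_inv {d : ℕ} {F H N : Type*} [NormedAddCommGroup F]
    [NormedSpace ℝ F] [TopologicalSpace H] {J : ModelWithCorners ℝ F H} [TopologicalSpace N]
    [ChartedSpace H N] {f : Eucl d → N} {χ : N → Eucl d} {z : Eucl d}
    (hχ : MDifferentiableAt J 𝓘(ℝ, Eucl d) χ (f z)) (hf : MDifferentiableAt 𝓘(ℝ, Eucl d) J f z)
    (h : ∀ᶠ z' in 𝓝 z, χ (f z') = z') : Injective (mfderiv 𝓘(ℝ, Eucl d) J f z) := by
  have h1 := mfderiv_comp z hχ hf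
  rw [(show χ ∘ f =ᶠ[𝓝 z] id from h).mfderiv_eq, mfderiv_id] at h1
  exact Function.LeftInverse.injective (g := mfderiv J 𝓘(ℝ, Eucl d) χ (f z))
    fun v => (congrArg (fun L => L v) h1).symm

theorem IsParamOn.mfderiv_injective {ψ : 𝔼 → X} {V : Set 𝔼}
    (h : IsParamOn ψ V) {z : 𝔼} (hz : z ∈ V) :
    Injective (mfderiv 𝓘(ℝ, 𝔼) 𝓑 ψ z) := by
  obtain ⟨χ, hχ, hinv⟩ := h.exists_inv z hz
  exact mfderiv_injective_of_left_inv (hχ.mdifferentiableAt (by simp)) (h.mdifferentiableAt hz) hinv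

theorem surjective_of_injective {d : ℕ} {L : Eucl d →L[ℝ] Eucl d} (h : Injective L) :
    Surjective L :=
  LinearMap.injective_iff_surjective (f := L.toLinearMap).1 h

theorem IsParamOn.mfderiv_surjective {ψ : 𝔼 → X} {V : Set 𝔼}
    (h : IsParamOn ψ V) {z : 𝔼} (hz : z ∈ V) :
    Surjective (mfderiv 𝓘(ℝ, 𝔼) 𝓑 ψ z) :=
  surjective_of_injective (L := (mfderiv 𝓘(ℝ, 𝔼) 𝓑 ψ z : 𝔼 →L[ℝ] 𝔼)) (h.mfderiv_injective hz)

theorem IsParamOn.contDiffOn_paramMatrix {ψ : 𝔼 → X} {V : Set 𝔼}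
    (h : IsParamOn ψ V) {g : BilinField X} (hg : g.SmoothInterior) (i j : Fin (m + 1)) :
    ContDiffOn ℝ ∞ (fun z => paramMatrix g ψ z i j) V := by
  have h1 : ContMDiffOn 𝓘(ℝ, 𝔼) ((𝓑).prod 𝓘(ℝ, 𝔼 →L[ℝ] 𝔼 →L[ℝ] ℝ)) ∞
      (bilinAlong 𝓑 ψ fun z => g (ψ z)) V :=
    ContMDiffOn.comp hg h.smooth fun z hz => h.interior z hz
  have h2 := contDiffOn_param h.isOpen h.smooth h1
  exact (h2.clm_apply contDiffOn_const).clm_apply contDiffOn_const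

theorem form_eq_dotProduct {d : ℕ} (B : Eucl d →L[ℝ] Eucl d →L[ℝ] ℝ) (a b : Eucl d) :
    B a b = a.ofLp ⬝ᵥ (Matrix.of fun i j => B (coordVec i) (coordVec j)) *ᵥ b.ofLp := by
  conv_lhs => rw [eucl_eq_sum a, eucl_eq_sum b]
  simp only [map_sum, map_smul, sum_apply, smul_apply, smul_eq_mul, dotProduct, Matrix.mulVec,
    Matrix.of_apply, mul_sum]
  rw [sum_comm]
  exact sum_congr rfl fun i _ => sum_congr rfl fun j _ => by ring

theorem paramMatrix_dotProduct (g : BilinField X) (ψ : 𝔼 → X) (z a b : 𝔼) :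
    g (ψ z) (mfderiv 𝓘(ℝ, 𝔼) 𝓑 ψ z a) (mfderiv 𝓘(ℝ, 𝔼) 𝓑 ψ z b) =
      a.ofLp ⬝ᵥ paramMatrix g ψ z *ᵥ b.ofLp :=
  form_eq_dotProduct (bilinPull (g (ψ z)) (mfderiv 𝓘(ℝ, 𝔼) 𝓑 ψ z) : 𝔼 →L[ℝ] 𝔼 →L[ℝ] ℝ) a b

theorem IsParamOn.det_ne_zero {ψ : 𝔼 → X} {V : Set 𝔼} (h : IsParamOn ψ V) {g : BilinField X}
    (hg : g.NondegInterior) {z : 𝔼} (hz : z ∈ V) : (paramMatrix g ψ z).det ≠ 0 := by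
  intro h0
  obtain ⟨v, hv, hGv⟩ := Matrix.exists_vecMul_eq_zero_iff.2 h0
  refine hv (congrArg WithLp.ofLp (h.mfderiv_injective hz (a₁ := WithLp.toLp 2 v) (a₂ := 0)
    (.trans ?_ (map_zero _).symm)))
  refine hg _ (h.interior z hz) _ fun w => ?_
  obtain ⟨w, rfl⟩ := h.mfderiv_surjective hz w
  refine (paramMatrix_dotProduct g ψ z (WithLp.toLp 2 v) w).trans ?_
  rw [Matrix.dotProduct_mulVec, hGv, zero_dotProduct]

/-- The part of the target of the chart at `p` that corresponds to interior points. -/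
def interiorTarget (p : X) : Set 𝔼 :=
  (extChartAt 𝓑 p).target ∩ interior (range 𝓑)

theorem isOpen_interiorTarget (p : X) : IsOpen (interiorTarget p) := by
  have : interiorTarget p = (𝓑).symm ⁻¹' (chartAt (EuclideanHalfSpace (m + 1)) p).target ∩
      interior (range 𝓑) := by
    rw [interiorTarget, extChartAt_target]
    ext z
    simp only [mem_inter_iff, mem_preimage]
    exact ⟨fun h => ⟨h.1.1, h.2⟩, fun h => ⟨⟨h.1, interior_subset h.2⟩, h.2⟩⟩
  rw [this]
  exact ((chartAt _ p).open_target.preimage (𝓑).continuous_symm).inter isOpen_interior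

theorem mem_interiorTarget_iff {p : X} {z : 𝔼} (hz : z ∈ (extChartAt 𝓑 p).target) :
    z ∈ interiorTarget p ↔ (extChartAt 𝓑 p).symm z ∈ X.interiorSet := by
  set q := (extChartAt 𝓑 p).symm z with hq
  have hqs : q ∈ (extChartAt 𝓑 p).source := (extChartAt _ p).map_target hz
  have h1 := ModelWithCorners.isInteriorPoint_iff_of_mem_atlas (I := 𝓑) (n := ∞)
    (by simp) (chart_mem_atlas (EuclideanHalfSpace (m + 1)) p)
    (by rwa [extChartAt_source] at hqs : q ∈ (chartAt (EuclideanHalfSpace (m + 1)) p).source)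
  have h2 : (chartAt (EuclideanHalfSpace (m + 1)) p).extend 𝓑 q = z :=
    (extChartAt 𝓑 p).right_inv hz
  rw [h2] at h1
  change _ ↔ (𝓑).IsInteriorPoint q
  rw [h1]
  constructor
  · intro h
    exact mem_interior_iff_mem_nhds.2 (mem_of_superset ((isOpen_interiorTarget p).mem_nhds h)
      inter_subset_left)
  · exact fun h => ⟨hz, interior_mono (extChartAt_target_subset_range p) h⟩

theorem isParamOn_extChartAt_symm (p : X) :
    IsParamOn (extChartAt 𝓑 p).symm (interiorTarget p) where
  isOpen := isOpen_interiorTarget p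
  smooth := (contMDiffOn_extChartAt_symm p).mono inter_subset_left
  interior z hz := (mem_interiorTarget_iff hz.1).1 hz
  exists_inv z hz := by
    refine ⟨extChartAt 𝓑 p, ?_, ?_⟩
    · refine contMDiffAt_extChartAt' ?_
      have := (extChartAt 𝓑 p).map_target hz.1
      rwa [extChartAt_source] at this
    · filter_upwards [(isOpen_interiorTarget p).mem_nhds hz] with z' hz'
      exact (extChartAt _ p).right_inv hz'.1

theorem mem_interiorTarget_self {p : X} (hp : p ∈ X.interiorSet) :
    extChartAt 𝓑 p p ∈ interiorTarget p :=
  (mem_interiorTarget_iff (mem_extChartAt_target p)).2 (by rwa [extChartAt_to_inv])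

theorem coordLaplacian_congr {d : ℕ} {G : Eucl d → Matrix (Fin d) (Fin d) ℝ} {f f' : Eucl d → ℂ}
    {z : Eucl d} (h : f =ᶠ[𝓝 z] f') : coordLaplacian G f z = coordLaplacian G f' z := by
  refine congrArg _ (sum_congr rfl fun i _ => pderivC_congr ?_)
  filter_upwards [h.eventually_nhds] with z' hz'
  simp only [fun j => pderivC_congr (i := j) hz']

theorem two_le_infty : (2 : WithTop ℕ∞) ≤ ∞ :=
  ENat.LEInfty.out

/-- The Laplacian may be computed in any parametrization. -/
theorem laplacian_param {g : BilinField X} (hgs : g.SmoothInterior) (hgn : g.NondegInterior)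
    {ψ : 𝔼 → X} {V : Set 𝔼} (hψ : IsParamOn ψ V) {z : 𝔼}
    (hz : z ∈ V) {u : X → ℂ} (hu : ContMDiffAt 𝓑 𝓘(ℝ, ℂ) ∞ u (ψ z)) :
    laplacian g u (ψ z) = coordLaplacian (paramMatrix g ψ) (fun z => u (ψ z)) z := by
  set p := ψ z with hp
  set e := extChartAt 𝓑 p with he
  have hpi : p ∈ X.interiorSet := hψ.interior z hz
  have hV : V ∈ 𝓝 z := hψ.isOpen.mem_nhds hz
  set θ : 𝔼 → 𝔼 := fun z => e (ψ z) with hθdef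
  have hψc : ContMDiffAt 𝓘(ℝ, 𝔼) 𝓑 ∞ ψ z := (hψ.smooth z hz).contMDiffAt hV
  have hparam := isParamOn_extChartAt_symm p
  have hθz : θ z ∈ interiorTarget p := mem_interiorTarget_self hpi
  have hθs : ContDiffAt ℝ ∞ θ z :=
    ((contMDiffAt_extChartAt (I := 𝓑) (x := p)).comp z hψc).contDiffAt
  have hsrc : ∀ᶠ z' in 𝓝 z, ψ z' ∈ e.source :=
    hψc.continuousAt.eventually (extChartAt_source_mem_nhds p)
  have heq : ∀ᶠ z' in 𝓝 z, e.symm (θ z') = ψ z' := hsrc.mono fun z' h => e.left_inv h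
  have hθd : ∀ᶠ z' in 𝓝 z, DifferentiableAt ℝ θ z' :=
    ((hθs.of_le (m := 1) (by exact_mod_cast le_top)).eventually (by simp)).mono
      fun _ h => h.differentiableAt (by simp)
  have hθt : ∀ᶠ z' in 𝓝 z, θ z' ∈ interiorTarget p :=
    hθs.continuousAt.eventually (hparam.isOpen.mem_nhds hθz)
  have hder : ∀ᶠ z' in 𝓝 z, ∀ v, mfderiv 𝓘(ℝ, 𝔼) 𝓑 e.symm (θ z')
      (fderiv ℝ θ z' v) = mfderiv 𝓘(ℝ, 𝔼) 𝓑 ψ z' v := by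
    filter_upwards [heq.eventually_nhds, hθd, hθt] with z' h1 h2 h3 v
    have h4 := mfderiv_comp z' (hparam.mdifferentiableAt h3) h2.mdifferentiableAt
    have h5 : (e.symm ∘ θ) =ᶠ[𝓝 z'] ψ := h1
    rw [h5.mfderiv_eq, mfderiv_eq_fderiv] at h4
    rw [h4]
    rfl
  have hG' : ∀ᶠ z' in 𝓝 z, paramMatrix g ψ z' =
      (jacobiMatrix θ z').transpose * paramMatrix g e.symm (θ z') * jacobiMatrix θ z' := by
    filter_upwards [hder, heq] with z' h1 h2
    ext i j
    have := paramMatrix_dotProduct g e.symm (θ z') (fderiv ℝ θ z' (coordVec i))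
      (fderiv ℝ θ z' (coordVec j))
    rw [h1, h1, h2] at this
    rw [Matrix.mul_assoc]
    exact this
  have hJ : (jacobiMatrix θ z).det ≠ 0 := fun h0 => hψ.det_ne_zero hgn hz (by
    rw [hG'.self_of_nhds, Matrix.det_mul, h0, mul_zero])
  have hf : ContDiffAt ℝ ∞ (fun z => u (e.symm z)) (θ z) := by
    have h1 : ContMDiffAt 𝓘(ℝ, 𝔼) 𝓑 ∞ e.symm (θ z) :=
      (hparam.smooth _ hθz).contMDiffAt (hparam.isOpen.mem_nhds hθz)
    have h2 : e.symm (θ z) = p := heq.self_of_nhds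
    exact (ContMDiffAt.comp (θ z) (by rw [h2]; exact hu) h1).contDiffAt
  have hmain := coordLaplacian_comp (G := paramMatrix g e.symm) (G' := paramMatrix g ψ)
    (f := fun z => u (e.symm z)) (z := z) (θ := θ) (hθs.of_le two_le_infty) hJ
    (fun i j => ((hparam.contDiffOn_paramMatrix hgs i j).contDiffAt
      (hparam.isOpen.mem_nhds hθz)).of_le (by exact_mod_cast le_top))
    (hparam.det_ne_zero hgn hθz) hG' (hf.of_le two_le_infty)
  have h6 : coordLaplacian (paramMatrix g ψ) (fun z => u (ψ z)) z =
      coordLaplacian (paramMatrix g ψ) (fun z => u (e.symm (θ z))) z :=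
    coordLaplacian_congr (heq.mono fun z' h => by simp only [h])
  rw [h6, hmain]
  rfl

end Param

/-! ### Conjugated operators in coordinates -/

section Conjugation

variable {d : ℕ}

theorem ofReal_cpow_eq_exp {r : ℝ} (hr : 0 < r) (β : ℂ) :
    (r : ℂ) ^ β = Complex.exp ((Real.log r : ℂ) * β) := by
  rw [Complex.cpow_def_of_ne_zero (by exact_mod_cast hr.ne'), Complex.ofReal_log hr.le]

theorem contDiffAt_ofReal_cpow {E : Type*} [NormedAddCommGroup E] [NormedSpace ℝ E]
    {n : WithTop ℕ∞} {x : E → ℝ} {z : E} (hx : ContDiffAt ℝ n x z) (h0 : 0 < x z) (β : ℂ) :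
    ContDiffAt ℝ n (fun z => (x z : ℂ) ^ β) z := by
  have h1 : ContDiffAt ℝ n (fun z => Complex.exp ((Real.log (x z) : ℂ) * β)) z := by
    refine ContDiffAt.cexp (ContDiffAt.mul ?_ contDiffAt_const)
    exact Complex.ofRealCLM.contDiff.contDiffAt.comp z (hx.log h0.ne')
  refine h1.congr_of_eventuallyEq ?_
  filter_upwards [hx.continuousAt.eventually (lt_mem_nhds h0)] with z' hz'
  exact ofReal_cpow_eq_exp hz' β

theorem pderivC_ofReal_cpow {x : Eucl d → ℝ} {z : Eucl d} (hx : ContDiffAt ℝ 1 x z) (h0 : 0 < x z)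
    (β : ℂ) (i : Fin d) :
    pderivC i (fun z => (x z : ℂ) ^ β) z = β * (x z : ℂ) ^ β * (pderivR i x z / x z : ℝ) := by
  have hxd : DifferentiableAt ℝ x z := hx.differentiableAt (by simp)
  have h1 : HasFDerivAt (fun z => Complex.exp ((Real.log (x z) : ℂ) * β))
      (Complex.exp ((Real.log (x z) : ℂ) * β) • (β • Complex.ofRealCLM.comp
        ((x z)⁻¹ • fderiv ℝ x z))) z := by
    refine HasFDerivAt.cexp (HasFDerivAt.mul_const ?_ β)
    exact Complex.ofRealCLM.hasFDerivAt.comp z (hxd.hasFDerivAt.log h0.ne')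
  have h2 : (fun z => (x z : ℂ) ^ β) =ᶠ[𝓝 z] fun z => Complex.exp ((Real.log (x z) : ℂ) * β) := by
    filter_upwards [hx.continuousAt.eventually (lt_mem_nhds h0)] with z' hz'
    exact ofReal_cpow_eq_exp hz' β
  rw [pderivC, h2.fderiv_eq, h1.fderiv, ← ofReal_cpow_eq_exp h0]
  simp [pderivR]
  field_simp

/-- The operator `s x^{-2α-2} (div grad + Λ) x^{2α}`, for the metric with coefficient matrix `G`. -/
def confOp (α Λ : ℂ) (s : ℝ) (G : Eucl d → Matrix (Fin d) (Fin d) ℝ) (x : Eucl d → ℝ)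
    (f : Eucl d → ℂ) (z : Eucl d) : ℂ :=
  s * (x z : ℂ) ^ (-2 * α - 2) *
    (-coordLaplacian G (fun z => (x z : ℂ) ^ (2 * α) * f z) z + Λ * ((x z : ℂ) ^ (2 * α) * f z))

/-- The coefficients of a differential operator of order two, by order. -/
abbrev Coefs (d : ℕ) := (Fin d → Fin d → ℂ) × (Fin d → ℂ) × ℂ

/-- The value at `z` of the differential operator with coefficients `A`. -/
def diffExpr (A : Eucl d → Coefs d) (f : Eucl d → ℂ) (z : Eucl d) : ℂ :=
  ∑ i, ∑ j, (A z).1 i j * pderivC i (pderivC j f) z + ∑ i, (A z).2.1 i * pderivC i f z +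
    (A z).2.2 * f z

/-- The coefficients of the conjugated operator. -/
def confCoefs (α : ℂ) (k : ℕ) (K : Fin d → Fin d → Eucl d → ℝ) (ρ : Eucl d → ℝ)
    (Z : Fin d → Eucl d → ℝ) (κ : Eucl d → ℝ) (z : Eucl d) : Coefs d :=
  (fun i j => K i j z, fun j => (((ρ z)⁻¹ * ∑ i, pderivR i (fun z => ρ z * K i j z) z : ℝ) : ℂ) +
      (2 * α - k / 2) * Z j z,
    α * (((ρ z)⁻¹ * ∑ i, pderivR i (fun z => ρ z * Z i z) z : ℝ) : ℂ) + α * (α - k / 2) * κ z)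

/-- The conjugated operator in terms of the inverse metric and the volume density, rescaled by
powers of `x` and of `μ = s x²`. -/
theorem confOp_eq {k : ℕ} {α Λ : ℂ} (hΛ : Λ = 4 * α * (k / 2 - α)) {s : ℝ} (hs : s * s = 1)
    {G : Eucl d → Matrix (Fin d) (Fin d) ℝ} {x μ : Eucl d → ℝ} {f : Eucl d → ℂ} {z : Eucl d}
    {K : Fin d → Fin d → Eucl d → ℝ} {ρ : Eucl d → ℝ} {Z : Fin d → Eucl d → ℝ} {κ : Eucl d → ℝ}
    (hx : ContDiffAt ℝ 2 x z) (hx0 : 0 < x z) (hμ : ∀ᶠ z' in 𝓝 z, μ z' = s * x z' ^ 2)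
    (hK : ∀ i j, ContDiffAt ℝ 1 (K i j) z) (hρ : ContDiffAt ℝ 1 ρ z) (hρ0 : ρ z ≠ 0)
    (hZ : ∀ i, ContDiffAt ℝ 1 (Z i) z)
    (hsymm : ∀ i j, K i j z = K j i z)
    (hG : ∀ᶠ z' in 𝓝 z, ∀ i j, (G z')⁻¹ i j = μ z' * K i j z')
    (hdet : ∀ᶠ z' in 𝓝 z, √|(G z').det| * x z' ^ (k + 2) = ρ z')
    (hKZ : ∀ᶠ z' in 𝓝 z, ∀ i, ∑ j, K i j z' * pderivR j μ z' = μ z' * Z i z')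
    (hZμ : ∑ i, Z i z * pderivR i μ z = 4 + μ z * κ z)
    (hf : ContDiffAt ℝ 2 f z) :
    confOp α Λ s G x f z = diffExpr (confCoefs α k K ρ Z κ) f z := by
  have hs0 : s ≠ 0 := by rintro rfl; simp at hs
  have hsC : (s : ℂ) * s = 1 := by exact_mod_cast hs
  have hfnear : ∀ᶠ z' in 𝓝 z, DifferentiableAt ℝ f z' :=
    (hf.eventually (by simp)).mono fun _ h => h.differentiableAt (by simp)
  set l : Fin d → Eucl d → ℂ := fun i z => (pderivR i μ z / μ z : ℝ) with hl
  have hnear : ∀ᶠ z' in 𝓝 z, 0 < x z' ∧ μ z' ≠ 0 ∧ ∀ (β : ℂ) i (g : Eucl d → ℂ),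
      DifferentiableAt ℝ g z' → pderivC i (fun z => (x z : ℂ) ^ β * g z) z' =
        (x z' : ℂ) ^ β * (β / 2 * l i z' * g z' + pderivC i g z') := by
    filter_upwards [hμ.eventually_nhds, hx.continuousAt.eventually (lt_mem_nhds hx0),
      (hx.of_le one_le_two).eventually (by simp)] with z' h1 h2 h3
    refine ⟨h2, by rw [h1.self_of_nhds]; positivity, fun β i g hg => ?_⟩
    have h4 : pderivR i μ z' / μ z' = 2 * (pderivR i x z' / x z') := by
      rw [pderivR_congr h1, h1.self_of_nhds, pderivR,
        (((h3.differentiableAt (by simp)).hasFDerivAt.pow 2).const_mul s).fderiv]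
      simp [pderivR]
      field_simp
    rw [pderivC_mul ((contDiffAt_ofReal_cpow h3 h2 _).differentiableAt (by simp)) hg,
      pderivC_ofReal_cpow h3 h2]
    simp only [hl, h4]
    push_cast
    ring
  have hKl : ∀ᶠ z' in 𝓝 z, ∀ i, ∑ j, (K i j z' : ℂ) * l j z' = Z i z' := by
    filter_upwards [hKZ, hnear] with z' h1 h2 i
    have : ∑ j, K i j z' * (pderivR j μ z' / μ z') = Z i z' := by
      simp only [← mul_div_assoc, ← Finset.sum_div, h1 i]
      exact mul_div_cancel_left₀ _ h2.2.1
    simp only [hl]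
    exact_mod_cast this
  set V : Fin d → Eucl d → ℂ := fun i z' =>
    ∑ j, (K i j z' : ℂ) * pderivC j f z' + α * f z' * Z i z' with hV
  have hflux : ∀ i, (fun z' => ((√|(G z').det| : ℝ) : ℂ) * ∑ j, (((G z')⁻¹ i j : ℝ) : ℂ) *
      pderivC j (fun z => (x z : ℂ) ^ (2 * α) * f z) z') =ᶠ[𝓝 z]
      fun z' => (x z' : ℂ) ^ (2 * α - k) * (s * (ρ z' * V i z')) := by
    intro i
    filter_upwards [hμ, hG, hdet, hKl, hnear, hfnear] with z' h1 h2 h3 h4 ⟨h5, h6, h7⟩ h8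
    have hxC : (x z' : ℂ) ≠ 0 := by exact_mod_cast h5.ne'
    have hpow : (x z' : ℂ) ^ (2 * α) * (x z' : ℂ) ^ 2 =
        (x z' : ℂ) ^ (2 * α - k) * (x z' : ℂ) ^ (k + 2) := by
      rw [Complex.cpow_sub _ _ hxC, Complex.cpow_natCast, pow_add]
      field_simp
    simp only [h7 _ _ f h8, h2 i, ← h3, hV, ← h4 i, h1]
    push_cast
    have : ∑ j, (s * (x z' : ℂ) ^ 2 * K i j z') * ((x z' : ℂ) ^ (2 * α) *
        (2 * α / 2 * l j z' * f z' + pderivC j f z')) = s * ((x z' : ℂ) ^ (2 * α) * x z' ^ 2) *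
        (∑ j, (K i j z' : ℂ) * pderivC j f z' + α * f z' * ∑ j, (K i j z' : ℂ) * l j z') := by
      simp only [mul_sum, ← sum_add_distrib]
      exact sum_congr rfl fun j _ => by ring
    rw [this, hpow]
    ring
  have hpf : ∀ j, DifferentiableAt ℝ (pderivC j f) z := fun j =>
    (contDiffAt_pderivC (k := 1) hf (by norm_num) j).differentiableAt (by simp)
  have hfd := hfnear.self_of_nhds
  have hρd : DifferentiableAt ℝ ρ z := hρ.differentiableAt (by simp)
  have hprod : ∀ {r : Eucl d → ℝ} {g : Eucl d → ℂ}, ContDiffAt ℝ 1 r z → DifferentiableAt ℝ g z →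
      DifferentiableAt ℝ (fun z => ((ρ z * r z : ℝ) : ℂ) * g z) z ∧
      ∀ i, pderivC i (fun z => ((ρ z * r z : ℝ) : ℂ) * g z) z =
        (pderivR i (fun z => ρ z * r z) z : ℂ) * g z + ρ z * (r z * pderivC i g z) := by
    intro r g hr hg
    have h1 := hρd.fun_mul (hr.differentiableAt (by simp))
    have h2 : DifferentiableAt ℝ (fun z => ((ρ z * r z : ℝ) : ℂ)) z :=
      Complex.ofRealCLM.differentiableAt.comp z h1
    refine ⟨h2.mul hg, fun i => ?_⟩
    rw [pderivC_mul h2 hg, pderivC_ofReal h1]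
    push_cast
    ring
  have hρV : ∀ i, (fun z => (ρ z : ℂ) * V i z) = fun z =>
      ∑ j, ((ρ z * K i j z : ℝ) : ℂ) * pderivC j f z + ((ρ z * Z i z : ℝ) : ℂ) * (α * f z) := by
    intro i
    funext z
    rw [hV, mul_add, mul_sum]
    push_cast
    exact congrArg₂ _ (sum_congr rfl fun j _ => by ring) (by ring)
  have hsumd : ∀ i, DifferentiableAt ℝ
      (fun z => ∑ j, ((ρ z * K i j z : ℝ) : ℂ) * pderivC j f z) z :=
    fun i => .fun_sum fun j _ => (hprod (hK i j) (hpf j)).1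
  have hZd := fun i => hprod (hZ i) (hfd.const_mul α)
  have hρVd : ∀ i, DifferentiableAt ℝ (fun z => (ρ z : ℂ) * V i z) z := fun i =>
    hρV i ▸ (hsumd i).add (hZd i).1
  have hdivV : ∀ i, pderivC i (fun z => (ρ z : ℂ) * V i z) z =
      ∑ j, ((pderivR i (fun z => ρ z * K i j z) z : ℂ) * pderivC j f z +
        ρ z * (K i j z * pderivC i (pderivC j f) z)) +
      ((pderivR i (fun z => ρ z * Z i z) z : ℂ) * (α * f z) +
        ρ z * (Z i z * (α * pderivC i f z))) := fun i => by
    rw [hρV i, pderivC_add (hsumd i) (hZd i).1, pderivC_sum fun j _ => (hprod (hK i j) (hpf j)).1,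
      (hZd i).2, pderivC_const_mul]
    simp only [fun j => (hprod (hK i j) (hpf j)).2 i]
  have h1 := hμ.self_of_nhds
  obtain ⟨-, hμ0, h7⟩ := hnear.self_of_nhds
  have hxC : (x z : ℂ) ≠ 0 := by exact_mod_cast hx0.ne'
  have hμC : (μ z : ℂ) ≠ 0 := by exact_mod_cast hμ0
  have hρC : (ρ z : ℂ) ≠ 0 := by exact_mod_cast hρ0
  have hVμ : ∑ i, l i z * V i z =
      ∑ i, (Z i z : ℂ) * pderivC i f z + α * f z * (4 + μ z * κ z) / μ z := by
    have h12 : ∑ i, (Z i z : ℂ) * l i z = (4 + μ z * κ z) / μ z := by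
      have : ∑ i, Z i z * (pderivR i μ z / μ z) = (4 + μ z * κ z) / μ z := by
        rw [← hZμ, Finset.sum_div]
        exact sum_congr rfl fun i _ => by ring
      simp only [hl]
      exact_mod_cast this
    simp only [hV, mul_add, sum_add_distrib]
    congr 1
    · simp only [← hKl.self_of_nhds, mul_sum, sum_mul]
      rw [sum_comm]
      exact sum_congr rfl fun j _ => sum_congr rfl fun i _ => by
        rw [hsymm i j]; ring
    · rw [← mul_add, mul_div_assoc, ← h12, mul_sum]
      exact sum_congr rfl fun i _ => by ring
  have hE : confOp α Λ s G x f z = (ρ z : ℂ)⁻¹ * ∑ i, pderivC i (fun z => (ρ z : ℂ) * V i z) z +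
      (α - k / 2) * ∑ i, l i z * V i z + Λ * f z / μ z := by
    have hp1 : (x z : ℂ) ^ (-2 * α - 2) = ((x z : ℂ) ^ (2 * α) * (x z : ℂ) ^ 2)⁻¹ := by
      rw [show -2 * α - 2 = -(2 * α + (2 : ℕ)) by push_cast; ring, Complex.cpow_neg,
        Complex.cpow_add _ _ hxC, Complex.cpow_natCast]
    have hx2 : (x z : ℂ) ^ (2 * α) ≠ 0 := by simp [Complex.cpow_eq_zero_iff, hxC]
    have hdiv : ∀ i, pderivC i (fun z' => ((√|(G z').det| : ℝ) : ℂ) *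
        ∑ j, (((G z')⁻¹ i j : ℝ) : ℂ) * pderivC j (fun z => (x z : ℂ) ^ (2 * α) * f z) z') z =
        (x z : ℂ) ^ (2 * α - k) * s * (pderivC i (fun z => (ρ z : ℂ) * V i z) z +
          ρ z * ((α - k / 2) * (l i z * V i z))) := fun i => by
      rw [pderivC_congr (hflux i), h7 _ _ _ ((hρVd i).const_mul _), pderivC_const_mul]
      ring
    rw [confOp, coordLaplacian]
    simp only [hdiv]
    rw [← mul_sum, sum_add_distrib, ← mul_sum, ← mul_sum,
      eq_div_of_mul_eq (by positivity) hdet.self_of_nhds, h1, hp1, Complex.cpow_sub _ _ hxC,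
      Complex.cpow_natCast, pow_add]
    push_cast
    have hsC0 : (s : ℂ) ≠ 0 := by exact_mod_cast hs0
    have hs2 : (s : ℂ) ^ 2 = 1 := by rw [sq, hsC]
    field_simp
    simp only [hs2]
    ring
  rw [hE, hVμ]
  simp only [hdivV, sum_add_distrib, ← mul_sum, ← sum_mul]
  have f2 : ∑ i, (Z i z : ℂ) * (α * pderivC i f z) = α * ∑ i, (Z i z : ℂ) * pderivC i f z := by
    rw [mul_sum]
    exact sum_congr rfl fun i _ => by ring
  have f4 : ∑ j, (confCoefs α k K ρ Z κ z).2.1 j * pderivC j f z =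
      (ρ z : ℂ)⁻¹ * ∑ i, ∑ j, (pderivR i (fun z => ρ z * K i j z) z : ℂ) * pderivC j f z +
        (2 * α - k / 2) * ∑ i, (Z i z : ℂ) * pderivC i f z := by
    rw [sum_comm, mul_sum, mul_sum, ← sum_add_distrib]
    refine sum_congr rfl fun j _ => ?_
    rw [confCoefs, ← sum_mul]
    push_cast
    ring
  rw [f2, diffExpr, f4, confCoefs, hΛ]
  push_cast
  field_simp
  ring

end Conjugation

/-! ### Coefficients of the conjugated operators, and their extension across the boundary -/

section Coefficients

open scoped Matrix

variable {d : ℕ}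

/-- The inverse metric, rescaled by `μ`. -/
def scaledInv (G : Eucl d → Matrix (Fin d) (Fin d) ℝ) (μ : Eucl d → ℝ) (i j : Fin d)
    (z : Eucl d) : ℝ :=
  (μ z)⁻¹ * (G z)⁻¹ i j

/-- The volume density, rescaled by a power of `x`. -/
def scaledDensity (k : ℕ) (G : Eucl d → Matrix (Fin d) (Fin d) ℝ) (x : Eucl d → ℝ)
    (z : Eucl d) : ℝ :=
  √|(G z).det| * x z ^ (k + 2)

/-- The gradient of `μ`, rescaled. -/
def scaledGrad (G : Eucl d → Matrix (Fin d) (Fin d) ℝ) (μ : Eucl d → ℝ) (i : Fin d)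
    (z : Eucl d) : ℝ :=
  (μ z)⁻¹ * ∑ j, scaledInv G μ i j z * pderivR j μ z

/-- The deviation of the rescaled square norm of `dμ` from its value on the boundary. -/
def normDefect (G : Eucl d → Matrix (Fin d) (Fin d) ℝ) (μ : Eucl d → ℝ) (z : Eucl d) : ℝ :=
  (μ z)⁻¹ * (∑ i, scaledGrad G μ i z * pderivR i μ z - 4)

theorem contDiffOn_confCoefs {α : ℂ} {k : ℕ} {K : Fin d → Fin d → Eucl d → ℝ} {ρ : Eucl d → ℝ}
    {Z : Fin d → Eucl d → ℝ} {κ : Eucl d → ℝ} {V : Set (Eucl d)} (hV : IsOpen V)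
    (hK : ∀ i j, ContDiffOn ℝ ∞ (K i j) V) (hρ : ContDiffOn ℝ ∞ ρ V) (hρ0 : ∀ z ∈ V, ρ z ≠ 0)
    (hZ : ∀ i, ContDiffOn ℝ ∞ (Z i) V) (hκ : ContDiffOn ℝ ∞ κ V) :
    ContDiffOn ℝ ∞ (confCoefs α k K ρ Z κ) V := by
  have hc : ∀ {f : Eucl d → ℝ}, ContDiffOn ℝ ∞ f V → ContDiffOn ℝ ∞ (fun z => (f z : ℂ)) V :=
    fun h => Complex.ofRealCLM.contDiff.comp_contDiffOn h
  have hd : ∀ {f : Fin d → Eucl d → ℝ}, (∀ i, ContDiffOn ℝ ∞ (f i) V) → ContDiffOn ℝ ∞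
      (fun z => (((ρ z)⁻¹ * ∑ i, pderivR i (fun z => ρ z * f i z) z : ℝ) : ℂ)) V := fun h =>
    hc ((hρ.inv hρ0).mul (.sum fun i _ => (hρ.mul (h i)).pderivR hV i))
  exact (contDiffOn_pi.2 fun i => contDiffOn_pi.2 fun j => hc (hK i j)).prodMk
    ((contDiffOn_pi.2 fun j => (hd fun i => hK i j).add (contDiffOn_const.mul (hc (hZ j)))).prodMk
      ((contDiffOn_const.mul (hd hZ)).add (contDiffOn_const.mul (hc hκ))))

theorem confCoefs_congr {α : ℂ} {k : ℕ} {K K' : Fin d → Fin d → Eucl d → ℝ} {ρ ρ' : Eucl d → ℝ}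
    {Z Z' : Fin d → Eucl d → ℝ} {κ κ' : Eucl d → ℝ} {z : Eucl d}
    (hK : ∀ i j, K i j =ᶠ[𝓝 z] K' i j) (hρ : ρ =ᶠ[𝓝 z] ρ') (hZ : ∀ i, Z i =ᶠ[𝓝 z] Z' i)
    (hκ : κ z = κ' z) : confCoefs α k K ρ Z κ z = confCoefs α k K' ρ' Z' κ' z := by
  simp only [confCoefs, hρ.self_of_nhds, hκ, fun i j => (hK i j).self_of_nhds,
    fun i => (hZ i).self_of_nhds, fun i j => pderivR_congr (i := i) (hρ.fun_mul (hK i j)),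
    fun i => pderivR_congr (i := i) (hρ.fun_mul (hZ i))]

/-- The function `μ = s x²`. -/
def scaledSq (s : ℝ) (x : Eucl d → ℝ) (z : Eucl d) : ℝ := s * x z ^ 2

/-- The coefficients of the conjugated operator where `x` is positive. -/
def regularCoefs (α : ℂ) (k : ℕ) (s : ℝ) (G : Eucl d → Matrix (Fin d) (Fin d) ℝ)
    (x : Eucl d → ℝ) : Eucl d → Coefs d :=
  confCoefs α k (scaledInv G (scaledSq s x)) (scaledDensity k G x) (scaledGrad G (scaledSq s x))
    (normDefect G (scaledSq s x))

/-- `G` and `x` are smooth on the open set `V`, `G` is symmetric and nondegenerate and `x` is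
positive. -/
structure IsRegularData (s : ℝ) (G : Eucl d → Matrix (Fin d) (Fin d) ℝ) (x : Eucl d → ℝ)
    (V : Set (Eucl d)) : Prop where
  isOpen : IsOpen V
  sign : s * s = 1
  smooth : ∀ i j, ContDiffOn ℝ ∞ (fun z => G z i j) V
  det : ∀ z ∈ V, (G z).det ≠ 0
  symm : ∀ z ∈ V, (G z).IsSymm
  smooth_x : ContDiffOn ℝ ∞ x V
  pos : ∀ z ∈ V, 0 < x z

namespace IsRegularData

variable {s : ℝ} {G : Eucl d → Matrix (Fin d) (Fin d) ℝ} {x : Eucl d → ℝ} {V : Set (Eucl d)}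

theorem mu_ne (h : IsRegularData s G x V) : ∀ z ∈ V, scaledSq s x z ≠ 0 := fun z hz => by
  have h1 : s ≠ 0 := left_ne_zero_of_mul (h.sign.trans_ne one_ne_zero)
  have := h.pos z hz
  rw [scaledSq]
  positivity

theorem smooth_inv_mu (h : IsRegularData s G x V) : ContDiffOn ℝ ∞ (fun z => (scaledSq s x z)⁻¹) V :=
  (contDiffOn_const.mul (h.smooth_x.pow 2)).inv h.mu_ne

theorem smooth_pderivR_mu (h : IsRegularData s G x V) (i : Fin d) :
    ContDiffOn ℝ ∞ (pderivR i (scaledSq s x)) V :=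
  (contDiffOn_const.mul (h.smooth_x.pow 2)).pderivR h.isOpen i

theorem smooth_scaledInv (h : IsRegularData s G x V) (i j : Fin d) :
    ContDiffOn ℝ ∞ (scaledInv G (scaledSq s x) i j) V :=
  h.smooth_inv_mu.mul (contDiffOn_inv_apply h.smooth h.det i j)

theorem smooth_scaledDensity (h : IsRegularData s G x V) (k : ℕ) :
    ContDiffOn ℝ ∞ (scaledDensity k G x) V :=
  .mul (fun z hz => ((((contDiffOn_det h.smooth).contDiffAt (h.isOpen.mem_nhds hz)).abs
    (h.det z hz)).sqrt (abs_ne_zero.2 (h.det z hz))).contDiffWithinAt) (h.smooth_x.pow _)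

theorem scaledDensity_ne (h : IsRegularData s G x V) (k : ℕ) : ∀ z ∈ V, scaledDensity k G x z ≠ 0 :=
  fun z hz => by
    have h1 := abs_pos.2 (h.det z hz)
    have h2 := h.pos z hz
    rw [scaledDensity]
    positivity

theorem smooth_scaledGrad (h : IsRegularData s G x V) (i : Fin d) :
    ContDiffOn ℝ ∞ (scaledGrad G (scaledSq s x) i) V :=
  h.smooth_inv_mu.mul (.sum fun j _ => (h.smooth_scaledInv i j).mul (h.smooth_pderivR_mu j))

theorem smooth_regularCoefs (h : IsRegularData s G x V) (α : ℂ) (k : ℕ) :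
    ContDiffOn ℝ ∞ (regularCoefs α k s G x) V :=
  contDiffOn_confCoefs h.isOpen h.smooth_scaledInv (h.smooth_scaledDensity k) (h.scaledDensity_ne k)
    h.smooth_scaledGrad (h.smooth_inv_mu.mul ((ContDiffOn.sum fun i _ =>
      (h.smooth_scaledGrad i).mul (h.smooth_pderivR_mu i)).sub contDiffOn_const))

theorem confOp_eq (h : IsRegularData s G x V) {k : ℕ} {α Λ : ℂ} (hΛ : Λ = 4 * α * (k / 2 - α))
    {f : Eucl d → ℂ} {z : Eucl d} (hz : z ∈ V) (hf : ContDiffAt ℝ 2 f z) :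
    confOp α Λ s G x f z = diffExpr (regularCoefs α k s G x) f z := by
  have hV : V ∈ 𝓝 z := h.isOpen.mem_nhds hz
  refine _root_.confOp_eq hΛ h.sign (μ := scaledSq s x)
    ((h.smooth_x.contDiffAt hV).of_le two_le_infty) (h.pos z hz) (.of_forall fun _ => rfl)
    (fun i j => ((h.smooth_scaledInv i j).contDiffAt hV).of_le ENat.LEInfty.out)
    (((h.smooth_scaledDensity k).contDiffAt hV).of_le ENat.LEInfty.out) (h.scaledDensity_ne k z hz)
    (fun i => ((h.smooth_scaledGrad i).contDiffAt hV).of_le ENat.LEInfty.out) (fun i j => ?_) ?_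
    (.of_forall fun _ => rfl) ?_ ?_ hf
  · have h1 : (G z)⁻¹.IsSymm := by
      rw [Matrix.IsSymm, Matrix.transpose_nonsing_inv, h.symm z hz]
    rw [scaledInv, scaledInv, h1.apply]
  · filter_upwards [hV] with z' hz' i j using (mul_inv_cancel_left₀ (h.mu_ne z' hz') _).symm
  · filter_upwards [hV] with z' hz' i using (mul_inv_cancel_left₀ (h.mu_ne z' hz') _).symm
  · rw [normDefect, mul_inv_cancel_left₀ (h.mu_ne z hz)]
    ring

end IsRegularData

/-! #### The model near the boundary -/

theorem collar_matrix_inv {B G : Matrix (Fin d) (Fin d) ℝ} (hB : B.IsSymm) (hdet : B.det ≠ 0)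
    {e : Fin d → ℝ} (he : e ⬝ᵥ (B⁻¹ *ᵥ e) = 1) {μ : ℝ} (hμ : μ ≠ 0)
    (hG : G = (4 * μ ^ 2)⁻¹ • Matrix.vecMulVec e e + μ⁻¹ • (B - Matrix.vecMulVec e e)) :
    G⁻¹ = μ • ((4 * μ - 1) • Matrix.vecMulVec (B⁻¹ *ᵥ e) (B⁻¹ *ᵥ e) + B⁻¹) := by
  have hu : IsUnit B.det := isUnit_iff_ne_zero.2 hdet
  have hBi : B⁻¹.transpose = B⁻¹ := by rw [Matrix.transpose_nonsing_inv, hB]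
  set n := B⁻¹ *ᵥ e with hn
  have h1 : Matrix.vecMulVec e e * Matrix.vecMulVec n n = Matrix.vecMulVec e n := by
    rw [Matrix.vecMulVec_mul_vecMulVec, he, one_smul]
  have h2 : Matrix.vecMulVec e e * B⁻¹ = Matrix.vecMulVec e n := by
    rw [Matrix.vecMulVec_mul, hn, ← Matrix.mulVec_transpose, hBi]
  have h3 : B * Matrix.vecMulVec n n = Matrix.vecMulVec e n := by
    rw [Matrix.mul_vecMulVec, hn, Matrix.mulVec_mulVec, Matrix.mul_nonsing_inv _ hu,
      Matrix.one_mulVec]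
  have h4 : B * B⁻¹ = 1 := Matrix.mul_nonsing_inv _ hu
  refine Matrix.inv_eq_right_inv ?_
  rw [hG]
  simp only [Matrix.add_mul, Matrix.mul_add, Matrix.smul_mul, Matrix.mul_smul, Matrix.sub_mul, h1, h2,
    h3, h4, sub_self, smul_zero, smul_add, smul_sub, smul_smul]
  ext i j
  simp only [Matrix.add_apply, Matrix.smul_apply, Matrix.sub_apply, smul_eq_mul, Matrix.zero_apply]
  field_simp
  ring

theorem collar_matrix_det {B G : Matrix (Fin d) (Fin d) ℝ} (hdet : B.det ≠ 0)
    {e : Fin d → ℝ} (he : e ⬝ᵥ (B⁻¹ *ᵥ e) = 1) {μ : ℝ} (hμ : μ ≠ 0)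
    (hG : G = (4 * μ ^ 2)⁻¹ • Matrix.vecMulVec e e + μ⁻¹ • (B - Matrix.vecMulVec e e)) :
    G.det = (μ ^ (d + 1))⁻¹ * (B.det / 4) := by
  have hu : IsUnit B.det := isUnit_iff_ne_zero.2 hdet
  have h1 : G = μ⁻¹ • (B + Matrix.replicateCol Unit (((4 * μ)⁻¹ - 1) • e) *
      Matrix.replicateRow Unit e) := by
    rw [hG, ← Matrix.vecMulVec_eq, Matrix.smul_vecMulVec]
    ext i j
    simp only [Matrix.add_apply, Matrix.smul_apply, Matrix.sub_apply, smul_eq_mul]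
    field_simp
    ring
  have h2 : (1 + Matrix.replicateRow Unit e * B⁻¹ * Matrix.replicateCol Unit
      (((4 * μ)⁻¹ - 1) • e)).det = (4 * μ)⁻¹ := by
    rw [Matrix.det_unique, Matrix.add_apply, Matrix.one_apply_eq, Matrix.mul_assoc,
      Matrix.mul_apply]
    have h3 : ∑ j, Matrix.replicateRow Unit e default j *
        (B⁻¹ * Matrix.replicateCol Unit (((4 * μ)⁻¹ - 1) • e)) j default =
        ((4 * μ)⁻¹ - 1) * (e ⬝ᵥ (B⁻¹ *ᵥ e)) := by
      have h4 : ((4 * μ)⁻¹ - 1) * (e ⬝ᵥ (B⁻¹ *ᵥ e)) = e ⬝ᵥ (B⁻¹ *ᵥ (((4 * μ)⁻¹ - 1) • e)) := by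
        rw [Matrix.mulVec_smul, dotProduct_smul, smul_eq_mul]
      rw [h4]
      rfl
    rw [h3, he]
    ring
  rw [h1, Matrix.det_smul, Matrix.det_add_replicateCol_mul_replicateRow hu, h2, Fintype.card_fin,
    inv_pow, pow_succ]
  field_simp

/-- Smooth data on `V` in terms of which the metric has the form
`dμ² / (4 μ²) + (B - dμ²) / μ`, with `dμ` of unit length for `B`. -/
structure IsCollarData (B : Eucl d → Matrix (Fin d) (Fin d) ℝ) (μ : Eucl d → ℝ)
    (V : Set (Eucl d)) : Prop where
  isOpen : IsOpen V
  smooth_mu : ContDiffOn ℝ ∞ μ V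
  smooth : ∀ i j, ContDiffOn ℝ ∞ (fun z => B z i j) V
  symm : ∀ z ∈ V, (B z).IsSymm
  det : ∀ z ∈ V, 0 < (B z).det
  unit : ∀ z ∈ V, (fun i => pderivR i μ z) ⬝ᵥ ((B z)⁻¹ *ᵥ fun i => pderivR i μ z) = 1

namespace IsCollarData

variable {B : Eucl d → Matrix (Fin d) (Fin d) ℝ} {μ : Eucl d → ℝ} {V : Set (Eucl d)}

/-- The unit normal. -/
def normal (B : Eucl d → Matrix (Fin d) (Fin d) ℝ) (μ : Eucl d → ℝ) (i : Fin d) (z : Eucl d) : ℝ :=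
  ∑ j, (B z)⁻¹ i j * pderivR j μ z

/-- The extension of the rescaled inverse metric. -/
def extInv (B : Eucl d → Matrix (Fin d) (Fin d) ℝ) (μ : Eucl d → ℝ) (i j : Fin d) (z : Eucl d) : ℝ :=
  (4 * μ z - 1) * (normal B μ i z * normal B μ j z) + (B z)⁻¹ i j

/-- The extension of the rescaled density. -/
def extDensity (B : Eucl d → Matrix (Fin d) (Fin d) ℝ) (z : Eucl d) : ℝ := √(B z).det / 2

/-- The extension of the coefficients of the conjugated operator. -/
def collarCoefs (α : ℂ) (k : ℕ) (B : Eucl d → Matrix (Fin d) (Fin d) ℝ) (μ : Eucl d → ℝ) :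
    Eucl d → Coefs d :=
  confCoefs α k (extInv B μ) (extDensity B) (fun i z => 4 * normal B μ i z) fun _ => 0

theorem smooth_normal (h : IsCollarData B μ V) (i : Fin d) : ContDiffOn ℝ ∞ (normal B μ i) V :=
  ContDiffOn.sum fun j _ => (contDiffOn_inv_apply h.smooth (fun z hz => (h.det z hz).ne') i j).mul
    (h.smooth_mu.pderivR h.isOpen j)

theorem smooth_collarCoefs (h : IsCollarData B μ V) (α : ℂ) (k : ℕ) :
    ContDiffOn ℝ ∞ (collarCoefs α k B μ) V :=
  contDiffOn_confCoefs h.isOpen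
    (fun i j => (((contDiffOn_const.mul h.smooth_mu).sub contDiffOn_const).mul
      ((h.smooth_normal i).mul (h.smooth_normal j))).add
      (contDiffOn_inv_apply h.smooth (fun z hz => (h.det z hz).ne') i j))
    (((contDiffOn_det h.smooth).sqrt fun z hz => (h.det z hz).ne').div_const 2)
    (fun z hz => by have := h.det z hz; rw [extDensity]; positivity)
    (fun i => contDiffOn_const.mul (h.smooth_normal i)) contDiffOn_const

variable {s : ℝ} {G : Eucl (m + 1) → Matrix (Fin (m + 1)) (Fin (m + 1)) ℝ}
  {B : Eucl (m + 1) → Matrix (Fin (m + 1)) (Fin (m + 1)) ℝ} {x μ : Eucl (m + 1) → ℝ}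
  {V W : Set (Eucl (m + 1))}

theorem coef_eq (h : IsCollarData B μ V) (hs : s * s = 1) (hW : IsOpen W) (hWV : W ⊆ V)
    (hx : ∀ z ∈ W, 0 < x z) (hμ : ∀ z ∈ W, μ z = s * x z ^ 2)
    (hG : ∀ z ∈ W, G z = (4 * μ z ^ 2)⁻¹ • Matrix.vecMulVec (fun i => pderivR i μ z)
      (fun i => pderivR i μ z) +
      (μ z)⁻¹ • (B z - Matrix.vecMulVec (fun i => pderivR i μ z) fun i => pderivR i μ z))
    {z : 𝔼} (hz : z ∈ W) (α : ℂ) : regularCoefs α m s G x z = collarCoefs α m B μ z := by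
  have hs0 : s ≠ 0 := left_ne_zero_of_mul (hs.trans_ne one_ne_zero)
  have hμ0 : ∀ z ∈ W, μ z ≠ 0 := fun z hz => by
    have := hx z hz
    rw [hμ z hz]; positivity
  have hμd : ∀ z ∈ W, ∀ i, pderivR i (scaledSq s x) z = pderivR i μ z := fun z hz i =>
    pderivR_congr (by filter_upwards [hW.mem_nhds hz] with z hz using (hμ z hz).symm)
  have hK : ∀ z ∈ W, ∀ i j, scaledInv G (scaledSq s x) i j z = extInv B μ i j z := fun z hz i j => by
    rw [scaledInv, scaledSq, ← hμ z hz, collar_matrix_inv (h.symm z (hWV hz)) (h.det z (hWV hz)).ne'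
      (h.unit z (hWV hz)) (hμ0 z hz) (hG z hz), Matrix.smul_apply, smul_eq_mul,
      inv_mul_cancel_left₀ (hμ0 z hz)]
    rfl
  have hρ : ∀ z ∈ W, scaledDensity m G x z = extDensity B z := fun z hz => by
    have hxz := hx z hz
    have hB := h.det z (hWV hz)
    have habs : |μ z| = x z ^ 2 := by
      rw [hμ z hz, abs_mul, abs_of_pos (pow_pos hxz 2)]
      have : |s| = 1 := by
        have h1 : |s| * |s| = 1 := by rw [← abs_mul, hs, abs_one]
        nlinarith [abs_nonneg s]
      rw [this, one_mul]
    rw [scaledDensity, collar_matrix_det hB.ne' (h.unit z (hWV hz)) (hμ0 z hz) (hG z hz), abs_mul,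
      abs_inv, abs_pow, habs, abs_of_pos (by positivity : 0 < (B z).det / 4), ← pow_mul,
      mul_comm 2, pow_mul, Real.sqrt_mul (by positivity), Real.sqrt_inv,
      Real.sqrt_sq (by positivity), Real.sqrt_div hB.le,
      show (4 : ℝ) = 2 ^ 2 by norm_num, Real.sqrt_sq (by norm_num), extDensity]
    field_simp
  have hunit : ∀ z ∈ W, ∑ i, normal B μ i z * pderivR i μ z = 1 := fun z hz =>
    (dotProduct_comm _ _).trans (h.unit z (hWV hz))
  have hZ : ∀ z ∈ W, ∀ i, scaledGrad G (scaledSq s x) i z = 4 * normal B μ i z := fun z hz i => by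
    have h1 : ∑ j, extInv B μ i j z * pderivR j μ z = 4 * μ z * normal B μ i z := by
      simp only [extInv, add_mul, sum_add_distrib]
      have h2 : ∑ j, (4 * μ z - 1) * (normal B μ i z * normal B μ j z) * pderivR j μ z =
          (4 * μ z - 1) * normal B μ i z * ∑ j, normal B μ j z * pderivR j μ z := by
        rw [mul_sum]
        exact sum_congr rfl fun j _ => by ring
      rw [h2, hunit z hz]
      change _ + normal B μ i z = _
      ring
    simp only [scaledGrad, hK z hz, hμd z hz, h1]
    rw [scaledSq, ← hμ z hz, mul_comm 4, mul_assoc, inv_mul_cancel_left₀ (hμ0 z hz)]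
  have hnear : W ∈ 𝓝 z := hW.mem_nhds hz
  refine confCoefs_congr (fun i j => ?_) (by filter_upwards [hnear] using hρ) (fun i => ?_) ?_
  · filter_upwards [hnear] with z' hz' using hK z' hz' i j
  · filter_upwards [hnear] with z' hz' using hZ z' hz' i
  · simp only [normDefect, hZ z hz, hμd z hz, mul_assoc]
    rw [← mul_sum, hunit z hz]
    simp

end IsCollarData

end Coefficients

/-! ### Differential operators from local data on a dense set -/


section Patching

variable {d : ℕ}

theorem eq_of_eventually_eq_of_mem_closure {X Z : Type*} [TopologicalSpace X] [TopologicalSpace Z]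
    [T2Space Z] {F G : X → Z} {D : Set X} {q : X} (hq : q ∈ closure D) (hF : ContinuousAt F q)
    (hG : ContinuousAt G q) (h : ∀ᶠ q' in 𝓝[D] q, F q' = G q') : F q = G q := by
  have : (𝓝[D] q).NeBot := mem_closure_iff_nhdsWithin_neBot.1 hq
  exact tendsto_nhds_unique_of_eventuallyEq (hF.mono_left nhdsWithin_le_nhds)
    (hG.mono_left nhdsWithin_le_nhds) h

/-- A function on a dense set which extends smoothly near every point extends smoothly. -/
theorem exists_contDiffOn_extension {W : Type*} [NormedAddCommGroup W] [NormedSpace ℝ W]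
    {f : Eucl d → W} {T D : Set (Eucl d)} (hTD : ∀ z ∈ T, z ∈ closure D)
    (hf : ∀ z ∈ T, ∃ N ∈ 𝓝 z, ∃ F : Eucl d → W, ContDiffOn ℝ ∞ F N ∧ ∀ z' ∈ N ∩ D, F z' = f z') :
    ∃ F : Eucl d → W, ContDiffOn ℝ ∞ F T ∧ ∀ z ∈ T ∩ D, F z = f z := by
  choose! N hN F hF hFf using hf
  refine ⟨fun z => F z z, fun z hz => ?_, fun z hz =>
    hFf z hz.1 z ⟨mem_of_mem_nhds (hN z hz.1), hz.2⟩⟩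
  have hagree : ∀ z' ∈ T, N z ∈ 𝓝 z' → F z' z' = F z z' := by
    intro z' hz' hzz'
    refine eq_of_eventually_eq_of_mem_closure (hTD z' hz')
      ((hF z' hz').continuousOn.continuousAt (hN z' hz'))
      ((hF z hz).continuousOn.continuousAt hzz') ?_
    filter_upwards [self_mem_nhdsWithin, mem_nhdsWithin_of_mem_nhds (hN z' hz'),
      mem_nhdsWithin_of_mem_nhds hzz'] with w h1 h2 h3
    rw [hFf z' hz' w ⟨h2, h1⟩, hFf z hz w ⟨h3, h1⟩]
  refine ((hF z hz).contDiffAt (hN z hz)).contDiffWithinAt.congr_of_eventuallyEq_of_mem ?_ hz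
  filter_upwards [self_mem_nhdsWithin, mem_nhdsWithin_of_mem_nhds (eventually_mem_nhds_iff.2 (hN z hz))]
    with z' h2 h3 using hagree z' h2 h3

theorem ContDiffOn.pderivC {f : Eucl d → ℂ} {V : Set (Eucl d)} (hV : IsOpen V)
    (hf : ContDiffOn ℝ ∞ f V) (i : Fin d) : ContDiffOn ℝ ∞ (pderivC i f) V :=
  (hf.fderiv_of_isOpen hV (by simp)).clm_apply contDiffOn_const

theorem contDiffOn_diffExpr {A : Eucl d → Coefs d} {f : Eucl d → ℂ} {V : Set (Eucl d)}
    (hV : IsOpen V) (hA : ContDiffOn ℝ ∞ A V) (hf : ContDiffOn ℝ ∞ f V) :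
    ContDiffOn ℝ ∞ (diffExpr A f) V := by
  have h1 := fun i j => contDiffOn_pi.1 (contDiffOn_pi.1 hA.fst i) j
  exact ((ContDiffOn.sum fun i _ => .sum fun j _ => (h1 i j).mul ((hf.pderivC hV j).pderivC hV i)).add
    (.sum fun i _ => (contDiffOn_pi.1 hA.snd.fst i).mul (hf.pderivC hV i))).add (hA.snd.snd.mul hf)

theorem diffExpr_add {A : Eucl d → Coefs d} {f g : Eucl d → ℂ} {V : Set (Eucl d)} (hV : IsOpen V)
    (hf : ContDiffOn ℝ ∞ f V) (hg : ContDiffOn ℝ ∞ g V) {z : Eucl d} (hz : z ∈ V) :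
    diffExpr A (fun z => f z + g z) z = diffExpr A f z + diffExpr A g z := by
  have hd : ∀ {f g : Eucl d → ℂ}, ContDiffOn ℝ ∞ f V → ContDiffOn ℝ ∞ g V → ∀ z ∈ V, ∀ j,
      pderivC j (fun z => f z + g z) z = pderivC j f z + pderivC j g z := fun hf hg z hz j =>
    pderivC_add ((hf.contDiffAt (hV.mem_nhds hz)).differentiableAt (by simp))
      ((hg.contDiffAt (hV.mem_nhds hz)).differentiableAt (by simp)) j
  have h2 : ∀ i j, pderivC i (pderivC j (fun z => f z + g z)) z =
      pderivC i (pderivC j f) z + pderivC i (pderivC j g) z := fun i j => by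
    rw [← hd (hf.pderivC hV j) (hg.pderivC hV j) z hz i]
    exact pderivC_congr (by filter_upwards [hV.mem_nhds hz] with z hz using hd hf hg z hz j)
  simp only [diffExpr, h2, hd hf hg z hz, mul_add, sum_add_distrib]
  ring

theorem diffExpr_const_mul {A : Eucl d → Coefs d} {f : Eucl d → ℂ} (r : ℂ) (z : Eucl d) :
    diffExpr A (fun z => r * f z) z = r * diffExpr A f z := by
  simp only [diffExpr, pderivC_const_mul, mul_add, mul_sum, mul_left_comm r]

theorem SmoothFun.contDiffOn_chart {M : ClosedManifold.{u} d} (v : SmoothFun M) (p : M) :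
    ContDiffOn ℝ ∞ (fun z => v ((extChartAt (𝓡 d) p).symm z)) (extChartAt (𝓡 d) p).target :=
  ContMDiffOn.contDiffOn (v.contMDiff.comp_contMDiffOn (contMDiffOn_extChartAt_symm p))

/-- Local expressions, valid on a dense set, define a global differential operator. -/
theorem exists_diffOp {M : ClosedManifold.{u} d} {D : Set M} (hD : Dense D)
    (Q : SmoothFun M → M → ℂ)
    (hQ : ∀ p : M, ∃ A : Eucl d → Coefs d, ContDiffOn ℝ ∞ A (extChartAt (𝓡 d) p).target ∧
      ∀ v : SmoothFun M, ∀ z ∈ (extChartAt (𝓡 d) p).target, (extChartAt (𝓡 d) p).symm z ∈ D →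
        Q v ((extChartAt (𝓡 d) p).symm z) =
          diffExpr A (fun z' => v ((extChartAt (𝓡 d) p).symm z')) z) :
    ∃ P : SmoothFun M →ₗ[ℝ] SmoothFun M, IsDiffOpTwo P ∧ ∀ v, ∀ q ∈ D, P v q = Q v q := by
  choose A hA hQ using hQ
  set L : M → SmoothFun M → M → ℂ := fun p v q => diffExpr (A p)
    (fun z' => v ((extChartAt (𝓡 d) p).symm z')) (extChartAt (𝓡 d) p q) with hL
  have hT : ∀ p : M, IsOpen (extChartAt (𝓡 d) p).target := fun p => isOpen_extChartAt_target p
  have hLs : ∀ p v, ContMDiffOn (𝓡 d) 𝓘(ℝ, ℂ) ∞ (L p v) (extChartAt (𝓡 d) p).source := fun p v =>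
    (contDiffOn_diffExpr (hT p) (hA p) (v.contDiffOn_chart p)).contMDiffOn.comp
      (by rw [extChartAt_source]; exact contMDiffOn_extChartAt)
      fun q hq => (extChartAt (𝓡 d) p).map_source hq
  have hopen : ∀ p : M, IsOpen (extChartAt (𝓡 d) p).source := fun p => isOpen_extChartAt_source p
  have hLQ : ∀ p v, ∀ q ∈ (extChartAt (𝓡 d) p).source, q ∈ D → L p v q = Q v q := by
    intro p v q hq hqD
    have h1 := (extChartAt (𝓡 d) p).left_inv hq
    rw [← h1] at hqD
    have h2 := hQ p v _ ((extChartAt (𝓡 d) p).map_source hq) hqD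
    rw [h1] at h2
    exact h2.symm
  have hLL : ∀ p p' v, ∀ q ∈ (extChartAt (𝓡 d) p).source, q ∈ (extChartAt (𝓡 d) p').source →
      L p v q = L p' v q := by
    intro p p' v q hq hq'
    refine eq_of_eventually_eq_of_mem_closure (hD q)
      ((hLs p v).continuousOn.continuousAt ((hopen p).mem_nhds hq))
      ((hLs p' v).continuousOn.continuousAt ((hopen p').mem_nhds hq')) ?_
    filter_upwards [self_mem_nhdsWithin, mem_nhdsWithin_of_mem_nhds ((hopen p).mem_nhds hq),
      mem_nhdsWithin_of_mem_nhds ((hopen p').mem_nhds hq')] with w h1 h2 h3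
    rw [hLQ p v w h2 h1, hLQ p' v w h3 h1]
  have hself : ∀ q : M, q ∈ (extChartAt (𝓡 d) q).source := fun q => mem_extChartAt_source q
  have hPs : ∀ v, ContMDiff (𝓡 d) 𝓘(ℝ, ℂ) ∞ fun q => L q v q := by
    intro v q
    refine ((hLs q v q (hself q)).contMDiffAt ((hopen q).mem_nhds (hself q))).congr_of_eventuallyEq ?_
    filter_upwards [(hopen q).mem_nhds (hself q)] with q' hq'
    exact hLL q' q v q' (hself q') hq'
  refine ⟨⟨⟨fun v => ⟨fun q => L q v q, hPs v⟩, fun v w => ?_⟩, fun r v => ?_⟩, fun p => ?_, ?_⟩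
  · ext q
    exact diffExpr_add (hT q) (v.contDiffOn_chart q) (w.contDiffOn_chart q)
      ((extChartAt (𝓡 d) q).map_source (hself q))
  · ext q
    have := diffExpr_const_mul (A := A q) (f := fun z => v ((extChartAt (𝓡 d) q).symm z)) r (extChartAt (𝓡 d) q q)
    refine Eq.trans ?_ (this.trans ?_)
    · simp only [hL, ContMDiffMap.coe_smul, Pi.smul_apply, Complex.real_smul]
      rfl
    · exact (Complex.real_smul (x := r) (z := L q v q)).symm
  · refine ⟨fun i j z => (A p z).1 i j, fun i z => (A p z).2.1 i, fun z => (A p z).2.2,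
      fun i j => contDiffOn_pi.1 (contDiffOn_pi.1 (hA p).fst i) j,
      fun i => contDiffOn_pi.1 (hA p).snd.fst i, (hA p).snd.snd, fun v z hz => ?_⟩
    have h1 := hLL ((extChartAt (𝓡 d) p).symm z) p v _ (hself _) ((extChartAt (𝓡 d) p).map_target hz)
    refine h1.trans ?_
    simp only [hL, (extChartAt (𝓡 d) p).right_inv hz]
    rfl
  · intro v q hq
    exact hLQ q v q (hself q) hq

end Patching

/-! ### The conjugated operators in charts of the global space -/

section Pieces

variable {X : CompactManifoldWithBoundary.{u} m} {Xt : ClosedManifold.{u} (m + 1)}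

/-- The operator `s x^{-2α-2} (div grad + Λ) x^{2α}`. -/
def pieceOp (α Λ : ℂ) (s : ℝ) (g : BilinField X) (x : X → ℝ) (v : X → ℂ) (p : X) : ℂ :=
  s * (x p : ℂ) ^ (-2 * α - 2) *
    (-laplacian g (fun q => (x q : ℂ) ^ (2 * α) * v q) p + Λ * ((x p : ℂ) ^ (2 * α) * v p))

/-- A piece of the global space, with a metric and a positive function on its interior. -/
structure IsMetricPiece (ι : X → Xt) (r : Xt → X) (g : BilinField X) (x : X → ℝ) (s : ℝ) :
    Prop where
  emb : IsPieceEmbedding ι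
  left_inv : ∀ p, r (ι p) = p
  sign : s * s = 1
  smooth : g.SmoothInterior
  nondeg : g.NondegInterior
  symm : ∀ p ∈ X.interiorSet, ∀ v w, g p v w = g p w v
  smooth_x : ContMDiffOn 𝓑 𝓘(ℝ, ℝ) ∞ x X.interiorSet
  pos : ∀ p ∈ X.interiorSet, 0 < x p

namespace IsMetricPiece

variable {ι : X → Xt} {r : Xt → X} {g : BilinField X} {x : X → ℝ} {s : ℝ} {p₀ : Xt}

/-- The inverse of the chart at `p₀`. -/
local notation "ζ" => PartialEquiv.symm (extChartAt 𝓢 p₀)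

theorem isOpen_image (h : IsMetricPiece ι r g x s) : IsOpen (ι '' X.interiorSet) := by
  rw [isOpen_iff_mem_nhds]
  rintro _ ⟨p, hp, rfl⟩
  obtain ⟨Φ, hpΦ, heq⟩ := h.emb.interior p hp
  have h1 : IsOpen (Φ '' (Φ.source ∩ X.interiorSet)) :=
    Φ.toOpenPartialHomeomorph.isOpen_image_of_subset_source
      (Φ.open_source.inter X.isOpen_interiorSet) inter_subset_left
  refine mem_of_superset (h1.mem_nhds ⟨p, ⟨hpΦ, hp⟩, (heq hpΦ).symm⟩) ?_
  rintro _ ⟨q, hq, rfl⟩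
  exact ⟨q, hq.2, heq hq.1⟩

theorem contMDiffAt_inv (h : IsMetricPiece ι r g x s) {p : X} (hp : p ∈ X.interiorSet) :
    ContMDiffAt 𝓢 𝓑 ∞ r (ι p) := by
  obtain ⟨Φ, hpΦ, heq⟩ := h.emb.interior p hp
  have hmem : ι p ∈ Φ.target := by
    rw [heq hpΦ]
    exact Φ.map_source hpΦ
  refine ((Φ.contMDiffOn_invFun _ hmem).contMDiffAt (Φ.open_target.mem_nhds hmem)).congr_of_eventuallyEq ?_
  filter_upwards [Φ.open_target.mem_nhds hmem] with q hq
  have h1 : Φ.symm q ∈ Φ.source := Φ.map_target hq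
  have h2 : ι (Φ.symm q) = q := (heq h1).trans (Φ.right_inv hq)
  change r q = Φ.symm q
  rw [← h2, h.left_inv, h2]

theorem contMDiffAt_map (h : IsMetricPiece ι r g x s) {p : X} (hp : p ∈ X.interiorSet) :
    ContMDiffAt 𝓑 𝓢 ∞ ι p :=
  (h.emb.interior p hp).contMDiffAt

variable (ι p₀) in
/-- The part of the chart at `p₀` that corresponds to the interior of the piece. -/
def chartPart : Set 𝔼 :=
  (extChartAt 𝓢 p₀).target ∩ ζ ⁻¹' (ι '' X.interiorSet)

theorem isOpen_chartPart (h : IsMetricPiece ι r g x s) : IsOpen (chartPart ι p₀) :=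
  (continuousOn_extChartAt_symm p₀).isOpen_inter_preimage (isOpen_extChartAt_target p₀)
    h.isOpen_image

theorem contMDiffAt_chart_symm {z : 𝔼} (hz : z ∈ (extChartAt 𝓢 p₀).target) :
    ContMDiffAt 𝓘(ℝ, 𝔼) 𝓢 ∞ ζ z :=
  (contMDiffOn_extChartAt_symm p₀ z hz).contMDiffAt ((isOpen_extChartAt_target p₀).mem_nhds hz)

theorem map_inv_chart (h : IsMetricPiece ι r g x s) {z : 𝔼}
    (hz : z ∈ chartPart ι p₀) : ι (r (ζ z)) = ζ z := by
  obtain ⟨p, hp, he⟩ := hz.2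
  rw [← he, h.left_inv]

theorem isParamOn (h : IsMetricPiece ι r g x s) :
    IsParamOn (fun z => r (ζ z)) (chartPart ι p₀) where
  isOpen := h.isOpen_chartPart
  smooth z hz := by
    obtain ⟨p, hp, he⟩ := hz.2
    have h1 := h.contMDiffAt_inv hp
    rw [he] at h1
    exact (h1.comp z (contMDiffAt_chart_symm hz.1)).contMDiffWithinAt
  interior z hz := by
    obtain ⟨p, hp, he⟩ := hz.2
    simp only [← he, h.left_inv, hp]
  exists_inv z hz := by
    refine ⟨fun p => extChartAt 𝓢 p₀ (ι p), ?_, ?_⟩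
    · obtain ⟨p, hp, he⟩ := hz.2
      have h2 : r (ζ z) = p := by rw [← he, h.left_inv]
      rw [h2]
      refine ContMDiffAt.comp p ?_ (h.contMDiffAt_map hp)
      rw [he]
      refine contMDiffAt_extChartAt' ?_
      have := (extChartAt 𝓢 p₀).map_target hz.1
      rwa [extChartAt_source] at this
    · filter_upwards [h.isOpen_chartPart.mem_nhds hz] with z' hz'
      rw [h.map_inv_chart hz']
      exact (extChartAt 𝓢 p₀).right_inv hz'.1

theorem isRegularData (h : IsMetricPiece ι r g x s) : IsRegularData s
    (paramMatrix g fun z => r (ζ z)) (fun z => x (r (ζ z))) (chartPart ι p₀) where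
  isOpen := h.isOpen_chartPart
  sign := h.sign
  smooth := h.isParamOn.contDiffOn_paramMatrix h.smooth
  det z hz := h.isParamOn.det_ne_zero h.nondeg hz
  symm z hz := by
    ext i j
    exact h.symm _ (h.isParamOn.interior z hz) _ _
  smooth_x := (h.smooth_x.comp h.isParamOn.smooth h.isParamOn.interior).contDiffOn
  pos z hz := h.pos _ (h.isParamOn.interior z hz)

theorem pieceOp_eq (h : IsMetricPiece ι r g x s) (α Λ : ℂ) {z : 𝔼}
    (hz : z ∈ chartPart ι p₀) (v : SmoothFun Xt) :
    pieceOp α Λ s g x (fun q => v (ι q)) (r (ζ z)) = confOp α Λ s (paramMatrix g fun z => r (ζ z))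
        (fun z => x (r (ζ z)))
        (fun z => v (ζ z)) z := by
  have hp := h.isParamOn.interior z hz
  set p := r (ζ z) with hpdef
  have h1 : ContMDiffAt 𝓑 𝓘(ℝ, ℂ) ∞ (fun q => (x q : ℂ) ^ (2 * α) * v (ι q)) p :=
    ContMDiffAt.comp (g := fun q : ℂ × ℂ => q.1 * q.2) p contDiff_mul.contMDiff.contMDiffAt
      ((ContMDiffAt.comp (g := fun t : ℝ => (t : ℂ) ^ (2 * α)) p
        (contDiffAt_ofReal_cpow contDiffAt_id (h.pos p hp) _).contMDiffAt
        ((h.smooth_x p hp).contMDiffAt (X.isOpen_interiorSet.mem_nhds hp))).prodMk_space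
        (v.contMDiff.contMDiffAt.comp p (h.contMDiffAt_map hp)))
  rw [pieceOp, hpdef, laplacian_param h.smooth h.nondeg h.isParamOn hz h1, confOp,
    h.map_inv_chart hz, coordLaplacian_congr]
  filter_upwards [h.isOpen_chartPart.mem_nhds hz] with z' hz'
  rw [h.map_inv_chart hz']

end IsMetricPiece

end Pieces

/-! ### Coordinates near the common boundary -/

section Ends

variable {X : CompactManifoldWithBoundary.{u} m} {Xt : ClosedManifold.{u} (m + 1)}
  {Y : ClosedManifold.{u} m}

/-- In the product decomposition `c`, the function `x` is the first coordinate and the metric is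
`(dx² + τ h(τ x²)) / x²`, for `x² < δ`. -/
def IsEndForm (τ δ : ℝ) (c : Collar X Y) (g : BilinField X) (x : X → ℝ) (h : BilinFamily Y) : Prop :=
  ∀ s : ℝ, 0 < s → s ^ 2 < δ → ∀ y : Y, x (c.φ (s, y)) = s ∧
    ∀ (a a' : ℝ) (v v' : TangentSpace (𝓡 m) y), g (c.φ (s, y)) (mfderiv 𝓒 𝓑 c.φ (s, y) (a, v))
        (mfderiv 𝓒 𝓑 c.φ (s, y) (a', v')) =
      (a * a' + τ * h (τ * s ^ 2) y v v') / s ^ 2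

theorem Collar.mem_source (c : Collar X Y) {s : ℝ} (hs : s ∈ Ico 0 c.ε) (y : Y) :
    (s, y) ∈ c.φ.source := by
  rw [c.source_eq]
  exact ⟨hs, trivial⟩

theorem Collar.contMDiffAt (c : Collar X Y) {s : ℝ} (hs : s ∈ Ioo 0 c.ε) (y : Y) :
    ContMDiffAt 𝓒 𝓑 ∞ c.φ (s, y) := by
  refine (c.smooth _ (c.mem_source ⟨hs.1.le, hs.2⟩ y)).contMDiffAt ?_
  rw [c.source_eq]
  exact prod_mem_nhds (Ico_mem_nhds hs.1 hs.2) univ_mem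

theorem Collar.mem_interior (c : Collar X Y) {s : ℝ} (hs : s ∈ Ioo 0 c.ε) (y : Y) :
    c.φ (s, y) ∈ X.interiorSet := by
  rw [mem_interiorSet_iff]
  intro h
  have h1 : c.φ (s, y) ∈ c.φ '' ({0} ×ˢ univ) := by
    rw [← c.boundary_eq]
    exact ⟨c.φ.map_source (c.mem_source ⟨hs.1.le, hs.2⟩ y), h⟩
  obtain ⟨⟨t, y'⟩, ⟨ht, -⟩, he⟩ := h1
  rw [mem_singleton_iff] at ht
  subst ht
  have h2 := c.φ.injOn (c.mem_source ⟨le_rfl, c.ε_pos⟩ y') (c.mem_source ⟨hs.1.le, hs.2⟩ y) he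
  exact hs.1.ne (congrArg Prod.fst h2)

variable {Φ : PartialDiffeomorph (𝓘(ℝ, ℝ).prod (𝓡 m)) (𝓡 (m + 1)) (ℝ × Y) Xt ∞} {δ : ℝ}
  {h : BilinFamily Y} {p₀ : Xt}

local notation "ζ" => PartialEquiv.symm (extChartAt 𝓢 p₀)

variable (Φ p₀) in
/-- The coordinates `(μ, y)` in the chart at `p₀`. -/
def endCoord (z : 𝔼) : ℝ × Y :=
  Φ.symm (ζ z)

local notation "ξ" => endCoord Φ p₀

variable (Φ δ p₀) in
/-- The part of the chart at `p₀` on which `(μ, y)` are coordinates with `|μ| < δ`. -/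
def endPart : Set 𝔼 :=
  (extChartAt 𝓢 p₀).target ∩ ζ ⁻¹' (Φ '' (Φ.source ∩ Ioo (-δ) δ ×ˢ univ))

local notation "Ω" => endPart Φ δ p₀

theorem isOpen_endPart : IsOpen Ω := by
  refine (continuousOn_extChartAt_symm p₀).isOpen_inter_preimage (isOpen_extChartAt_target p₀) ?_
  exact Φ.toOpenPartialHomeomorph.isOpen_image_of_subset_source
    (Φ.open_source.inter (isOpen_Ioo.prod isOpen_univ)) inter_subset_left

theorem map_endCoord {z : 𝔼} (hz : z ∈ Ω) : ξ z ∈ Φ.source ∧ (ξ z).1 ∈ Ioo (-δ) δ ∧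
      Φ (ξ z) = ζ z := by
  obtain ⟨q, hq, he⟩ := hz.2
  have h1 : ξ z = q := by
    rw [endCoord, ← he]
    exact Φ.left_inv hq.1
  rw [h1]
  exact ⟨hq.1, hq.2.1, he⟩

theorem contMDiffAt_endCoord {z : 𝔼} (hz : z ∈ Ω) : ContMDiffAt 𝓘(ℝ, 𝔼) 𝓒 ∞ ξ z := by
  obtain ⟨q, hq, he⟩ := hz.2
  have h1 : ζ z ∈ Φ.target := by
    rw [← he]
    exact Φ.map_source hq.1
  exact ContMDiffAt.comp z ((Φ.contMDiffOn_invFun _ h1).contMDiffAt (Φ.open_target.mem_nhds h1))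
    (IsMetricPiece.contMDiffAt_chart_symm hz.1)

theorem mfderiv_endCoord_bijective {z : 𝔼} (hz : z ∈ Ω) : Bijective (mfderiv 𝓘(ℝ, 𝔼) 𝓒 ξ z) := by
  obtain ⟨h1, h2, h3⟩ := map_endCoord hz
  have hχ : MDifferentiableAt 𝓒 𝓘(ℝ, 𝔼) (fun q => extChartAt 𝓢 p₀ (Φ q)) (ξ z) := by
    refine ContMDiffAt.mdifferentiableAt (n := ∞) (ContMDiffAt.comp _ (contMDiffAt_extChartAt' ?_)
      ((Φ.contMDiffOn_toFun _ h1).contMDiffAt (Φ.open_source.mem_nhds h1))) (by simp)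
    have := (extChartAt 𝓢 p₀).map_target hz.1
    rwa [extChartAt_source, ← h3] at this
  have hinj := mfderiv_injective_of_left_inv hχ
    ((contMDiffAt_endCoord hz).mdifferentiableAt (by simp)) (by
      filter_upwards [isOpen_endPart.mem_nhds hz] with z' hz'
      rw [(map_endCoord hz').2.2, (extChartAt 𝓢 p₀).right_inv hz'.1])
  have hdim : Module.finrank ℝ 𝔼 = Module.finrank ℝ (ℝ × Eucl m) := by
    simp [Module.finrank_prod, add_comm]
  exact ⟨hinj, (LinearMap.injective_iff_surjective_of_finrank_eq_finrank hdim
    (f := (mfderiv 𝓘(ℝ, 𝔼) 𝓒 ξ z : 𝔼 →L[ℝ] ℝ × Eucl m).toLinearMap)).1 hinj⟩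

variable (Φ p₀) in
/-- The coordinate `μ` in the chart at `p₀`. -/
def endMu (z : 𝔼) : ℝ :=
  (ξ z).1

local notation "μ" => endMu Φ p₀

variable (Φ p₀) in
/-- The coordinate `y` in the chart at `p₀`. -/
def endY (z : 𝔼) : Y :=
  (ξ z).2

local notation "η" => endY Φ p₀

/-- The derivative of the coordinate `y`. -/
local notation "dη" => mfderiv 𝓘(ℝ, 𝔼) (𝓡 m) (endY Φ p₀)

theorem contDiffAt_endMu {z : 𝔼} (hz : z ∈ Ω) : ContDiffAt ℝ ∞ μ z :=
  (contMDiffAt_fst.comp z (contMDiffAt_endCoord hz)).contDiffAt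

theorem contMDiffAt_endY {z : 𝔼} (hz : z ∈ Ω) : ContMDiffAt 𝓘(ℝ, 𝔼) (𝓡 m) ∞ η z :=
  contMDiffAt_snd.comp z (contMDiffAt_endCoord hz)

theorem mfderiv_endCoord {z : 𝔼} (hz : z ∈ Ω) (v : 𝔼) : mfderiv 𝓘(ℝ, 𝔼) 𝓒 ξ z v =
      (fderiv ℝ μ z v, dη z v) := by
  have h1 : ξ = fun z => (μ z, η z) := rfl
  rw [h1, mfderiv_prodMk
    ((contDiffAt_endMu hz).contMDiffAt.mdifferentiableAt (by simp))
    ((contMDiffAt_endY hz).mdifferentiableAt (by simp)), mfderiv_eq_fderiv]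
  rfl

variable (Φ h p₀) in
/-- The form `dμ² + h(μ)` in the chart at `p₀`. -/
def endForm (z : 𝔼) : 𝔼 →L[ℝ] 𝔼 →L[ℝ] ℝ :=
  (fderiv ℝ μ z).smulRight (fderiv ℝ μ z) + (bilinPull (h (μ z) (η z)) (dη z) : 𝔼 →L[ℝ] 𝔼 →L[ℝ] ℝ)

variable (Φ h p₀) in
/-- The matrix of `dμ² + h(μ)` in the chart at `p₀`. -/
def endMatrix (z : 𝔼) : Matrix (Fin (m + 1)) (Fin (m + 1)) ℝ :=
  Matrix.of fun i j => endForm Φ h p₀ z (coordVec i) (coordVec j)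

theorem endForm_apply (z v w : 𝔼) : endForm Φ h p₀ z v w =
    fderiv ℝ μ z v * fderiv ℝ μ z w + h (μ z) (η z) (dη z v) (dη z w) := rfl

theorem isCollarData_end (hs : h.SmoothOnSet (Ioo (-δ) δ))
    (hp : ∀ t ∈ Ioo (-δ) δ, ∀ y, IsPosDefForm (h t y)) :
    IsCollarData (endMatrix Φ h p₀) μ Ω := by
  have hopen : IsOpen Ω := isOpen_endPart
  have hμs : ContDiffOn ℝ ∞ μ Ω := fun z hz =>
    (contDiffAt_endMu hz).contDiffWithinAt
  have hsymm : ∀ z ∈ Ω, (endMatrix Φ h p₀ z).IsSymm := fun z hz => by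
    ext i j
    exact congrArg₂ (· + ·) (mul_comm _ _) ((hp _ (map_endCoord hz).2.1 _).1 _ _)
  have hpd : ∀ z ∈ Ω, (endMatrix Φ h p₀ z).PosDef := fun z hz => by
    refine Matrix.PosDef.of_dotProduct_mulVec_pos (hsymm z hz) fun {v} hv => ?_
    set v' : 𝔼 := WithLp.toLp 2 v
    refine lt_of_lt_of_eq ?_ (form_eq_dotProduct (endForm Φ h p₀ z) v' v')
    rw [endForm_apply]
    have hv' : v' ≠ 0 := fun h0 => hv (congrArg WithLp.ofLp h0)
    have hpos := hp _ (map_endCoord hz).2.1 (η z)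
    by_cases h0 : dη z v' = 0
    · have h1 : fderiv ℝ μ z v' ≠ 0 := by
        intro h2
        apply hv'
        apply (mfderiv_endCoord_bijective hz).1
        rw [mfderiv_endCoord hz, h2, h0]
        exact (map_zero (mfderiv 𝓘(ℝ, 𝔼) 𝓒 ξ z)).symm
      rw [h0, map_zero, add_zero]
      exact mul_self_pos.2 h1
    · exact add_pos_of_nonneg_of_pos (mul_self_nonneg _) (hpos.2 _ h0)
  refine ⟨hopen, hμs, fun i j => ?_, hsymm, fun z hz => (hpd z hz).det_pos, fun z hz => ?_⟩
  · have h1 : ContMDiffOn 𝓘(ℝ, 𝔼) ((𝓡 m).prod 𝓘(ℝ, Eucl m →L[ℝ] Eucl m →L[ℝ] ℝ)) ∞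
        (bilinAlong (𝓡 m) η fun z => h (μ z) (η z)) Ω :=
      ContMDiffOn.comp (f := ξ) hs (fun z hz => (contMDiffAt_endCoord hz).contMDiffWithinAt)
        fun z hz => ⟨(map_endCoord hz).2.1, trivial⟩
    have h2 := contDiffOn_param hopen (fun z hz => (contMDiffAt_endY hz).contMDiffWithinAt) h1
    exact ((hμs.pderivR hopen i).mul (hμs.pderivR hopen j)).add
      ((h2.clm_apply contDiffOn_const).clm_apply contDiffOn_const)
  · obtain ⟨v, hv⟩ : ∃ v : 𝔼, mfderiv 𝓘(ℝ, 𝔼) 𝓒 ξ z v = ((1, 0) : ℝ × Eucl m) :=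
      (mfderiv_endCoord_bijective hz).2 ((1, 0) : ℝ × Eucl m)
    replace hv := (mfderiv_endCoord hz v).symm.trans hv
    have hv1 : fderiv ℝ μ z v = 1 := congrArg Prod.fst hv
    have hv2 : dη z v = 0 := congrArg Prod.snd hv
    have h1 : (endMatrix Φ h p₀ z).mulVec v = fun i => pderivR i μ z := by
      funext i
      have := form_eq_dotProduct (endForm Φ h p₀ z) (coordVec i) v
      rw [endForm_apply, hv1, hv2, map_zero, add_zero, mul_one] at this
      simpa [endMatrix, pderivR] using this.symm
    rw [← h1, Matrix.mulVec_mulVec, Matrix.nonsing_inv_mul _ (hpd z hz).det_pos.ne'.isUnit,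
      Matrix.one_mulVec, h1, dotProduct]
    rw [eucl_eq_sum v, map_sum] at hv1
    rw [← hv1]
    exact sum_congr rfl fun i _ => by rw [map_smul, smul_eq_mul, mul_comm]; rfl

theorem end_side {ι : X → Xt} {r : Xt → X} {g : BilinField X} {x : X → ℝ} {τ : ℝ}
    (hpc : IsMetricPiece ι r g x τ) {c : Collar X Y} (hδ : δ ≤ c.ε ^ 2) (hform : IsEndForm τ δ c g x h)
    (hglue : ∀ s : ℝ, 0 ≤ s → s ^ 2 < δ → ∀ y : Y, Φ (τ * s ^ 2, y) = ι (c.φ (s, y)))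
    {z : 𝔼} (hz : z ∈ Ω) (hpos : 0 < τ * μ z) :
    z ∈ IsMetricPiece.chartPart ι p₀ ∧
    μ z = τ * x (r (ζ z)) ^ 2 ∧
    paramMatrix g (fun z => r (ζ z)) z = (4 * μ z ^ 2)⁻¹ • Matrix.vecMulVec (fun i => pderivR i μ z)
        (fun i => pderivR i μ z) +
      (μ z)⁻¹ • (endMatrix Φ h p₀ z - Matrix.vecMulVec
        (fun i => pderivR i μ z) fun i => pderivR i μ z) := by
  have hτ := hpc.sign
  have hτa : |τ| = 1 := by
    have h1 : |τ| * |τ| = 1 := by rw [← abs_mul, hτ, abs_one]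
    nlinarith [abs_nonneg τ]
  set σ : 𝔼 → ℝ := fun z => √(τ * μ z) with hσ
  have key : ∀ z ∈ Ω, 0 < τ * μ z → 0 < σ z ∧ σ z ^ 2 = τ * μ z ∧ σ z ^ 2 < δ ∧ σ z ∈ Ioo 0 c.ε ∧
      ζ z = ι (c.φ (σ z, η z)) := by
    intro z hz hpos
    obtain ⟨h1, h2, h3⟩ := map_endCoord hz
    have hσp : 0 < σ z := Real.sqrt_pos.2 hpos
    have hsq : σ z ^ 2 = τ * μ z := Real.sq_sqrt hpos.le
    have hlt : σ z ^ 2 < δ := by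
      rw [hsq]
      calc τ * μ z ≤ |τ * μ z| := le_abs_self _
        _ = |μ z| := by rw [abs_mul, hτa, one_mul]
        _ < δ := abs_lt.2 h2
    refine ⟨hσp, hsq, hlt, ⟨hσp, ?_⟩, ?_⟩
    · have := hlt.trans_le hδ
      exact lt_of_pow_lt_pow_left₀ 2 c.ε_pos.le this
    · rw [← hglue _ hσp.le hlt, hsq, ← mul_assoc, hτ, one_mul, ← h3]
      rfl
  obtain ⟨hσp, hsq, hlt, hσε, heq⟩ := key z hz hpos
  have hpart : z ∈ IsMetricPiece.chartPart ι p₀ :=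
    ⟨hz.1, ⟨_, c.mem_interior hσε _, heq.symm⟩⟩
  have hr : r (ζ z) = c.φ (σ z, η z) := by
    rw [heq, hpc.left_inv]
  obtain ⟨hx, hg⟩ := hform (σ z) hσp hlt (η z)
  have hμ : μ z = τ * σ z ^ 2 := by rw [hsq, ← mul_assoc, hτ, one_mul]
  refine ⟨hpart, by rw [hr, hx, hμ], ?_⟩
  have hμd : DifferentiableAt ℝ μ z := (contDiffAt_endMu hz).differentiableAt (by simp)
  have hμτ : DifferentiableAt ℝ (fun z => τ * μ z) z := hμd.const_mul τ
  have hσder : HasFDerivAt σ ((1 / (2 * σ z)) • τ • fderiv ℝ μ z) z :=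
    (hμd.hasFDerivAt.const_mul τ).sqrt hpos.ne'
  have hev : (fun z => r (ζ z)) =ᶠ[𝓝 z] c.φ ∘ fun z => (σ z, η z) := by
    filter_upwards [(isOpen_endPart).mem_nhds hz,
      hμτ.continuousAt.eventually (lt_mem_nhds hpos)] with z' hz' hpos'
    change r _ = c.φ (σ z', η z')
    rw [(key z' hz' hpos').2.2.2.2, hpc.left_inv]
  have hYd : MDifferentiableAt 𝓘(ℝ, 𝔼) (𝓡 m) η z :=
    (contMDiffAt_endY hz).mdifferentiableAt (by simp)
  have hcd : MDifferentiableAt 𝓒 𝓑 c.φ (σ z, η z) :=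
    (c.contMDiffAt hσε _).mdifferentiableAt (by simp)
  have hder : ∀ v : 𝔼, mfderiv 𝓘(ℝ, 𝔼) 𝓑 (c.φ ∘ fun z => (σ z, η z)) z v =
      mfderiv 𝓒 𝓑 c.φ (σ z, η z) (1 / (2 * σ z) * (τ * fderiv ℝ μ z v), dη z v) := by
    intro v
    have h2 : mfderiv 𝓘(ℝ, 𝔼) 𝓒 (fun z => (σ z, η z)) z v = (1 / (2 * σ z) * (τ * fderiv ℝ μ z v),
          dη z v) := by
      rw [mfderiv_prodMk hσder.differentiableAt.mdifferentiableAt hYd, mfderiv_eq_fderiv,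
        hσder.fderiv]
      rfl
    rw [mfderiv_comp z hcd (hσder.differentiableAt.mdifferentiableAt.prodMk hYd)]
    exact congrArg _ h2
  ext i j
  rw [paramMatrix_congr hev]
  set H := h (μ z) (η z) (dη z (coordVec i)) (dη z (coordVec j)) with hH
  have h1 : paramMatrix g (c.φ ∘ fun z => (σ z, η z)) z i j = (1 / (2 * σ z) * (τ * pderivR i μ z) *
        (1 / (2 * σ z) * (τ * pderivR j μ z)) + τ * H) / σ z ^ 2 := by
    simp only [paramMatrix, Matrix.of_apply]
    rw [hder, hder, hH, hμ]
    exact hg _ _ _ _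
  rw [h1]
  have hE : endMatrix Φ h p₀ z i j = pderivR i μ z * pderivR j μ z + H := rfl
  simp only [Matrix.add_apply, Matrix.smul_apply, Matrix.sub_apply, smul_eq_mul,
    Matrix.vecMulVec_apply, hE, add_sub_cancel_left]
  have hσ0 := hσp.ne'
  have hτ0 : τ ≠ 0 := by rintro rfl; simp at hτ
  rw [hμ]
  have hτ2 : τ ^ 2 = 1 := by rw [sq, hτ]
  have e1 : (4 * (τ * σ z ^ 2) ^ 2)⁻¹ = (4 * (σ z ^ 2) ^ 2)⁻¹ := by rw [mul_pow, hτ2, one_mul]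
  have e2 : (τ * σ z ^ 2)⁻¹ = τ / σ z ^ 2 := by
    rw [mul_inv, inv_eq_of_mul_eq_one_left hτ, div_eq_mul_inv]
  rw [e1, e2]
  field_simp
  linear_combination (4 * pderivR i μ z * pderivR j μ z) * hτ2

end Ends

/-! ### The global operator -/

section GlobalOperator

variable {X X' : CompactManifoldWithBoundary.{u} m} {Xt : ClosedManifold.{u} (m + 1)}
  {Y : ClosedManifold.{u} m}

/-- Near `Y`, the pieces `X` and `X'` are glued by means of `Φ`, and their metrics are obtained
from the same family `h`. -/
structure IsMatchedEnd (c : Collar X Y) (c' : Collar X' Y) (g : BilinField X) (x : X → ℝ)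
    (g' : BilinField X') (x' : X' → ℝ) (δ : ℝ) (h : BilinFamily Y) : Prop where
  pos : 0 < δ
  le : δ ≤ c.ε ^ 2
  le' : δ ≤ c'.ε ^ 2
  smooth : h.SmoothOnSet (Ioo (-δ) δ)
  posDef : ∀ t ∈ Ioo (-δ) δ, ∀ y, IsPosDefForm (h t y)
  form : IsEndForm 1 δ c g x h
  form' : IsEndForm (-1) δ c' g' x' h

theorem IsMatchedEnd.mono {c : Collar X Y} {c' : Collar X' Y} {g : BilinField X} {x : X → ℝ}
    {g' : BilinField X'} {x' : X' → ℝ} {δ δ' : ℝ} {h : BilinFamily Y}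
    (H : IsMatchedEnd c c' g x g' x' δ h) (hδ' : 0 < δ') (hle : δ' ≤ δ) :
    IsMatchedEnd c c' g x g' x' δ' h where
  pos := hδ'
  le := hle.trans H.le
  le' := hle.trans H.le'
  smooth := H.smooth.mono (prod_mono (Ioo_subset_Ioo (neg_le_neg hle) hle) Subset.rfl)
  posDef t ht := H.posDef t (Ioo_subset_Ioo (neg_le_neg hle) hle ht)
  form s hs hs' := H.form s hs (hs'.trans_le hle)
  form' s hs hs' := H.form' s hs (hs'.trans_le hle)

theorem exists_global_operator {κ : Type} {X : κ → CompactManifoldWithBoundary.{u} m}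
    {ι : ∀ k, X k → Xt} {r : ∀ k, Xt → X k} {g : ∀ k, BilinField (X k)} {x : ∀ k, X k → ℝ}
    {s : κ → ℝ} (hpc : ∀ k, IsMetricPiece (ι k) (r k) (g k) (x k) (s k))
    (hdisj : ∀ k k' p p', p ∈ (X k).interiorSet → p' ∈ (X k').interiorSet → ι k p = ι k' p' → k = k')
    (hend : ∀ q : Xt, (∀ k, q ∉ ι k '' (X k).interiorSet) → ∃ (kp km : κ) (Y : ClosedManifold.{u} m)
      (c : Collar (X kp) Y) (c' : Collar (X km) Y) (δ : ℝ) (h : BilinFamily Y)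
      (Φ : PartialDiffeomorph 𝓒 𝓢 (ℝ × Y) Xt ∞), s kp = 1 ∧ s km = -1 ∧
      IsMatchedEnd c c' (g kp) (x kp) (g km) (x km) δ h ∧ Ioo (-δ) δ ×ˢ univ ⊆ Φ.source ∧
      (∀ t : ℝ, 0 ≤ t → t ^ 2 < δ → ∀ y : Y, Φ (t ^ 2, y) = ι kp (c.φ (t, y)) ∧
        Φ (-t ^ 2, y) = ι km (c'.φ (t, y))) ∧
      (∀ y k, Φ (0, y) ∉ ι k '' (X k).interiorSet) ∧ ∃ y, Φ (0, y) = q)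
    {α Λ : ℂ} (hΛ : Λ = 4 * α * (m / 2 - α)) :
    ∃ P : SmoothFun Xt →ₗ[ℝ] SmoothFun Xt, IsDiffOpTwo P ∧ ∀ k v, ∀ p ∈ (X k).interiorSet,
        P v (ι k p) = pieceOp α Λ (s k) (g k) (x k) (fun q => v (ι k q)) p := by
  classical
  set D : Set Xt := ⋃ k, ι k '' (X k).interiorSet with hDdef
  have hDk : ∀ k p, p ∈ (X k).interiorSet → ι k p ∈ D := fun k p hp =>
    mem_iUnion.2 ⟨k, p, hp, rfl⟩
  have hside : ∀ {kp km : κ} {Y : ClosedManifold.{u} m} {c : Collar (X kp) Y}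
      {c' : Collar (X km) Y} {δ : ℝ} {h : BilinFamily Y}, 
      IsMatchedEnd c c' (g kp) (x kp) (g km) (x km) δ h → ∀ t : ℝ, t ^ 2 < δ → 0 < t →
      t ∈ Ioo 0 c.ε ∧ t ∈ Ioo 0 c'.ε := fun {kp km Y c c' δ h} H t ht ht0 =>
    ⟨⟨ht0, lt_of_pow_lt_pow_left₀ 2 c.ε_pos.le (ht.trans_le H.le)⟩,
      ⟨ht0, lt_of_pow_lt_pow_left₀ 2 c'.ε_pos.le (ht.trans_le H.le')⟩⟩
  have hDdense : Dense D := by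
    intro q
    by_cases hq : q ∈ D
    · exact subset_closure hq
    have hq' : ∀ k, q ∉ ι k '' (X k).interiorSet := fun k hk => hq (mem_iUnion.2 ⟨k, hk⟩)
    obtain ⟨kp, km, Y, c, c', δ, h, Φ, hkp, hkm, H, hsrc, hglue, hbd, y, rfl⟩ := hend q hq'
    have h0 : ((0 : ℝ), y) ∈ Φ.source := hsrc ⟨⟨neg_lt_zero.2 H.pos, H.pos⟩, trivial⟩
    have hcont : ContinuousAt (fun t : ℝ => Φ (t ^ 2, y)) 0 := by
      have h1 : ContinuousAt Φ ((0 : ℝ) ^ 2, y) := by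
        rw [zero_pow two_ne_zero]
        exact Φ.contMDiffOn_toFun.continuousOn.continuousAt (Φ.open_source.mem_nhds h0)
      exact h1.comp (f := fun t : ℝ => (t ^ 2, y)) (by fun_prop)
    have h2 : Tendsto (fun t : ℝ => Φ (t ^ 2, y)) (𝓝[>] 0) (𝓝 (Φ (0, y))) := by
      have := hcont.tendsto.mono_left (nhdsWithin_le_nhds (s := Ioi 0))
      rwa [zero_pow two_ne_zero] at this
    refine mem_closure_of_tendsto h2 ?_
    have h3 : ∀ᶠ t : ℝ in 𝓝 0, t ^ 2 < δ := by
      have : ContinuousAt (fun t : ℝ => t ^ 2) 0 := by fun_prop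
      exact this.eventually (gt_mem_nhds (by simpa using H.pos))
    filter_upwards [self_mem_nhdsWithin, mem_nhdsWithin_of_mem_nhds h3] with t ht ht'
    rw [(hglue t (le_of_lt ht) ht' y).1]
    exact hDk _ _ (c.mem_interior (hside H t ht' ht).1 y)
  set Q : SmoothFun Xt → Xt → ℂ := fun v q =>
    if hq : ∃ k, q ∈ ι k '' (X k).interiorSet then
      pieceOp α Λ (s hq.choose) (g hq.choose) (x hq.choose) (fun p => v (ι hq.choose p))
        (r hq.choose q) else 0 with hQdef
  have hchoose : ∀ {q : Xt} (hq : ∃ k, q ∈ ι k '' (X k).interiorSet) {k : κ},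
      q ∈ ι k '' (X k).interiorSet → hq.choose = k := by
    intro q hq k hk
    obtain ⟨p, hp, he⟩ := hq.choose_spec
    obtain ⟨p', hp', he'⟩ := hk
    exact hdisj _ _ p p' hp hp' (he.trans he'.symm)
  have hQk : ∀ k v q, q ∈ ι k '' (X k).interiorSet →
      Q v q = pieceOp α Λ (s k) (g k) (x k) (fun p => v (ι k p)) (r k q) := by
    intro k v q hq
    have hex : ∃ k, q ∈ ι k '' (X k).interiorSet := ⟨k, hq⟩
    simp only [hQdef, dif_pos hex]
    rw [hchoose hex hq]
  suffices h : ∃ P : SmoothFun Xt →ₗ[ℝ] SmoothFun Xt, IsDiffOpTwo P ∧ ∀ v, ∀ q ∈ D, P v q = Q v q by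
    obtain ⟨P, hP, hPQ⟩ := h
    refine ⟨P, hP, fun k v p hp => ?_⟩
    rw [hPQ v _ (hDk k p hp), hQk k v _ ⟨p, hp, rfl⟩, (hpc k).left_inv]
  refine exists_diffOp hDdense Q fun p₀ => ?_
  set ψ := (extChartAt 𝓢 p₀).symm with hψ
  set T := (extChartAt 𝓢 p₀).target with hT
  set Gk : ∀ k : κ, 𝔼 → Matrix (Fin (m + 1)) (Fin (m + 1)) ℝ := fun k =>
    paramMatrix (g k) fun z => r k (ψ z) with hGk
  set xk : κ → 𝔼 → ℝ := fun k z => x k (r k (ψ z)) with hxk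
  set C : κ → Set 𝔼 := fun k => IsMetricPiece.chartPart (ι k) p₀ with hC
  have hreg : ∀ k, IsRegularData (s k) (Gk k) (xk k) (C k) := fun k => (hpc k).isRegularData
  have hCk : ∀ {z k}, z ∈ C k → ψ z ∈ ι k '' (X k).interiorSet := fun h => h.2
  set F₀ : 𝔼 → Coefs (m + 1) := fun z => if hz : ∃ k, ψ z ∈ ι k '' (X k).interiorSet then
    regularCoefs α m (s hz.choose) (Gk hz.choose) (xk hz.choose) z else 0 with hF₀
  have hF : ∀ k, ∀ z ∈ C k, F₀ z = regularCoefs α m (s k) (Gk k) (xk k) z := fun k z hz => by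
    have hex : ∃ k, ψ z ∈ ι k '' (X k).interiorSet := ⟨k, hCk hz⟩
    simp only [hF₀, dif_pos hex]
    rw [hchoose hex (hCk hz)]
  set DT : Set 𝔼 := ⋃ k, C k with hDT
  have hTopen : IsOpen T := isOpen_extChartAt_target p₀
  have hTD : ∀ z ∈ T, z ∈ closure DT := by
    intro z hz
    rw [mem_closure_iff_nhds]
    intro N hN
    have hN' : N ∩ T ∈ 𝓝 z := inter_mem hN (hTopen.mem_nhds hz)
    have hsrc : ψ z ∈ (extChartAt 𝓢 p₀).source := (extChartAt 𝓢 p₀).map_target hz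
    have h1 : (extChartAt 𝓢 p₀) ⁻¹' (N ∩ T) ∈ 𝓝 (ψ z) := by
      refine (continuousAt_extChartAt' hsrc).preimage_mem_nhds ?_
      rwa [(extChartAt 𝓢 p₀).right_inv hz]
    have h2 := inter_mem h1 ((isOpen_extChartAt_source (I := 𝓢) p₀).mem_nhds hsrc)
    obtain ⟨q, hq1, hq2⟩ := mem_closure_iff_nhds.1 (hDdense (ψ z)) _ h2
    refine ⟨extChartAt 𝓢 p₀ q, hq1.1.1, ?_⟩
    obtain ⟨k, hk⟩ := mem_iUnion.1 hq2
    refine mem_iUnion.2 ⟨k, hq1.1.2, ?_⟩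
    rw [mem_preimage, (extChartAt 𝓢 p₀).left_inv hq1.2]
    exact hk
  obtain ⟨A, hA, hAF⟩ := exists_contDiffOn_extension (f := F₀) hTD (fun z hz => by
    by_cases hzk : ∃ k, ψ z ∈ ι k '' (X k).interiorSet
    · obtain ⟨k, hk⟩ := hzk
      exact ⟨C k, (hreg k).isOpen.mem_nhds ⟨hz, hk⟩, _, (hreg k).smooth_regularCoefs α m,
        fun z' hz' => (hF k z' hz'.1).symm⟩
    obtain ⟨kp, km, Y, c, c', δ, h, Φ, hkp, hkm, H, hsrc, hglue, hbd, y, hy⟩ :=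
      hend (ψ z) (not_exists.1 hzk)
    have hcd := isCollarData_end (Φ := Φ) (p₀ := p₀) H.smooth H.posDef
    have h0 : ((0 : ℝ), y) ∈ Ioo (-δ) δ ×ˢ univ := ⟨⟨neg_lt_zero.2 H.pos, H.pos⟩, trivial⟩
    have hone : ∀ (k : κ) (ck : Collar (X k) Y), δ ≤ ck.ε ^ 2 → IsEndForm (s k) δ ck (g k) (x k) h →
        (∀ t : ℝ, 0 ≤ t → t ^ 2 < δ → ∀ y : Y, Φ (s k * t ^ 2, y) = ι k (ck.φ (t, y))) →
        ∀ z' ∈ endPart Φ δ p₀, 0 < s k * endMu Φ p₀ z' →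
          IsCollarData.collarCoefs α m (endMatrix Φ h p₀) (endMu Φ p₀) z' = F₀ z' := by
      intro k ck hle hf hg z' hz' hpos
      have hes := fun z (hz : z ∈ endPart Φ δ p₀ ∩ {z | 0 < s k * endMu Φ p₀ z}) =>
        end_side (hpc k) hle hf hg hz.1 hz.2
      rw [hF k z' (hes z' ⟨hz', hpos⟩).1]
      exact (hcd.coef_eq (hpc k).sign
        ((continuousOn_const.mul hcd.smooth_mu.continuousOn).isOpen_inter_preimage hcd.isOpen
          isOpen_Ioi) inter_subset_left (fun z hz => (hreg k).pos z (hes z hz).1)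
        (fun z hz => (hes z hz).2.1) (fun z hz => (hes z hz).2.2) ⟨hz', hpos⟩ α).symm
    refine ⟨endPart Φ δ p₀, hcd.isOpen.mem_nhds ⟨hz, (0, y), ⟨hsrc h0, h0⟩, hy⟩, _,
      hcd.smooth_collarCoefs α m, fun z' ⟨hz', hz''⟩ => ?_⟩
    rcases lt_trichotomy (endMu Φ p₀ z') 0 with hneg | h0 | hpos
    · exact hone km c' H.le' (by rw [hkm]; exact H.form')
        (fun t ht ht' y => by rw [hkm, neg_one_mul]; exact (hglue t ht ht' y).2) z' hz'
        (by rw [hkm]; linarith)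
    · obtain ⟨k, hk⟩ := mem_iUnion.1 hz''
      have h2 : endCoord Φ p₀ z' = (0, endY Φ p₀ z') := Prod.ext h0 rfl
      refine absurd (hCk hk) (hbd (endY Φ p₀ z') k ∘ fun h1 => ?_)
      rwa [← h2, (map_endCoord hz').2.2]
    · exact hone kp c H.le (by rw [hkp]; exact H.form)
        (fun t ht ht' y => by rw [hkp, one_mul]; exact (hglue t ht ht' y).1) z' hz'
        (by rw [hkp]; linarith))
  refine ⟨A, hA, fun v z hz hzD => ?_⟩
  obtain ⟨k, hk⟩ := mem_iUnion.1 hzD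
  have hzk : z ∈ C k := ⟨hz, hk⟩
  rw [hQk k v _ hk]
  refine ((hpc k).pieceOp_eq α Λ hzk v).trans ?_
  have hf : ContDiffAt ℝ 2 (fun z => v (ψ z)) z :=
    ((v.contDiffOn_chart p₀).contDiffAt (hTopen.mem_nhds hz)).of_le two_le_infty
  refine ((hreg k).confOp_eq hΛ hzk hf).trans ?_
  simp only [diffExpr, hAF z ⟨hz, mem_iUnion.2 ⟨k, hzk⟩⟩, hF k z hzk]

end GlobalOperator

/-! ### Manifolds from families of charts -/

section Charts

theorem ClosedManifold.exists_of_charts {d : ℕ} {M : Type u} [TopologicalSpace M] [T2Space M]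
    [CompactSpace M] {J : Type*} (e : J → OpenPartialHomeomorph M (Eucl d))
    (hcov : ∀ q, ∃ j, q ∈ (e j).source)
    (hsm : ∀ j j', ContMDiffOn (𝓡 d) (𝓡 d) ∞ ((e j).symm ≫ₕ e j') ((e j).symm ≫ₕ e j').source) :
    ∃ (Xt : ClosedManifold.{u} d) (θ : M ≃ₜ Xt), ∀ j,
      ContMDiffOn (𝓡 d) (𝓡 d) ∞ (fun q => e j (θ.symm q)) (θ.symm ⁻¹' (e j).source) ∧
      ContMDiffOn (𝓡 d) (𝓡 d) ∞ (fun z => θ ((e j).symm z)) (e j).target := by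
  choose jj hjj using hcov
  let cs : ChartedSpace (Eucl d) M :=
    { atlas := range e
      chartAt := fun q => e (jj q)
      mem_chart_source := hjj
      chart_mem_atlas := fun q => mem_range_self _ }
  have hman : IsManifold (𝓡 d) ∞ M := by
    refine isManifold_of_contDiffOn (𝓡 d) ∞ M ?_
    rintro _ _ ⟨j, rfl⟩ ⟨j', rfl⟩
    have h := contMDiffOn_iff_contDiffOn.1 (hsm j j')
    simpa using h
  refine ⟨⟨M⟩, Homeomorph.refl M, fun j => ?_⟩
  have hj : e j ∈ IsManifold.maximalAtlas (𝓡 d) ∞ M :=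
    IsManifold.subset_maximalAtlas (mem_range_self j)
  exact ⟨contMDiffOn_of_mem_maximalAtlas hj, contMDiffOn_symm_of_mem_maximalAtlas hj⟩

variable {E₁ E₂ F₁ F₂ H₁ H₂ G₁ G₂ : Type*} [NormedAddCommGroup E₁] [NormedSpace ℝ E₁]
  [NormedAddCommGroup E₂] [NormedSpace ℝ E₂] [TopologicalSpace H₁] [TopologicalSpace H₂]
  [NormedAddCommGroup F₁] [NormedSpace ℝ F₁]
  [NormedAddCommGroup F₂] [NormedSpace ℝ F₂] [TopologicalSpace G₁] [TopologicalSpace G₂]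
  {I₁ : ModelWithCorners ℝ E₁ H₁} {I₂ : ModelWithCorners ℝ E₂ H₂}
  {J₁ : ModelWithCorners ℝ F₁ G₁} {J₂ : ModelWithCorners ℝ F₂ G₂}
  {N₁ N₂ M L₁ L₂ : Type*} [TopologicalSpace N₁] [ChartedSpace H₁ N₁] [TopologicalSpace N₂]
  [ChartedSpace H₂ N₂] [TopologicalSpace M] [TopologicalSpace L₁] [ChartedSpace G₁ L₁]
  [TopologicalSpace L₂] [ChartedSpace G₂ L₂]

/-- The chart of `M` obtained from a chart of `N` and a homeomorphism of open sets. -/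
def inducedChart (f : OpenPartialHomeomorph N₁ M) (Ψ : PartialDiffeomorph I₁ J₁ N₁ L₁ ∞) :
    OpenPartialHomeomorph M L₁ :=
  f.symm ≫ₕ Ψ.toOpenPartialHomeomorph

theorem contMDiffOn_inducedChart_trans {f₁ : OpenPartialHomeomorph N₁ M}
    {f₂ : OpenPartialHomeomorph N₂ M} (Ψ₁ : PartialDiffeomorph I₁ J₁ N₁ L₁ ∞)
    (Ψ₂ : PartialDiffeomorph I₂ J₂ N₂ L₂ ∞)
    (h : ContMDiffOn I₁ I₂ ∞ (f₁ ≫ₕ f₂.symm) (f₁ ≫ₕ f₂.symm).source) :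
    ContMDiffOn J₁ J₂ ∞ ((inducedChart f₁ Ψ₁).symm ≫ₕ inducedChart f₂ Ψ₂)
      ((inducedChart f₁ Ψ₁).symm ≫ₕ inducedChart f₂ Ψ₂).source := by
  have h1 := h.comp' Ψ₁.contMDiffOn_invFun
  have h2 := Ψ₂.contMDiffOn_toFun.comp' h1
  refine (h2.congr fun z hz => rfl).mono fun z hz => ?_
  simp only [inducedChart, OpenPartialHomeomorph.trans_source, OpenPartialHomeomorph.symm_source,
    mem_inter_iff,
    mem_preimage, OpenPartialHomeomorph.coe_trans, OpenPartialHomeomorph.trans_symm_eq_symm_trans_symm,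
    OpenPartialHomeomorph.symm_symm, Function.comp_apply] at hz
  obtain ⟨⟨hz1, hz2⟩, hz3, hz4⟩ := hz
  exact ⟨⟨hz1, hz2, hz3⟩, hz4⟩

theorem contMDiffOn_of_inducedChart {P : Type*} [TopologicalSpace P] [ChartedSpace G₂ P]
    {f : OpenPartialHomeomorph N₁ M} {θ : M ≃ₜ P}
    (H : ∀ a ∈ f.source, ∃ Ψ : PartialDiffeomorph I₁ J₁ N₁ L₁ ∞, a ∈ Ψ.source ∧
      ContMDiffOn J₂ J₁ ∞ (fun q => inducedChart f Ψ (θ.symm q)) (θ.symm ⁻¹' (inducedChart f Ψ).source) ∧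
      ContMDiffOn J₁ J₂ ∞ (fun z => θ ((inducedChart f Ψ).symm z)) (inducedChart f Ψ).target) :
    ∃ Φ : PartialDiffeomorph I₁ J₂ N₁ P ∞, Φ.source = f.source ∧ ∀ a, Φ a = θ (f a) := by
  refine ⟨{ toPartialEquiv := f.toPartialEquiv.trans θ.toEquiv.toPartialEquiv
            open_source := ?_
            open_target := ?_
            contMDiffOn_toFun := ?_
            contMDiffOn_invFun := ?_ }, ?_, fun a => rfl⟩
  · exact (f ≫ₕ θ.toOpenPartialHomeomorph).open_source
  · exact (f ≫ₕ θ.toOpenPartialHomeomorph).open_target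
  · intro a ha
    have ha' : a ∈ f.source := ha.1
    obtain ⟨Ψ, haΨ, -, h2⟩ := H a ha'
    have hmem : Ψ a ∈ (inducedChart f Ψ).target := by
      simp only [inducedChart, OpenPartialHomeomorph.trans_target]
      exact ⟨Ψ.map_source haΨ, by
        change Ψ.invFun (Ψ a) ∈ f.source
        rwa [show Ψ.invFun (Ψ a) = a from Ψ.left_inv haΨ]⟩
    have h3 := (h2.contMDiffAt ((inducedChart f Ψ).open_target.mem_nhds hmem)).comp a
      (Ψ.contMDiffOn_toFun.contMDiffAt (Ψ.open_source.mem_nhds haΨ))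
    refine (h3.congr_of_eventuallyEq ?_).contMDiffWithinAt
    filter_upwards [Ψ.open_source.mem_nhds haΨ] with b hb
    change θ (f b) = θ (f (Ψ.invFun (Ψ b)))
    rw [show Ψ.invFun (Ψ b) = b from Ψ.left_inv hb]
  · intro q hq
    have hq1 : θ.symm q ∈ f.target := hq.2
    have ha : f.symm (θ.symm q) ∈ f.source := f.map_target hq1
    obtain ⟨Ψ, haΨ, h1, -⟩ := H _ ha
    have hmem : θ.symm q ∈ (inducedChart f Ψ).source := ⟨hq1, haΨ⟩
    have hopen : IsOpen (θ.symm ⁻¹' (inducedChart f Ψ).source) :=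
      (inducedChart f Ψ).open_source.preimage θ.symm.continuous
    have h2 := h1.contMDiffAt (hopen.mem_nhds hmem)
    have h3 := (Ψ.contMDiffOn_invFun.contMDiffAt (Ψ.open_target.mem_nhds (Ψ.map_source haΨ))).comp q h2
    refine (h3.congr_of_eventuallyEq ?_).contMDiffWithinAt
    filter_upwards [hopen.mem_nhds hmem] with b hb
    exact (Ψ.left_inv hb.2).symm
  · ext a
    simp

end Charts

/-! ### Gluing along the boundary -/

section Gluing

variable {X : CompactManifoldWithBoundary.{u} m} {E : Type} {Y : E → ClosedManifold.{u} m}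

/-- The boundary of `X` is covered by the bases of the collars `c e b`, which are disjoint, and
`c e true` and `c e false` have the same base `Y e`. -/
structure IsGluable (c : ∀ e, Bool → Collar X (Y e)) (δ : ℝ) : Prop where
  pos : 0 < δ
  le : ∀ e b, δ ≤ (c e b).ε ^ 2
  boundary : ∀ p ∈ X.boundarySet, ∃ e b y, (c e b).φ (0, y) = p
  disj : ∀ e b e₁ b₁ (s s' : ℝ) y y', 0 ≤ s → s ^ 2 < δ → 0 ≤ s' → s' ^ 2 < δ →
    (c e b).φ (s, y) = (c e₁ b₁).φ (s', y') → e = e₁ ∧ b = b₁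

/-- Boundary points are identified. -/
def glueRel (c : ∀ e, Bool → Collar X (Y e)) (p q : X) : Prop :=
  p = q ∨ ∃ e b b' y, (c e b).φ (0, y) = p ∧ (c e b').φ (0, y) = q

theorem Collar.zero_mem_boundary {Y : ClosedManifold.{u} m} (c : Collar X Y) (y : Y) :
    c.φ (0, y) ∈ X.boundarySet := by
  have h : c.φ (0, y) ∈ c.φ.target ∩ X.boundarySet := by
    rw [c.boundary_eq]
    exact ⟨(0, y), ⟨rfl, trivial⟩, rfl⟩
  exact h.2

theorem Collar.continuous_zero {Y : ClosedManifold.{u} m} (c : Collar X Y) :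
    Continuous fun y => c.φ (0, y) := by
  refine c.smooth.continuousOn.comp_continuous (by fun_prop) fun y =>
    c.mem_source ⟨le_rfl, c.ε_pos⟩ y

namespace IsGluable

variable {c : ∀ e, Bool → Collar X (Y e)} {δ : ℝ} (H : IsGluable c δ)

theorem mem_Ico (H : IsGluable c δ) {s : ℝ} (hs : 0 ≤ s) (hs' : s ^ 2 < δ) (e : E) (b : Bool) :
    s ∈ Ico 0 (c e b).ε :=
  ⟨hs, lt_of_pow_lt_pow_left₀ 2 (c e b).ε_pos.le (hs'.trans_le (H.le e b))⟩

theorem inj (H : IsGluable c δ) {e : E} {b b' : Bool} {s s' : ℝ} {y y' : Y e} (hs : 0 ≤ s)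
    (hsδ : s ^ 2 < δ) (hs' : 0 ≤ s') (hsδ' : s' ^ 2 < δ)
    (h : (c e b).φ (s, y) = (c e b').φ (s', y')) : b = b' ∧ s = s' ∧ y = y' := by
  obtain ⟨-, rfl⟩ := H.disj _ _ _ _ _ _ _ _ hs hsδ hs' hsδ' h
  have := (c e b).φ.injOn ((c e b).mem_source (H.mem_Ico hs hsδ e b) y)
    ((c e b).mem_source (H.mem_Ico hs' hsδ' e b) y') h
  exact ⟨rfl, congrArg Prod.fst this, congrArg Prod.snd this⟩

theorem zero_sq_lt (H : IsGluable c δ) : (0 : ℝ) ^ 2 < δ := by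
  rw [zero_pow two_ne_zero]
  exact H.pos

/-- The equivalence relation that identifies boundary points. -/
def setoid (H : IsGluable c δ) : Setoid X where
  r := glueRel c
  iseqv := by
    refine ⟨fun p => Or.inl rfl, ?_, ?_⟩
    · rintro p q (rfl | ⟨e, b, b', y, rfl, rfl⟩)
      · exact Or.inl rfl
      · exact Or.inr ⟨e, b', b, y, rfl, rfl⟩
    · rintro p q r (rfl | ⟨e, b, b', y, rfl, rfl⟩) h
      · exact h
      · rcases h with rfl | ⟨e', b₁, b₁', y', h1, rfl⟩
        · exact Or.inr ⟨e, b, b', y, rfl, rfl⟩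
        · obtain ⟨rfl, -⟩ := H.disj _ _ _ _ _ _ _ _ le_rfl H.zero_sq_lt le_rfl H.zero_sq_lt h1
          obtain ⟨-, -, rfl⟩ := H.inj le_rfl H.zero_sq_lt le_rfl H.zero_sq_lt h1
          exact Or.inr ⟨e', b, b₁', y', rfl, rfl⟩

/-- The glued space. -/
def Glued (H : IsGluable c δ) : Type u := Quotient H.setoid

instance : TopologicalSpace H.Glued :=
  inferInstanceAs (TopologicalSpace (Quotient H.setoid))

/-- The projection to the glued space. -/
def proj (p : X) : H.Glued := Quotient.mk H.setoid p

/-- A representative of a point of the glued space. -/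
def rep (q : H.Glued) : X := Quotient.out q

theorem proj_rep (q : H.Glued) : H.proj (H.rep q) = q := Quotient.out_eq q

theorem proj_eq_iff {p q : X} : H.proj p = H.proj q ↔ glueRel c p q :=
  Quotient.eq (r := H.setoid)

theorem isQuotientMap_proj : IsQuotientMap H.proj :=
  isQuotientMap_quot_mk

theorem continuous_proj : Continuous H.proj := H.isQuotientMap_proj.continuous

theorem surjective_proj : Surjective H.proj :=
  H.isQuotientMap_proj.surjective

instance : CompactSpace H.Glued :=
  inferInstanceAs (CompactSpace (Quotient H.setoid))

theorem eq_of_proj_eq {p q : X} (hp : p ∈ X.interiorSet) (h : H.proj p = H.proj q) : p = q := by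
  rcases H.proj_eq_iff.1 h with h | ⟨e, b, b', y, rfl, rfl⟩
  · exact h
  · exact absurd ((c e b).zero_mem_boundary y) (mem_interiorSet_iff.1 hp)

theorem isClosedMap_proj [Finite E] : IsClosedMap H.proj := by
  intro C hC
  rw [← H.isQuotientMap_proj.isClosed_preimage]
  have h : H.proj ⁻¹' (H.proj '' C) = C ∪ ⋃ e, ⋃ b : Bool, ⋃ b' : Bool,
      (fun y => (c e b').φ (0, y)) '' ((fun y => (c e b).φ (0, y)) ⁻¹' C) := by
    ext p
    simp only [mem_preimage, mem_image, mem_union, mem_iUnion]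
    constructor
    · rintro ⟨q, hq, he⟩
      rcases H.proj_eq_iff.1 he with rfl | ⟨e, b, b', y, rfl, rfl⟩
      · exact Or.inl hq
      · exact Or.inr ⟨e, b, b', y, hq, rfl⟩
    · rintro (hp | ⟨e, b, b', y, hq, rfl⟩)
      · exact ⟨p, hp, rfl⟩
      · exact ⟨_, hq, H.proj_eq_iff.2 (Or.inr ⟨e, b, b', y, rfl, rfl⟩)⟩
  rw [h]
  refine hC.union (isClosed_iUnion_of_finite fun e => isClosed_iUnion_of_finite fun b =>
    isClosed_iUnion_of_finite fun b' => ?_)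
  exact (((hC.preimage (c e b).continuous_zero).isCompact).image (c e b').continuous_zero).isClosed

instance [Finite E] : T2Space H.Glued := by
  refine ⟨fun a b hab => ?_⟩
  have hclosed : ∀ a : H.Glued, IsClosed (H.proj ⁻¹' {a}) := fun a => by
    obtain ⟨p, rfl⟩ := H.surjective_proj a
    have := H.isClosedMap_proj _ (isClosed_singleton (x := p))
    rw [image_singleton] at this
    exact this.preimage H.continuous_proj
  have hd : Disjoint (H.proj ⁻¹' {a}) (H.proj ⁻¹' {b}) :=
    Disjoint.preimage _ (disjoint_singleton.2 hab)
  obtain ⟨U, V, hU, hV, hUa, hVb, hUV⟩ := SeparatedNhds.of_isCompact_isCompact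
    (hclosed a).isCompact (hclosed b).isCompact hd
  refine ⟨(H.proj '' Uᶜ)ᶜ, (H.proj '' Vᶜ)ᶜ, (H.isClosedMap_proj _ hU.isClosed_compl).isOpen_compl,
    (H.isClosedMap_proj _ hV.isClosed_compl).isOpen_compl, ?_, ?_, ?_⟩
  · rintro ⟨p, hp, rfl⟩
    exact hp (hUa rfl)
  · rintro ⟨p, hp, rfl⟩
    exact hp (hVb rfl)
  · rw [Set.disjoint_left]
    intro q hq hq'
    obtain ⟨p, rfl⟩ := H.surjective_proj q
    refine hUV.le_bot (show p ∈ U ∩ V from ⟨?_, ?_⟩)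
    · by_contra hp
      exact hq ⟨p, hp, rfl⟩
    · by_contra hp
      exact hq' ⟨p, hp, rfl⟩

/-- The interior of `X`, as an open part of the glued space. -/
def interiorHomeo : OpenPartialHomeomorph X H.Glued :=
  OpenPartialHomeomorph.ofContinuousOpenRestrict
    { toFun := H.proj
      invFun := H.rep
      source := X.interiorSet
      target := H.proj '' X.interiorSet
      map_source' := fun p hp => ⟨p, hp, rfl⟩
      map_target' := by
        rintro _ ⟨p, hp, rfl⟩
        rwa [← H.eq_of_proj_eq hp (H.proj_rep (H.proj p)).symm]
      left_inv' := fun p hp => (H.eq_of_proj_eq hp (H.proj_rep (H.proj p)).symm).symm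
      right_inv' := fun q _ => H.proj_rep q }
    H.continuous_proj.continuousOn
    (by
      intro U hU
      rw [← H.isQuotientMap_proj.isOpen_preimage]
      have : H.proj ⁻¹' (X.interiorSet.domRestrict H.proj '' U) = Subtype.val '' U := by
        ext p
        constructor
        · rintro ⟨q, hq, he⟩
          exact ⟨q, hq, H.eq_of_proj_eq q.2 he⟩
        · rintro ⟨q, hq, rfl⟩
          exact ⟨q, hq, rfl⟩
      exact this ▸ X.isOpen_interiorSet.isOpenMap_subtype_val _ hU)
    X.isOpen_interiorSet

end IsGluable

end Gluing

section Gluing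

variable {X : CompactManifoldWithBoundary.{u} m} {E : Type} {Y : E → ClosedManifold.{u} m}

/-- `s²` or `-s²`. -/
def signedSq (b : Bool) (s : ℝ) : ℝ := if b then s ^ 2 else -s ^ 2

theorem contDiff_signedSq (b : Bool) : ContDiff ℝ ∞ (signedSq b) := by
  cases b
  · exact (contDiff_id.pow 2).neg
  · exact contDiff_id.pow 2

theorem abs_signedSq (b : Bool) (s : ℝ) : |signedSq b s| = s ^ 2 := by
  cases b
  · simp [signedSq]
  · simp [signedSq]

theorem signedSq_sqrt (μ : ℝ) : signedSq (decide (0 ≤ μ)) (√|μ|) = μ := by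
  rw [signedSq, Real.sq_sqrt (abs_nonneg μ)]
  by_cases h : 0 ≤ μ
  · simp [h, abs_of_nonneg h]
  · simp [h, abs_of_neg (not_le.1 h)]

namespace IsGluable

variable {c : ∀ e, Bool → Collar X (Y e)} {δ : ℝ} (H : IsGluable c δ)

theorem eq_collar_of_proj_eq {p : X} {e : E} {b : Bool} {s : ℝ} {y : Y e}
    (hs : 0 ≤ s) (hsδ : s ^ 2 < δ) (h : H.proj p = H.proj ((c e b).φ (s, y))) :
    ∃ b', p = (c e b').φ (s, y) ∧ (b' = b ∨ s = 0) := by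
  rcases H.proj_eq_iff.1 h with rfl | ⟨e', b₁, b₂, y', rfl, h2⟩
  · exact ⟨b, rfl, Or.inl rfl⟩
  · obtain ⟨rfl, -⟩ := H.disj _ _ _ _ _ _ _ _ le_rfl H.zero_sq_lt hs hsδ h2
    obtain ⟨-, rfl, rfl⟩ := H.inj le_rfl H.zero_sq_lt hs hsδ h2
    exact ⟨b₁, rfl, Or.inr rfl⟩

theorem proj_collar_zero (e : E) (b b' : Bool) (y : Y e) :
    H.proj ((c e b).φ (0, y)) = H.proj ((c e b').φ (0, y)) :=
  H.proj_eq_iff.2 (Or.inr ⟨e, b, b', y, rfl, rfl⟩)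

/-- The coordinates near a common boundary part. -/
def endFun (e : E) (q : ℝ × Y e) : H.Glued :=
  if 0 ≤ q.1 then H.proj ((c e true).φ (√|q.1|, q.2)) else H.proj ((c e false).φ (√|q.1|, q.2))

theorem endFun_eq (e : E) (q : ℝ × Y e) :
    H.endFun e q = H.proj ((c e (decide (0 ≤ q.1))).φ (√|q.1|, q.2)) := by
  rw [endFun]
  split_ifs with h <;> simp [h]

theorem endFun_signedSq (e : E) (b : Bool) {s : ℝ} (hs : 0 ≤ s) (y : Y e) :
    H.endFun e (signedSq b s, y) = H.proj ((c e b).φ (s, y)) := by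
  rw [endFun_eq]
  simp only [abs_signedSq, Real.sqrt_sq hs]
  rcases hs.eq_or_lt with rfl | hs
  · exact H.proj_collar_zero e _ _ y
  · have : decide (0 ≤ signedSq b s) = b := by
      cases b
      · simp [signedSq, hs.ne']
      · simp [signedSq, sq_nonneg]
    rw [this]

open Classical in
/-- The inverse of `endFun`. -/
def endInv (e : E) (q : H.Glued) : ℝ × Y e :=
  if H.rep q ∈ (c e true).φ '' {a | a.1 ∈ Ico 0 (√δ)} then
    (signedSq true ((c e true).φ.symm (H.rep q)).1, ((c e true).φ.symm (H.rep q)).2)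
  else (signedSq false ((c e false).φ.symm (H.rep q)).1, ((c e false).φ.symm (H.rep q)).2)

theorem endInv_proj {e : E} {b : Bool} {s : ℝ} (hs : 0 ≤ s) (hsδ : s ^ 2 < δ)
    (y : Y e) : H.endInv e (H.proj ((c e b).φ (s, y))) = (signedSq b s, y) := by
  obtain ⟨b', hb', hb⟩ := H.eq_collar_of_proj_eq hs hsδ (H.proj_rep (H.proj ((c e b).φ (s, y))))
  have h1 : signedSq b' s = signedSq b s := by
    rcases hb with rfl | rfl
    · rfl
    · simp [signedSq]
  have hmem : ∀ b, (s, y) ∈ (c e b).φ.source := fun b =>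
    (c e b).mem_source (H.mem_Ico hs hsδ e b) y
  rw [endInv, hb', ← h1]
  cases b'
  · rw [if_neg]
    · rw [(c e false).φ.left_inv (hmem _)]
    · rintro ⟨⟨s', y'⟩, ⟨hs1, hs2⟩, he⟩
      have := (H.inj hs1 ((Real.lt_sqrt hs1).1 hs2) hs hsδ he).1
      exact absurd this (by decide)
  · rw [if_pos ⟨(s, y), ⟨hs, (Real.lt_sqrt hs).2 hsδ⟩, rfl⟩, (c e true).φ.left_inv (hmem _)]

theorem sqrt_abs_sq_lt {μ : ℝ} (hμ : μ ∈ Ioo (-δ) δ) : √|μ| ^ 2 < δ := by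
  rw [Real.sq_sqrt (abs_nonneg μ)]
  exact abs_lt.2 hμ

theorem continuousOn_endFun (e : E) : ContinuousOn (H.endFun e) (Ioo (-δ) δ ×ˢ univ) := by
  have hb : ∀ b, ContinuousOn (fun q : ℝ × Y e => H.proj ((c e b).φ (√|q.1|, q.2)))
      (Ioo (-δ) δ ×ˢ univ) := fun b => by
    refine H.continuous_proj.comp_continuousOn ((c e b).smooth.continuousOn.comp ?_ ?_)
    · exact Continuous.continuousOn (by fun_prop)
    · intro q hq
      exact (c e b).mem_source (H.mem_Ico (Real.sqrt_nonneg _) (sqrt_abs_sq_lt hq.1) e b) q.2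
  refine ContinuousOn.if ?_ ((hb true).mono inter_subset_left) ((hb false).mono inter_subset_left)
  intro q hq
  have : q.1 = 0 := (frontier_le_subset_eq continuous_const continuous_fst hq.2).symm
  simp only [this, abs_zero, Real.sqrt_zero]
  exact H.proj_collar_zero e _ _ _

theorem endInv_endFun {e : E} {q : ℝ × Y e} (hq : q.1 ∈ Ioo (-δ) δ) :
    H.endInv e (H.endFun e q) = q := by
  rw [endFun_eq, H.endInv_proj (Real.sqrt_nonneg _) (sqrt_abs_sq_lt hq), signedSq_sqrt]

/-- The coordinates near a common boundary part. -/
def endHomeo (e : E) : OpenPartialHomeomorph (ℝ × Y e) H.Glued :=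
  OpenPartialHomeomorph.ofContinuousOpenRestrict
    { toFun := H.endFun e
      invFun := H.endInv e
      source := Ioo (-δ) δ ×ˢ univ
      target := H.endFun e '' (Ioo (-δ) δ ×ˢ univ)
      map_source' := fun p hp => ⟨p, hp, rfl⟩
      map_target' := by
        rintro _ ⟨q, hq, rfl⟩
        rwa [H.endInv_endFun hq.1]
      left_inv' := fun q hq => H.endInv_endFun hq.1
      right_inv' := by
        rintro _ ⟨q, hq, rfl⟩
        rw [H.endInv_endFun hq.1] }
    (H.continuousOn_endFun e)
    (by
      intro U hU
      have hsrc : IsOpen (Ioo (-δ) δ ×ˢ (univ : Set (Y e))) := isOpen_Ioo.prod isOpen_univ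
      have hO : IsOpen (Subtype.val '' U) := hsrc.isOpenMap_subtype_val _ hU
      rw [← H.isQuotientMap_proj.isOpen_preimage]
      have : H.proj ⁻¹' ((Ioo (-δ) δ ×ˢ univ).domRestrict (H.endFun e) '' U) = ⋃ b,
          (c e b).φ.target ∩ (fun p => (signedSq b ((c e b).φ.symm p).1, ((c e b).φ.symm p).2)) ⁻¹'
            (Subtype.val '' U) := by
        ext p
        simp only [mem_iUnion]
        constructor
        · rintro ⟨⟨⟨μ, y⟩, hq⟩, hqU, he⟩
          change H.endFun e (μ, y) = _ at he
          rw [endFun_eq] at he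
          obtain ⟨b, rfl, hb⟩ := H.eq_collar_of_proj_eq (Real.sqrt_nonneg _) (sqrt_abs_sq_lt hq.1)
            he.symm
          have hm := (c e b).mem_source (H.mem_Ico (Real.sqrt_nonneg _) (sqrt_abs_sq_lt hq.1) e b) y
          refine ⟨b, (c e b).φ.map_source hm, ⟨(μ, y), hq⟩, hqU, ?_⟩
          simp only [(c e b).φ.left_inv hm]
          have h1 : signedSq b √|μ| = μ := by
            rcases hb with rfl | hb
            · exact signedSq_sqrt μ
            · have : μ = 0 := by simpa using hb
              simp [this, signedSq]
          rw [h1]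
        · rintro ⟨b, hp, ⟨⟨q, hq⟩, hqU, he⟩⟩
          refine ⟨⟨q, hq⟩, hqU, ?_⟩
          change H.endFun e q = _
          change q = _ at he
          have hs : 0 ≤ ((c e b).φ.symm p).1 := by
            have := (c e b).φ.map_target hp
            rw [(c e b).source_eq] at this
            exact this.1.1
          rw [he, H.endFun_signedSq e b hs, Prod.mk.eta, (c e b).φ.right_inv hp]
      refine this ▸ isOpen_iUnion fun b => ?_
      refine ContinuousOn.isOpen_inter_preimage ?_ (c e b).open_target hO
      have h1 := (c e b).smooth_symm.continuousOn
      exact ((contDiff_signedSq b).continuous.comp_continuousOn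
        (continuous_fst.comp_continuousOn h1)).prodMk (continuous_snd.comp_continuousOn h1))
    (isOpen_Ioo.prod isOpen_univ)

end IsGluable

end Gluing

section Gluing

variable {X : CompactManifoldWithBoundary.{u} m} {E : Type} {Y : E → ClosedManifold.{u} m}

/-- The interior part of a chart. -/
def interiorCoord (p : X) :
    PartialDiffeomorph 𝓑 𝓢 X 𝔼 ∞ where
  toFun := extChartAt 𝓑 p
  invFun := (extChartAt 𝓑 p).symm
  source := (extChartAt 𝓑 p).source ∩ X.interiorSet
  target := interiorTarget p
  map_source' q hq := (mem_interiorTarget_iff ((extChartAt _ p).map_source hq.1)).2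
    (by rw [(extChartAt _ p).left_inv hq.1]; exact hq.2)
  map_target' z hz := ⟨(extChartAt _ p).map_target hz.1, (mem_interiorTarget_iff hz.1).1 hz⟩
  left_inv' q hq := (extChartAt _ p).left_inv hq.1
  right_inv' z hz := (extChartAt _ p).right_inv hz.1
  open_source := (isOpen_extChartAt_source p).inter X.isOpen_interiorSet
  open_target := isOpen_interiorTarget p
  contMDiffOn_toFun := (contMDiffOn_extChartAt (x := p) (n := ∞)).mono
    (by rw [← extChartAt_source 𝓑]; exact inter_subset_left)
  contMDiffOn_invFun := (contMDiffOn_extChartAt_symm p).mono inter_subset_left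

/-- `ℝ × ℝ^m` and `ℝ^{m+1}`. -/
def prodEquiv (m : ℕ) : (ℝ × Eucl m) ≃L[ℝ] Eucl (m + 1) :=
  ContinuousLinearEquiv.ofFinrankEq (by simp [add_comm])

/-- Product coordinates. -/
def productCoord {Y : ClosedManifold.{u} m} (q : ℝ × Y) :
    PartialDiffeomorph 𝓒 𝓢 (ℝ × Y) 𝔼 ∞ where
  toFun a := prodEquiv m (extChartAt 𝓒 q a)
  invFun z := (extChartAt 𝓒 q).symm ((prodEquiv m).symm z)
  source := (extChartAt 𝓒 q).source
  target := (prodEquiv m).symm ⁻¹' (extChartAt 𝓒 q).target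
  map_source' a ha := by
    rw [mem_preimage, ContinuousLinearEquiv.symm_apply_apply]
    exact (extChartAt _ q).map_source ha
  map_target' z hz := (extChartAt _ q).map_target hz
  left_inv' a ha := by
    rw [ContinuousLinearEquiv.symm_apply_apply]
    exact (extChartAt _ q).left_inv ha
  right_inv' z hz := by
    rw [(extChartAt _ q).right_inv hz, ContinuousLinearEquiv.apply_symm_apply]
  open_source := isOpen_extChartAt_source q
  open_target := (isOpen_extChartAt_target q).preimage (prodEquiv m).symm.continuous
  contMDiffOn_toFun := (prodEquiv m).contDiff.contMDiff.comp_contMDiffOn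
    ((contMDiffOn_extChartAt (x := q) (n := ∞)).mono
      (by rw [← extChartAt_source 𝓒]))
  contMDiffOn_invFun := (contMDiffOn_extChartAt_symm q).comp
    (prodEquiv m).symm.contDiff.contMDiff.contMDiffOn (fun _ h => h)

namespace IsGluable

variable {c : ∀ e, Bool → Collar X (Y e)} {δ : ℝ} (H : IsGluable c δ)

theorem contMDiffOn_self {E₁ H₁ N M : Type*} [NormedAddCommGroup E₁] [NormedSpace ℝ E₁]
    [TopologicalSpace H₁] {I : ModelWithCorners ℝ E₁ H₁} [TopologicalSpace N] [ChartedSpace H₁ N]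
    [TopologicalSpace M] (f : OpenPartialHomeomorph N M) :
    ContMDiffOn I I ∞ (f ≫ₕ f.symm) (f ≫ₕ f.symm).source :=
  contMDiffOn_id.congr fun _ ha => f.left_inv ha.1

theorem contMDiffOn_end_interior (e : E) : ContMDiffOn 𝓒 𝓑 ∞ (H.endHomeo e ≫ₕ H.interiorHomeo.symm)
      (H.endHomeo e ≫ₕ H.interiorHomeo.symm).source := by
  rintro ⟨μ, y⟩ ⟨⟨hμ, -⟩, p, hp, hpe⟩
  change H.proj p = H.endFun e (μ, y) at hpe
  rw [endFun_eq] at hpe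
  have hp' := H.eq_of_proj_eq hp hpe
  have hμ0 : μ ≠ 0 := by
    rintro rfl
    subst hp'
    refine absurd ?_ (mem_interiorSet_iff.1 hp)
    simp only [abs_zero, Real.sqrt_zero]
    exact Collar.zero_mem_boundary _ y
  set b := decide (0 ≤ μ) with hb
  have hmem : ∀ μ' ∈ Ioo (-δ) δ, μ' ≠ 0 → √|μ'| ∈ Ioo 0 (c e b).ε := fun μ' hμ' h0 =>
    ⟨Real.sqrt_pos.2 (abs_pos.2 h0), (H.mem_Ico (Real.sqrt_nonneg _) (sqrt_abs_sq_lt hμ') e b).2⟩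
  have hf : ContMDiffAt 𝓒 𝓑 ∞ (fun q : ℝ × Y e => (c e b).φ (√|q.1|, q.2)) (μ, y) := by
    refine ContMDiffAt.comp (μ, y) (g := (c e b).φ) (f := fun q : ℝ × Y e => (√|q.1|, q.2))
      ((c e b).contMDiffAt (hmem μ hμ hμ0) y) (ContMDiffAt.prodMk ?_ contMDiffAt_snd)
    have h1 : ContDiffAt ℝ ∞ (fun t : ℝ => √|t|) μ :=
      (contDiffAt_abs hμ0).sqrt (abs_pos.2 hμ0).ne'
    exact ContMDiffAt.comp (μ, y) (g := fun t : ℝ => √|t|) (f := fun q : ℝ × Y e => q.1)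
      h1.contMDiffAt contMDiffAt_fst
  refine (hf.congr_of_eventuallyEq ?_).contMDiffWithinAt
  have hs : ∀ᶠ μ' in 𝓝 μ, decide (0 ≤ μ') = b ∧ μ' ≠ 0 ∧ μ' ∈ Ioo (-δ) δ := by
    rcases hμ0.lt_or_gt with h | h
    · filter_upwards [gt_mem_nhds h, isOpen_Ioo.mem_nhds hμ] with μ' h1 h2
      exact ⟨by simp [hb, not_le.2 h1, not_le.2 h], h1.ne, h2⟩
    · filter_upwards [lt_mem_nhds h, isOpen_Ioo.mem_nhds hμ] with μ' h1 h2
      exact ⟨by simp [hb, h1.le, h.le], h1.ne', h2⟩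
  filter_upwards [continuousAt_fst.eventually hs] with q hq
  change H.rep (H.endFun e q) = _
  rw [endFun_eq, hq.1]
  exact (H.eq_of_proj_eq ((c e b).mem_interior (hmem q.1 hq.2.2 hq.2.1) q.2)
    (H.proj_rep _).symm).symm

theorem contMDiffOn_interior_end (e : E) :
    ContMDiffOn 𝓑 𝓒 ∞ (H.interiorHomeo ≫ₕ (H.endHomeo e).symm)
      (H.interiorHomeo ≫ₕ (H.endHomeo e).symm).source := by
  rintro p ⟨hp, ⟨μ, y⟩, ⟨hμ, -⟩, hpe⟩
  change H.endFun e (μ, y) = H.proj p at hpe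
  rw [endFun_eq] at hpe
  have hp' := H.eq_of_proj_eq hp hpe.symm
  set b := decide (0 ≤ μ) with hb
  set s := √|μ| with hs
  have hs2 : s ^ 2 < δ := sqrt_abs_sq_lt hμ
  have hm : (s, y) ∈ (c e b).φ.source :=
    (c e b).mem_source (H.mem_Ico (Real.sqrt_nonneg _) hs2 e b) y
  have hpt : p ∈ (c e b).φ.target := hp' ▸ (c e b).φ.map_source hm
  have hsymm := (c e b).smooth_symm.contMDiffAt ((c e b).open_target.mem_nhds hpt)
  have hf : ContMDiffAt 𝓑 𝓒 ∞
      (fun p => (signedSq b ((c e b).φ.symm p).1, ((c e b).φ.symm p).2)) p :=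
    ContMDiffAt.prodMk ((contDiff_signedSq b).contMDiff.contMDiffAt.comp p (contMDiffAt_fst.comp p hsymm))
      (contMDiffAt_snd.comp p hsymm)
  refine (hf.congr_of_eventuallyEq ?_).contMDiffWithinAt
  have h1 : ∀ᶠ p' in 𝓝 p, ((c e b).φ.symm p').1 ^ 2 < δ := by
    have hc : ContinuousAt (fun p' => ((c e b).φ.symm p').1 ^ 2) p :=
      (continuousAt_fst.comp hsymm.continuousAt).pow 2
    refine hc.eventually (gt_mem_nhds ?_)
    simp only [hp', (c e b).φ.left_inv hm]
    exact hs2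
  filter_upwards [h1, (c e b).open_target.mem_nhds hpt] with p' h1 h2
  change H.endInv e (H.proj p') = _
  have h3 := (c e b).φ.map_target h2
  rw [(c e b).source_eq] at h3
  conv_lhs => rw [← (c e b).φ.right_inv h2, ← Prod.mk.eta (p := (c e b).φ.symm p')]
  exact H.endInv_proj h3.1.1 h1 _

theorem contMDiffOn_end_end (e e' : E) : ContMDiffOn 𝓒 𝓒 ∞ (H.endHomeo e ≫ₕ (H.endHomeo e').symm)
      (H.endHomeo e ≫ₕ (H.endHomeo e').symm).source := by
  rintro ⟨μ, y⟩ hq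
  have he : e = e' := by
    obtain ⟨⟨hμ, -⟩, ⟨μ', y'⟩, ⟨hμ', -⟩, he⟩ := hq
    change H.endFun e' (μ', y') = H.endFun e (μ, y) at he
    rw [endFun_eq, endFun_eq] at he
    obtain ⟨b', hb', -⟩ := H.eq_collar_of_proj_eq (Real.sqrt_nonneg _) (sqrt_abs_sq_lt hμ) he
    exact (H.disj _ _ _ _ _ _ _ _ (Real.sqrt_nonneg _) (sqrt_abs_sq_lt hμ') (Real.sqrt_nonneg _)
      (sqrt_abs_sq_lt hμ) hb').1.symm
  subst he
  exact contMDiffOn_self (H.endHomeo e) _ hq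

theorem exists_glued [Finite E] (H : IsGluable c δ) :
    ∃ (Xt : ClosedManifold.{u} (m + 1)) (ι : X → Xt), Continuous ι ∧ Surjective ι ∧
      (∀ p q, ι p = ι q ↔ glueRel c p q) ∧
      (∀ p ∈ X.interiorSet, IsLocalDiffeomorphAt 𝓑 𝓢 ∞ ι p) ∧
      ∀ e, ∃ Φ : PartialDiffeomorph 𝓒 𝓢 (ℝ × Y e) Xt ∞,
        Φ.source = Ioo (-δ) δ ×ˢ univ ∧ ∀ s : ℝ, 0 ≤ s → s ^ 2 < δ → ∀ y,
          Φ (s ^ 2, y) = ι ((c e true).φ (s, y)) ∧ Φ (-s ^ 2, y) = ι ((c e false).φ (s, y)) := by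
  let ch : X ⊕ (Σ e, ℝ × Y e) → OpenPartialHomeomorph H.Glued 𝔼 := fun j =>
    j.elim (fun p => inducedChart H.interiorHomeo (interiorCoord p))
      (fun q => inducedChart (H.endHomeo q.1) (productCoord q.2))
  have hmemE : ∀ e y, ((0 : ℝ), y) ∈ (H.endHomeo e).source := fun e y =>
    ⟨⟨neg_lt_zero.2 H.pos, H.pos⟩, trivial⟩
  obtain ⟨Xt, θ, hθ⟩ := ClosedManifold.exists_of_charts ch (by
    intro q
    obtain ⟨p, rfl⟩ := H.surjective_proj q
    by_cases hp : p ∈ X.interiorSet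
    · refine ⟨Sum.inl p, ⟨p, hp, rfl⟩, ?_⟩
      change H.interiorHomeo.symm (H.interiorHomeo p) ∈ (interiorCoord p).source
      rw [H.interiorHomeo.left_inv hp]
      exact ⟨mem_extChartAt_source p, hp⟩
    · rw [mem_interiorSet_iff, not_not] at hp
      obtain ⟨e, b, y, rfl⟩ := H.boundary p hp
      have h0 : H.proj ((c e b).φ (0, y)) = H.endHomeo e (0, y) := by
        change _ = H.endFun e (0, y)
        rw [← H.endFun_signedSq e b le_rfl]
        simp [signedSq]
      refine ⟨Sum.inr ⟨e, 0, y⟩, ?_, ?_⟩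
      · rw [h0]
        exact (H.endHomeo e).map_source (hmemE e y)
      · rw [mem_preimage, h0]
        change (H.endHomeo e).symm (H.endHomeo e (0, y)) ∈ (productCoord ((0 : ℝ), y)).source
        rw [(H.endHomeo e).left_inv (hmemE e y)]
        exact mem_extChartAt_source (I := 𝓒) ((0 : ℝ), y)) (by
    rintro (p | q) (p' | q')
    · exact contMDiffOn_inducedChart_trans _ _ (contMDiffOn_self _)
    · exact contMDiffOn_inducedChart_trans _ _ (H.contMDiffOn_interior_end _)
    · exact contMDiffOn_inducedChart_trans _ _ (H.contMDiffOn_end_interior _)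
    · exact contMDiffOn_inducedChart_trans _ _ (H.contMDiffOn_end_end _ _))
  refine ⟨Xt, fun p => θ (H.proj p), θ.continuous.comp H.continuous_proj,
    θ.surjective.comp H.surjective_proj, fun p q => by rw [θ.injective.eq_iff, H.proj_eq_iff],
    fun p hp => ?_, fun e => ?_⟩
  · obtain ⟨Φ, hΦ, hΦ'⟩ := contMDiffOn_of_inducedChart (f := H.interiorHomeo) (θ := θ)
      (I₁ := 𝓑) (J₁ := 𝓢) (J₂ := 𝓢) (L₁ := 𝔼) fun a ha =>
        ⟨interiorCoord a, ⟨mem_extChartAt_source a, ha⟩, hθ (Sum.inl a)⟩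
    exact ⟨Φ, hΦ ▸ hp, fun a _ => (hΦ' a).symm⟩
  · obtain ⟨Φ, hΦ, hΦ'⟩ := contMDiffOn_of_inducedChart (f := H.endHomeo e) (θ := θ)
      (I₁ := 𝓒) (J₁ := 𝓢) (J₂ := 𝓢) (L₁ := 𝔼) fun a ha =>
        ⟨productCoord a, mem_extChartAt_source (I := 𝓒) a, hθ (Sum.inr ⟨e, a⟩)⟩
    refine ⟨Φ, hΦ, fun s hs _ y => ⟨?_, ?_⟩⟩
    · exact (hΦ' _).trans (congrArg θ (H.endFun_signedSq e true hs y))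
    · exact (hΦ' _).trans (congrArg θ (H.endFun_signedSq e false hs y))

end IsGluable

end Gluing

/-! ### Summands of disjoint unions -/

section Summand

variable {X X' Z Z' : CompactManifoldWithBoundary.{u} m} {Y : ClosedManifold.{u} m}

/-- `k` identifies `X` with a summand of the disjoint union `Z`. -/
structure IsSummand (k : X → Z) : Prop where
  smooth : ContMDiff 𝓑 𝓑 ∞ k
  emb : IsOpenEmbedding k
  inv : ∀ _ : X, ∃ r : Z → X, ContMDiff 𝓑 𝓑 ∞ r ∧ ∀ p', r (k p') = p'
  boundary : ∀ p, k p ∈ Z.boundarySet ↔ p ∈ X.boundarySet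

theorem IsSummand.interior {k : X → Z} (hk : IsSummand k) (p : X) :
    k p ∈ Z.interiorSet ↔ p ∈ X.interiorSet := by
  rw [mem_interiorSet_iff, hk.boundary, mem_interiorSet_iff]

theorem IsSummand.comp {k : X → Z} {k' : Z → Z'} (hk' : IsSummand k') (hk : IsSummand k) :
    IsSummand (k' ∘ k) where
  smooth := hk'.smooth.comp hk.smooth
  emb := hk'.emb.comp hk.emb
  inv p := by
    obtain ⟨r, hr, hr'⟩ := hk.inv p
    obtain ⟨s, hs, hs'⟩ := hk'.inv (k p)
    exact ⟨r ∘ s, hr.comp hs, fun p' => by simp [hs', hr']⟩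
  boundary p := (hk'.boundary _).trans (hk.boundary p)

theorem IsSummand.isLocalDiffeomorphAt {k : X → Z} (hk : IsSummand k) (p : X) :
    IsLocalDiffeomorphAt 𝓑 𝓑 ∞ k p := by
  obtain ⟨r, hr, hr'⟩ := hk.inv p
  exact ⟨{  toFun := k
            invFun := r
            source := univ
            target := range k
            map_source' := fun q _ => ⟨q, rfl⟩
            map_target' := fun q _ => trivial
            left_inv' := fun q _ => hr' q
            right_inv' := by rintro _ ⟨q, rfl⟩; rw [hr']
            open_source := isOpen_univ
            open_target := hk.emb.isOpen_range
            contMDiffOn_toFun := hk.smooth.contMDiffOn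
            contMDiffOn_invFun := hr.contMDiffOn }, trivial, fun _ _ => rfl⟩

/-- Disjoint union. -/
def CompactManifoldWithBoundary.sum (X Z : CompactManifoldWithBoundary.{u} m) :
    CompactManifoldWithBoundary.{u} m where
  carrier := X ⊕ Z

/-- The first summand. -/
def CompactManifoldWithBoundary.inl (X X' : CompactManifoldWithBoundary.{u} m) (p : X) : X.sum X' :=
  Sum.inl p

/-- The second summand. -/
def CompactManifoldWithBoundary.inr (X X' : CompactManifoldWithBoundary.{u} m) (p : X') : X.sum X' :=
  Sum.inr p

theorem isSummand_inl : IsSummand (X.inl X') where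
  smooth := ContMDiff.inl
  emb := IsOpenEmbedding.inl
  inv p := ⟨Sum.elim id fun _ => p, ContMDiff.sumElim contMDiff_id contMDiff_const, fun _ => rfl⟩
  boundary p := by
    have h : (X.sum X').boundarySet = (Sum.inl '' X.boundarySet ∪ Sum.inr '' X'.boundarySet :
      Set (X ⊕ X')) := ModelWithCorners.boundary_disjointUnion
    rw [h]
    exact ⟨by rintro (⟨q, hq, he⟩ | ⟨q, hq, he⟩) <;> cases he; exact hq, fun hp => Or.inl ⟨p, hp, rfl⟩⟩

theorem isSummand_inr : IsSummand (X.inr X') where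
  smooth := ContMDiff.inr
  emb := IsOpenEmbedding.inr
  inv p := ⟨Sum.elim (fun _ => p) id, ContMDiff.sumElim contMDiff_const contMDiff_id, fun _ => rfl⟩
  boundary p := by
    have h : (X.sum X').boundarySet = (Sum.inl '' X.boundarySet ∪ Sum.inr '' X'.boundarySet :
      Set (X ⊕ X')) := ModelWithCorners.boundary_disjointUnion
    rw [h]
    exact ⟨by rintro (⟨q, hq, he⟩ | ⟨q, hq, he⟩) <;> cases he; exact hq, fun hp => Or.inr ⟨p, hp, rfl⟩⟩

theorem Collar.mem_base {c : Collar X Y} {p : X} : p ∈ c.base ↔ ∃ y, c.φ (0, y) = p :=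
  ⟨by rintro ⟨⟨s, y⟩, ⟨rfl, -⟩, rfl⟩; exact ⟨y, rfl⟩, fun ⟨y, hy⟩ => ⟨(0, y), ⟨rfl, trivial⟩, hy⟩⟩

theorem Collar.mem_target_iff (c : Collar X Y) {p : X} :
    p ∈ c.φ.target ∧ p ∈ X.boundarySet ↔ ∃ y, c.φ (0, y) = p := by
  rw [← mem_inter_iff, c.boundary_eq]
  exact mem_base

open Classical in
/-- A collar of a summand is a collar of the disjoint union. -/
def Collar.push (c : Collar X Y) {k : X → Z} (hk : IsSummand k) (j : Z → Y) : Collar Z Y where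
  ε := c.ε
  ε_pos := c.ε_pos
  φ :=
    { toFun := fun q => k (c.φ q)
      invFun := fun z => if h : ∃ p, k p = z then c.φ.symm h.choose else (0, j z)
      source := c.φ.source
      target := k '' c.φ.target
      map_source' := fun q hq => ⟨_, c.φ.map_source hq, rfl⟩
      map_target' := by
        rintro _ ⟨p, hp, rfl⟩
        have h : ∃ p', k p' = k p := ⟨p, rfl⟩
        rw [dif_pos h, hk.emb.injective h.choose_spec]
        exact c.φ.map_target hp
      left_inv' := by
        intro q hq
        have h : ∃ p', k p' = k (c.φ q) := ⟨_, rfl⟩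
        rw [dif_pos h, hk.emb.injective h.choose_spec]
        exact c.φ.left_inv hq
      right_inv' := by
        rintro _ ⟨p, hp, rfl⟩
        have h : ∃ p', k p' = k p := ⟨p, rfl⟩
        rw [dif_pos h, hk.emb.injective h.choose_spec, c.φ.right_inv hp] }
  source_eq := c.source_eq
  open_target := hk.emb.isOpenMap _ c.open_target
  smooth := hk.smooth.comp_contMDiffOn c.smooth
  smooth_symm := by
    rintro _ ⟨p, hp, rfl⟩
    obtain ⟨r, hr, hr'⟩ := hk.inv p
    have h1 : ContMDiffAt 𝓑 𝓒 ∞ (fun z => c.φ.symm (r z)) (k p) := by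
      refine ContMDiffAt.comp (k p) (g := c.φ.symm) (f := r) ?_ hr.contMDiffAt
      rw [hr']
      exact c.smooth_symm.contMDiffAt (c.open_target.mem_nhds hp)
    refine (h1.congr_of_eventuallyEq ?_).contMDiffWithinAt
    filter_upwards [hk.emb.isOpen_range.mem_nhds ⟨p, rfl⟩]
    rintro _ ⟨p', rfl⟩
    have h : ∃ p'', k p'' = k p' := ⟨p', rfl⟩
    change (if h : ∃ p'', k p'' = k p' then c.φ.symm h.choose else (0, j (k p'))) = _
    rw [dif_pos h, hk.emb.injective h.choose_spec, hr']
  boundary_eq := by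
    ext z
    constructor
    · rintro ⟨⟨p, hp, rfl⟩, hb⟩
      obtain ⟨y, rfl⟩ := c.mem_target_iff.1 ⟨hp, (hk.boundary p).1 hb⟩
      exact ⟨(0, y), ⟨rfl, trivial⟩, rfl⟩
    · rintro ⟨⟨s, y⟩, ⟨rfl, -⟩, rfl⟩
      have := c.mem_target_iff.2 ⟨y, rfl⟩
      exact ⟨⟨_, this.1, rfl⟩, (hk.boundary _).2 this.2⟩

theorem Collar.exists_forall_mem (c : Collar X Y) {U : Set X} (hU : IsOpen U) (hc : c.base ⊆ U) :
    ∃ r > 0, ∀ s ∈ Ico 0 c.ε, s < r → ∀ y, c.φ (s, y) ∈ U := by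
  obtain ⟨O, hO, hOU⟩ := continuousOn_iff'.1 c.smooth.continuousOn U hU
  have hsub : ({0} : Set ℝ) ×ˢ (univ : Set Y) ⊆ O := by
    rintro ⟨s, y⟩ ⟨rfl, -⟩
    have : ((0 : ℝ), y) ∈ c.φ ⁻¹' U ∩ c.φ.source :=
      ⟨hc (Collar.mem_base.2 ⟨y, rfl⟩), c.mem_source ⟨le_rfl, c.ε_pos⟩ y⟩
    rw [hOU] at this
    exact this.1
  obtain ⟨A, B, hA, -, h0, hB, hAB⟩ := generalized_tube_lemma isCompact_singleton isCompact_univ hO hsub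
  obtain ⟨r, hr, hrA⟩ := Metric.isOpen_iff.1 hA 0 (h0 rfl)
  refine ⟨r, hr, fun s hs hsr y => ?_⟩
  have : (s, y) ∈ O ∩ c.φ.source := by
    refine ⟨hAB ⟨hrA ?_, hB trivial⟩, c.mem_source hs y⟩
    rw [Metric.mem_ball, Real.dist_eq, sub_zero, abs_of_nonneg hs.1]
    exact hsr
  rw [← hOU] at this
  exact this.1

theorem Collar.isCompact_base (c : Collar X Y) : IsCompact c.base := by
  have : c.base = range fun y => c.φ (0, y) := by
    ext p
    exact Collar.mem_base
  rw [this]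
  exact isCompact_range c.continuous_zero

theorem Collar.exists_disjoint {Y' : ClosedManifold.{u} m} (c : Collar X Y) (c' : Collar X Y')
    (h : Disjoint c.base c'.base) : ∃ r > 0, ∀ s ∈ Ico 0 c.ε, ∀ s' ∈ Ico 0 c'.ε, s < r → s' < r →
      ∀ y y', c.φ (s, y) ≠ c'.φ (s', y') := by
  obtain ⟨U, V, hU, hV, hcU, hcV, hUV⟩ :=
    SeparatedNhds.of_isCompact_isCompact c.isCompact_base c'.isCompact_base h
  obtain ⟨r, hr, hr'⟩ := c.exists_forall_mem hU hcU
  obtain ⟨t, ht, ht'⟩ := c'.exists_forall_mem hV hcV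
  refine ⟨min r t, lt_min hr ht, fun s hs s' hs' hsr hsr' y y' he => ?_⟩
  have h1 := hr' s hs (hsr.trans_le (min_le_left _ _)) y
  have h2 := ht' s' hs' (hsr'.trans_le (min_le_right _ _)) y'
  exact hUV.le_bot (show c.φ (s, y) ∈ U ∩ V from ⟨h1, he ▸ h2⟩)

end Summand

/-! ### The global space -/

section GlobalSpace

variable {X : Option Bool → CompactManifoldWithBoundary.{u} m} {Y : Bool → ClosedManifold.{u} m}
  {cp : ∀ e, Collar (X (some e)) (Y e)} {cm : ∀ e, Collar (X none) (Y e)}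

/-- The embeddings `ι` of the pieces and coordinates `Φ` near the common boundary parts exhibit
`Xt` as the space glued from the pieces. -/
structure IsGluedSpace (cp : ∀ e, Collar (X (some e)) (Y e)) (cm : ∀ e, Collar (X none) (Y e))
    {Xt : ClosedManifold.{u} (m + 1)} (ι : ∀ i, X i → Xt) (δ : ℝ)
    (Φ : ∀ e, PartialDiffeomorph 𝓒 𝓢 (ℝ × Y e) Xt ∞) : Prop where
  emb : ∀ i, IsPieceEmbedding (ι i)
  cover : ∀ q, ∃ i p, ι i p = q
  disj_interior : ∀ i i' p p', p ∈ (X i).interiorSet → ι i p = ι i' p' → i = i'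
  inter : ∀ e p p', ι (some e) p = ι none p' → p ∈ (cp e).base
  disj : ∀ p p', ι (some true) p ≠ ι (some false) p'
  pos : 0 < δ
  le : ∀ e, δ ≤ (cp e).ε ^ 2
  le' : ∀ e, δ ≤ (cm e).ε ^ 2
  source : ∀ e, (Φ e).source = Ioo (-δ) δ ×ˢ univ
  coord : ∀ e (s : ℝ), 0 ≤ s → s ^ 2 < δ → ∀ y, Φ e (s ^ 2, y) = ι (some e) ((cp e).φ (s, y)) ∧
    Φ e (-s ^ 2, y) = ι none ((cm e).φ (s, y))

theorem exists_isGluedSpace (hcp : ∀ e, (X (some e)).boundarySet = (cp e).base)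
    (hcm : (X none).boundarySet = (cm true).base ∪ (cm false).base)
    (hdisj : Disjoint (cm true).base (cm false).base) :
    ∃ (Xt : ClosedManifold.{u} (m + 1)) (ι : ∀ i, X i → Xt) (δ : ℝ)
      (Φ : ∀ e, PartialDiffeomorph 𝓒 𝓢 (ℝ × Y e) Xt ∞),
      IsGluedSpace cp cm ι δ Φ := by
  let Z := (X none).sum ((X (some true)).sum (X (some false)))
  let k : ∀ i, X i → Z := fun i => match i with
    | none => (X none).inl _
    | some true => (X none).inr _ ∘ (X (some true)).inl _
    | some false => (X none).inr _ ∘ (X (some true)).inr _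
  have hk : ∀ i, IsSummand (k i) := by
    rintro (_ | _ | _)
    · exact isSummand_inl
    · exact isSummand_inr.comp isSummand_inr
    · exact isSummand_inr.comp isSummand_inl
  have hk1 : ∀ i i' p p', k i p = k i' p' → i = i' := by
    rintro (_ | _ | _) (_ | _ | _) p p' h <;> first | rfl | (exfalso; cases h)
  have hk2 : ∀ z : Z, ∃ i p, k i p = z := by
    rintro (p | p | p)
    · exact ⟨none, p, rfl⟩
    · exact ⟨some true, p, rfl⟩
    · exact ⟨some false, p, rfl⟩
  have j0 : ∀ e, Z → Y e := fun e => Sum.elim (fun p => ((cm e).φ.symm p).2)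
    (Sum.elim (fun p => ((cm e).φ.symm ((cm true).φ (0, ((cp true).φ.symm p).2))).2)
      (fun p => ((cm e).φ.symm ((cm false).φ (0, ((cp false).φ.symm p).2))).2))
  let c : ∀ e, Bool → Collar Z (Y e) := fun e b => match b with
    | true => (cp e).push (hk (some e)) (j0 e)
    | false => (cm e).push (hk none) (j0 e)
  let pc : Bool → Bool → Option Bool := fun e b => if b then some e else none
  have hrange : ∀ e b q, ∃ p, (c e b).φ q = k (pc e b) p := by
    rintro e (_ | _) q
    · exact ⟨(cm e).φ q, rfl⟩
    · exact ⟨(cp e).φ q, rfl⟩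
  obtain ⟨r, hr, hr'⟩ := (cm true).exists_disjoint (cm false) hdisj
  obtain ⟨δ, hδ, hδr, hδp, hδm⟩ : ∃ δ : ℝ, 0 < δ ∧ δ ≤ r ^ 2 ∧ (∀ e, δ ≤ (cp e).ε ^ 2) ∧
      ∀ e, δ ≤ (cm e).ε ^ 2 := by
    refine ⟨min (r ^ 2) (min (min ((cp true).ε ^ 2) ((cp false).ε ^ 2))
      (min ((cm true).ε ^ 2) ((cm false).ε ^ 2))), ?_, min_le_left _ _, ?_, ?_⟩
    · have h1 := (cp true).ε_pos
      have h2 := (cp false).ε_pos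
      have h3 := (cm true).ε_pos
      have h4 := (cm false).ε_pos
      positivity
    · rintro (_ | _)
      · exact (min_le_right _ _).trans ((min_le_left _ _).trans (min_le_right _ _))
      · exact (min_le_right _ _).trans ((min_le_left _ _).trans (min_le_left _ _))
    · rintro (_ | _)
      · exact (min_le_right _ _).trans ((min_le_right _ _).trans (min_le_right _ _))
      · exact (min_le_right _ _).trans ((min_le_right _ _).trans (min_le_left _ _))
  have hlt : ∀ s : ℝ, 0 ≤ s → s ^ 2 < δ → s < r ∧ ∀ e, s ∈ Ico 0 (cm e).ε := fun s hs hsδ =>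
    ⟨lt_of_pow_lt_pow_left₀ 2 hr.le (hsδ.trans_le hδr), fun e =>
      ⟨hs, lt_of_pow_lt_pow_left₀ 2 (cm e).ε_pos.le (hsδ.trans_le (hδm e))⟩⟩
  have H : IsGluable c δ := by
    refine ⟨hδ, ?_, ?_, ?_⟩
    · rintro e (_ | _)
      · exact hδm e
      · exact hδp e
    · intro z hz
      obtain ⟨i, p, rfl⟩ := hk2 z
      rw [(hk i).boundary] at hz
      rcases i with _ | e
      · rw [hcm] at hz
        rcases hz with hz | hz
        · obtain ⟨y, rfl⟩ := Collar.mem_base.1 hz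
          exact ⟨true, false, y, rfl⟩
        · obtain ⟨y, rfl⟩ := Collar.mem_base.1 hz
          exact ⟨false, false, y, rfl⟩
      · rw [hcp] at hz
        obtain ⟨y, rfl⟩ := Collar.mem_base.1 hz
        exact ⟨e, true, y, rfl⟩
    · intro e b e' b' s s' y y' hs hsδ hs' hsδ' he
      have hpc : pc e b = pc e' b' := by
        obtain ⟨p, hp⟩ := hrange e b (s, y)
        obtain ⟨p', hp'⟩ := hrange e' b' (s', y')
        exact hk1 _ _ p p' (by rw [← hp, ← hp', he])
      have h1 := hlt s hs hsδ
      have h2 := hlt s' hs' hsδ'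
      cases b <;> cases b'
      · refine ⟨?_, rfl⟩
        have he' := (hk none).emb.injective he
        cases e <;> cases e'
        · rfl
        · exact absurd he'.symm (hr' _ (h2.2 _) _ (h1.2 _) h2.1 h1.1 _ _)
        · exact absurd he' (hr' _ (h1.2 _) _ (h2.2 _) h1.1 h2.1 _ _)
        · rfl
      · exact absurd hpc (by simp [pc])
      · exact absurd hpc (by simp [pc])
      · exact ⟨by simpa [pc] using hpc, rfl⟩
  obtain ⟨Xt, ι, hcont, hsurj, heq, hloc, hΦ⟩ := H.exists_glued
  choose Φ hΦ1 hΦ2 using hΦ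
  have hinj : ∀ i, Injective fun p => ι (k i p) := by
    intro i p p' h
    rcases (heq _ _).1 h with h | ⟨e, b, b', y, h1, h2⟩
    · exact (hk i).emb.injective h
    · obtain ⟨q, hq⟩ := hrange e b (0, y)
      obtain ⟨q', hq'⟩ := hrange e b' (0, y)
      have e1 : pc e b = i := hk1 _ _ q p (hq.symm.trans h1)
      have e2 : pc e b' = i := hk1 _ _ q' p' (hq'.symm.trans h2)
      have e3 : b = b' := by
        rw [← e2] at e1
        cases b <;> cases b' <;> first | rfl | simp [pc] at e1
      subst e3
      exact (hk i).emb.injective (h1.symm.trans h2)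
  refine ⟨Xt, fun i p => ι (k i p), δ, Φ, ⟨fun i => ⟨?_, ?_⟩, ?_, ?_, ?_, ?_, hδ, hδp, hδm, hΦ1, ?_⟩⟩
  · exact ((hcont.comp (hk i).smooth.continuous).isClosedEmbedding (hinj i)).isEmbedding
  · intro p hp
    exact ((hk i).isLocalDiffeomorphAt p).comp 𝓢 Xt (hloc _ (((hk i).interior p).2 hp))
  · intro q
    obtain ⟨z, rfl⟩ := hsurj q
    obtain ⟨i, p, rfl⟩ := hk2 z
    exact ⟨i, p, rfl⟩
  · intro i i' p p' hp h
    rcases (heq _ _).1 h with h | ⟨e, b, b', y, h1, h2⟩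
    · exact hk1 _ _ _ _ h
    · have h3 := (c e b).zero_mem_boundary y
      rw [h1, (hk i).boundary] at h3
      exact absurd h3 (mem_interiorSet_iff.1 hp)
  · intro e p p' h
    rw [← hcp]
    rcases (heq _ _).1 h with h | ⟨e', b, b', y, h1, h2⟩
    · exact absurd (hk1 (some e) none p p' h) (by simp)
    · have h3 := (c e' b).zero_mem_boundary y
      rwa [h1, (hk _).boundary] at h3
  · intro p p' h
    rcases (heq _ _).1 h with h | ⟨e', b, b', y, h1, h2⟩
    · exact absurd (hk1 (some true) (some false) p p' h) (by simp)
    · obtain ⟨q, hq⟩ := hrange e' b (0, y)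
      obtain ⟨q', hq'⟩ := hrange e' b' (0, y)
      have e1 : pc e' b = some true := hk1 _ _ q p (hq.symm.trans h1)
      have e2 : pc e' b' = some false := hk1 _ _ q' p' (hq'.symm.trans h2)
      revert e1 e2
      cases b <;> cases b' <;> simp +contextual [pc]
  · intro e s hs hsδ y
    exact hΦ2 e s hs hsδ y

theorem IsGluedSpace.isGlobalSpace {Xt : ClosedManifold.{u} (m + 1)} {ι : ∀ i, X i → Xt} {δ : ℝ}
    {Φ : ∀ e, PartialDiffeomorph 𝓒 𝓢 (ℝ × Y e) Xt ∞}
    (H : IsGluedSpace cp cm ι δ Φ) :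
    IsGlobalSpace (cp true) (cm true) (cm false) (cp false) (ι (some true)) (ι none)
      (ι (some false)) := by
  have hinter : ∀ e, range (ι (some e)) ∩ range (ι none) = ι (some e) '' (cp e).base := by
    intro e
    ext q
    constructor
    · rintro ⟨⟨p, rfl⟩, ⟨p', hp'⟩⟩
      exact ⟨p, H.inter e p p' hp'.symm, rfl⟩
    · rintro ⟨p, hp, rfl⟩
      obtain ⟨y, rfl⟩ := Collar.mem_base.1 hp
      have h := H.coord e 0 le_rfl (by rw [zero_pow two_ne_zero]; exact H.pos) y
      refine ⟨⟨_, rfl⟩, (cm e).φ (0, y), ?_⟩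
      rw [← h.1, ← h.2]
      simp
  refine ⟨H.emb _, H.emb _, H.emb _, ?_, hinter true, hinter false, ?_,
    ⟨δ, H.pos, H.le _, H.le' _, Φ true, H.source true, H.coord true⟩,
    ⟨δ, H.pos, H.le _, H.le' _, Φ false, H.source false, H.coord false⟩⟩
  · rw [eq_univ_iff_forall]
    intro q
    obtain ⟨_ | _ | _, p, rfl⟩ := H.cover q
    · exact Or.inl (Or.inr ⟨p, rfl⟩)
    · exact Or.inr ⟨p, rfl⟩
    · exact Or.inl (Or.inl ⟨p, rfl⟩)
  · rw [Set.disjoint_left]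
    rintro _ ⟨p, rfl⟩ ⟨p', hp'⟩
    exact H.disj p p' hp'.symm

end GlobalSpace

section GlobalOperator

theorem IsPosDefForm.nondeg {V : Type*} [AddCommGroup V] [Module ℝ V] [TopologicalSpace V]
    {b : V →L[ℝ] V →L[ℝ] ℝ} (hb : IsPosDefForm b) {v : V} (hv : ∀ w, b v w = 0) : v = 0 := by
  by_contra h
  exact (hb.2 v h).ne' (hv v)

theorem IsLorentzForm.nondeg {V : Type*} [AddCommGroup V] [Module ℝ V] [TopologicalSpace V]
    {b : V →L[ℝ] V →L[ℝ] ℝ} (hb : IsLorentzForm b) {v : V} (hv : ∀ w, b v w = 0) : v = 0 := by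
  obtain ⟨hs, t, -, ht'⟩ := hb
  by_contra h
  exact (ht' v (by rw [hs]; exact hv t) h).ne (hv v)

namespace IsConformallyCompact

variable {X : CompactManifoldWithBoundary.{u} m}
  {Sig : ∀ p : X, (TangentSpace (𝓡∂ (m + 1)) p →L[ℝ] TangentSpace (𝓡∂ (m + 1)) p →L[ℝ] ℝ) → Prop}
  {g : BilinField X} {x : X → ℝ}

theorem pos (H : IsConformallyCompact Sig g x) {p : X} (hp : p ∈ X.interiorSet) : 0 < x p := by
  refine (H.1.nonneg p).lt_of_ne fun h => ?_
  exact mem_interiorSet_iff.1 hp ((H.1.zero_iff p).1 h.symm)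

theorem smoothInterior (H : IsConformallyCompact Sig g x) : g.SmoothInterior := by
  obtain ⟨ghat, hs, -, hg, -⟩ := H.2
  intro p hp
  rw [contMDiffWithinAt_bilinAlong_iff]
  refine ⟨contMDiffWithinAt_id, fun v w => ?_⟩
  have hs' : ContMDiffWithinAt 𝓑 ((𝓑).prod 𝓘(ℝ, 𝔼 →L[ℝ] 𝔼 →L[ℝ] ℝ)) ∞
      (bilinAlong 𝓑 id ghat) X.interiorSet p := (hs p).contMDiffWithinAt
  have h1 := (contMDiffWithinAt_bilinAlong_iff.1 hs').2 v w
  have h2 : ContMDiffWithinAt 𝓑 𝓘(ℝ, ℝ) ∞ (fun q => ((x q) ^ 2)⁻¹) X.interiorSet p := by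
    have h3 : ContDiffAt ℝ ∞ (fun t : ℝ => (t ^ 2)⁻¹) (x p) :=
      (contDiffAt_id.pow 2).inv (pow_ne_zero 2 (H.pos hp).ne')
    exact (h3.contMDiffAt.comp p (H.1.smooth p)).contMDiffWithinAt
  refine (h2.mul h1).congr (fun q hq => ?_) ?_
  · simp only [id_eq]
    rw [hg q hq]
    rfl
  · simp only [id_eq]
    rw [hg p hp]
    rfl

theorem nondegInterior (H : IsConformallyCompact Sig g x)
    (hSig : ∀ p b, Sig p b → ∀ v, (∀ w, b v w = 0) → v = 0) : g.NondegInterior := by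
  obtain ⟨ghat, -, hS, hg, -⟩ := H.2
  intro p hp v hv
  refine hSig p _ (hS p) v fun w => ?_
  have := hv w
  rw [hg p hp] at this
  rcases mul_eq_zero.1 (show ((x p) ^ 2)⁻¹ * ghat p v w = 0 from this) with h | h
  · exact absurd h (inv_ne_zero (pow_ne_zero 2 (H.pos hp).ne'))
  · exact h

theorem symm (H : IsConformallyCompact Sig g x)
    (hSig : ∀ p b, Sig p b → ∀ v w, b v w = b w v) {p : X} (hp : p ∈ X.interiorSet)
    (v w : TangentSpace 𝓑 p) : g p v w = g p w v := by
  obtain ⟨ghat, -, hS, hg, -⟩ := H.2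
  rw [hg p hp]
  exact congrArg _ (hSig p _ (hS p) v w)

theorem isMetricPiece (H : IsConformallyCompact Sig g x)
    (hSig : ∀ p b, Sig p b → (∀ v w, b v w = b w v) ∧ ∀ v, (∀ w, b v w = 0) → v = 0)
    {Xt : ClosedManifold.{u} (m + 1)} {ι : X → Xt} {r : Xt → X} (hι : IsPieceEmbedding ι)
    (hr : ∀ p, r (ι p) = p) {s : ℝ} (hs : s * s = 1) : IsMetricPiece ι r g x s where
  emb := hι
  left_inv := hr
  sign := hs
  smooth := H.smoothInterior
  nondeg := H.nondegInterior fun p b h => (hSig p b h).2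
  symm _ hp := H.symm (fun p b h => (hSig p b h).1) hp
  smooth_x := H.1.smooth.contMDiffOn
  pos _ hp := H.pos hp

end IsConformallyCompact

variable {X : Option Bool → CompactManifoldWithBoundary.{u} m} {Y : Bool → ClosedManifold.{u} m}
  {cp : ∀ e, Collar (X (some e)) (Y e)} {cm : ∀ e, Collar (X none) (Y e)}
  {g : ∀ i, BilinField (X i)} {x : ∀ i, X i → ℝ}

theorem hasGlobalOperator_family
    (hp : ∀ e, IsConformallyCompact (fun _ b => IsPosDefForm b) (g (some e)) (x (some e)))
    (hm : IsConformallyCompact (fun _ b => IsLorentzForm b) (g none) (x none))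
    (hcp : ∀ e, (X (some e)).boundarySet = (cp e).base)
    (hcm : (X none).boundarySet = (cm true).base ∪ (cm false).base)
    (hdisj : Disjoint (cm true).base (cm false).base)
    (hmatch : ∀ e, ∃ δ h, IsMatchedEnd (cp e) (cm e) (g (some e)) (x (some e)) (g none) (x none) δ h) :
    HasGlobalOperator (cp true) (g (some true)) (x (some true)) (cm true) (cm false) (g none) (x none)
      (cp false) (g (some false)) (x (some false)) := by
  obtain ⟨Xt, ι, δ, Φ, H⟩ := exists_isGluedSpace hcp hcm hdisj
  refine ⟨Xt, _, _, _, H.isGlobalSpace, fun σ => ?_⟩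
  have htr : ∀ i i', X i → Nonempty (X i') := by
    have h0 : ∀ i, X i → Nonempty (X none) := by
      rintro (_ | e) p
      · exact ⟨p⟩
      · exact ⟨(cm e).φ (0, ((cp e).φ.symm p).2)⟩
    rintro i (_ | e) p
    · exact h0 i p
    · obtain ⟨q⟩ := h0 i p
      exact ⟨(cp e).φ (0, ((cm e).φ.symm q).2)⟩
  have hr : ∀ i, ∃ r : Xt → X i, ∀ p, r (ι i p) = p := by
    intro i
    rcases isEmpty_or_nonempty Xt with hE | ⟨⟨q⟩⟩
    · exact ⟨fun q => hE.elim q, fun p => hE.elim (ι i p)⟩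
    · obtain ⟨i', p', -⟩ := H.cover q
      have := htr i' i p'
      exact ⟨Function.invFun (ι i), Function.leftInverse_invFun (H.emb i).embedding.injective⟩
  choose r hr using hr
  let s : Option Bool → ℝ := fun i => i.elim (-1) fun _ => 1
  set α : ℂ := (-(Complex.I * σ) + (m : ℂ) / 2) / 2 with hα
  set Λ : ℂ := σ ^ 2 + ((m : ℂ) / 2) ^ 2 with hΛdef
  have h2α : 2 * α = -(Complex.I * σ) + (m : ℂ) / 2 := by rw [hα]; ring
  have hΛ : Λ = 4 * α * (m / 2 - α) := by
    rw [hα, hΛdef]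
    linear_combination (σ ^ 2) * Complex.I_sq
  have hpc : ∀ i, IsMetricPiece (ι i) (r i) (g i) (x i) (s i) := by
    rintro (_ | e)
    · exact hm.isMetricPiece (fun p b h => ⟨h.1, fun v => h.nondeg⟩) (H.emb _) (hr _) (by simp [s])
    · exact (hp e).isMetricPiece (fun p b h => ⟨h.1, fun v => h.nondeg⟩) (H.emb _) (hr _)
        (by simp [s])
  have h00 : (0 : ℝ) ^ 2 < δ := by rw [zero_pow two_ne_zero]; exact H.pos
  have hbd : ∀ e y i, Φ e (0, y) ∉ ι i '' (X i).interiorSet := by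
    rintro e y i ⟨p, hpi, hpe⟩
    have h1 := H.coord e 0 le_rfl h00 y
    simp only [zero_pow two_ne_zero, neg_zero] at h1
    have e1 : i = some e := H.disj_interior _ _ p _ hpi (hpe.trans h1.1)
    have e2 : i = none := H.disj_interior _ _ p _ hpi (hpe.trans h1.2)
    exact absurd (e1.symm.trans e2) (by simp)
  obtain ⟨P, hP, hPk⟩ := exists_global_operator hpc
    (fun i i' p p' hpi _ he => H.disj_interior i i' p p' hpi he) (by
    intro q hq
    obtain ⟨i, p, rfl⟩ := H.cover q
    have hpb : p ∈ (X i).boundarySet := by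
      by_contra h
      exact hq i ⟨p, mem_interiorSet_iff.2 h, rfl⟩
    have hex : ∃ e y, Φ e (0, y) = ι i p := by
      rcases i with _ | e
      · rw [hcm] at hpb
        obtain ⟨e, he⟩ : ∃ e, p ∈ (cm e).base := by
          rcases hpb with h | h
          · exact ⟨_, h⟩
          · exact ⟨_, h⟩
        obtain ⟨y, rfl⟩ := Collar.mem_base.1 he
        exact ⟨e, y, by simpa using (H.coord e 0 le_rfl h00 y).2⟩
      · rw [hcp] at hpb
        obtain ⟨y, rfl⟩ := Collar.mem_base.1 hpb
        exact ⟨e, y, by simpa using (H.coord e 0 le_rfl h00 y).1⟩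
    obtain ⟨e, y, hy⟩ := hex
    obtain ⟨δ₁, h, hM⟩ := hmatch e
    have hmin : 0 < min δ δ₁ := lt_min H.pos hM.pos
    refine ⟨some e, none, Y e, cp e, cm e, min δ δ₁, h, Φ e, rfl, rfl,
      hM.mono hmin (min_le_right _ _), ?_, ?_, hbd e, y, hy⟩
    · rw [H.source]
      exact prod_mono (Ioo_subset_Ioo (neg_le_neg (min_le_left _ _)) (min_le_left _ _)) subset_rfl
    · exact fun t ht htδ y => H.coord e t ht (htδ.trans_le (min_le_left _ _)) y) hΛ
  have hexp : Complex.I * σ - (m : ℂ) / 2 - 2 = -2 * α - 2 := by linear_combination (-1) * h2α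
  refine ⟨P, hP, ?_, ?_, ?_⟩
  · intro v p hp
    rw [hPk (some true) v p hp, pieceOp, conjugated, specHyp, hexp, ← h2α, ← hΛdef]
    simp only [s, Option.elim]
    push_cast
    ring
  · intro v p hp
    rw [hPk none v p hp, pieceOp, conjugated, specDS, hexp, ← h2α]
    simp only [s, Option.elim]
    push_cast
    ring
  · intro v p hp
    rw [hPk (some false) v p hp, pieceOp, conjugated, specHyp, hexp, ← h2α, ← hΛdef]
    simp only [s, Option.elim]
    push_cast
    ring

theorem hasGlobalOperator_of_matched {XP X0 XM : CompactManifoldWithBoundary.{u} m}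
    {YP YM : ClosedManifold.{u} m} {cP : Collar XP YP} {gP : BilinField XP} {xP : XP → ℝ}
    {c0P : Collar X0 YP} {c0M : Collar X0 YM} {g0 : BilinField X0} {x0 : X0 → ℝ}
    {cM : Collar XM YM} {gM : BilinField XM} {xM : XM → ℝ}
    (hP : IsConformallyCompact (fun _ b => IsPosDefForm b) gP xP) (hbP : XP.boundarySet = cP.base)
    (h0 : IsConformallyCompact (fun _ b => IsLorentzForm b) g0 x0)
    (hb0 : X0.boundarySet = c0P.base ∪ c0M.base) (hdisj : Disjoint c0P.base c0M.base)
    (hM : IsConformallyCompact (fun _ b => IsPosDefForm b) gM xM) (hbM : XM.boundarySet = cM.base)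
    {δP δM : ℝ} {fP : BilinFamily YP} {fM : BilinFamily YM}
    (HP : IsMatchedEnd cP c0P gP xP g0 x0 δP fP) (HM : IsMatchedEnd cM c0M gM xM g0 x0 δM fM) :
    HasGlobalOperator cP gP xP c0P c0M g0 x0 cM gM xM :=
  hasGlobalOperator_family
    (X := fun i => match i with | none => X0 | some true => XP | some false => XM)
    (Y := fun e => match e with | true => YP | false => YM)
    (cp := fun e => match e with | true => cP | false => cM)
    (cm := fun e => match e with | true => c0P | false => c0M)
    (g := fun i => match i with | none => g0 | some true => gP | some false => gM)
    (x := fun i => match i with | none => x0 | some true => xP | some false => xM)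
    (fun e => match e with | true => hP | false => hM) h0
    (fun e => match e with | true => hbP | false => hbM) hb0 hdisj
    (fun e => match e with | true => ⟨δP, fP, HP⟩ | false => ⟨δM, fM, HM⟩)

end GlobalOperator

/-! ### Product metrics near the boundary -/

section ProductForm

variable {Y : ClosedManifold.{u} m}

/-- The form `dr² + b` on the tangent space of `ℝ × Y`. -/
def prodForm (q : ℝ × Y) (b : TangentSpace (𝓡 m) q.2 →L[ℝ] TangentSpace (𝓡 m) q.2 →L[ℝ] ℝ) :
    TangentSpace 𝓒 q →L[ℝ] TangentSpace 𝓒 q →L[ℝ] ℝ :=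
  diffSq 𝓒 Prod.fst q + bilinPull b (mfderiv 𝓒 (𝓡 m) Prod.snd q)

theorem prodForm_apply (q : ℝ × Y) (b : TangentSpace (𝓡 m) q.2 →L[ℝ] TangentSpace (𝓡 m) q.2 →L[ℝ] ℝ)
    (v w : TangentSpace 𝓒 q) :
    prodForm q b v w = v.1 * w.1 + b v.2 w.2 := by
  have h1 : ∀ v, diffAt 𝓒 (Prod.fst : ℝ × Y → ℝ) q v = v.1 := fun v => by
    rw [diffAt, mfderiv_fst]
    rfl
  change diffSq 𝓒 Prod.fst q v w + bilinPull b (mfderiv 𝓒 (𝓡 m) Prod.snd q) v w = _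
  rw [diffSq_apply, h1, h1, bilinPull_apply, mfderiv_snd]
  rfl

section Add

variable {E : Type*} [NormedAddCommGroup E] [NormedSpace ℝ E] [FiniteDimensional ℝ E]
  {H : Type*} [TopologicalSpace H] {I : ModelWithCorners ℝ E H}
  {M : Type*} [TopologicalSpace M] [ChartedSpace H M] [IsManifold I ∞ M]
  {E' : Type*} [NormedAddCommGroup E'] [NormedSpace ℝ E']
  {H' : Type*} [TopologicalSpace H'] {J : ModelWithCorners ℝ E' H'}
  {N : Type*} [TopologicalSpace N] [ChartedSpace H' N] [IsManifold J ∞ N]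

theorem ContMDiffWithinAt.bilinAlong_add {f : N → M}
    {b b' : ∀ q : N, TangentSpace I (f q) →L[ℝ] TangentSpace I (f q) →L[ℝ] ℝ} {s : Set N} {q₀ : N}
    (hb : ContMDiffWithinAt J (I.prod 𝓘(ℝ, E →L[ℝ] E →L[ℝ] ℝ)) ∞ (bilinAlong I f b) s q₀)
    (hb' : ContMDiffWithinAt J (I.prod 𝓘(ℝ, E →L[ℝ] E →L[ℝ] ℝ)) ∞ (bilinAlong I f b') s q₀) :
    ContMDiffWithinAt J (I.prod 𝓘(ℝ, E →L[ℝ] E →L[ℝ] ℝ)) ∞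
      (bilinAlong I f fun q => b q + b' q) s q₀ := by
  rw [contMDiffWithinAt_bilinAlong_iff] at hb hb' ⊢
  exact ⟨hb.1, fun v w => (hb.2 v w).add (hb'.2 v w)⟩

theorem ContMDiffWithinAt.bilinAlong_smul {f : N → M}
    {b : ∀ q : N, TangentSpace I (f q) →L[ℝ] TangentSpace I (f q) →L[ℝ] ℝ} {s : Set N} {q₀ : N}
    {a : N → ℝ} (ha : ContMDiffWithinAt J 𝓘(ℝ, ℝ) ∞ a s q₀)
    (hb : ContMDiffWithinAt J (I.prod 𝓘(ℝ, E →L[ℝ] E →L[ℝ] ℝ)) ∞ (bilinAlong I f b) s q₀) :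
    ContMDiffWithinAt J (I.prod 𝓘(ℝ, E →L[ℝ] E →L[ℝ] ℝ)) ∞
      (bilinAlong I f fun q => a q • b q) s q₀ := by
  rw [contMDiffWithinAt_bilinAlong_iff] at hb ⊢
  exact ⟨hb.1, fun v w => ha.mul (hb.2 v w)⟩

end Add

theorem contMDiffAt_prodForm {h : BilinFamily Y} {S : Set ℝ} (hS : IsOpen S)
    (hh : h.SmoothOnSet S) {q : ℝ × Y} (hq : q.1 ∈ S) :
    ContMDiffAt 𝓒 ((𝓒).prod 𝓘(ℝ, (ℝ × Eucl m) →L[ℝ] (ℝ × Eucl m) →L[ℝ] ℝ)) ∞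
      (bilinAlong 𝓒 id fun q : ℝ × Y => prodForm q (h q.1 q.2)) q := by
  have h1 : ContMDiffAt 𝓒 ((𝓒).prod 𝓘(ℝ, (ℝ × Eucl m) →L[ℝ] (ℝ × Eucl m) →L[ℝ] ℝ)) ∞
      (bilinAlong 𝓒 id (diffSq 𝓒 (Prod.fst : ℝ × Y → ℝ))) q :=
    contMDiffAt_diffSq isOpen_univ contMDiffOn_fst trivial
  have h2 := contMDiffAt_bilinPull (J := 𝓒) (I := 𝓡 m) (N := ℝ × Y)
    (F := fun q : ℝ × Y => q.2) isOpen_univ contMDiffOn_snd (q₀ := q) trivial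
    (hh.contMDiffAt ((hS.prod isOpen_univ).mem_nhds ⟨hq, trivial⟩))
  rw [← contMDiffWithinAt_univ] at h1 h2 ⊢
  exact h1.bilinAlong_add h2

theorem isPosDefForm_prodForm {q : ℝ × Y}
    {b : TangentSpace (𝓡 m) q.2 →L[ℝ] TangentSpace (𝓡 m) q.2 →L[ℝ] ℝ} (hb : IsPosDefForm b) :
    IsPosDefForm (prodForm q b) := by
  refine ⟨fun v w => ?_, fun v hv => ?_⟩
  · rw [prodForm_apply, prodForm_apply]
    exact congrArg₂ (· + ·) (mul_comm _ _) (hb.1 _ _)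
  · rw [prodForm_apply]
    by_cases h2 : v.2 = 0
    · have h1 : v.1 ≠ 0 := fun h1 => hv (Prod.ext h1 h2)
      have : b v.2 v.2 = 0 := by rw [h2]; exact map_zero _
      rw [this, add_zero]
      exact mul_self_pos.2 h1
    · exact add_pos_of_nonneg_of_pos (mul_self_nonneg _) (hb.2 _ h2)

end ProductForm

section CollarForm

variable {X : CompactManifoldWithBoundary.{u} m} {Y : ClosedManifold.{u} m} (c : Collar X Y)

/-- The inverse of the differential of `c.φ.symm`. -/
def Collar.deriv (q : ℝ × Y) : TangentSpace 𝓒 q →L[ℝ] TangentSpace 𝓑 (c.φ q) :=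
  mfderivWithin 𝓒 𝓑 c.φ c.φ.source q

theorem Collar.uniqueMDiffOn_source : UniqueMDiffOn 𝓒 c.φ.source := by
  rw [c.source_eq]
  refine UniqueMDiffOn.prod ?_ uniqueMDiffOn_univ
  rw [uniqueMDiffOn_iff_uniqueDiffOn]
  exact uniqueDiffOn_Ico 0 c.ε

theorem Collar.hasMFDerivAt_symm {p : X} (hp : p ∈ c.φ.target) : HasMFDerivAt 𝓑 𝓒 c.φ.symm p
      (mfderiv 𝓑 𝓒 c.φ.symm p) :=
  ((c.smooth_symm.contMDiffAt (c.open_target.mem_nhds hp)).mdifferentiableAt (by simp)).hasMFDerivAt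

theorem Collar.hasMFDerivWithinAt {q : ℝ × Y} (hq : q ∈ c.φ.source) :
    HasMFDerivWithinAt 𝓒 𝓑 c.φ c.φ.source q (c.deriv q) :=
  ((c.smooth q hq).mdifferentiableWithinAt (by simp)).hasMFDerivWithinAt

theorem Collar.mfderiv_symm_deriv {q : ℝ × Y} (hq : q ∈ c.φ.source) (v : TangentSpace 𝓒 q) :
    (mfderiv 𝓑 𝓒 c.φ.symm (c.φ q) (c.deriv q v) : ℝ × Eucl m) = v := by
  have h1 := (c.hasMFDerivAt_symm (c.φ.map_source hq)).comp_hasMFDerivWithinAt q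
    (c.hasMFDerivWithinAt hq)
  have h2 : HasMFDerivWithinAt 𝓒 𝓒 (c.φ.symm ∘ c.φ)
      c.φ.source q (ContinuousLinearMap.id ℝ (TangentSpace 𝓒 q)) := by
    refine ((hasMFDerivAt_id q).hasMFDerivWithinAt (s := c.φ.source)).congr_of_eventuallyEq ?_
      (c.φ.left_inv hq)
    filter_upwards [self_mem_nhdsWithin] with q' hq' using c.φ.left_inv hq'
  exact congrArg (fun L : ℝ × Eucl m →L[ℝ] ℝ × Eucl m => L v)
    ((c.uniqueMDiffOn_source q hq).eq h1 h2)

theorem Collar.deriv_mfderiv_symm {q : ℝ × Y} (hq : q ∈ c.φ.source) (w : TangentSpace 𝓑 (c.φ q)) :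
    (c.deriv q (mfderiv 𝓑 𝓒 c.φ.symm (c.φ q) w : ℝ × Eucl m) : 𝔼) = w := by
  have hp := c.φ.map_source hq
  have h0 := c.hasMFDerivWithinAt hq
  have h1 : HasMFDerivAt 𝓑 𝓑 (c.φ ∘ c.φ.symm) (c.φ q) ((c.deriv q : ℝ × Eucl m →L[ℝ] 𝔼).comp
        (mfderiv 𝓑 𝓒 c.φ.symm (c.φ q))) := by
    rw [← c.φ.left_inv hq] at h0
    have h2 := HasMFDerivWithinAt.comp (c.φ q) h0
      ((c.hasMFDerivAt_symm hp).hasMFDerivWithinAt (s := c.φ.target)) fun p' hp' => c.φ.map_target hp'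
    have h3 := h2.hasMFDerivAt (c.open_target.mem_nhds hp)
    convert h3 using 1
    rw [c.φ.left_inv hq]
  have h2 : HasMFDerivAt 𝓑 𝓑 (c.φ ∘ c.φ.symm) (c.φ q)
      (ContinuousLinearMap.id ℝ (TangentSpace 𝓑 (c.φ q))) := by
    refine (hasMFDerivAt_id (c.φ q)).congr_of_eventuallyEq ?_
    filter_upwards [c.open_target.mem_nhds hp] with p' hp' using c.φ.right_inv hp'
  exact congrArg (fun L : 𝔼 →L[ℝ] 𝔼 => L w) (hasMFDerivAt_unique h1 h2)

theorem Collar.mfderiv_eq_deriv {s : ℝ} (hs : s ∈ Ioo 0 c.ε) (y : Y) :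
    mfderiv 𝓒 𝓑 c.φ (s, y) = c.deriv (s, y) := by
  refine (mfderivWithin_of_mem_nhds ?_).symm
  rw [c.source_eq]
  exact prod_mem_nhds (Ico_mem_nhds hs.1 hs.2) univ_mem

end CollarForm

/-! ### Even asymptotically hyperbolic metrics with prescribed ends -/

section EvenMetric

variable {X : CompactManifoldWithBoundary.{u} m} {Y : ClosedManifold.{u} m} (c : Collar X Y)

/-- The form `dr² + h(r²)` in a collar. -/
def Collar.form (h : BilinFamily Y) : BilinField X := fun p =>
  bilinPull (prodForm (c.φ.symm p) (h ((c.φ.symm p).1 ^ 2) (c.φ.symm p).2)) (mfderiv 𝓑 𝓒 c.φ.symm p)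

theorem Collar.form_deriv (h : BilinFamily Y) {q : ℝ × Y} (hq : q ∈ c.φ.source)
    (v w : TangentSpace 𝓒 q) :
    c.form h (c.φ q) (c.deriv q v) (c.deriv q w) = v.1 * w.1 + h (q.1 ^ 2) q.2 v.2 w.2 := by
  have h1 : c.form h (c.φ q) (c.deriv q v) (c.deriv q w) =
      prodForm (c.φ.symm (c.φ q)) (h ((c.φ.symm (c.φ q)).1 ^ 2) (c.φ.symm (c.φ q)).2)
        (v : ℝ × Eucl m) (w : ℝ × Eucl m) :=
    congrArg₂ (fun v w : ℝ × Eucl m => (prodForm (c.φ.symm (c.φ q))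
      (h ((c.φ.symm (c.φ q)).1 ^ 2) (c.φ.symm (c.φ q)).2) v w : ℝ))
      (c.mfderiv_symm_deriv hq v) (c.mfderiv_symm_deriv hq w)
  rw [h1, c.φ.left_inv hq]
  exact prodForm_apply q _ v w

theorem BilinFamily.SmoothOnSet.comp_sq {h : BilinFamily Y} {δ : ℝ} (hh : h.SmoothOnSet (Ioo (-δ) δ)) :
    BilinFamily.SmoothOnSet (fun r => h (r ^ 2)) {r | r ^ 2 < δ} := by
  have h1 : ContMDiffOn 𝓒 𝓒 ∞ (fun q : ℝ × Y => (q.1 ^ 2, q.2)) ({r | r ^ 2 < δ} ×ˢ univ) := by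
    refine ContMDiffOn.prodMk ?_ contMDiffOn_snd
    exact ((contDiff_id.pow 2 : ContDiff ℝ ∞ fun t : ℝ => t ^ 2).contMDiff.comp
      contMDiff_fst).contMDiffOn
  refine ContMDiffOn.comp hh h1 ?_
  rintro ⟨r, y⟩ ⟨hr, -⟩
  refine ⟨⟨?_, hr⟩, trivial⟩
  have : r ^ 2 < δ := hr
  nlinarith [sq_nonneg r]

theorem Collar.contMDiffAt_form {h : BilinFamily Y} {δ : ℝ} (hh : h.SmoothOnSet (Ioo (-δ) δ)) {p : X}
    (hp : p ∈ c.φ.target) (hpδ : (c.φ.symm p).1 ^ 2 < δ) :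
    ContMDiffAt 𝓑 ((𝓑).prod 𝓘(ℝ, 𝔼 →L[ℝ] 𝔼 →L[ℝ] ℝ)) ∞ (bilinAlong 𝓑 id (c.form h)) p := by
  have hopen : IsOpen {r : ℝ | r ^ 2 < δ} := isOpen_lt (by fun_prop) continuous_const
  have h1 := contMDiffAt_prodForm hopen hh.comp_sq (q := c.φ.symm p) hpδ
  have h2 := h1.comp p (c.smooth_symm.contMDiffAt (c.open_target.mem_nhds hp))
  exact contMDiffAt_bilinPull c.open_target c.smooth_symm hp h2

theorem Collar.isPosDefForm_form {h : BilinFamily Y} {p : X} (hp : p ∈ c.φ.target)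
    (hpos : IsPosDefForm (h ((c.φ.symm p).1 ^ 2) (c.φ.symm p).2)) : IsPosDefForm (c.form h p) := by
  have h1 := isPosDefForm_prodForm (q := c.φ.symm p) hpos
  refine ⟨fun v w => h1.1 _ _, fun v hv => h1.2 _ fun h0 => hv ?_⟩
  have h2 := c.deriv_mfderiv_symm (c.φ.map_target hp)
  rw [c.φ.right_inv hp] at h2
  have h3 := h2 v
  rw [show (mfderiv 𝓑 𝓒 c.φ.symm p v : ℝ × Eucl m) = 0 from h0] at h3
  exact h3.symm.trans (map_zero _)

theorem Collar.isClosed_image {r : ℝ} (hr : r < c.ε) : IsClosed (c.φ '' (Icc 0 r ×ˢ univ)) := by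
  refine ((isCompact_Icc.prod isCompact_univ).image_of_continuousOn (c.smooth.continuousOn.mono ?_)).isClosed
  rintro ⟨s, y⟩ ⟨hs, -⟩
  exact c.mem_source ⟨hs.1, hs.2.trans_lt hr⟩ y

theorem Collar.symm_mem (p : X) (hp : p ∈ c.φ.target) : (c.φ.symm p).1 ∈ Ico 0 c.ε := by
  have hm := c.φ.map_target hp
  rw [c.source_eq] at hm
  exact hm.1

/-- A boundary defining function that is the first coordinate near the boundary. -/
theorem Collar.exists_boundaryFun {r : ℝ} (hrε : r < c.ε) :
    ∃ x : X → ℝ, ContMDiff 𝓑 𝓘(ℝ, ℝ) ∞ x ∧ (∀ s ∈ Icc 0 r, ∀ y, x (c.φ (s, y)) = s) ∧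
      ∀ p, p ∉ c.base → 0 < x p := by
  set K := c.φ '' (Icc 0 r ×ˢ univ)
  have hKt : K ⊆ c.φ.target := by
    rintro _ ⟨⟨s, y⟩, ⟨hs, -⟩, rfl⟩
    exact c.φ.map_source (c.mem_source ⟨hs.1, hs.2.trans_lt hrε⟩ y)
  obtain ⟨x, hx⟩ := exists_contMDiffMap_forall_mem_convex_of_local (n := ⊤) 𝓑 (M := X)
    (t := fun p => {a : ℝ | (p ∈ K → a = (c.φ.symm p).1) ∧ (p ∉ c.base → 0 < a)}) (by
      intro p a ha b hb s t hs ht hst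
      refine ⟨fun hp => ?_, fun hp => ?_⟩
      · rw [ha.1 hp, hb.1 hp, ← add_smul, hst, one_smul]
      · have h1 := ha.2 hp
        have h2 := hb.2 hp
        simp only [smul_eq_mul]
        rcases hs.eq_or_lt with rfl | hs
        · have : t = 1 := by linarith
          simpa [this] using h2
        · have := mul_nonneg ht h2.le
          have := mul_pos hs h1
          linarith) (by
      intro p
      by_cases hp : p ∈ c.φ.target
      · refine ⟨c.φ.target, c.open_target.mem_nhds hp, fun p => (c.φ.symm p).1,
          contMDiff_fst.comp_contMDiffOn c.smooth_symm, fun p' hp' => ⟨fun _ => rfl, fun hb => ?_⟩⟩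
        refine (c.symm_mem p' hp').1.lt_of_ne fun h0 => hb (Collar.mem_base.2 ⟨(c.φ.symm p').2, ?_⟩)
        rw [h0, Prod.mk.eta, c.φ.right_inv hp']
      · refine ⟨Kᶜ, (c.isClosed_image hrε).isOpen_compl.mem_nhds fun h => hp (hKt h), fun _ => 1,
          contMDiffOn_const, fun p' hp' => ⟨fun h => absurd h hp', fun _ => one_pos⟩⟩)
  refine ⟨x, x.contMDiff, fun s hs y => ?_, fun p hp => (hx p).2 hp⟩
  rw [(hx _).1 ⟨(s, y), ⟨hs, trivial⟩, rfl⟩, c.φ.left_inv (c.mem_source ⟨hs.1, hs.2.trans_lt hrε⟩ y)]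

/-- Every point has a neighbourhood with a Riemannian metric. -/
theorem exists_local_metric (p : X) : ∃ U ∈ 𝓝 p, ∃ b : BilinField X,
    ContMDiffOn 𝓑 ((𝓑).prod 𝓘(ℝ, 𝔼 →L[ℝ] 𝔼 →L[ℝ] ℝ)) ∞
      (bilinAlong 𝓑 id b) U ∧ ∀ q ∈ U, IsPosDefForm (b q) := by
  set U := (chartAt (EuclideanHalfSpace (m + 1)) p).source
  have hU : IsOpen U := (chartAt (EuclideanHalfSpace (m + 1)) p).open_source
  set F : X → 𝔼 := fun q => extChartAt 𝓑 p q
  have hF : ContMDiffOn 𝓑 𝓘(ℝ, 𝔼) ∞ F U := contMDiffOn_extChartAt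
  obtain ⟨B, hB⟩ : ∃ B : 𝔼 →L[ℝ] 𝔼 →L[ℝ] ℝ, IsPosDefForm B :=
    ⟨innerSL ℝ, fun v w => by
      rw [innerSL_apply_apply, innerSL_apply_apply, real_inner_comm], fun v hv => real_inner_self_pos.2 hv⟩
  have hFb : ∀ q ∈ U, ContMDiffAt 𝓑 (𝓘(ℝ, 𝔼).prod 𝓘(ℝ, 𝔼 →L[ℝ] 𝔼 →L[ℝ] ℝ)) ∞
      (bilinAlong 𝓘(ℝ, 𝔼) F fun q => ofModelForm (F q) B) q := by
    intro q hq
    rw [← contMDiffWithinAt_univ, contMDiffWithinAt_bilinAlong_iff]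
    refine ⟨(hF.contMDiffAt (hU.mem_nhds hq)).contMDiffWithinAt, fun v w => ?_⟩
    have h0 : ∀ a b v : 𝔼, (tangentFrame 𝓘(ℝ, 𝔼) a b v : 𝔼) = v := by
      intro a b v
      simp only [tangentFrame, TangentBundle.symmL_model_space]
      rfl
    refine (contMDiffWithinAt_const (c := B v w)).congr (fun q' _ => ?_) ?_
    · exact congrArg₂ (fun v w => B v w) (h0 _ _ v) (h0 _ _ w)
    · exact congrArg₂ (fun v w => B v w) (h0 _ _ v) (h0 _ _ w)
  refine ⟨U, hU.mem_nhds (mem_chart_source _ p), fun q => bilinPull (ofModelForm (F q) B)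
    (mfderiv 𝓑 𝓘(ℝ, 𝔼) F q), fun q hq =>
      (contMDiffAt_bilinPull hU hF hq (hFb q hq)).contMDiffWithinAt, fun q hq => ?_⟩
  refine ⟨fun v w => hB.1 _ _, fun v hv => hB.2 _ fun h0 => hv ?_⟩
  have hinj : Injective (mfderiv 𝓑 𝓘(ℝ, 𝔼) F q) :=
    (isInvertible_mfderiv_extChartAt (I := 𝓑) (by rwa [extChartAt_source])).injective
  exact hinj (h0.trans (map_zero _).symm)

end EvenMetric

section EvenMetric

variable {X : CompactManifoldWithBoundary.{u} m} {Y : ClosedManifold.{u} m}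

theorem IsPosDefForm.convex {V : Type*} [AddCommGroup V] [Module ℝ V] [TopologicalSpace V]
    [IsTopologicalAddGroup V] [ContinuousSMul ℝ V]
    {b b' : V →L[ℝ] V →L[ℝ] ℝ} (hb : IsPosDefForm b) (hb' : IsPosDefForm b') {s t : ℝ} (hs : 0 ≤ s)
    (ht : 0 ≤ t) (hst : s + t = 1) : IsPosDefForm (s • b + t • b') := by
  refine ⟨fun v w => ?_, fun v hv => ?_⟩
  · change s * b v w + t * b' v w = s * b w v + t * b' w v
    rw [hb.1, hb'.1]
  · change 0 < s * b v v + t * b' v v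
    have h1 := hb.2 v hv
    have h2 := hb'.2 v hv
    rcases hs.eq_or_lt with rfl | hs
    · have : t = 1 := by linarith
      simpa [this] using h2
    · have := mul_nonneg ht h2.le
      have := mul_pos hs h1
      linarith

set_option synthInstance.maxHeartbeats 400000 in
theorem Collar.exists_metric (c : Collar X Y) {h : BilinFamily Y} {δ : ℝ}
    (hh : h.SmoothOnSet (Ioo (-δ) δ)) (hpos : ∀ t ∈ Ioo (-δ) δ, ∀ y, IsPosDefForm (h t y)) {r : ℝ}
    (hrε : r < c.ε) (hrδ : r ^ 2 < δ) :
    ∃ b : BilinField X, b.Smooth ∧ (∀ p, IsPosDefForm (b p)) ∧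
      ∀ s ∈ Icc 0 r, ∀ y, b (c.φ (s, y)) = c.form h (c.φ (s, y)) := by
  set K := c.φ '' (Icc 0 r ×ˢ univ) with hK
  have hδ : 0 < δ := (sq_nonneg r).trans_lt hrδ
  obtain ⟨b, hb⟩ := exists_contMDiffSection_forall_mem_convex_of_local (n := ⊤) 𝓑 (M := X)
    (F_fiber := 𝔼 →L[ℝ] 𝔼 →L[ℝ] ℝ)
    (fun p : X => TangentSpace 𝓑 p →L[ℝ] TangentSpace 𝓑 p →L[ℝ] ℝ)
    (fun p => {b | IsPosDefForm b ∧ (p ∈ K → b = c.form h p)}) (by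
      intro p b hb b' hb' s t hs ht hst
      refine ⟨hb.1.convex hb'.1 hs ht hst, fun hp => ?_⟩
      rw [hb.2 hp, hb'.2 hp]
      refine ContinuousLinearMap.ext fun v => ContinuousLinearMap.ext fun w => ?_
      change s * c.form h p v w + t * c.form h p v w = c.form h p v w
      rw [← add_mul, hst, one_mul]) (by
      intro p
      by_cases hp : p ∈ K
      · set W := c.φ.target ∩ (fun p => (c.φ.symm p).1 ^ 2) ⁻¹' (Iio δ)
        have hW : IsOpen W := ((continuous_fst.comp_continuousOn
          c.smooth_symm.continuousOn).pow 2).isOpen_inter_preimage c.open_target isOpen_Iio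
        have hpW : p ∈ W := by
          obtain ⟨⟨s, y⟩, ⟨hs, -⟩, rfl⟩ := hp
          have hm := c.mem_source ⟨hs.1, hs.2.trans_lt hrε⟩ y
          refine ⟨c.φ.map_source hm, ?_⟩
          rw [mem_preimage, c.φ.left_inv hm]
          exact (pow_le_pow_left₀ hs.1 hs.2 2).trans_lt hrδ
        refine ⟨W, hW.mem_nhds hpW, c.form h, fun q hq =>
          (c.contMDiffAt_form hh hq.1 hq.2).contMDiffWithinAt, fun q hq => ⟨?_, fun _ => rfl⟩⟩
        refine c.isPosDefForm_form hq.1 (hpos _ ⟨?_, hq.2⟩ _)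
        exact (neg_lt_zero.2 hδ).trans_le (sq_nonneg _)
      · obtain ⟨U, hU, b, hb, hb'⟩ := exists_local_metric p
        exact ⟨U ∩ Kᶜ, inter_mem hU ((c.isClosed_image hrε).isOpen_compl.mem_nhds hp), b,
          hb.mono inter_subset_left, fun q hq => ⟨hb' q hq.1, fun h => absurd h hq.2⟩⟩)
  exact ⟨b, b.contMDiff, fun p => (hb p).1, fun s hs y => (hb _).2 ⟨(s, y), ⟨hs, trivial⟩, rfl⟩⟩

theorem Collar.mfderiv_boundaryFun (c : Collar X Y) {x : X → ℝ}
    (hxs : ContMDiff 𝓑 𝓘(ℝ, ℝ) ∞ x) {r : ℝ} (hr : 0 < r)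
    (hx : ∀ s ∈ Ico 0 r, ∀ y, x (c.φ (s, y)) = s) (y : Y)
    (v : TangentSpace 𝓒 ((0 : ℝ), y)) :
    (mfderiv 𝓑 𝓘(ℝ, ℝ) x (c.φ (0, y)) (c.deriv (0, y) v) : ℝ) = v.1 := by
  have hq := c.mem_source ⟨le_rfl, c.ε_pos⟩ y
  have h1 := ((hxs (c.φ (0, y))).mdifferentiableAt (by simp)).hasMFDerivAt.comp_hasMFDerivWithinAt
    ((0 : ℝ), y) (c.hasMFDerivWithinAt hq)
  have h2 : HasMFDerivWithinAt 𝓒 𝓘(ℝ, ℝ) (x ∘ c.φ)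
      c.φ.source ((0 : ℝ), y) (mfderiv 𝓒 𝓘(ℝ, ℝ) (Prod.fst : ℝ × Y → ℝ) (0, y)) := by
    refine (mdifferentiableAt_fst.hasMFDerivAt.hasMFDerivWithinAt
      (s := c.φ.source)).congr_of_eventuallyEq ?_ (hx 0 ⟨le_rfl, hr⟩ y)
    have h3 : ∀ᶠ q : ℝ × Y in 𝓝[c.φ.source] (0, y), q.1 < r :=
      mem_nhdsWithin_of_mem_nhds (continuousAt_fst.eventually (gt_mem_nhds hr))
    filter_upwards [self_mem_nhdsWithin, h3] with q hq hqr
    rw [c.source_eq] at hq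
    exact hx q.1 ⟨hq.1.1, hqr⟩ q.2
  have h3 := congrArg (fun L : ℝ × Eucl m →L[ℝ] ℝ => L v) ((c.uniqueMDiffOn_source _ hq).eq h1 h2)
  refine h3.trans ?_
  rw [mfderiv_fst]
  rfl

theorem Collar.exists_evenAsymptoticallyHyperbolic (c : Collar X Y) (hb : X.boundarySet = c.base)
    {h : BilinFamily Y} {δ : ℝ} (hδ : 0 < δ) (hh : h.SmoothOnSet (Ioo (-δ) δ))
    (hpos : ∀ t ∈ Ioo (-δ) δ, ∀ y, IsPosDefForm (h t y)) :
    ∃ (g : BilinField X) (x : X → ℝ), IsEvenAsymptoticallyHyperbolic c g x ∧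
      ∃ δ' > 0, δ' ≤ δ ∧ δ' ≤ c.ε ^ 2 ∧ IsEndForm 1 δ' c g x h := by
  obtain ⟨r, hr, hrε, hrδ⟩ : ∃ r > 0, r < c.ε ∧ r ^ 2 < δ := by
    refine ⟨min (c.ε / 2) (√δ / 2), by have := c.ε_pos; positivity,
      (min_le_left _ _).trans_lt (half_lt_self c.ε_pos), ?_⟩
    have h1 : 0 < √δ := Real.sqrt_pos.2 hδ
    calc (min (c.ε / 2) (√δ / 2)) ^ 2 ≤ (√δ / 2) ^ 2 :=
          pow_le_pow_left₀ (by have := c.ε_pos; positivity) (min_le_right _ _) 2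
      _ = δ / 4 := by rw [div_pow, Real.sq_sqrt hδ.le]; norm_num
      _ < δ := by linarith
  obtain ⟨x, hxs, hx, hxpos⟩ := c.exists_boundaryFun hrε
  obtain ⟨b, hbs, hbpos, hbK⟩ := c.exists_metric hh hpos hrε hrδ
  have hx' : ∀ s ∈ Ico 0 r, ∀ y, x (c.φ (s, y)) = s := fun s hs => hx s (Ico_subset_Icc_self hs)
  set g : BilinField X := fun p => ((x p) ^ 2)⁻¹ • b p with hg
  have hform : ∀ s ∈ Ioc 0 r, ∀ (y : Y) (a a' : ℝ) (v v' : TangentSpace (𝓡 m) y),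
      g (c.φ (s, y)) (mfderiv 𝓒 𝓑 c.φ (s, y) (a, v)) (mfderiv 𝓒 𝓑 c.φ (s, y) (a', v')) =
      (a * a' + 1 * h (s ^ 2) y v v') / s ^ 2 := by
    intro s hs y a a' v v'
    have hsI := Ioc_subset_Icc_self hs
    rw [c.mfderiv_eq_deriv ⟨hs.1, hs.2.trans_lt hrε⟩ y]
    change ((x (c.φ (s, y))) ^ 2)⁻¹ * b (c.φ (s, y)) _ _ = _
    rw [hx s hsI, hbK s hsI, one_mul, div_eq_inv_mul]
    exact congrArg _ (c.form_deriv h (c.mem_source ⟨hsI.1, hsI.2.trans_lt hrε⟩ y) (a, v) (a', v'))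
  have hzero : ∀ p ∈ X.boundarySet, ∃ y, c.φ (0, y) = p := fun p hp =>
    Collar.mem_base.1 (hb ▸ hp)
  refine ⟨g, x, ⟨⟨⟨hxs, fun p => ?_, fun p => ⟨fun hp => ?_, fun hp => ?_⟩, fun p hp hd => ?_⟩,
    b, hbs, hbpos, fun p _ => rfl, fun p hp => ?_⟩, hb, ?_⟩, r ^ 2, pow_pos hr 2, hrδ.le,
    pow_le_pow_left₀ hr.le hrε.le 2, fun s hs hsr y => ?_⟩
  · by_cases hp : p ∈ c.base
    · obtain ⟨y, rfl⟩ := Collar.mem_base.1 hp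
      exact (hx 0 ⟨le_rfl, hr.le⟩ y).ge
    · exact (hxpos p hp).le
  · by_contra h0
    rw [hb] at h0
    exact (hxpos p h0).ne' hp
  · obtain ⟨y, rfl⟩ := hzero p hp
    exact hx 0 ⟨le_rfl, hr.le⟩ y
  · obtain ⟨y, rfl⟩ := hzero p hp
    have h1 := c.mfderiv_boundaryFun hxs hr hx' y (1, 0)
    rw [hd] at h1
    exact zero_ne_one (α := ℝ) h1
  · obtain ⟨y, rfl⟩ := hzero p hp
    have hm := c.mem_source ⟨le_rfl, c.ε_pos⟩ y
    have h1 := c.mfderiv_boundaryFun hxs hr hx' y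
    have hbv : ∀ w : TangentSpace 𝓒 ((0 : ℝ), y),
        b (c.φ (0, y)) (c.deriv (0, y) ((1, 0) : ℝ × Eucl m)) (c.deriv (0, y) w) = w.1 := by
      intro w
      rw [hbK 0 ⟨le_rfl, hr.le⟩]
      refine (c.form_deriv h hm ((1, 0) : ℝ × Eucl m) w).trans ?_
      have h0 : h ((0 : ℝ) ^ 2) y (0 : Eucl m) w.2 = 0 :=
        congrArg (fun L : Eucl m →L[ℝ] ℝ => L w.2) (map_zero (h ((0 : ℝ) ^ 2) y))
      exact (congrArg₂ (· + ·) (one_mul _) h0).trans (add_zero _)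
    refine ⟨c.deriv (0, y) ((1, 0) : ℝ × Eucl m), fun w => ?_, hbv _⟩
    rw [← c.deriv_mfderiv_symm hm w]
    exact (hbv _).trans (h1 _).symm
  · refine ⟨r, hr, hrε.le, hx', h, hh.mono ?_, fun t ht y => hpos t ⟨?_, ht.2.trans hrδ⟩ y,
      fun s hs y a a' v v' => hform s ⟨hs.1, hs.2.le⟩ y a a' v v'⟩
    · rintro ⟨t, y⟩ ⟨ht, -⟩
      exact ⟨⟨(neg_lt_zero.2 hδ).trans_le ht.1, ht.2.trans hrδ⟩, trivial⟩
    · exact (neg_lt_zero.2 hδ).trans_le ht.1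
  · have hsr' : s ≤ r := (lt_of_pow_lt_pow_left₀ 2 hr.le hsr).le
    refine ⟨hx s ⟨hs.le, hsr'⟩ y, fun a a' v v' => ?_⟩
    rw [hform s ⟨hs, hsr'⟩ y, one_mul (s ^ 2)]

end EvenMetric

section Matching

variable {X : CompactManifoldWithBoundary.{u} m} {Y : ClosedManifold.{u} m}

/-- Near the boundary the metric is `(dx² + τ h(τ x², y, dy)) / x²`, where `h` is a family of
metrics on `Y` that is also defined for negative parameters. -/
def IsEvenEnd (τ : ℝ) (c : Collar X Y) (g : BilinField X) (x : X → ℝ) : Prop :=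
  ∃ δ > 0, δ ≤ c.ε ^ 2 ∧ ∃ h : BilinFamily Y, h.SmoothOnSet (Ioo (-δ) δ) ∧
    (∀ t ∈ Ioo (-δ) δ, ∀ y, IsPosDefForm (h t y)) ∧ IsEndForm τ δ c g x h

theorem IsEvenNear.isEvenEnd {τ : ℝ} (hτ : τ * τ = 1) {c : Collar X Y} {g : BilinField X}
    {x : X → ℝ} (H : IsEvenNear τ c g x) : IsEvenEnd τ c g x := by
  obtain ⟨δ, hδ, hδε, hx, h, hs, hpos, hg⟩ := H
  obtain ⟨δ', hδ', hle, h', hs', heq, hpos'⟩ := exists_family_extension (pow_pos hδ 2) hs hpos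
  have hmap : ∀ t ∈ Ioo (-δ') δ', τ * t ∈ Ioo (-δ') δ' := by
    intro t ht
    rw [mem_Ioo, ← abs_lt] at ht
    have h1 : |τ| = 1 := by
      have : |τ| * |τ| = 1 := by rw [← abs_mul, hτ, abs_one]
      nlinarith [abs_nonneg τ]
    rw [mem_Ioo, ← abs_lt, abs_mul, h1, one_mul]
    exact ht
  refine ⟨δ', hδ', hle.trans (pow_le_pow_left₀ hδ.le hδε 2), fun t => h' (τ * t), ?_,
    fun t ht => hpos' _ (hmap t ht), fun s hs0 hsδ y => ?_⟩
  · have h1 : ContMDiff 𝓒 𝓒 ∞ (fun q : ℝ × Y => (τ * q.1, q.2)) := by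
      refine ContMDiff.prodMk ?_ contMDiff_snd
      exact (contDiff_const.mul contDiff_id : ContDiff ℝ ∞ fun t : ℝ => τ * t).contMDiff.comp
        contMDiff_fst
    exact ContMDiffOn.comp hs' h1.contMDiffOn fun q hq => ⟨hmap _ hq.1, trivial⟩
  · have hsδ' : s < δ := lt_of_pow_lt_pow_left₀ 2 hδ.le (hsδ.trans_le hle)
    refine ⟨hx s ⟨hs0.le, hsδ'⟩ y, fun a a' v v' => ?_⟩
    have h1 : h' (τ * (τ * s ^ 2)) = h (s ^ 2) := by
      rw [← mul_assoc, hτ, one_mul]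
      exact heq _ ⟨sq_nonneg s, hsδ⟩
    have h2 := hg s ⟨hs0, hsδ'⟩ y a a' v v'
    rw [← h1] at h2
    exact h2

/-- Everything but the dynamical condition. -/
structure IsEvenLorentzian {YP YM : ClosedManifold.{u} m} (cP : Collar X YP) (cM : Collar X YM)
    (g : BilinField X) (x : X → ℝ) : Prop where
  conformallyCompact : IsConformallyCompact (fun _ b => IsLorentzForm b) g x
  boundary_eq : X.boundarySet = cP.base ∪ cM.base
  disjoint : Disjoint cP.base cM.base
  even_plus : IsEvenEnd (-1) cP g x
  even_minus : IsEvenEnd (-1) cM g x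

theorem IsEvenEnd.exists_matched {X' : CompactManifoldWithBoundary.{u} m} {c : Collar X Y}
    {g : BilinField X} {x : X → ℝ} (H : IsEvenEnd (-1) c g x) (c' : Collar X' Y)
    (hc' : X'.boundarySet = c'.base) : ∃ (g' : BilinField X') (x' : X' → ℝ),
      IsEvenAsymptoticallyHyperbolic c' g' x' ∧ ∃ δ h, IsMatchedEnd c' c g' x' g x δ h := by
  obtain ⟨δ, hδ, hδε, h, hs, hpos, hend⟩ := H
  obtain ⟨g', x', hg', δ', hδ', hle, hε, hend'⟩ :=
    c'.exists_evenAsymptoticallyHyperbolic hc' hδ hs hpos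
  exact ⟨g', x', hg', δ', h, hδ', hε, hle.trans hδε,
    hs.mono (prod_mono (Ioo_subset_Ioo (neg_le_neg hle) hle) subset_rfl),
    fun t ht => hpos t (Ioo_subset_Ioo (neg_le_neg hle) hle ht), hend',
    fun s h0 hsδ => hend s h0 (hsδ.trans_le hle)⟩

theorem IsEvenLorentzian.exists_hyperbolic {YP YM : ClosedManifold.{u} m} {c0P : Collar X YP}
    {c0M : Collar X YM} {g0 : BilinField X} {x0 : X → ℝ} (H : IsEvenLorentzian c0P c0M g0 x0)
    {XP XM : CompactManifoldWithBoundary.{u} m} (cP : Collar XP YP) (cM : Collar XM YM)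
    (hP : XP.boundarySet = cP.base) (hM : XM.boundarySet = cM.base) :
    ∃ (gP : BilinField XP) (xP : XP → ℝ) (gM : BilinField XM) (xM : XM → ℝ),
      IsEvenAsymptoticallyHyperbolic cP gP xP ∧ IsEvenAsymptoticallyHyperbolic cM gM xM ∧
      HasGlobalOperator cP gP xP c0P c0M g0 x0 cM gM xM := by
  obtain ⟨gP, xP, hgP, δP, fP, mP⟩ := H.even_plus.exists_matched cP hP
  obtain ⟨gM, xM, hgM, δM, fM, mM⟩ := H.even_minus.exists_matched cM hM
  exact ⟨gP, xP, gM, xM, hgP, hgM, hasGlobalOperator_of_matched hgP.conformallyCompact hP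
    H.conformallyCompact H.boundary_eq H.disjoint hgM.conformallyCompact hM mP mM⟩

theorem IsEvenAsymptoticallyDeSitter.isEvenLorentzian {YP YM : ClosedManifold.{u} m}
    {cP : Collar X YP} {cM : Collar X YM} {g : BilinField X} {x : X → ℝ}
    (H : IsEvenAsymptoticallyDeSitter cP cM g x) : IsEvenLorentzian cP cM g x :=
  ⟨H.conformallyCompact, H.boundary_eq, H.disjoint, H.even_plus.isEvenEnd (by norm_num),
    H.even_minus.isEvenEnd (by norm_num)⟩

end Matching

/-! ### Cylinders -/

section Cylinder

/-- `ℝ × ℝ^m` and `ℝ^{m+1}`. -/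
def consEquiv (m : ℕ) : (Eucl 1 × Eucl m) ≃L[ℝ] Eucl (m + 1) :=
  LinearEquiv.toContinuousLinearEquiv
    { toFun := fun a => WithLp.toLp 2 (Fin.cons (a.1 0) a.2 : Fin (m + 1) → ℝ)
      invFun := fun z => (WithLp.toLp 2 fun _ => z 0, WithLp.toLp 2 fun i => z i.succ)
      map_add' := fun a b => by
        ext i
        refine Fin.cases ?_ (fun j => ?_) i <;> simp
      map_smul' := fun a b => by
        ext i
        refine Fin.cases ?_ (fun j => ?_) i <;> simp
      left_inv := fun a => by
        refine Prod.ext ?_ ?_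
        · ext i
          rw [Subsingleton.elim i 0]
          simp
        · ext i
          simp
      right_inv := fun z => by
        ext i
        refine Fin.cases ?_ (fun j => ?_) i <;> simp }

theorem consEquiv_symm_zero (z : 𝔼) : ((consEquiv m).symm z).1 0 = z 0 := rfl

/-- `[0, ∞) × ℝ^m` and the half space. -/
def consHomeo (m : ℕ) : ModelProd (EuclideanHalfSpace 1) (Eucl m) ≃ₜ EuclideanHalfSpace (m + 1) where
  toFun a := ⟨consEquiv m (a.1.1, a.2), a.1.2⟩
  invFun z := (⟨((consEquiv m).symm z.1).1, z.2⟩, ((consEquiv m).symm z.1).2)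
  left_inv a := by
    refine Prod.ext (Subtype.ext ?_) ?_ <;> simp
  right_inv z := Subtype.ext ((consEquiv m).apply_symm_apply z.1)
  continuous_toFun := Continuous.subtype_mk ((consEquiv m).continuous.comp
    ((continuous_subtype_val.comp continuous_fst).prodMk continuous_snd)) _
  continuous_invFun := by
    have h := (consEquiv m).symm.continuous.comp
      (continuous_subtype_val : Continuous (Subtype.val : EuclideanHalfSpace (m + 1) → _))
    exact ((continuous_fst.comp h).subtype_mk _).prodMk (continuous_snd.comp h)

/-- The model of the product `[0, 1] × Y`. -/
abbrev cylModel (m : ℕ) : ModelWithCorners ℝ (Eucl 1 × Eucl m) (ModelProd (EuclideanHalfSpace 1) (Eucl m)) :=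
  (𝓡∂ 1).prod (𝓡 m)

theorem consEquiv_cylModel (a : ModelProd (EuclideanHalfSpace 1) (Eucl m)) :
    consEquiv m (cylModel m a) = 𝓑 (consHomeo m a) := rfl

theorem consHomeo_symm_model (z : 𝔼) :
    (consHomeo m).symm ((𝓑).symm z) = (cylModel m).symm ((consEquiv m).symm z) := by
  refine Prod.ext (Subtype.ext ?_) ?_
  · ext i
    rw [Subsingleton.elim i 0]
    change Function.update z 0 (max (z 0) 0) 0 =
      Function.update (((consEquiv m).symm z).1) 0 (max (((consEquiv m).symm z).1 0) 0) 0
    rw [Function.update_self, Function.update_self, consEquiv_symm_zero]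
  · ext i
    change Function.update z 0 (max (z 0) 0) i.succ = z i.succ
    rw [Function.update_of_ne (Fin.succ_ne_zero i)]

theorem mem_range_cylModel {z : 𝔼} (hz : z ∈ range 𝓑) :
    (consEquiv m).symm z ∈ range (cylModel m) := by
  obtain ⟨a, rfl⟩ := hz
  obtain ⟨b, rfl⟩ := (consHomeo m).surjective a
  rw [← consEquiv_cylModel, ContinuousLinearEquiv.symm_apply_apply]
  exact ⟨b, rfl⟩

variable (Y : ClosedManifold.{u} m)

/-- The chart of `[0, 1] × Y` that belongs to a chart of the product. -/
def cylChart (e : OpenPartialHomeomorph (Icc (0 : ℝ) 1 × Y) (ModelProd (EuclideanHalfSpace 1) (Eucl m))) :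
    OpenPartialHomeomorph (Icc (0 : ℝ) 1 × Y) (EuclideanHalfSpace (m + 1)) :=
  e.trans (consHomeo m).toOpenPartialHomeomorph

/-- The underlying space of `[0, 1] × Y`. -/
def CylinderSpace : Type u := Icc (0 : ℝ) 1 × Y

instance : TopologicalSpace (CylinderSpace Y) := inferInstanceAs (TopologicalSpace (Icc (0 : ℝ) 1 × Y))

instance : T2Space (CylinderSpace Y) := inferInstanceAs (T2Space (Icc (0 : ℝ) 1 × Y))

instance : CompactSpace (CylinderSpace Y) := inferInstanceAs (CompactSpace (Icc (0 : ℝ) 1 × Y))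

instance : ChartedSpace (EuclideanHalfSpace (m + 1)) (CylinderSpace Y) where
  atlas := cylChart Y '' atlas (ModelProd (EuclideanHalfSpace 1) (Eucl m)) (Icc (0 : ℝ) 1 × Y)
  chartAt p := cylChart Y (chartAt (ModelProd (EuclideanHalfSpace 1) (Eucl m)) (p : Icc (0 : ℝ) 1 × Y))
  mem_chart_source _ := ⟨mem_chart_source (ModelProd (EuclideanHalfSpace 1) (Eucl m)) _, trivial⟩
  chart_mem_atlas _ := mem_image_of_mem _ (chart_mem_atlas (ModelProd (EuclideanHalfSpace 1) (Eucl m)) _)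

instance : IsManifold 𝓑 ∞ (CylinderSpace Y) := by
  refine isManifold_of_contDiffOn _ _ _ ?_
  rintro _ _ ⟨e, he, rfl⟩ ⟨e', he', rfl⟩
  have h : ContDiffOn ℝ ∞ (cylModel m ∘ (e.symm ≫ₕ e') ∘ (cylModel m).symm)
      ((cylModel m).symm ⁻¹' (e.symm ≫ₕ e').source ∩ range (cylModel m)) :=
    (mem_groupoid_of_pregroupoid.1
      (HasGroupoid.compatible (G := contDiffGroupoid ∞ (cylModel m)) he he')).1
  refine ((consEquiv m).contDiff.comp_contDiffOn (h.comp (consEquiv m).symm.contDiff.contDiffOn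
    ?_)).congr ?_
  · rintro z ⟨hz, hz'⟩
    refine ⟨?_, mem_range_cylModel hz'⟩
    rw [mem_preimage, ← consHomeo_symm_model]
    exact ⟨hz.1.2, hz.2.1⟩
  · rintro z -
    change 𝓑 (consHomeo m (e' (e.symm ((consHomeo m).symm ((𝓑).symm z))))) = _
    rw [consHomeo_symm_model]
    rfl

/-- The product `[0, 1] × Y`. -/
def ClosedManifold.cylinder : CompactManifoldWithBoundary.{u} m where
  carrier := CylinderSpace Y

variable {Y}

/-- The identity of `[0, 1] × Y`. -/
def cylPair (p : Y.cylinder) : Icc (0 : ℝ) 1 × Y := p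

/-- The identity of `[0, 1] × Y`. -/
def cylMk (p : Icc (0 : ℝ) 1 × Y) : Y.cylinder := p

theorem contMDiff_cylPair : ContMDiff 𝓑 (cylModel m) ∞ (cylPair (Y := Y)) := by
  intro p
  rw [contMDiffAt_iff]
  refine ⟨continuous_id.continuousAt, ?_⟩
  refine (consEquiv m).symm.contDiff.contDiffWithinAt.congr_of_eventuallyEq_of_mem ?_
    (mem_range_self _)
  filter_upwards [extChartAt_target_mem_nhdsWithin (I := 𝓑) p] with z hz
  have h1 := (extChartAt 𝓑 p).right_inv hz
  rw [ContinuousLinearEquiv.eq_symm_apply]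
  exact h1

theorem contMDiff_cylMk : ContMDiff (cylModel m) 𝓑 ∞ (cylMk (Y := Y)) := by
  intro p
  rw [contMDiffAt_iff]
  refine ⟨continuous_id.continuousAt, ?_⟩
  refine (consEquiv m).contDiff.contDiffWithinAt.congr_of_eventuallyEq_of_mem ?_ (mem_range_self _)
  filter_upwards [extChartAt_target_mem_nhdsWithin (I := cylModel m) p] with z hz
  have h1 := (extChartAt (cylModel m) p).right_inv hz
  exact congrArg (consEquiv m) h1

/-- The first coordinate. -/
def cylR (p : Y.cylinder) : ℝ := (cylPair p).1

/-- The second coordinate. -/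
def cylY (p : Y.cylinder) : Y := (cylPair p).2

/-- The point with given coordinates. -/
def cylPt (q : ℝ × Y) : Y.cylinder := cylMk (projIcc 0 1 zero_le_one q.1, q.2)

theorem contMDiff_cylR : ContMDiff 𝓑 𝓘(ℝ, ℝ) ∞ (cylR (Y := Y)) :=
  contMDiff_subtypeVal_Icc.comp (contMDiff_fst.comp contMDiff_cylPair)

theorem contMDiff_cylY : ContMDiff 𝓑 (𝓡 m) ∞ (cylY (Y := Y)) :=
  contMDiff_snd.comp contMDiff_cylPair

theorem contMDiffOn_cylPt : ContMDiffOn 𝓒 𝓑 ∞ (cylPt (Y := Y)) (Icc 0 1 ×ˢ univ) :=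
  contMDiff_cylMk.comp_contMDiffOn ((contMDiffOn_projIcc.comp contMDiffOn_fst
    fun _ h => h.1).prodMk contMDiffOn_snd)

theorem cylR_mem (p : Y.cylinder) : cylR p ∈ Icc (0 : ℝ) 1 := (cylPair p).1.2

theorem cylR_cylPt {q : ℝ × Y} (hq : q.1 ∈ Icc (0 : ℝ) 1) : cylR (cylPt q) = q.1 :=
  congrArg Subtype.val (projIcc_of_mem zero_le_one hq)

theorem cylPt_eta (p : Y.cylinder) : cylPt (cylR p, cylY p) = p :=
  Prod.ext (projIcc_val zero_le_one (cylPair p).1) rfl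

theorem mem_interiorSet_cylinder {p : Y.cylinder} :
    p ∈ Y.cylinder.interiorSet ↔ cylR p ∈ Ioo (0 : ℝ) 1 := by
  change extChartAt 𝓑 p p ∈ interior (range 𝓑) ↔ _
  rw [interior_range_modelWithCornersEuclideanHalfSpace]
  change 0 < (chartAt (EuclideanHalfSpace 1) (cylPair p).1 (cylPair p).1).1 0 ↔ _
  have h := cylR_mem p
  by_cases h1 : cylR p < 1
  · rw [Icc_chartedSpaceChartAt_of_le_top h1, IccLeftChart_apply]
    change 0 < cylR p - 0 ↔ _
    rw [sub_zero]
    exact ⟨fun h0 => ⟨h0, h1⟩, fun h0 => h0.1⟩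
  · rw [Icc_chartedSpaceChartAt_of_top_le (not_lt.1 h1), IccRightChart_apply]
    change 0 < 1 - cylR p ↔ _
    exact ⟨fun h0 => absurd (sub_pos.1 h0) h1, fun h0 => absurd h0.2 h1⟩

theorem mem_boundarySet_cylinder {p : Y.cylinder} :
    p ∈ Y.cylinder.boundarySet ↔ cylR p = 0 ∨ cylR p = 1 := by
  have h : p ∈ Y.cylinder.boundarySet ↔ ¬ p ∈ Y.cylinder.interiorSet :=
    (𝓑).isBoundaryPoint_iff_not_isInteriorPoint p
  rw [h, mem_interiorSet_cylinder]
  have h2 := cylR_mem p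
  constructor
  · intro h3
    by_contra! h4
    exact h3 ⟨lt_of_le_of_ne h2.1 (Ne.symm h4.1), lt_of_le_of_ne h2.2 h4.2⟩
  · rintro (h3 | h3) h4
    · exact h4.1.ne' h3
    · exact h4.2.ne h3

end Cylinder

section CylinderCollar

variable {Y : ClosedManifold.{u} m}

/-- The identity, or the reflection of `[0, 1]`. -/
def flipIf (r : Bool) (t : ℝ) : ℝ := if r then 1 - t else t

theorem flipIf_flipIf (r : Bool) (t : ℝ) : flipIf r (flipIf r t) = t := by
  cases r <;> simp [flipIf]

theorem contDiff_flipIf (r : Bool) : ContDiff ℝ ∞ (flipIf r) := by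
  cases r
  · exact contDiff_id
  · exact contDiff_const.sub contDiff_id

theorem flipIf_mem {r : Bool} {t : ℝ} : flipIf r t ∈ Icc (0 : ℝ) 1 ↔ t ∈ Icc (0 : ℝ) 1 := by
  cases r
  · simp [flipIf]
  · simp [flipIf, and_comm]

theorem flipIf_zero_iff {r : Bool} {t : ℝ} : t = 0 ∨ t = 1 ↔ flipIf r t = 0 ∨ flipIf r t = 1 := by
  cases r
  · simp [flipIf]
  · simp only [flipIf, if_true]
    constructor <;> rintro (h | h) <;> [right; left; right; left] <;> linarith

theorem contMDiffOn_cylPt_comp {E H M : Type*} [NormedAddCommGroup E] [NormedSpace ℝ E]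
    [TopologicalSpace H] {I : ModelWithCorners ℝ E H} [TopologicalSpace M] [ChartedSpace H M]
    {a : M → ℝ} {b : M → Y} {S : Set M} (ha : ContMDiffOn I 𝓘(ℝ, ℝ) ∞ a S)
    (hb : ContMDiffOn I (𝓡 m) ∞ b S) (hS : ∀ p ∈ S, a p ∈ Icc (0 : ℝ) 1) :
    ContMDiffOn I 𝓑 ∞ (fun p => cylPt (a p, b p)) S :=
  contMDiffOn_cylPt.comp (ha.prodMk hb) fun p hp => ⟨hS p hp, trivial⟩

/-- The product decomposition of the cylinder at one of its ends, in which the cylinder has the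
length `a`. -/
def cylCollar (Y : ClosedManifold.{u} m) (r : Bool) {a : ℝ} (ha : 0 < a) :
    Collar Y.cylinder Y where
  ε := a
  ε_pos := ha
  φ :=
    { toFun := fun q => cylPt (flipIf r (q.1 / a), q.2)
      invFun := fun p => (a * flipIf r (cylR p), cylY p)
      source := Ico 0 a ×ˢ univ
      target := {p | flipIf r (cylR p) < 1}
      map_source' := fun q hq => by
        have h : q.1 / a ∈ Ico (0 : ℝ) 1 := ⟨div_nonneg hq.1.1 ha.le, (div_lt_one ha).2 hq.1.2⟩
        change flipIf r (cylR (cylPt (flipIf r (q.1 / a), q.2))) < 1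
        rw [cylR_cylPt (flipIf_mem.2 (Ico_subset_Icc_self h)), flipIf_flipIf]
        exact h.2
      map_target' := fun p hp => by
        have h := (flipIf_mem (r := r)).2 (cylR_mem p)
        exact ⟨⟨mul_nonneg ha.le h.1, mul_lt_of_lt_one_right ha hp⟩, trivial⟩
      left_inv' := fun q hq => by
        have h : q.1 / a ∈ Icc (0 : ℝ) 1 := ⟨div_nonneg hq.1.1 ha.le, (div_le_one ha).2 hq.1.2.le⟩
        refine Prod.ext ?_ rfl
        change a * flipIf r (cylR (cylPt (flipIf r (q.1 / a), q.2))) = q.1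
        rw [cylR_cylPt (flipIf_mem.2 h), flipIf_flipIf, mul_div_cancel₀ _ ha.ne']
      right_inv' := fun p _ => by
        change cylPt (flipIf r (a * flipIf r (cylR p) / a), cylY p) = p
        rw [mul_div_cancel_left₀ _ ha.ne', flipIf_flipIf, cylPt_eta] }
  source_eq := rfl
  open_target := isOpen_lt ((contDiff_flipIf r).continuous.comp contMDiff_cylR.continuous)
    continuous_const
  smooth := by
    refine contMDiffOn_cylPt_comp ?_ contMDiffOn_snd fun q hq => flipIf_mem.2
      ⟨div_nonneg hq.1.1 ha.le, (div_le_one ha).2 hq.1.2.le⟩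
    exact ((contDiff_flipIf r).comp (contDiff_id.div_const a)).contMDiff.comp_contMDiffOn
      contMDiffOn_fst
  smooth_symm := by
    refine ContMDiffOn.prodMk ?_ contMDiff_cylY.contMDiffOn
    exact ((contDiff_const.mul (contDiff_flipIf r)).contMDiff.comp contMDiff_cylR).contMDiffOn
  boundary_eq := by
    ext p
    rw [mem_inter_iff, mem_boundarySet_cylinder, flipIf_zero_iff (r := r)]
    constructor
    · rintro ⟨h1, h2⟩
      have h3 : flipIf r (cylR p) = 0 := h2.resolve_right (LT.lt.ne h1)
      refine ⟨(0, cylY p), ⟨rfl, trivial⟩, ?_⟩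
      change cylPt (flipIf r (0 / a), cylY p) = p
      rw [zero_div, ← h3, flipIf_flipIf, cylPt_eta]
    · rintro ⟨⟨_, y⟩, ⟨rfl, -⟩, rfl⟩
      have h : flipIf r (cylR (cylPt (flipIf r ((0 : ℝ) / a), y))) = 0 := by
        rw [cylR_cylPt (flipIf_mem.2 (by simp)), flipIf_flipIf, zero_div]
      refine ⟨?_, Or.inl h⟩
      change flipIf r (cylR (cylPt (flipIf r ((0 : ℝ) / a), y))) < 1
      rw [h]
      exact one_pos

theorem cylCollar_apply (r : Bool) {a : ℝ} (ha : 0 < a) (q : ℝ × Y) :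
    (cylCollar Y r ha).φ q = cylPt (flipIf r (q.1 / a), q.2) := rfl

theorem mem_base_cylCollar {r : Bool} {a : ℝ} {ha : 0 < a} {p : Y.cylinder} :
    p ∈ (cylCollar Y r ha).base ↔ flipIf r (cylR p) = 0 := by
  rw [Collar.mem_base]
  constructor
  · rintro ⟨y, rfl⟩
    rw [cylCollar_apply, cylR_cylPt (flipIf_mem.2 (by simp)), flipIf_flipIf, zero_div]
  · intro h
    refine ⟨cylY p, ?_⟩
    rw [cylCollar_apply, zero_div, ← h, flipIf_flipIf, cylPt_eta]

/-- The projection of two copies of `Y` to `Y`. -/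
def ClosedManifold.fold (Y : ClosedManifold.{u} m) : Y.double → Y := Sum.elim id id

theorem ClosedManifold.contMDiff_fold : ContMDiff (𝓡 m) (𝓡 m) ∞ Y.fold :=
  ContMDiff.sumElim contMDiff_id contMDiff_id

/-- The side on which a point of two copies of `Y` lies. -/
def ClosedManifold.side (Y : ClosedManifold.{u} m) : Y.double → Bool := Sum.isRight

theorem ClosedManifold.eventually_side (z : Y.double) : ∀ᶠ z' in 𝓝 z, Y.side z' = Y.side z := by
  rcases z with y | y
  · exact mem_of_superset (isOpen_range_inl.mem_nhds ⟨y, rfl⟩) (by rintro _ ⟨y', rfl⟩; rfl)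
  · exact mem_of_superset (isOpen_range_inr.mem_nhds ⟨y, rfl⟩) (by rintro _ ⟨y', rfl⟩; rfl)

/-- A point of two copies of `Y` with given side. -/
def ClosedManifold.onSide (Y : ClosedManifold.{u} m) (r : Bool) (y : Y) : Y.double :=
  if r then Sum.inr y else Sum.inl y

theorem ClosedManifold.contMDiff_onSide (r : Bool) : ContMDiff (𝓡 m) (𝓡 m) ∞ (Y.onSide r) := by
  cases r
  · exact ContMDiff.inl
  · exact ContMDiff.inr

theorem ClosedManifold.onSide_side (z : Y.double) : Y.onSide (Y.side z) (Y.fold z) = z := by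
  rcases z with y | y <;> rfl

theorem flipIf_lt_half {r : Bool} {t : ℝ} (h0 : 0 ≤ t) (h : t < 1 / 2) :
    flipIf r t ∈ Icc (0 : ℝ) 1 ∧ flipIf r t ≠ 1 / 2 ∧ decide (1 / 2 < flipIf r t) = r := by
  cases r
  · refine ⟨⟨h0, ?_⟩, ?_, ?_⟩ <;> simp [flipIf] <;> norm_num at h ⊢ <;> linarith
  · refine ⟨⟨?_, ?_⟩, ?_, ?_⟩ <;> simp [flipIf] <;> norm_num at h ⊢ <;> linarith

/-- Both ends of the cylinder. -/
def cylDoubleCollar (Y : ClosedManifold.{u} m) : Collar Y.cylinder Y.double where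
  ε := 1 / 2
  ε_pos := by norm_num
  φ :=
    { toFun := fun q => cylPt (flipIf (Y.side q.2) q.1, Y.fold q.2)
      invFun := fun p => (flipIf (decide (1 / 2 < cylR p)) (cylR p),
        Y.onSide (decide (1 / 2 < cylR p)) (cylY p))
      source := Ico 0 (1 / 2) ×ˢ univ
      target := {p | cylR p ≠ 1 / 2}
      map_source' := fun q hq => by
        obtain ⟨h1, h2, -⟩ := flipIf_lt_half (r := Y.side q.2) hq.1.1 hq.1.2
        change cylR (cylPt (flipIf (Y.side q.2) q.1, Y.fold q.2)) ≠ 1 / 2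
        rw [cylR_cylPt h1]
        exact h2
      map_target' := fun p hp => by
        have h := cylR_mem p
        have hp' : cylR p ≠ 1 / 2 := hp
        refine ⟨?_, trivial⟩
        by_cases h1 : 1 / 2 < cylR p
        · simp only [h1, decide_true, flipIf, if_true]
          exact ⟨sub_nonneg.2 h.2, by linarith⟩
        · simp only [h1, decide_false, flipIf]
          exact ⟨h.1, lt_of_le_of_ne (not_lt.1 h1) hp'⟩
      left_inv' := fun q hq => by
        obtain ⟨h1, -, h3⟩ := flipIf_lt_half (r := Y.side q.2) hq.1.1 hq.1.2
        rw [cylR_cylPt h1, h3, flipIf_flipIf]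
        exact Prod.ext rfl (ClosedManifold.onSide_side q.2)
      right_inv' := fun p _ => by
        by_cases h1 : 1 / 2 < cylR p
        · simp only [h1, decide_true]
          change cylPt (flipIf true (flipIf true (cylR p)), cylY p) = p
          rw [flipIf_flipIf, cylPt_eta]
        · simp only [h1, decide_false]
          change cylPt (flipIf false (flipIf false (cylR p)), cylY p) = p
          rw [flipIf_flipIf, cylPt_eta] }
  source_eq := rfl
  open_target := isOpen_ne_fun contMDiff_cylR.continuous continuous_const
  smooth := by
    intro q hq
    refine (contMDiffOn_cylPt_comp (a := fun q' : ℝ × Y.double => flipIf (Y.side q.2) q'.1)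
      (b := fun q' => Y.fold q'.2) ((contDiff_flipIf _).contMDiff.comp_contMDiffOn contMDiffOn_fst)
      (ClosedManifold.contMDiff_fold.comp_contMDiffOn contMDiffOn_snd)
      (fun q' hq' => (flipIf_lt_half hq'.1.1 hq'.1.2).1) q hq).congr_of_eventuallyEq ?_ rfl
    filter_upwards [nhdsWithin_le_nhds
      (continuous_snd.continuousAt.eventually (ClosedManifold.eventually_side q.2))] with q' hq'
    rw [hq']
  smooth_symm := by
    intro p hp
    have hR := contMDiff_cylR (Y := Y)
    refine ContMDiffAt.contMDiffWithinAt ((((contDiff_flipIf (decide (1 / 2 < cylR p))).contMDiff.comp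
      hR).prodMk ((ClosedManifold.contMDiff_onSide (decide (1 / 2 < cylR p))).comp
      contMDiff_cylY)).contMDiffAt.congr_of_eventuallyEq ?_)
    have hev : ∀ᶠ p' in 𝓝 p, decide (1 / 2 < cylR p') = decide (1 / 2 < cylR p) := by
      rcases lt_or_gt_of_ne (show cylR p ≠ 1 / 2 from hp) with h | h
      · filter_upwards [hR.continuous.continuousAt.eventually (gt_mem_nhds h)] with p' hp'
        rw [decide_eq_false hp'.not_gt, decide_eq_false h.not_gt]
      · filter_upwards [hR.continuous.continuousAt.eventually (lt_mem_nhds h)] with p' hp'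
        rw [decide_eq_true hp', decide_eq_true h]
    filter_upwards [hev] with p' hp'
    change (flipIf (decide (1 / 2 < cylR p')) (cylR p'), Y.onSide (decide (1 / 2 < cylR p')) _) = _
    rw [hp']
    rfl
  boundary_eq := by
    ext p
    rw [mem_inter_iff, mem_boundarySet_cylinder]
    constructor
    · rintro ⟨-, h | h⟩
      · refine ⟨(0, Y.onSide false (cylY p)), ⟨rfl, trivial⟩, ?_⟩
        change cylPt (0, cylY p) = p
        rw [← h, cylPt_eta]
      · refine ⟨(0, Y.onSide true (cylY p)), ⟨rfl, trivial⟩, ?_⟩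
        change cylPt (1 - 0, cylY p) = p
        rw [sub_zero, ← h, cylPt_eta]
    · rintro ⟨⟨_, z⟩, ⟨rfl, -⟩, rfl⟩
      obtain ⟨h1, h2, -⟩ := flipIf_lt_half (r := Y.side z) le_rfl (by norm_num : (0 : ℝ) < 1 / 2)
      change cylR (cylPt (flipIf (Y.side z) 0, Y.fold z)) ≠ 1 / 2 ∧
        (cylR (cylPt (flipIf (Y.side z) 0, Y.fold z)) = 0 ∨
          cylR (cylPt (flipIf (Y.side z) 0, Y.fold z)) = 1)
      rw [cylR_cylPt h1]
      refine ⟨h2, ?_⟩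
      cases Y.side z
      · exact Or.inl rfl
      · exact Or.inr (sub_zero 1)

theorem boundarySet_eq_base_cylDoubleCollar :
    Y.cylinder.boundarySet = (cylDoubleCollar Y).base := by
  refine (inter_eq_right.2 fun p hp => ?_).symm.trans (cylDoubleCollar Y).boundary_eq
  change cylR p ≠ 1 / 2
  rcases mem_boundarySet_cylinder.1 hp with h | h <;> rw [h] <;> norm_num

end CylinderCollar

/-! ### Two copies of a space -/

section Double

theorem IsLorentzForm.bilinPull {V W : Type*} [AddCommGroup V] [Module ℝ V] [TopologicalSpace V]
    [AddCommGroup W] [Module ℝ W] [TopologicalSpace W] {b : W →L[ℝ] W →L[ℝ] ℝ}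
    (hb : IsLorentzForm b) {L : V →L[ℝ] W} (hL : Bijective L) :
    IsLorentzForm (bilinPull b L) := by
  obtain ⟨hs, v, hv, hneg⟩ := hb
  obtain ⟨v, rfl⟩ := hL.2 v
  exact ⟨fun a a' => hs _ _, v, hv, fun w hw hw0 => hneg _ hw fun h =>
    hw0 (hL.1 (h.trans (map_zero L).symm))⟩

theorem IsPosDefForm.bilinPull {V W : Type*} [AddCommGroup V] [Module ℝ V] [TopologicalSpace V]
    [AddCommGroup W] [Module ℝ W] [TopologicalSpace W] {b : W →L[ℝ] W →L[ℝ] ℝ}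
    (hb : IsPosDefForm b) {L : V →L[ℝ] W} (hL : Injective L) :
    IsPosDefForm (bilinPull b L) :=
  ⟨fun _ _ => hb.1 _ _, fun _ hv => hb.2 _ fun h => hv (hL (h.trans (map_zero L).symm))⟩

theorem injective_of_surjective {E : Type*} [NormedAddCommGroup E] [NormedSpace ℝ E]
    [FiniteDimensional ℝ E] {L : E →L[ℝ] E} (h : Surjective L) : Injective L :=
  (LinearMap.injective_iff_surjective (f := L.toLinearMap)).2 h

theorem mfderiv_fold_bijective {E : Type*} [NormedAddCommGroup E] [NormedSpace ℝ E]
    [FiniteDimensional ℝ E] {H : Type*} [TopologicalSpace H] {I : ModelWithCorners ℝ E H}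
    {M : Type*} [TopologicalSpace M] [ChartedSpace H M] (p : M ⊕ M) :
    Bijective (mfderiv I I (Sum.elim id id : M ⊕ M → M) p) := by
  have hs : Surjective (mfderiv I I (Sum.elim id id : M ⊕ M → M) p) := by
    have hf : MDifferentiable I I (Sum.elim id id : M ⊕ M → M) :=
      (ContMDiff.sumElim contMDiff_id contMDiff_id : ContMDiff I I 1 _).mdifferentiable one_ne_zero
    rcases p with q | q
    · have h := mfderiv_comp q (hf (Sum.inl q))
        ((ContMDiff.inl (M' := M) (n := 1) (I := I)).mdifferentiable one_ne_zero q)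
      intro v
      refine ⟨mfderiv I I (Sum.inl : M → M ⊕ M) q v, ?_⟩
      exact (congrArg (fun L => L v) h).symm.trans
        (congrArg (fun L => L v) (mfderiv_id (I := I) (x := q)))
    · have h := mfderiv_comp q (hf (Sum.inr q))
        ((ContMDiff.inr (M := M) (n := 1) (I := I)).mdifferentiable one_ne_zero q)
      intro v
      refine ⟨mfderiv I I (Sum.inr : M → M ⊕ M) q v, ?_⟩
      exact (congrArg (fun L => L v) h).symm.trans
        (congrArg (fun L => L v) (mfderiv_id (I := I) (x := q)))
  exact ⟨injective_of_surjective (E := E) hs, hs⟩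

variable {X : CompactManifoldWithBoundary.{u} m} {Y : ClosedManifold.{u} m}

theorem BilinField.Smooth.double {g : BilinField X} (hg : g.Smooth) : g.double.Smooth := fun p =>
  contMDiffAt_bilinPull isOpen_univ X.fold_smooth.contMDiffOn (b := fun q => g (X.fold q)) trivial
    ((hg.comp X.fold_smooth) p)

theorem BilinFamily.SmoothOnSet.double {h : BilinFamily Y} {S : Set ℝ}
    (hh : h.SmoothOnSet S) : BilinFamily.SmoothOnSet (Y := Y.double)
      (fun t z => bilinPull (h t (Y.fold z)) (mfderiv (𝓡 m) (𝓡 m) Y.fold z)) S := by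
  intro q hq
  rw [contMDiffWithinAt_bilinAlong_iff]
  refine ⟨contMDiffWithinAt_snd, fun v w => ?_⟩
  have hF := ClosedManifold.contMDiff_fold (Y := Y)
  have hs : ∀ v : Eucl m, ContMDiffWithinAt 𝓒 (𝓡 m).tangent ∞
      (fun q' : ℝ × Y.double => (⟨Y.fold q'.2, mfderiv (𝓡 m) (𝓡 m) Y.fold q'.2
        (tangentFrame (𝓡 m) q.2 q'.2 v)⟩ : TangentBundle (𝓡 m) Y)) (S ×ˢ univ) q := fun v =>
    ((hF.contMDiffOn.mfderiv_section isOpen_univ subset_rfl (mem_univ q.2)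
      (contMDiffAt_tangentFrame q.2 (mem_chart_source _ _) v).contMDiffWithinAt).contMDiffAt
      univ_mem).comp_contMDiffWithinAt q contMDiffWithinAt_snd
  exact ContMDiffWithinAt.bilinAlong_apply (f := fun q' : ℝ × Y.double => Y.fold q'.2)
    (b := fun q' : ℝ × Y.double => h q'.1 (Y.fold q'.2))
    (ContMDiffWithinAt.comp (t := S ×ˢ univ) q (hh (q.1, Y.fold q.2) ⟨hq.1, trivial⟩)
      (contMDiffWithinAt_fst.prodMk ((hF _).comp_contMDiffWithinAt q contMDiffWithinAt_snd))
      fun q' hq' => ⟨hq'.1, trivial⟩) (hs v) (hs w)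

theorem IsConformallyCompact.double {g : BilinField X} {x : X → ℝ}
    (H : IsConformallyCompact (fun _ b => IsLorentzForm b) g x) :
    IsConformallyCompact (fun _ b => IsLorentzForm b) g.double (x ∘ X.fold) := by
  obtain ⟨⟨hs, hn, hz, hd⟩, ghat, hgs, hsig, hg, hu⟩ := H
  have hbd := fun p => X.mem_boundarySet_double p
  have hchain : ∀ p : X.double, mfderiv 𝓑 𝓘(ℝ, ℝ) (x ∘ X.fold) p =
      (mfderiv 𝓑 𝓘(ℝ, ℝ) x (X.fold p)).comp (mfderiv 𝓑 𝓑 X.fold p) := fun p =>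
    mfderiv_comp p (hs.mdifferentiable (by simp) _) (X.fold_smooth.mdifferentiable (by simp) _)
  have hbij : ∀ p : X.double, Bijective (mfderiv 𝓑 𝓑 X.fold p) :=
    fun p => mfderiv_fold_bijective (M := X) p
  refine ⟨⟨hs.comp X.fold_smooth, fun p => hn _, fun p => (hz _).trans (hbd p).symm,
    fun p hp h0 => hd _ ((hbd p).1 hp) ?_⟩, ghat.double, hgs.double,
    fun p => (hsig _).bilinPull (hbij p), fun p hp => ?_, fun p hp => ?_⟩
  · ext v
    obtain ⟨v, rfl⟩ := (hbij p).2 v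
    have h1 := congrArg (fun L => L v) ((hchain p).symm.trans h0)
    exact h1
  · have hp' : X.fold p ∈ X.interiorSet := by
      have h1 : ¬ p ∈ X.double.boundarySet := fun h =>
        ((𝓑).isBoundaryPoint_iff_not_isInteriorPoint p).1 h hp
      rw [hbd] at h1
      by_contra h2
      exact h1 (((𝓑).isBoundaryPoint_iff_not_isInteriorPoint _).2 h2)
    change bilinPull (g (X.fold p)) _ = _ • bilinPull (ghat (X.fold p)) _
    rw [hg _ hp']
    rfl
  · obtain ⟨v, hv, hv1⟩ := hu _ ((hbd p).1 hp)
    obtain ⟨v, rfl⟩ := (hbij p).2 v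
    refine ⟨v, fun w => ?_, hv1⟩
    exact (hv _).trans (congrArg (fun L => L w) (hchain p)).symm

theorem mem_base_double {c : Collar X Y} {p : X.double} :
    p ∈ c.double.base ↔ X.fold p ∈ c.base := by
  rw [Collar.mem_base, Collar.mem_base]
  constructor
  · rintro ⟨y | y, rfl⟩
    · exact ⟨y, rfl⟩
    · exact ⟨y, rfl⟩
  · rintro ⟨y, hy⟩
    rcases p with p | p
    · exact ⟨Sum.inl y, congrArg Sum.inl hy⟩
    · exact ⟨Sum.inr y, congrArg Sum.inr hy⟩

theorem Collar.fold_double (c : Collar X Y) (q : ℝ × Y.double) :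
    X.fold (c.double.φ q) = c.φ (q.1, Y.fold q.2) := by
  obtain ⟨s, y | y⟩ := q <;> rfl

theorem IsEvenEnd.double {τ : ℝ} {c : Collar X Y} {g : BilinField X} {x : X → ℝ}
    (H : IsEvenEnd τ c g x) : IsEvenEnd τ c.double g.double (x ∘ X.fold) := by
  obtain ⟨δ, hδ, hε, h, hs, hpos, hend⟩ := H
  refine ⟨δ, hδ, hε, _, hs.double, fun t ht z => (hpos t ht _).bilinPull
    (mfderiv_fold_bijective (M := Y) z).1, fun s h0 hsδ z => ?_⟩
  obtain ⟨h1, h2⟩ := hend s h0 hsδ (Y.fold z)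
  have hsε : s ∈ Ioo 0 c.ε := ⟨h0, lt_of_pow_lt_pow_left₀ 2 c.ε_pos.le (hsδ.trans_le hε)⟩
  refine ⟨(congrArg x (c.fold_double (s, z))).trans h1, fun a a' v v' => ?_⟩
  have hd1 : MDifferentiableAt 𝓒 𝓑 c.double.φ (s, z) :=
    (c.double.contMDiffAt hsε z).mdifferentiableAt (by simp)
  have hd2 : MDifferentiableAt 𝓒 𝓑 c.φ (s, Y.fold z) :=
    (c.contMDiffAt hsε (Y.fold z)).mdifferentiableAt (by simp)
  have hF : HasMFDerivAt (𝓡 m) (𝓡 m) Y.fold z (mfderiv (𝓡 m) (𝓡 m) Y.fold z) :=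
    (ClosedManifold.contMDiff_fold.mdifferentiable (by simp) z).hasMFDerivAt
  have hid := HasMFDerivAt.prodMap (p := (s, z)) (hasMFDerivAt_id (I := 𝓘(ℝ, ℝ)) s) hF
  have hc1 := (X.fold_smooth.mdifferentiable (by simp) (c.double.φ (s, z))).hasMFDerivAt.comp
    (s, z) hd1.hasMFDerivAt
  have hc2 := hd2.hasMFDerivAt.comp (s, z) hid
  have hfun : X.fold ∘ c.double.φ = c.φ ∘ Prod.map id Y.fold := funext fun q => c.fold_double q
  rw [hfun] at hc1
  have hL := hasMFDerivAt_unique hc1 hc2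
  have key : ∀ (a : ℝ) (v : TangentSpace (𝓡 m) z), (mfderiv 𝓑 𝓑 X.fold (c.double.φ (s, z))
        (mfderiv 𝓒 𝓑 c.double.φ (s, z) (a, v)) : 𝔼) =
      mfderiv 𝓒 𝓑 c.φ (s, Y.fold z) (a, mfderiv (𝓡 m) (𝓡 m) Y.fold z v) := fun a v =>
    (congrArg (fun L => L (a, v)) hL).trans (congrArg (fun b : ℝ =>
      mfderiv 𝓒 𝓑 c.φ (s, Y.fold z) (b, mfderiv (𝓡 m) (𝓡 m) Y.fold z v))
      (congrArg (fun L => L a) (mfderiv_id (I := 𝓘(ℝ, ℝ)) (x := s))))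
  have hp := c.fold_double (s, z)
  refine Eq.trans ?_ (h2 a a' (mfderiv (𝓡 m) (𝓡 m) Y.fold z v) (mfderiv (𝓡 m) (𝓡 m) Y.fold z v'))
  have e1 : ∀ (p q : X) (_ : p = q) (u u' w w' : 𝔼), u = w → u' = w' →
      (g p u u' : ℝ) = g q w w' := by
    rintro p _ rfl u u' _ _ rfl rfl
    rfl
  exact e1 _ _ hp _ _ _ _ (key a v) (key a' v')

theorem IsEvenLorentzian.double {YP YM : ClosedManifold.{u} m} {cP : Collar X YP}
    {cM : Collar X YM} {g : BilinField X} {x : X → ℝ} (H : IsEvenLorentzian cP cM g x) :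
    IsEvenLorentzian cP.double cM.double g.double (x ∘ X.fold) where
  conformallyCompact := H.conformallyCompact.double
  boundary_eq := by
    ext p
    rw [X.mem_boundarySet_double, H.boundary_eq, mem_union, mem_union, mem_base_double,
      mem_base_double]
  disjoint := disjoint_left.2 fun _ h h' =>
    disjoint_left.1 H.disjoint (mem_base_double.1 h) (mem_base_double.1 h')
  even_plus := H.even_plus.double
  even_minus := H.even_minus.double

end Double

/-! ### The equation of null geodesics in coordinates -/

section EulerLagrange

variable {V : Type*} [NormedAddCommGroup V] [NormedSpace ℝ V]
  {W : Type*} [NormedAddCommGroup W] [NormedSpace ℝ W]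

/-- The curve `z` in a vector space satisfies at `t` the equation of null geodesics of the metric
`G`. -/
def IsNullAt (G : V → V →L[ℝ] V →L[ℝ] ℝ) (z : ℝ → V) (t : ℝ) : Prop :=
  deriv z t ≠ 0 ∧ G (z t) (deriv z t) (deriv z t) = 0 ∧ ∀ w : V,
    HasDerivAt (fun t' => G (z t') (deriv z t') w)
      ((1 / 2) * fderiv ℝ (fun x => G x (deriv z t) (deriv z t)) (z t) w) t

theorem IsNullAt.congr {G G' : V → V →L[ℝ] V →L[ℝ] ℝ} {z z' : ℝ → V} {t : ℝ}
    (h : IsNullAt G z t) (hG : G =ᶠ[𝓝 (z t)] G') (hz : z =ᶠ[𝓝 t] z')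
    (hc : ContinuousAt z t) : IsNullAt G' z' t := by
  have hd := hz.deriv
  have e0 : z' t = z t := hz.self_of_nhds.symm
  have e1 : deriv z' t = deriv z t := hd.self_of_nhds.symm
  refine ⟨by rw [e1]; exact h.1, by rw [e0, e1, ← hG.self_of_nhds]; exact h.2.1, fun w => ?_⟩
  rw [e0, e1]
  have e2 : (fun x => G' x (deriv z t) (deriv z t)) =ᶠ[𝓝 (z t)]
      fun x => G x (deriv z t) (deriv z t) := hG.mono fun x hx =>
    congrArg (fun B : V →L[ℝ] V →L[ℝ] ℝ => B (deriv z t) (deriv z t)) hx.symm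
  rw [e2.fderiv_eq]
  refine (h.2.2 w).congr_of_eventuallyEq ?_
  filter_upwards [hz, hd, hc.eventually hG] with t' h1 h2 h3
  rw [← h1, ← h2, h3]

theorem IsNullAt.comp_neg {G : V → V →L[ℝ] V →L[ℝ] ℝ} {z : ℝ → V} {t : ℝ}
    (h : IsNullAt G z (-t)) : IsNullAt G (fun t' => z (-t')) t := by
  have hd : ∀ t', deriv (fun t' => z (-t')) t' = -deriv z (-t') := fun t' => deriv_comp_neg z t'
  refine ⟨by rw [hd]; exact neg_ne_zero.2 h.1, by rw [hd]; simpa using h.2.1, fun w => ?_⟩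
  simp only [hd, map_neg, neg_apply, neg_neg]
  have h1 : HasDerivAt (fun t' => -(G (z (-t')) (deriv z (-t')) w)) _ t :=
    ((h.2.2 w).scomp t (hasDerivAt_neg t)).neg
  exact h1.congr_deriv (by simp)

theorem ContDiffAt.deriv_right {n k : WithTop ℕ∞} {z : ℝ → V} {t : ℝ} (hz : ContDiffAt ℝ n z t)
    (h : k + 1 ≤ n) : ContDiffAt ℝ k (deriv z) t :=
  (hz.fderiv_right h).clm_apply contDiffAt_const

theorem fderiv_quadratic {G : V → V →L[ℝ] V →L[ℝ] ℝ} {x : V} (hG : DifferentiableAt ℝ G x)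
    (v w : V) : fderiv ℝ (fun x => G x v v) x w = fderiv ℝ G x w v v := by
  have h := ((hG.hasFDerivAt.clm_apply (hasFDerivAt_const v x)).clm_apply
    (hasFDerivAt_const v x)).fderiv
  rw [h]
  simp

/-- The equation does not depend on the coordinates. -/
theorem IsNullAt.comp {G : V → V →L[ℝ] V →L[ℝ] ℝ} {G' : W → W →L[ℝ] W →L[ℝ] ℝ} {z : ℝ → V}
    {t : ℝ} {ψ : V → W} (h : IsNullAt G z t) (hz : ContDiffAt ℝ 2 z t)
    (hψ : ContDiffAt ℝ 2 ψ (z t)) (hG' : DifferentiableAt ℝ G' (ψ (z t)))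
    (hsym : ∀ a b, G' (ψ (z t)) a b = G' (ψ (z t)) b a)
    (hbij : Bijective (fderiv ℝ ψ (z t)))
    (hG : ∀ᶠ x in 𝓝 (z t), G x = bilinPull (G' (ψ x)) (fderiv ℝ ψ x)) :
    IsNullAt G' (ψ ∘ z) t := by
  have hz1 : DifferentiableAt ℝ z t := hz.differentiableAt two_ne_zero
  have hψ1 : DifferentiableAt ℝ ψ (z t) := hψ.differentiableAt two_ne_zero
  have hd : deriv (ψ ∘ z) =ᶠ[𝓝 t] fun t' => fderiv ℝ ψ (z t') (deriv z t') := by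
    filter_upwards [(hz.eventually (by simp)), hz1.continuousAt.eventually (hψ.eventually (by simp))]
      with t' h1 h2
    exact fderiv_comp_deriv t' (h2.differentiableAt two_ne_zero) (h1.differentiableAt two_ne_zero)
  have hd0 := hd.self_of_nhds
  have hP : HasDerivAt (fun t' => fderiv ℝ ψ (z t')) (fderiv ℝ (fderiv ℝ ψ) (z t) (deriv z t)) t :=
    ((hψ.fderiv_right (m := 1) le_rfl).differentiableAt one_ne_zero).hasFDerivAt.comp_hasDerivAt t
      hz1.hasDerivAt
  have hz' : DifferentiableAt ℝ (deriv z) t :=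
    (hz.deriv_right (k := 1) le_rfl).differentiableAt one_ne_zero
  have hζ : DifferentiableAt ℝ (fun t' => G' (ψ (z t')) (deriv (ψ ∘ z) t')) t := by
    have h1 : DifferentiableAt ℝ (fun t' => G' (ψ (z t'))) t := by
      exact hG'.comp t (hψ1.comp t hz1)
    exact h1.clm_apply ((hP.differentiableAt.clm_apply hz').congr_of_eventuallyEq hd)
  refine ⟨?_, ?_, fun w => ?_⟩
  · rw [hd0]
    exact fun h0 => h.1 (hbij.1 (h0.trans (map_zero _).symm))
  · have h1 := h.2.1
    rw [hG.self_of_nhds] at h1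
    rw [hd0]
    exact h1
  obtain ⟨w, rfl⟩ := hbij.2 w
  have e1 := hζ.hasDerivAt.clm_apply (hP.clm_apply (hasDerivAt_const t w))
  have e2 : HasDerivAt (fun t' => G' (ψ (z t')) (deriv (ψ ∘ z) t') (fderiv ℝ ψ (z t') w)) _ t :=
    (h.2.2 w).congr_of_eventuallyEq (by
      filter_upwards [hd, hz1.continuousAt.eventually hG] with t' h1 h2
      rw [h1, h2]
      rfl)
  have e3 := e1.unique e2
  have e4 : fderiv ℝ (fun x => G x (deriv z t) (deriv z t)) (z t) w =
      fderiv ℝ G' (ψ (z t)) (fderiv ℝ ψ (z t) w) (deriv (ψ ∘ z) t) (deriv (ψ ∘ z) t) +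
        2 * G' (ψ (z t)) (deriv (ψ ∘ z) t) (fderiv ℝ (fderiv ℝ ψ) (z t) w (deriv z t)) := by
    have h1 : (fun x => G x (deriv z t) (deriv z t)) =ᶠ[𝓝 (z t)]
        fun x => G' (ψ x) (fderiv ℝ ψ x (deriv z t)) (fderiv ℝ ψ x (deriv z t)) := by
      filter_upwards [hG] with x hx
      rw [hx]
      rfl
    have h2 := ((hψ.fderiv_right (m := 1) le_rfl).differentiableAt one_ne_zero).hasFDerivAt.clm_apply
      (hasFDerivAt_const (deriv z t) (z t))
    have h3 := (((hG'.hasFDerivAt.comp (z t) hψ1.hasFDerivAt).clm_apply h2).clm_apply h2).fderiv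
    rw [h1.fderiv_eq]
    refine (congrArg (fun L => L w) h3).trans ?_
    rw [hd0]
    simp [hsym (fderiv ℝ (fderiv ℝ ψ) (z t) w (deriv z t))]
    ring
  have hsymm : fderiv ℝ (fderiv ℝ ψ) (z t) w (deriv z t) =
      fderiv ℝ (fderiv ℝ ψ) (z t) (deriv z t) w := hψ.isSymmSndFDerivAt (by simp) _ _
  have e5 : deriv (fun t' => G' (ψ (z t')) (deriv (ψ ∘ z) t')) t (fderiv ℝ ψ (z t) w) =
      1 / 2 * fderiv ℝ (fun x => G' x (deriv (ψ ∘ z) t) (deriv (ψ ∘ z) t)) (ψ (z t))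
        (fderiv ℝ ψ (z t) w) := by
    rw [fderiv_quadratic hG']
    rw [e4, hsymm] at e3
    simp at e3 ⊢
    linarith
  refine (hζ.hasDerivAt.clm_apply (hasDerivAt_const t (fderiv ℝ ψ (z t) w))).congr_deriv ?_
  simpa using e5

end EulerLagrange

section Extension

variable {V : Type*} [NormedAddCommGroup V] [NormedSpace ℝ V] {G : V → V →L[ℝ] V →L[ℝ] ℝ}
  {U : Set V}

theorem IsNullAt.hasDerivAt {z : ℝ → V} {t : ℝ} (h : IsNullAt G z t) (hz : ContDiffAt ℝ 2 z t)
    (hG : DifferentiableAt ℝ G (z t)) : HasDerivAt (fun t' => G (z t') (deriv z t'))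
      ((1 / 2 : ℝ) • fderiv ℝ (fun x => G x (deriv z t) (deriv z t)) (z t)) t := by
  have h1 : DifferentiableAt ℝ (fun t' => G (z t') (deriv z t')) t :=
    (hG.comp t (hz.differentiableAt two_ne_zero)).clm_apply
      ((hz.deriv_right (k := 1) le_rfl).differentiableAt one_ne_zero)
  refine h1.hasDerivAt.congr_deriv (ContinuousLinearMap.ext fun w => ?_)
  have h2 := (h1.hasDerivAt.clm_apply (hasDerivAt_const t w)).unique (h.2.2 w)
  simpa using h2

theorem hasDerivAt_energy {z : ℝ → V} {t : ℝ} (hz : ContDiffAt ℝ 2 z t)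
    (hG : DifferentiableAt ℝ G (z t)) (hsym : ∀ a b, G (z t) a b = G (z t) b a)
    (h : HasDerivAt (fun t' => G (z t') (deriv z t'))
      ((1 / 2 : ℝ) • fderiv ℝ (fun x => G x (deriv z t) (deriv z t)) (z t)) t) :
    HasDerivAt (fun t' => G (z t') (deriv z t') (deriv z t')) 0 t := by
  have h1 := (hz.differentiableAt two_ne_zero).hasDerivAt
  have h2 := ((hz.deriv_right (k := 1) le_rfl).differentiableAt one_ne_zero).hasDerivAt
  have h3 := congrArg (fun L : V →L[ℝ] ℝ => L (deriv z t))
    (h.unique ((hG.hasFDerivAt.comp_hasDerivAt t h1).clm_apply h2))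
  refine (h.clm_apply h2).congr_deriv ?_
  simp only [smul_apply, add_apply, fderiv_quadratic hG, smul_eq_mul] at h3 ⊢
  rw [Function.comp_apply, hsym (deriv (deriv z) t)] at h3
  linarith

variable [FiniteDimensional ℝ V]

theorem isInvertible_of_injective {B : V →L[ℝ] V →L[ℝ] ℝ} (h : Injective B) : B.IsInvertible := by
  have hd : Module.finrank ℝ V = Module.finrank ℝ (V →L[ℝ] ℝ) := by
    rw [← (LinearMap.toContinuousLinearMap (𝕜 := ℝ) (E := V) (F' := ℝ)).finrank_eq]
    exact (Subspace.dual_finrank_eq (K := ℝ) (V := V)).symm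
  exact ⟨(LinearEquiv.ofInjectiveOfFinrankEq B.toLinearMap h hd).toContinuousLinearEquiv,
    ContinuousLinearMap.ext fun v => rfl⟩

/-- The vector field of the geodesic flow on the cotangent bundle. -/
def hamiltonField (G : V → V →L[ℝ] V →L[ℝ] ℝ) (y : V × (V →L[ℝ] ℝ)) : V × (V →L[ℝ] ℝ) :=
  ((G y.1).inverse y.2, (1 / 2 : ℝ) •
    fderiv ℝ (fun x => G x ((G y.1).inverse y.2) ((G y.1).inverse y.2)) y.1)

theorem contDiffOn_hamiltonField (hU : IsOpen U) (hG : ContDiffOn ℝ ∞ G U)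
    (hnd : ∀ x ∈ U, Injective (G x)) :
    ContDiffOn ℝ ∞ (hamiltonField G) (U ×ˢ univ) := by
  have hG1 : ContDiffOn ℝ ∞ (fun y : V × (V →L[ℝ] ℝ) => G y.1) (U ×ˢ univ) :=
    hG.comp contDiffOn_fst fun y hy => hy.1
  have hv : ContDiffOn ℝ ∞ (fun y : V × (V →L[ℝ] ℝ) => (G y.1).inverse y.2) (U ×ˢ univ) := by
    refine ContDiffOn.clm_apply (fun y hy => ?_) contDiffOn_snd
    obtain ⟨e, he⟩ := isInvertible_of_injective (hnd y.1 hy.1)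
    have h1 := contDiffAt_map_inverse (𝕜 := ℝ) (n := ∞) e
    rw [he] at h1
    exact h1.comp_contDiffWithinAt y (hG1 y hy)
  refine hv.prodMk (ContDiffOn.const_smul _ (contDiffOn_clm_apply.2 fun w => ?_))
  have hG2 : ContDiffOn ℝ ∞ (fun y : V × (V →L[ℝ] ℝ) => fderiv ℝ G y.1) (U ×ˢ univ) :=
    (hG.fderiv_of_isOpen hU (m := ∞) le_rfl).comp contDiffOn_fst fun y hy => hy.1
  refine (((hG2.clm_apply (contDiffOn_const (c := w))).clm_apply hv).clm_apply hv).congr fun y hy => ?_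
  exact fderiv_quadratic ((hG.contDiffAt (hU.mem_nhds hy.1)).differentiableAt (by simp)) _ w

theorem contDiffOn_of_hasDerivAt {W : Type*} [NormedAddCommGroup W] [NormedSpace ℝ W] {F : W → W}
    {S : Set W} (hF : ContDiffOn ℝ ∞ F S) {η : ℝ → W} {J : Set ℝ} (hJ : IsOpen J)
    (hη : ∀ t ∈ J, HasDerivAt η (F (η t)) t) (hS : MapsTo η J S) : ContDiffOn ℝ ∞ η J := by
  refine contDiffOn_infty.2 fun n => ?_
  induction n with
  | zero => exact contDiffOn_zero.2 fun t ht => (hη t ht).continuousAt.continuousWithinAt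
  | succ n ih =>
    refine (contDiffOn_succ_iff_deriv_of_isOpen (n := (n : WithTop ℕ∞)) hJ).2
      ⟨fun t ht => (hη t ht).differentiableAt.differentiableWithinAt, fun h => by simp at h, ?_⟩
    exact ((hF.of_le (by exact_mod_cast le_top)).comp ih hS).congr fun t ht => (hη t ht).deriv

theorem exists_limit_of_bound {W : Type*} [NormedAddCommGroup W] [NormedSpace ℝ W]
    [FiniteDimensional ℝ W] {ζ ζ' : ℝ → W} {a b C : ℝ} (hab : a < b)
    (h : ∀ t ∈ Ioo a b, HasDerivAt ζ (ζ' t) t) (hC : ∀ t ∈ Ioo a b, ‖ζ' t‖ ≤ C) :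
    ∃ l, Tendsto ζ (𝓝[<] b) (𝓝 l) := by
  have h1 : LipschitzOnWith C.toNNReal ζ (Ioo a b) :=
    (convex_Ioo a b).lipschitzOnWith_of_nnnorm_hasDerivWithin_le
      (fun t ht => (h t ht).hasDerivWithinAt) fun t ht => by
        rw [← NNReal.coe_le_coe, coe_nnnorm]
        exact (hC t ht).trans (Real.le_coe_toNNReal C)
  obtain ⟨ξ, hξ, heq⟩ := h1.extend_finite_dimension
  refine ⟨ξ b, (hξ.continuous.continuousAt.mono_left nhdsWithin_le_nhds).congr' ?_⟩
  filter_upwards [Ioo_mem_nhdsLT hab] with t ht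
  exact (heq ht).symm

theorem hasDerivAt_of_left {W : Type*} [NormedAddCommGroup W] [NormedSpace ℝ W] {F : W → W}
    {η : ℝ → W} {b : ℝ} (hl : ∀ᶠ t in 𝓝[<] b, HasDerivAt η (F (η t)) t)
    (hc : Tendsto η (𝓝[<] b) (𝓝 (η b))) (hF : ContinuousAt F (η b))
    (hr : HasDerivWithinAt η (F (η b)) (Ici b) b) : HasDerivAt η (F (η b)) b := by
  obtain ⟨a, hab, ha⟩ := (mem_nhdsLT_iff_exists_Ioo_subset (α := ℝ)).1 hl
  have h1 : HasDerivWithinAt η (F (η b)) (Iic b) b := by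
    refine hasDerivWithinAt_Iic_of_tendsto_deriv (s := Ioo a b)
      (fun t ht => (ha ht).differentiableAt.differentiableWithinAt)
      (hc.mono_left (nhdsWithin_mono _ fun t ht => ht.2)) (Ioo_mem_nhdsLT hab) ?_
    exact (hF.tendsto.comp hc).congr' (hl.mono fun t ht => ht.deriv.symm)
  have h2 := h1.union hr
  rwa [Iic_union_Ici, hasDerivWithinAt_univ] at h2

/-- A null geodesic that converges in a coordinate domain, with bounded velocity, can be
extended. -/
theorem exists_null_extension (hU : IsOpen U) (hG : ContDiffOn ℝ ∞ G U)
    (hsym : ∀ x ∈ U, ∀ a b, G x a b = G x b a) (hnd : ∀ x ∈ U, Injective (G x))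
    {z : ℝ → V} {x : V} (hx : x ∈ U) {b C c : ℝ} (hc : 0 < c) (l : V →L[ℝ] ℝ)
    (hz : Tendsto z (𝓝[<] b) (𝓝 x))
    (H : ∀ᶠ t in 𝓝[<] b, ContDiffAt ℝ ∞ z t ∧ IsNullAt G z t ∧ ‖deriv z t‖ ≤ C ∧
      c ≤ |l (deriv z t)|) :
    ∃ z' : ℝ → V, (∀ t < b, z' t = z t) ∧
      ∀ᶠ t in 𝓝 b, z' t ∈ U ∧ ContDiffAt ℝ ∞ z' t ∧ IsNullAt G z' t := by
  have h2 : (2 : WithTop ℕ∞) ≤ ∞ := two_le_infty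
  have hGd : ∀ y ∈ U, DifferentiableAt ℝ G y := fun y hy =>
    (hG.contDiffAt (hU.mem_nhds hy)).differentiableAt (by simp)
  have hinv : ∀ y ∈ U, ∀ v, (G y).inverse (G y v) = v := fun y hy v => by
    obtain ⟨e, he⟩ := isInvertible_of_injective (hnd y hy)
    rw [← he, ContinuousLinearMap.inverse_equiv]
    exact e.symm_apply_apply v
  have hinv' : ∀ y ∈ U, ∀ v, G y ((G y).inverse v) = v := fun y hy v => by
    obtain ⟨e, he⟩ := isInvertible_of_injective (hnd y hy)
    rw [← he, ContinuousLinearMap.inverse_equiv]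
    exact e.apply_symm_apply v
  have hF := contDiffOn_hamiltonField hU hG hnd
  have hopen : IsOpen (U ×ˢ (univ : Set (V →L[ℝ] ℝ))) := hU.prod isOpen_univ
  set ζ : ℝ → V →L[ℝ] ℝ := fun t => G (z t) (deriv z t) with hζ
  -- the momentum converges
  obtain ⟨M, hM⟩ : ∃ M, ∀ᶠ y in 𝓝 x, ‖fderiv ℝ G y‖ ≤ M := by
    have h1 : ContinuousAt (fun y => ‖fderiv ℝ G y‖) x :=
      ((hG.fderiv_of_isOpen hU (m := ∞) le_rfl).continuousOn.continuousAt (hU.mem_nhds hx)).norm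
    exact ⟨_, (h1.eventually (gt_mem_nhds (lt_add_one _))).mono fun y hy => hy.le⟩
  have hsol : ∀ᶠ t in 𝓝[<] b, HasDerivAt (fun t => (z t, ζ t)) (hamiltonField G (z t, ζ t)) t ∧
      ‖(hamiltonField G (z t, ζ t)).2‖ ≤ 1 / 2 * (M * C * C) := by
    filter_upwards [H, hz.eventually (hU.mem_nhds hx), hz.eventually hM] with t ht h6 h7
    obtain ⟨h3, h4, h5, -⟩ := ht
    have e1 : (G (z t)).inverse (ζ t) = deriv z t := hinv _ h6 _
    have e2 : hamiltonField G (z t, ζ t) = (deriv z t, (1 / 2 : ℝ) •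
        fderiv ℝ (fun x => G x (deriv z t) (deriv z t)) (z t)) := by
      simp only [hamiltonField, e1]
    rw [e2]
    refine ⟨(h3.differentiableAt (by simp)).hasDerivAt.prodMk
      (h4.hasDerivAt (h3.of_le h2) (hGd _ h6)), ?_⟩
    rw [norm_smul, Real.norm_of_nonneg (by norm_num)]
    refine mul_le_mul_of_nonneg_left (ContinuousLinearMap.opNorm_le_bound _ ?_ fun w => ?_)
      (by norm_num)
    · have := (norm_nonneg _).trans h7
      have := (norm_nonneg _).trans h5
      positivity
    · rw [fderiv_quadratic (hGd _ h6)]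
      calc ‖fderiv ℝ G (z t) w (deriv z t) (deriv z t)‖
          ≤ ‖fderiv ℝ G (z t) w‖ * ‖deriv z t‖ * ‖deriv z t‖ := ContinuousLinearMap.le_opNorm₂ _ _ _
        _ ≤ (M * ‖w‖) * C * C := by
          have := (norm_nonneg _).trans h7
          have := (norm_nonneg _).trans h5
          have h8 : ‖fderiv ℝ G (z t) w‖ ≤ M * ‖w‖ :=
            (ContinuousLinearMap.le_opNorm _ _).trans (by gcongr)
          gcongr
        _ = _ := by ring
  obtain ⟨a, hab, ha⟩ := (mem_nhdsLT_iff_exists_Ioo_subset (α := ℝ)).1 hsol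
  obtain ⟨ζ₀, hζ₀⟩ := exists_limit_of_bound (ζ := ζ) hab
    (fun t ht => (hasFDerivAt_snd.comp_hasDerivAt t (ha ht).1 :)) fun t ht => (ha ht).2
  -- the solution that starts at the limit
  have hFx := hF.contDiffAt (hopen.mem_nhds (show (x, ζ₀) ∈ _ from ⟨hx, trivial⟩))
  obtain ⟨α, hα0, ε, hε, hα⟩ :=
    (hFx.of_le (by simp)).exists_forall_mem_closedBall_exists_eq_forall_mem_Ioo_hasDerivAt₀ b
  set η : ℝ → V × (V →L[ℝ] ℝ) := fun t => if t < b then (z t, ζ t) else α t with hη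
  have hηl : ∀ t < b, η t = (z t, ζ t) := fun t ht => if_pos ht
  have hηr : ∀ t, b ≤ t → η t = α t := fun t ht => if_neg ht.not_gt
  have hηb : η b = (x, ζ₀) := (hηr b le_rfl).trans hα0
  have hder : ∀ᶠ t in 𝓝 b, HasDerivAt η (hamiltonField G (η t)) t := by
    have hl : ∀ᶠ t in 𝓝[<] b, HasDerivAt η (hamiltonField G (η t)) t := by
      filter_upwards [hsol, self_mem_nhdsWithin] with t ht htb
      rw [hηl t htb]
      exact ht.1.congr_of_eventuallyEq ((gt_mem_nhds htb).mono hηl)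
    have hb : HasDerivAt η (hamiltonField G (η b)) b := by
      refine hasDerivAt_of_left hl ?_ ?_ ?_
      · rw [hηb]
        exact (hz.prodMk_nhds hζ₀).congr' (eventually_nhdsWithin_of_forall fun t ht => (hηl t ht).symm)
      · rw [hηb]
        exact hFx.continuousAt
      · rw [hηr b le_rfl]
        exact (hα b ⟨by linarith, by linarith⟩).hasDerivWithinAt.congr (fun t ht => hηr t ht)
          (hηr b le_rfl)
    have hr : ∀ᶠ t in 𝓝[>] b, HasDerivAt η (hamiltonField G (η t)) t := by
      filter_upwards [self_mem_nhdsWithin, Ioo_mem_nhdsGT (show b < b + ε by linarith)] with t htb ht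
      rw [hηr t htb.le]
      exact (hα t ⟨by linarith [ht.1], ht.2⟩).congr_of_eventuallyEq
        ((lt_mem_nhds htb).mono fun s hs => hηr s hs.le)
    rw [← nhdsLT_sup_nhdsGE b, ← Ioi_insert, nhdsWithin_insert]
    exact ⟨hl, hb, hr⟩
  have hmem : ∀ᶠ t in 𝓝 b, η t ∈ U ×ˢ (univ : Set (V →L[ℝ] ℝ)) :=
    hder.self_of_nhds.continuousAt.eventually (hopen.mem_nhds (by rw [hηb]; exact ⟨hx, trivial⟩))
  obtain ⟨r, hr, hball⟩ := Metric.eventually_nhds_iff_ball.1 (hder.and hmem)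
  rw [Real.ball_eq_Ioo] at hball
  set N := Ioo (b - r) (b + r)
  have hsm : ContDiffOn ℝ ∞ η N :=
    contDiffOn_of_hasDerivAt hF isOpen_Ioo (fun t ht => (hball t ht).1) fun t ht => (hball t ht).2
  set z' : ℝ → V := fun t => (η t).1 with hz'
  have hz'l : ∀ t < b, z' t = z t := fun t ht => congrArg Prod.fst (hηl t ht)
  have hz's : ∀ t ∈ N, ContDiffAt ℝ ∞ z' t := fun t ht =>
    contDiffAt_fst.comp t (hsm.contDiffAt (isOpen_Ioo.mem_nhds ht))
  have hz'd : ∀ t ∈ N, deriv z' t = (G (z' t)).inverse (η t).2 := fun t ht =>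
    ((ContinuousLinearMap.fst ℝ V (V →L[ℝ] ℝ)).hasFDerivAt.comp_hasDerivAt t (hball t ht).1 :
      HasDerivAt z' (hamiltonField G (η t)).1 t).deriv
  have hmom : ∀ t ∈ N, G (z' t) (deriv z' t) = (η t).2 := fun t ht => by
    rw [hz'd t ht]
    exact hinv' _ (hball t ht).2.1 _
  have hEL : ∀ t ∈ N, HasDerivAt (fun t' => G (z' t') (deriv z' t'))
      ((1 / 2 : ℝ) • fderiv ℝ (fun x => G x (deriv z' t) (deriv z' t)) (z' t)) t := by
    intro t ht
    rw [hz'd t ht]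
    exact ((ContinuousLinearMap.snd ℝ V (V →L[ℝ] ℝ)).hasFDerivAt.comp_hasDerivAt t (hball t ht).1 :
      HasDerivAt (fun t => (η t).2) (hamiltonField G (η t)).2 t).congr_of_eventuallyEq
      (eventuallyEq_of_mem (isOpen_Ioo.mem_nhds ht) hmom)
  have hbm : b ∈ N := ⟨by linarith, by linarith⟩
  have hleft : ∀ᶠ t in 𝓝[<] b, t ∈ N ∧ z' =ᶠ[𝓝 t] z := by
    filter_upwards [self_mem_nhdsWithin, nhdsWithin_le_nhds (isOpen_Ioo.mem_nhds hbm)] with t ht ht'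
    exact ⟨ht', (gt_mem_nhds ht).mono hz'l⟩
  have hnull : ∀ t ∈ N, G (z' t) (deriv z' t) (deriv z' t) = 0 := by
    have hE : ∀ t ∈ N,
        HasDerivAt (fun t' => G (z' t') (deriv z' t') (deriv z' t')) 0 t := fun t ht =>
      hasDerivAt_energy ((hz's t ht).of_le h2) (hGd _ (hball t ht).2.1)
        (hsym _ (hball t ht).2.1) (hEL t ht)
    obtain ⟨e, he⟩ := isOpen_Ioo.exists_is_const_of_deriv_eq_zero isPreconnected_Ioo
      (fun t ht => (hE t ht).differentiableAt.differentiableWithinAt) fun t ht => (hE t ht).deriv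
    obtain ⟨t, ⟨ht, htz⟩, -, h4, -⟩ := (hleft.and H).exists
    have h5 := he t ht
    rw [htz.deriv_eq, htz.self_of_nhds, h4.2.1] at h5
    exact fun s hs => (he s hs).trans h5.symm
  have hcont : ContinuousAt (deriv z') b :=
    ((hz's b hbm).deriv_right (k := 0) (by simp)).continuousAt
  have hne : deriv z' b ≠ 0 := by
    intro h0
    have h3 : Tendsto (fun t => |l (deriv z' t)|) (𝓝[<] b) (𝓝 |l (deriv z' b)|) :=
      ((l.continuous.continuousAt.comp hcont).abs).tendsto.mono_left nhdsWithin_le_nhds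
    have h4 := ge_of_tendsto h3 ((hleft.and H).mono fun t ht => by
      rw [ht.1.2.deriv_eq]
      exact ht.2.2.2.2)
    rw [h0, map_zero, abs_zero] at h4
    linarith
  refine ⟨z', hz'l, ?_⟩
  filter_upwards [isOpen_Ioo.mem_nhds hbm, hcont.eventually_ne hne] with t ht ht0
  refine ⟨(hball t ht).2.1, hz's t ht, ht0, hnull t ht, fun w => ?_⟩
  refine ((hEL t ht).clm_apply (hasDerivAt_const t w)).congr_deriv ?_
  simp

end Extension

section Coordinates

variable {X : CompactManifoldWithBoundary.{u} m}
  {V : Type*} [NormedAddCommGroup V] [NormedSpace ℝ V]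
  {W : Type*} [NormedAddCommGroup W] [NormedSpace ℝ W]

/-- The metric `g` in the coordinates `Θ`. -/
def coordForm (g : BilinField X) (Θ : PartialDiffeomorph 𝓑 𝓘(ℝ, V) X V ∞) (z : V) :
    V →L[ℝ] V →L[ℝ] ℝ :=
  bilinPull (g (Θ.symm z)) (mfderiv 𝓘(ℝ, V) 𝓑 Θ.symm z)

theorem PartialDiffeomorph.mfderiv_bijective {E H M E' H' N : Type*} [NormedAddCommGroup E]
    [NormedSpace ℝ E] [TopologicalSpace H] [TopologicalSpace M] [ChartedSpace H M]
    {I : ModelWithCorners ℝ E H} [NormedAddCommGroup E'] [NormedSpace ℝ E'] [TopologicalSpace H']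
    [TopologicalSpace N] [ChartedSpace H' N] {I' : ModelWithCorners ℝ E' H'}
    (Φ : PartialDiffeomorph I I' M N ∞) {p : M} (hp : p ∈ Φ.source) :
    Bijective (mfderiv I I' Φ p) :=
  ((Φ.isLocalDiffeomorphAt _ _ _ hp).mfderivToContinuousLinearEquiv (by simp)).bijective

variable {g : BilinField X} {Θ : PartialDiffeomorph (𝓡∂ (m + 1)) 𝓘(ℝ, V) X V ∞}
  {Θ' : PartialDiffeomorph (𝓡∂ (m + 1)) 𝓘(ℝ, W) X W ∞}

theorem contDiffOn_coordForm [FiniteDimensional ℝ V] (hg : g.SmoothInterior)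
    (hΘ : Θ.source ⊆ X.interiorSet) : ContDiffOn ℝ ∞ (coordForm g Θ) Θ.target :=
  contDiffOn_param Θ.open_target Θ.contMDiffOn_invFun
    (ContMDiffOn.comp hg Θ.contMDiffOn_invFun fun _ hz => hΘ (Θ.map_target hz))

theorem coordForm_injective (hg : g.NondegInterior) (hΘ : Θ.source ⊆ X.interiorSet) {z : V}
    (hz : z ∈ Θ.target) : Injective (coordForm g Θ z) := by
  have hb := Θ.symm.mfderiv_bijective hz
  rw [injective_iff_map_eq_zero]
  intro v hv
  have h0 := hg _ (hΘ (Θ.map_target hz)) (mfderiv 𝓘(ℝ, V) 𝓑 Θ.symm z v) fun w => by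
    obtain ⟨w, rfl⟩ := hb.2 w
    exact congrArg (fun L : V →L[ℝ] ℝ => L w) hv
  exact hb.1 (h0.trans (map_zero _).symm)

/-- The equation of null geodesics in different coordinates. -/
theorem IsNullAt.coord_change [FiniteDimensional ℝ W] (hg : g.SmoothInterior)
    (hsym : ∀ p ∈ X.interiorSet, ∀ a b, g p a b = g p b a) (hΘ' : Θ'.source ⊆ X.interiorSet)
    {γ : ℝ → X} {t : ℝ} (hγ : ContMDiffAt 𝓘(ℝ, ℝ) 𝓑 ∞ γ t) (ht : γ t ∈ Θ.source)
    (ht' : γ t ∈ Θ'.source) (h : IsNullAt (coordForm g Θ) (Θ ∘ γ) t) :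
    IsNullAt (coordForm g Θ') (Θ' ∘ γ) t := by
  set Ψ := Θ.symm.trans Θ' with hΨ
  have hl : Θ.symm (Θ (γ t)) = γ t := Θ.left_inv ht
  have hsrc : Θ (γ t) ∈ Ψ.source := ⟨Θ.map_source ht, by
    change Θ.symm (Θ (γ t)) ∈ Θ'.source
    rwa [hl]⟩
  have hΨt : Ψ (Θ (γ t)) = Θ' (γ t) := congrArg Θ' hl
  have hz : ContDiffAt ℝ 2 (Θ ∘ γ) t := by
    rw [← contMDiffAt_iff_contDiffAt]
    exact ((Θ.contMDiffOn_toFun.contMDiffAt (Θ.open_source.mem_nhds ht)).comp t hγ).of_le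
      two_le_infty
  have hψ : ∀ x ∈ Ψ.source, ContDiffAt ℝ ∞ Ψ x := fun x hx =>
    contMDiffAt_iff_contDiffAt.1 (Ψ.contMDiffOn_toFun.contMDiffAt (Ψ.open_source.mem_nhds hx))
  have hcomp : (Ψ ∘ (Θ ∘ γ)) =ᶠ[𝓝 t] Θ' ∘ γ := by
    filter_upwards [hγ.continuousAt.eventually (Θ.open_source.mem_nhds ht)] with t' h1
    exact congrArg Θ' (Θ.left_inv h1)
  have hmem : Θ' (γ t) ∈ Θ'.target := Θ'.map_source ht'
  have hG' := (contDiffOn_coordForm hg hΘ').contDiffAt (Θ'.open_target.mem_nhds hmem)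
  have h1 := h.comp (ψ := Ψ) (G' := coordForm g Θ') hz ((hψ _ hsrc).of_le two_le_infty)
    (by rw [Function.comp_apply, hΨt]; exact hG'.differentiableAt (by simp)) (by
      intro a b
      exact hsym _ (hΘ' (Θ'.map_target (by rw [Function.comp_apply, hΨt]; exact hmem))) _ _) (by
      have := Ψ.mfderiv_bijective hsrc
      rwa [mfderiv_eq_fderiv] at this) ?_
  · exact h1.congr (Eventually.of_forall fun _ => rfl) hcomp
      (ContinuousAt.comp (f := Θ ∘ γ) (hψ _ hsrc).continuousAt hz.continuousAt)
  · filter_upwards [Ψ.open_source.mem_nhds hsrc] with x hx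
    have hx2 : Θ.symm x ∈ Θ'.source := hx.2
    have e1 : Θ'.symm (Ψ x) = Θ.symm x := Θ'.left_inv hx2
    have e2 : Θ.symm =ᶠ[𝓝 x] Θ'.symm ∘ Ψ := by
      filter_upwards [Ψ.open_source.mem_nhds hx] with y hy
      exact (Θ'.left_inv hy.2).symm
    have e3 := e2.mfderiv_eq (I := 𝓘(ℝ, V)) (I' := 𝓑)
    have e4 := mfderiv_comp x (Θ'.symm.mdifferentiableAt (by simp) (x := Ψ x)
      (Θ'.map_source hx2)) (Ψ.mdifferentiableAt (by simp) hx)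
    rw [mfderiv_eq_fderiv] at e4
    have key : ∀ v : V, (mfderiv 𝓘(ℝ, V) 𝓑 Θ.symm x v : 𝔼) =
        mfderiv 𝓘(ℝ, W) 𝓑 Θ'.symm (Ψ x) (fderiv ℝ Ψ x v) := fun v =>
      (congrArg (fun L : V →L[ℝ] 𝔼 => L v) e3).trans (congrArg (fun L : V →L[ℝ] 𝔼 => L v) e4)
    have e5 : ∀ (p q : X) (_ : p = q) (a a' b b' : 𝔼), a = b → a' = b' →
        (g p a a' : ℝ) = g q b b' := by
      rintro p _ rfl a a' _ _ rfl rfl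
      rfl
    exact ContinuousLinearMap.ext fun v => ContinuousLinearMap.ext fun w =>
      e5 _ _ e1.symm _ _ _ _ (key v) (key w)

theorem IsNullGeodesicOn.isNullAt [FiniteDimensional ℝ W] (hg : g.SmoothInterior)
    (hsym : ∀ p ∈ X.interiorSet, ∀ a b, g p a b = g p b a) (hΘ' : Θ'.source ⊆ X.interiorSet)
    {γ : ℝ → X} {J : Set ℝ} (hJ : IsOpen J) (h : IsNullGeodesicOn g γ J) {t : ℝ} (ht : t ∈ J)
    (ht' : γ t ∈ Θ'.source) : IsNullAt (coordForm g Θ') (Θ' ∘ γ) t :=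
  IsNullAt.coord_change (Θ := interiorCoord (γ t)) hg hsym hΘ' (h.1.contMDiffAt (hJ.mem_nhds ht))
    ⟨mem_extChartAt_source (γ t), (h.2 t ht).1⟩ ht' (h.2 t ht).2

theorem isNullGeodesicOn_of_isNullAt (hg : g.SmoothInterior)
    (hsym : ∀ p ∈ X.interiorSet, ∀ a b, g p a b = g p b a) {γ : ℝ → X} {J : Set ℝ}
    (h : ∀ t ∈ J, ContMDiffAt 𝓘(ℝ, ℝ) 𝓑 ∞ γ t ∧
      ∃ Θ : PartialDiffeomorph 𝓑 𝓘(ℝ, V) X V ∞, Θ.source ⊆ X.interiorSet ∧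
        γ t ∈ Θ.source ∧ IsNullAt (coordForm g Θ) (Θ ∘ γ) t) : IsNullGeodesicOn g γ J := by
  refine ⟨fun t ht => (h t ht).1.contMDiffWithinAt, fun t ht => ?_⟩
  obtain ⟨h1, Θ, hΘ, h2, h3⟩ := h t ht
  exact ⟨hΘ h2, IsNullAt.coord_change (Θ' := interiorCoord (γ t)) hg hsym inter_subset_right h1 h2
    ⟨mem_extChartAt_source (γ t), hΘ h2⟩ h3⟩

theorem IsMaximalNullGeodesic.comp_neg {γ : ℝ → X} {J : Set ℝ} (h : IsMaximalNullGeodesic g γ J) :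
    IsMaximalNullGeodesic g (fun t => γ (-t)) (Neg.neg ⁻¹' J) := by
  have hrev : ∀ {γ : ℝ → X} {J : Set ℝ}, IsNullGeodesicOn g γ J →
      IsNullGeodesicOn g (fun t => γ (-t)) (Neg.neg ⁻¹' J) := fun {γ J} h =>
    ⟨h.1.comp contDiff_neg.contMDiff.contMDiffOn subset_rfl, fun t ht => ⟨(h.2 (-t) ht).1,
      IsNullAt.comp_neg (G := coordForm g (interiorCoord (γ (-t))))
        (z := interiorCoord (γ (-t)) ∘ γ) (h.2 (-t) ht).2⟩⟩
  have hord : ∀ {J : Set ℝ}, J.OrdConnected → (Neg.neg ⁻¹' J).OrdConnected := fun hJ =>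
    ⟨fun a ha b hb c hc => hJ.out hb ha ⟨neg_le_neg hc.2, neg_le_neg hc.1⟩⟩
  obtain ⟨⟨t, ht⟩, h1, h2, h3, h4⟩ := h
  refine ⟨⟨-t, by simpa using ht⟩, h1.preimage continuous_neg, hord h2, hrev h3,
    fun J' γ' hJ' hc' hsub hγ' heq => ?_⟩
  have := h4 (Neg.neg ⁻¹' J') (fun t => γ' (-t)) (hJ'.preimage continuous_neg) (hord hc')
    (fun t ht => hsub (by simpa using ht)) (hrev hγ') fun t ht => by
      simpa using heq (x := -t) (by simpa using ht)
  rw [← this]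
  ext t
  simp

end Coordinates

/-! ### Bounds by a family of metrics -/

section Domination

variable {Y : ClosedManifold.{u} m}

theorem IsPosDefForm.nonneg {V : Type*} [AddCommGroup V] [Module ℝ V] [TopologicalSpace V]
    {b : V →L[ℝ] V →L[ℝ] ℝ} (hb : IsPosDefForm b) (v : V) : 0 ≤ b v v := by
  by_cases h : v = 0
  · rw [h, map_zero]
  · exact (hb.2 v h).le

/-- `k` is a family of Riemannian metrics on a neighbourhood `S` of `[0, 1]`. -/
structure IsMetricFamily (k : BilinFamily Y) (S : Set ℝ) : Prop where
  isOpen : IsOpen S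
  smooth : k.SmoothOnSet S
  subset : Icc 0 1 ⊆ S
  pos : ∀ R ∈ Icc (0 : ℝ) 1, ∀ y, IsPosDefForm (k R y)

variable {k : BilinFamily Y} {S : Set ℝ}

theorem exists_domination (hk : IsMetricFamily k S) {q : ℝ → ∀ y : Y, TangentSpace (𝓡 m) y → ℝ}
    (hq : ∀ R₀ ∈ Icc (0 : ℝ) 1, ∀ y₀ : Y, ∃ B : ℝ × Y → Eucl m →L[ℝ] Eucl m →L[ℝ] ℝ,
      ContinuousAt B (R₀, y₀) ∧ ∀ᶠ p in 𝓝 (R₀, y₀), ∀ v : Eucl m,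
        q p.1 p.2 (tangentFrame (𝓡 m) y₀ p.2 v) = B p v v) :
    ∃ C ≥ 0, ∀ R ∈ Icc (0 : ℝ) 1, ∀ (y : Y) (v : TangentSpace (𝓡 m) y),
      |q R y v| ≤ C * k R y v v := by
  have hc : IsCompact (Icc (0 : ℝ) 1 ×ˢ (univ : Set Y)) := isCompact_Icc.prod isCompact_univ
  suffices h : ∃ C ≥ 0, ∀ x ∈ Icc (0 : ℝ) 1 ×ˢ (univ : Set Y), x.1 ∈ Icc (0 : ℝ) 1 →
      ∀ v, |q x.1 x.2 v| ≤ C * k x.1 x.2 v v by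
    obtain ⟨C, hC, h⟩ := h
    exact ⟨C, hC, fun R hR y v => h (R, y) ⟨hR, trivial⟩ hR v⟩
  refine hc.induction_on (p := fun s => ∃ C ≥ 0, ∀ x ∈ s, x.1 ∈ Icc (0 : ℝ) 1 →
    ∀ v, |q x.1 x.2 v| ≤ C * k x.1 x.2 v v) ⟨0, le_rfl, fun x hx => hx.elim⟩
    (fun s t hst ⟨C, hC, h⟩ => ⟨C, hC, fun x hx => h x (hst hx)⟩) ?_ ?_
  · rintro s t ⟨C, hC, h⟩ ⟨C', hC', h'⟩
    refine ⟨max C C', le_max_of_le_left hC, fun x hx hx1 v => ?_⟩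
    have h0 := (hk.pos x.1 hx1 x.2).nonneg v
    rcases hx with hx | hx
    · exact (h x hx hx1 v).trans (mul_le_mul_of_nonneg_right (le_max_left _ _) h0)
    · exact (h' x hx hx1 v).trans (mul_le_mul_of_nonneg_right (le_max_right _ _) h0)
  · rintro ⟨R₀, y₀⟩ ⟨hR₀, -⟩
    obtain ⟨B, hB, hqB⟩ := hq R₀ hR₀ y₀
    have hkc : ContinuousAt (fun p : ℝ × Y => frameForm (I := 𝓡 m) y₀ p.2 (k p.1 p.2)) (R₀, y₀) :=
      ((hk.smooth (R₀, y₀) ⟨hk.subset hR₀, trivial⟩).frameForm.continuousWithinAt).continuousAt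
        ((hk.isOpen.prod isOpen_univ).mem_nhds ⟨hk.subset hR₀, trivial⟩)
    obtain ⟨c, hc0, hcv⟩ := exists_pos_bound
      ((frameForm_pos_iff (mem_chart_source (Eucl m) y₀)).2 (hk.pos R₀ hR₀ y₀).2)
    refine ⟨_, mem_nhdsWithin_of_mem_nhds ((hkc.eventually
      (Metric.ball_mem_nhds _ (half_pos hc0))).and
      ((hB.norm.eventually (gt_mem_nhds (lt_add_one _))).and (hqB.and
        (continuous_snd.continuousAt.eventually ((chartAt (Eucl m) y₀).open_source.mem_nhds
          (mem_chart_source _ _)))))), (‖B (R₀, y₀)‖ + 1) * (2 / c), by positivity, ?_⟩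
    rintro p ⟨h1, h2, h3, h4⟩ - v
    obtain ⟨v, rfl⟩ := (tangentFrame_bijective (I := 𝓡 m) h4).2 v
    rw [h3 v]
    have h5 : c / 2 * ‖v‖ ^ 2 ≤ k p.1 p.2 (tangentFrame (𝓡 m) y₀ p.2 v)
        (tangentFrame (𝓡 m) y₀ p.2 v) := by
      have e1 : ‖frameForm (I := 𝓡 m) y₀ p.2 (k p.1 p.2) - frameForm (I := 𝓡 m) y₀ y₀ (k R₀ y₀)‖ <
          c / 2 := by simpa [dist_eq_norm] using h1
      have e2 := ContinuousLinearMap.le_opNorm₂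
        (frameForm (I := 𝓡 m) y₀ p.2 (k p.1 p.2) - frameForm (I := 𝓡 m) y₀ y₀ (k R₀ y₀)) v v
      rw [Real.norm_eq_abs] at e2
      have e3 : (frameForm (I := 𝓡 m) y₀ p.2 (k p.1 p.2) -
          frameForm (I := 𝓡 m) y₀ y₀ (k R₀ y₀)) v v = k p.1 p.2 (tangentFrame (𝓡 m) y₀ p.2 v)
        (tangentFrame (𝓡 m) y₀ p.2 v) - frameForm (I := 𝓡 m) y₀ y₀ (k R₀ y₀) v v := rfl
      rw [e3] at e2
      have e4 := neg_abs_le (k p.1 p.2 (tangentFrame (𝓡 m) y₀ p.2 v)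
        (tangentFrame (𝓡 m) y₀ p.2 v) - frameForm (I := 𝓡 m) y₀ y₀ (k R₀ y₀) v v)
      have e5 := hcv v
      have e6 := mul_le_mul_of_nonneg_right e1.le (sq_nonneg ‖v‖)
      nlinarith
    have h6 : |B p v v| ≤ (‖B (R₀, y₀)‖ + 1) * ‖v‖ ^ 2 := by
      refine (ContinuousLinearMap.le_opNorm₂ (B p) v v).trans ?_
      rw [mul_assoc, ← sq]
      exact mul_le_mul_of_nonneg_right h2.le (sq_nonneg _)
    refine h6.trans ?_
    rw [mul_assoc]
    refine mul_le_mul_of_nonneg_left ?_ (by positivity)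
    rw [div_mul_eq_mul_div, le_div_iff₀ hc0]
    linarith

theorem exists_differential_bound (hk : IsMetricFamily k S) {f : Y → ℝ}
    (hf : ContMDiff (𝓡 m) 𝓘(ℝ, ℝ) ∞ f) : ∃ C ≥ 0, ∀ R ∈ Icc (0 : ℝ) 1, ∀ (y : Y)
      (v : TangentSpace (𝓡 m) y), diffAt (𝓡 m) f y v ^ 2 ≤ C * k R y v v := by
  obtain ⟨C, hC, h⟩ := exists_domination hk (q := fun _ y v => diffSq (𝓡 m) f y v v) fun R₀ _ y₀ =>
      ⟨fun p => frameForm (I := 𝓡 m) y₀ p.2 (diffSq (𝓡 m) f p.2), by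
        have h1 := (contMDiffAt_diffSq (q₀ := y₀) isOpen_univ hf.contMDiffOn
          trivial).contMDiffWithinAt (s := univ)
        have h2 := h1.frameForm.continuousWithinAt
        rw [continuousWithinAt_univ] at h2
        exact ContinuousAt.comp (x := (R₀, y₀)) (f := Prod.snd) h2 continuous_snd.continuousAt,
        Eventually.of_forall fun p v => rfl⟩
  refine ⟨C, hC, fun R hR y v => ?_⟩
  rw [sq]
  exact (le_abs_self _).trans (h R hR y v)

theorem continuousAt_deriv_fst {F : Type*} [NormedAddCommGroup F] [NormedSpace ℝ F]
    {Φ : ℝ × Y → F} {x₀ : ℝ × Y} (hΦ : ContMDiffAt 𝓒 𝓘(ℝ, F) ∞ Φ x₀) :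
    ContinuousAt (fun p : ℝ × Y => deriv (fun s => Φ (s, p.2)) p.1) x₀ ∧
      ∀ᶠ p in 𝓝 x₀, DifferentiableAt ℝ (fun s => Φ (s, p.2)) p.1 := by
  set e := extChartAt 𝓒 x₀ with he
  set Φ' : ℝ × Eucl m → F := Φ ∘ e.symm with hΦ'
  have h1 : ContDiffAt ℝ ∞ Φ' (e x₀) := by
    have := (contMDiffAt_iff.1 hΦ).2
    rw [show range 𝓒 = univ from ModelWithCorners.range_eq_univ _, contDiffWithinAt_univ] at this
    exact this
  have hec : ContinuousAt e x₀ := continuousAt_extChartAt x₀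
  have hsrc : ∀ᶠ p in 𝓝 x₀, p.2 ∈ (extChartAt (𝓡 m) x₀.2).source ∧ ContDiffAt ℝ 1 Φ' (e p) :=
    (continuous_snd.continuousAt.eventually (extChartAt_source_mem_nhds x₀.2)).and
      (hec.eventually ((h1.of_le (by simp)).eventually (by simp)))
  have hfun : ∀ p : ℝ × Y, p.2 ∈ (extChartAt (𝓡 m) x₀.2).source →
      (fun s => Φ (s, p.2)) = fun s => Φ' (s, extChartAt (𝓡 m) x₀.2 p.2) := by
    intro p hp
    funext s
    change Φ (s, p.2) = Φ (e.symm (s, extChartAt (𝓡 m) x₀.2 p.2))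
    rw [he, extChartAt_prod]
    exact congrArg Φ (Prod.ext rfl ((extChartAt (𝓡 m) x₀.2).left_inv hp).symm)
  have hder : ∀ᶠ p in 𝓝 x₀, HasDerivAt (fun s => Φ (s, p.2)) (fderiv ℝ Φ' (e p) (1, 0)) p.1 := by
    filter_upwards [hsrc] with p hp
    rw [hfun p hp.1]
    have hep : e p = (p.1, extChartAt (𝓡 m) x₀.2 p.2) := by rw [he, extChartAt_prod]; rfl
    have h2 := (hp.2.differentiableAt (by simp)).hasFDerivAt
    rw [hep] at h2 ⊢
    exact HasFDerivAt.comp_hasDerivAt (f := fun s => (s, extChartAt (𝓡 m) x₀.2 p.2)) p.1 h2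
      ((hasDerivAt_id p.1).prodMk (hasDerivAt_const _ _))
  refine ⟨?_, hder.mono fun p hp => hp.differentiableAt⟩
  have h3 : ContinuousAt (fun p => fderiv ℝ Φ' (e p) ((1, 0) : ℝ × Eucl m)) x₀ :=
    (ContinuousAt.comp (f := e) (h1.fderiv_right (m := 0) (by simp)).continuousAt hec).clm_apply
      continuousAt_const
  exact h3.congr (hder.mono fun p hp => hp.deriv.symm)

theorem exists_deriv_bound (hk : IsMetricFamily k S) : ∃ C ≥ 0,
    ∀ R ∈ Icc (0 : ℝ) 1, ∀ (y : Y) (v : TangentSpace (𝓡 m) y),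
      DifferentiableAt ℝ (fun s => k s y v v) R ∧
      |deriv (fun s => k s y v v) R| ≤ C * k R y v v := by
  have hΦ : ∀ R ∈ Icc (0 : ℝ) 1, ∀ y₀ : Y, ContMDiffAt 𝓒 _ ∞
      (fun p : ℝ × Y => frameForm (I := 𝓡 m) y₀ p.2 (k p.1 p.2)) (R, y₀) := fun R hR y₀ =>
    ((hk.smooth (R, y₀) ⟨hk.subset hR, trivial⟩).frameForm).contMDiffAt
      ((hk.isOpen.prod isOpen_univ).mem_nhds ⟨hk.subset hR, trivial⟩)
  have happ : ∀ (y₀ : Y) (p : ℝ × Y) (v : Eucl m), DifferentiableAt ℝ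
      (fun s => frameForm (I := 𝓡 m) y₀ p.2 (k s p.2)) p.1 → HasDerivAt
      (fun s => k s p.2 (tangentFrame (𝓡 m) y₀ p.2 v) (tangentFrame (𝓡 m) y₀ p.2 v))
      (deriv (fun s => frameForm (I := 𝓡 m) y₀ p.2 (k s p.2)) p.1 v v) p.1 := by
    intro y₀ p v h
    have := (h.hasDerivAt.clm_apply (hasDerivAt_const p.1 v)).clm_apply (hasDerivAt_const p.1 v)
    simp only [map_zero, add_zero] at this
    exact this
  obtain ⟨C, hC, h⟩ := exists_domination hk
    (q := fun R y v => deriv (fun s => k s y v v) R) fun R₀ hR₀ y₀ =>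
      ⟨fun p => deriv (fun s => frameForm (I := 𝓡 m) y₀ p.2 (k s p.2)) p.1,
        (continuousAt_deriv_fst (hΦ R₀ hR₀ y₀)).1,
        (continuousAt_deriv_fst (hΦ R₀ hR₀ y₀)).2.mono fun p hp v => (happ y₀ p v hp).deriv⟩
  refine ⟨C, hC, fun R hR y v => ⟨?_, h R hR y v⟩⟩
  obtain ⟨v, rfl⟩ := (tangentFrame_bijective (I := 𝓡 m) (mem_chart_source (Eucl m) y)).2 v
  exact (happ y (R, y) v (continuousAt_deriv_fst (hΦ R hR y)).2.self_of_nhds).differentiableAt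

end Domination

/-! ### Lorentzian metrics on cylinders -/

section CylinderMetric

variable {Y : ClosedManifold.{u} m} {k : BilinFamily Y} {S : Set ℝ}

/-- The coordinates on the cylinder. -/
def cylMap (p : Y.cylinder) : ℝ × Y := (cylR p, cylY p)

theorem contMDiff_cylMap : ContMDiff 𝓑 𝓒 ∞ (cylMap (Y := Y)) :=
  contMDiff_cylR.prodMk contMDiff_cylY

theorem injective_mfderiv_cylMap (p : Y.cylinder) : Injective (mfderiv 𝓑 𝓒 cylMap p) := by
  obtain ⟨r, hr⟩ : ∃ r : Bool, p ∈ (cylCollar Y r one_pos).φ.target := by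
    by_cases h : cylR p < 1
    · exact ⟨false, h⟩
    · refine ⟨true, ?_⟩
      change 1 - cylR p < 1
      linarith
  set c := cylCollar Y r one_pos
  have hT : ContMDiff 𝓒 𝓒 ∞ (fun q : ℝ × Y => (1 * flipIf r q.1, q.2)) :=
    ((contDiff_const.mul (contDiff_flipIf r)).contMDiff.comp contMDiff_fst).prodMk contMDiff_snd
  have h1 := mfderiv_comp p (hT.mdifferentiable (by simp) (cylMap p))
    (contMDiff_cylMap.mdifferentiable (by simp) p)
  have h2 : Injective (mfderiv 𝓑 𝓒 c.φ.symm p) := by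
    have h3 := c.φ.right_inv hr
    intro v w hvw
    have h4 : ∀ v : TangentSpace 𝓑 p, (c.deriv (c.φ.symm p)
        (mfderiv 𝓑 𝓒 c.φ.symm p v) : 𝔼) = v := by
      have := c.deriv_mfderiv_symm (c.φ.map_target hr)
      rw [h3] at this
      exact this
    exact (h4 v).symm.trans ((congrArg (c.deriv (c.φ.symm p)) hvw).trans (h4 w))
  intro v w hvw
  refine h2 ((congrArg (fun L => L v) h1).trans (Eq.trans ?_ (congrArg (fun L => L w) h1).symm))
  exact congrArg (mfderiv 𝓒 𝓒 _ (cylMap p)) hvw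

theorem bijective_mfderiv_cylMap (p : Y.cylinder) : Bijective (mfderiv 𝓑 𝓒 cylMap p) := by
  have hd : Module.finrank ℝ 𝔼 = Module.finrank ℝ (ℝ × Eucl m) := by simp [add_comm]
  exact ⟨injective_mfderiv_cylMap p, (LinearMap.injective_iff_surjective_of_finrank_eq_finrank
    (f := (mfderiv 𝓑 𝓒 cylMap p :
      𝔼 →L[ℝ] ℝ × Eucl m).toLinearMap) hd).1 (injective_mfderiv_cylMap p)⟩

/-- The form `dR² - k(R)`. -/
def cylForm (k : BilinFamily Y) : BilinField Y.cylinder := fun p =>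
  bilinPull (prodForm (cylMap p) ((-1 : ℝ) • k (cylMap p).1 (cylMap p).2)) (mfderiv 𝓑 𝓒 cylMap p)

theorem smooth_cylForm (hk : IsMetricFamily k S) : (cylForm k).Smooth := by
  intro p
  have hk' : BilinFamily.SmoothOnSet (fun R y => (-1 : ℝ) • k R y) S := fun q hq =>
    ContMDiffWithinAt.bilinAlong_smul contMDiffWithinAt_const (hk.smooth q hq)
  exact contMDiffAt_bilinPull isOpen_univ contMDiff_cylMap.contMDiffOn trivial
    (ContMDiffAt.comp p (contMDiffAt_prodForm hk.isOpen hk' (hk.subset (cylR_mem p))) (contMDiff_cylMap p))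

theorem isLorentzForm_cylForm {k : BilinFamily Y} (p : Y.cylinder)
    (hpos : IsPosDefForm (k (cylR p) (cylY p))) : IsLorentzForm (cylForm k p) := by
  refine IsLorentzForm.bilinPull ?_ (bijective_mfderiv_cylMap p)
  have happ := prodForm_apply (cylMap p) ((-1 : ℝ) • k (cylMap p).1 (cylMap p).2)
  refine ⟨fun v w => ?_, ((1, 0) : ℝ × Eucl m), ?_, fun w hw hw0 => ?_⟩
  · rw [happ, happ]
    exact congrArg₂ (· + ·) (mul_comm _ _) (congrArg (fun a : ℝ => -1 * a) (hpos.1 _ _))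
  · refine lt_of_lt_of_eq ?_ (happ _ _).symm
    change (0 : ℝ) < 1 * 1 + -1 * k (cylR p) (cylY p) 0 0
    simp
  · have h := (happ _ w).symm.trans hw
    have h1 : (w.1 : ℝ) = 0 := by
      change (1 : ℝ) * w.1 + -1 * k (cylR p) (cylY p) 0 w.2 = 0 at h
      have h0 : k (cylR p) (cylY p) 0 w.2 = 0 :=
        congrArg (fun L => L w.2) (k (cylR p) (cylY p)).map_zero
      linarith
    have h2 : w.2 ≠ 0 := fun h2 => hw0 (Prod.ext h1 h2)
    have h3 := hpos.2 _ h2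
    refine lt_of_eq_of_lt (happ w w) ?_
    change (w.1 * w.1 + -1 * k (cylR p) (cylY p) w.2 w.2 : ℝ) < 0
    rw [h1]
    linarith

theorem cylForm_mfderiv {E H N : Type*} [NormedAddCommGroup E] [NormedSpace ℝ E]
    [TopologicalSpace H] {I : ModelWithCorners ℝ E H} [TopologicalSpace N] [ChartedSpace H N]
    (k : BilinFamily Y) {f : N → Y.cylinder} {q : N} (hf : MDifferentiableAt I 𝓑 f q)
    {φ : N → ℝ × Y} (hφ : cylMap ∘ f =ᶠ[𝓝 q] φ) {D : TangentSpace I q →L[ℝ] ℝ × Eucl m}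
    (hD : HasMFDerivAt I 𝓒 φ q D) (v w : TangentSpace I q) :
    cylForm k (f q) (mfderiv I 𝓑 f q v) (mfderiv I 𝓑 f q w) =
      (D v).1 * (D w).1 - k (φ q).1 (φ q).2 (D v).2 (D w).2 := by
  have h1 := (contMDiff_cylMap.mdifferentiable (by simp) (f q)).hasMFDerivAt.comp q hf.hasMFDerivAt
  have h2 := hasMFDerivAt_unique (h1.congr_of_eventuallyEq hφ.symm) hD
  have h3 : ∀ v, (mfderiv 𝓑 𝓒 cylMap (f q)
      (mfderiv I 𝓑 f q v) : ℝ × Eucl m) = D v := fun v => congrArg (fun L => L v) h2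
  have e : ∀ (p p' : ℝ × Y) (_ : p = p') (a a' b b' : ℝ × Eucl m), a = b → a' = b' →
      (prodForm p ((-1 : ℝ) • k p.1 p.2) a a' : ℝ) = b.1 * b'.1 - k p'.1 p'.2 b.2 b'.2 := by
    rintro p _ rfl a a' _ _ rfl rfl
    refine (prodForm_apply p ((-1 : ℝ) • k p.1 p.2) a a').trans ?_
    change a.1 * a'.1 + -1 * k p.1 p.2 a.2 a'.2 = _
    ring
  exact e _ _ hφ.self_of_nhds _ _ _ _ (h3 v) (h3 w)

/-- A function on `[0, 1]` that is the distance to the ends near these. -/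
def cylX (t : ℝ) : ℝ := t + (1 - 2 * t) * Real.smoothTransition (3 * t - 1)

theorem contDiff_cylX : ContDiff ℝ ∞ cylX :=
  contDiff_id.add ((contDiff_const.sub (contDiff_const.mul contDiff_id)).mul
    (Real.smoothTransition.contDiff.comp ((contDiff_const.mul contDiff_id).sub contDiff_const)))

theorem cylX_flipIf (r : Bool) {t : ℝ} (ht : t ≤ 1 / 3) : cylX (flipIf r t) = t := by
  cases r
  · simp only [cylX, flipIf]
    rw [Real.smoothTransition.zero_of_nonpos]
    · simp
    · simp only [Bool.false_eq_true, if_false]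
      linarith
  · simp only [cylX, flipIf, if_true]
    rw [Real.smoothTransition.one_of_one_le (by linarith)]
    ring

theorem cylX_pos {t : ℝ} (ht : t ∈ Ioo (0 : ℝ) 1) : 0 < cylX t := by
  have h0 := Real.smoothTransition.nonneg (3 * t - 1)
  have h1 := Real.smoothTransition.le_one (3 * t - 1)
  have h2 := ht.1
  have h3 := ht.2
  unfold cylX
  rcases h0.eq_or_lt with h | h
  · rw [← h]
    linarith
  · nlinarith [mul_nonneg h2.le (sub_nonneg.2 h1), mul_pos h (sub_pos.2 h3)]

theorem abs_cylX_le {t : ℝ} (ht : t ∈ Ioo (-1 : ℝ) 2) : |cylX t| ≤ 1 := by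
  rcases lt_or_ge t (1 / 3) with h | h
  · have h1 : cylX t = t := cylX_flipIf false h.le
    rw [h1, abs_le]
    exact ⟨ht.1.le, by linarith⟩
  rcases lt_or_ge (2 / 3) t with h' | h'
  · have h1 : cylX (1 - (1 - t)) = 1 - t := cylX_flipIf true (by linarith)
    rw [sub_sub_cancel] at h1
    rw [h1, abs_le]
    exact ⟨by linarith [ht.2], by linarith⟩
  · have h0 := Real.smoothTransition.nonneg (3 * t - 1)
    have h1 := Real.smoothTransition.le_one (3 * t - 1)
    rw [abs_le]
    unfold cylX
    constructor <;> nlinarith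

/-- The metric `(dR² - k(R)) / x(R)²`. -/
def cylMetric (k : BilinFamily Y) : BilinField Y.cylinder := fun p =>
  ((cylX (cylR p)) ^ 2)⁻¹ • cylForm k p

/-- Product coordinates on the cylinder. -/
def cylCoord (y : Y) :
    PartialDiffeomorph 𝓑 𝓘(ℝ, ℝ × Eucl m) Y.cylinder (ℝ × Eucl m) ∞ where
  toFun p := (cylR p, extChartAt (𝓡 m) y (cylY p))
  invFun z := cylPt (z.1, (extChartAt (𝓡 m) y).symm z.2)
  source := cylR ⁻¹' Ioo 0 1 ∩ cylY ⁻¹' (extChartAt (𝓡 m) y).source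
  target := Ioo 0 1 ×ˢ (extChartAt (𝓡 m) y).target
  map_source' p hp := ⟨hp.1, (extChartAt (𝓡 m) y).map_source hp.2⟩
  map_target' z hz := ⟨by
    rw [mem_preimage, cylR_cylPt (Ioo_subset_Icc_self hz.1)]
    exact hz.1, (extChartAt (𝓡 m) y).map_target hz.2⟩
  left_inv' p hp := by
    rw [(extChartAt (𝓡 m) y).left_inv hp.2]
    exact cylPt_eta p
  right_inv' z hz := by
    rw [cylR_cylPt (Ioo_subset_Icc_self hz.1)]
    exact Prod.ext rfl ((extChartAt (𝓡 m) y).right_inv hz.2)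
  open_source := (isOpen_Ioo.preimage contMDiff_cylR.continuous).inter
    ((isOpen_extChartAt_source y).preimage contMDiff_cylY.continuous)
  open_target := isOpen_Ioo.prod (isOpen_extChartAt_target y)
  contMDiffOn_toFun := contMDiff_cylR.contMDiffOn.prodMk_space
    ((contMDiffOn_extChartAt (x := y) (n := ∞)).comp contMDiff_cylY.contMDiffOn fun p hp => by
      rw [mem_preimage, ← extChartAt_source (𝓡 m)]
      exact hp.2)
  contMDiffOn_invFun := contMDiffOn_cylPt_comp contDiff_fst.contMDiff.contMDiffOn
    ((contMDiffOn_extChartAt_symm y).comp contDiff_snd.contMDiff.contMDiffOn fun z hz => hz.2)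
    fun z hz => Ioo_subset_Icc_self hz.1

theorem cylCoord_source_subset (y : Y) : (cylCoord y).source ⊆ Y.cylinder.interiorSet :=
  fun _ hp => mem_interiorSet_cylinder.2 hp.1

theorem coordForm_cylMetric (k : BilinFamily Y) (y : Y) {z : ℝ × Eucl m}
    (hz : z ∈ (cylCoord y).target) (v w : ℝ × Eucl m) :
    coordForm (cylMetric k) (cylCoord y) z v w = ((cylX z.1) ^ 2)⁻¹ * (v.1 * w.1 -
      k z.1 ((extChartAt (𝓡 m) y).symm z.2)
        (mfderiv 𝓘(ℝ, Eucl m) (𝓡 m) (extChartAt (𝓡 m) y).symm z.2 v.2)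
        (mfderiv 𝓘(ℝ, Eucl m) (𝓡 m) (extChartAt (𝓡 m) y).symm z.2 w.2)) := by
  have hχ : HasMFDerivAt 𝓘(ℝ, Eucl m) (𝓡 m) (extChartAt (𝓡 m) y).symm z.2
      (mfderiv 𝓘(ℝ, Eucl m) (𝓡 m) (extChartAt (𝓡 m) y).symm z.2) :=
    (((contMDiffOn_extChartAt_symm (n := ∞) y).contMDiffAt
      ((isOpen_extChartAt_target y).mem_nhds hz.2)).mdifferentiableAt (by simp)).hasMFDerivAt
  have h1 : HasMFDerivAt 𝓘(ℝ, ℝ × Eucl m) 𝓘(ℝ, ℝ) (Prod.fst : ℝ × Eucl m → ℝ) z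
    (ContinuousLinearMap.fst ℝ ℝ (Eucl m)) := hasFDerivAt_fst.hasMFDerivAt
  have h2 : HasMFDerivAt 𝓘(ℝ, ℝ × Eucl m) 𝓘(ℝ, Eucl m) (Prod.snd : ℝ × Eucl m → Eucl m) z
    (ContinuousLinearMap.snd ℝ ℝ (Eucl m)) := hasFDerivAt_snd.hasMFDerivAt
  have hD := h1.prodMk (hχ.comp z h2)
  have hR : cylR ((cylCoord y).symm z) = z.1 := cylR_cylPt (Ioo_subset_Icc_self hz.1)
  have h3 := cylForm_mfderiv k ((cylCoord y).symm.mdifferentiableAt (by simp) hz) (φ := _) (by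
    filter_upwards [(cylCoord y).open_target.mem_nhds hz] with z' hz'
    exact Prod.ext (cylR_cylPt (Ioo_subset_Icc_self hz'.1)) rfl) hD v w
  change ((cylX (cylR ((cylCoord y).symm z))) ^ 2)⁻¹ * _ = _
  rw [hR]
  exact congrArg _ h3

end CylinderMetric

section CylinderSpace

variable {Y : ClosedManifold.{u} m}

theorem cylX_eq_zero_iff (p : Y.cylinder) : cylX (cylR p) = 0 ↔ p ∈ Y.cylinder.boundarySet := by
  rw [mem_boundarySet_cylinder]
  constructor
  · intro h
    by_contra! h'
    exact (cylX_pos ⟨(cylR_mem p).1.lt_of_ne' h'.1, (cylR_mem p).2.lt_of_ne h'.2⟩).ne' h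
  · have h0 : cylX 0 = 0 := cylX_flipIf false (by norm_num)
    have h1 : cylX (1 - 0) = 0 := cylX_flipIf true (by norm_num)
    rw [sub_zero] at h1
    rintro (h | h) <;> rw [h] <;> assumption

theorem deriv_cylX_sq {t : ℝ} (ht : t = 0 ∨ t = 1) : deriv cylX t * deriv cylX t = 1 := by
  rcases ht with rfl | rfl
  · have h : cylX =ᶠ[𝓝 0] id := by
      filter_upwards [Iio_mem_nhds (show (0 : ℝ) < 1 / 3 by norm_num)] with t ht
      exact cylX_flipIf false (le_of_lt ht)
    rw [h.deriv_eq, deriv_id, one_mul]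
  · have h : cylX =ᶠ[𝓝 1] fun t => 1 - t := by
      filter_upwards [Ioi_mem_nhds (show (2 / 3 : ℝ) < 1 by norm_num)] with t ht
      have h1 : cylX (1 - (1 - t)) = 1 - t :=
        cylX_flipIf true (by linarith [mem_Ioi.1 ht])
      rwa [sub_sub_cancel] at h1
    rw [h.deriv_eq, deriv_const_sub, deriv_id'']
    norm_num

theorem contMDiff_cylX {a : ℝ} : ContMDiff 𝓑 𝓘(ℝ, ℝ) ∞ (fun p : Y.cylinder => a * cylX (cylR p)) :=
  (contDiff_const.mul contDiff_cylX).contMDiff.comp contMDiff_cylR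

theorem unitDifferentialAt_cylinder {a : ℝ} (ha : 0 < a) (k : BilinFamily Y) {p : Y.cylinder}
    (hp : p ∈ Y.cylinder.boundarySet) :
    UnitDifferentialAt (fun p => a ^ 2 • cylForm k p) (fun p => a * cylX (cylR p)) p := by
  have hd := deriv_cylX_sq (mem_boundarySet_cylinder.1 hp)
  set d := deriv cylX (cylR p)
  have h1 : HasMFDerivAt 𝓑 𝓘(ℝ, ℝ) (fun p : Y.cylinder => a * cylX (cylR p)) p
      (((a * d) • ContinuousLinearMap.fst ℝ ℝ (Eucl m)).comp (mfderiv 𝓑 𝓒 cylMap p)) := by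
    have h2 : HasMFDerivAt 𝓘(ℝ, ℝ) 𝓘(ℝ, ℝ) (fun t => a * cylX t) (cylR p)
        ((1 : ℝ →L[ℝ] ℝ).smulRight (a * d)) :=
      (((contDiff_cylX.differentiable (by simp) (cylR p)).hasDerivAt.const_mul
        a).hasFDerivAt).hasMFDerivAt
    have h3 : HasMFDerivAt 𝓒 𝓘(ℝ, ℝ) (Prod.fst : ℝ × Y → ℝ) (cylMap p)
        (ContinuousLinearMap.fst ℝ ℝ (Eucl m)) := hasMFDerivAt_fst _
    have h4 := (h2.comp (cylMap p) h3).comp p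
      (contMDiff_cylMap.mdifferentiable (by simp) p).hasMFDerivAt
    have e : (a * d) • ContinuousLinearMap.fst ℝ ℝ (Eucl m) =
        ((1 : ℝ →L[ℝ] ℝ).smulRight (a * d)).comp (ContinuousLinearMap.fst ℝ ℝ (Eucl m)) :=
      ContinuousLinearMap.ext fun v => mul_comm _ _
    rw [e]
    exact h4
  obtain ⟨v, hv⟩ := (bijective_mfderiv_cylMap p).2 ((d / a, 0) : ℝ × Eucl m)
  have h5 : ∀ w, cylForm k p v w = d / a * (mfderiv 𝓑 𝓒 cylMap p w : ℝ × Eucl m).1 := by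
    intro w
    refine (prodForm_apply (cylMap p) ((-1 : ℝ) • k (cylMap p).1 (cylMap p).2) _ _).trans ?_
    have e : ∀ (b b' : ℝ × Eucl m), b = (d / a, 0) →
        b.1 * b'.1 + -1 * k (cylR p) (cylY p) b.2 b'.2 = d / a * b'.1 := by
      rintro _ b' rfl
      have : k (cylR p) (cylY p) 0 b'.2 = 0 :=
        congrArg (fun L => L b'.2) (k (cylR p) (cylY p)).map_zero
      change d / a * b'.1 + -1 * k (cylR p) (cylY p) 0 b'.2 = _
      rw [this]
      ring
    exact e _ _ hv
  have h6 : a ^ 2 * (d / a) = a * d := by field_simp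
  refine ⟨v, fun w => ?_, ?_⟩
  · rw [h1.mfderiv]
    change a ^ 2 * cylForm k p v w = _
    rw [h5, ← mul_assoc, h6]
    rfl
  · change a ^ 2 * cylForm k p v v = _
    rw [h5, ← mul_assoc, h6, show (mfderiv 𝓑 𝓒 cylMap p v :
      ℝ × Eucl m).1 = d / a from congrArg Prod.fst hv]
    field_simp
    rw [pow_two, hd]

theorem isConformallyCompact_cylMetric {a : ℝ} (ha : 0 < a) {k : BilinFamily Y} {S : Set ℝ}
    (hk : IsMetricFamily k S) :
    IsConformallyCompact (fun _ b => IsLorentzForm b) (cylMetric k)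
      (fun p => a * cylX (cylR p)) := by
  have hz : ∀ p : Y.cylinder, a * cylX (cylR p) = 0 ↔ p ∈ Y.cylinder.boundarySet := fun p => by
    rw [mul_eq_zero, or_iff_right ha.ne', cylX_eq_zero_iff]
  refine ⟨⟨contMDiff_cylX, fun p => ?_, hz, fun p hp h0 => ?_⟩, fun p => a ^ 2 • cylForm k p,
    fun p => ?_, fun p => ?_, fun p hp => ?_, fun p hp => unitDifferentialAt_cylinder ha k hp⟩
  · by_cases hp : p ∈ Y.cylinder.boundarySet
    · exact ((hz p).2 hp).ge
    · refine mul_nonneg ha.le (cylX_pos ?_).le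
      rw [mem_boundarySet_cylinder, not_or] at hp
      exact ⟨(cylR_mem p).1.lt_of_ne' hp.1, (cylR_mem p).2.lt_of_ne hp.2⟩
  · obtain ⟨v, hv, hv'⟩ := unitDifferentialAt_cylinder ha k hp
    have := (hv v).symm.trans hv'
    rw [h0] at this
    exact zero_ne_one (α := ℝ) this
  · exact ContMDiffWithinAt.bilinAlong_smul contMDiffWithinAt_const (smooth_cylForm hk p)
  · obtain ⟨h1, v, hv, h2⟩ := isLorentzForm_cylForm (k := k) p (hk.pos _ (cylR_mem p) _)
    have ha2 : 0 < a ^ 2 := by positivity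
    refine ⟨fun v w => congrArg (a ^ 2 * ·) (h1 v w), v, mul_pos ha2 hv, fun w hw hw0 => ?_⟩
    exact mul_neg_of_pos_of_neg ha2 (h2 w ((mul_eq_zero.1 hw).resolve_left ha2.ne') hw0)
  · have h : (((a * cylX (cylR p)) ^ 2)⁻¹ * a ^ 2 : ℝ) = ((cylX (cylR p)) ^ 2)⁻¹ := by
      field_simp
    exact (congrArg (· • cylForm k p) h).symm.trans (mul_smul _ _ _)

theorem boundarySet_cylinder {a b : ℝ} (ha : 0 < a) (hb : 0 < b) :
    Y.cylinder.boundarySet = (cylCollar Y false ha).base ∪ (cylCollar Y true hb).base := by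
  ext p
  rw [mem_union, mem_base_cylCollar, mem_base_cylCollar, mem_boundarySet_cylinder]
  simp only [flipIf, if_true, Bool.false_eq_true, if_false]
  rw [sub_eq_zero, eq_comm (a := (1 : ℝ))]

theorem disjoint_cylinder {a b : ℝ} (ha : 0 < a) (hb : 0 < b) :
    Disjoint (cylCollar Y false ha).base (cylCollar Y true hb).base := by
  rw [disjoint_left]
  intro p hp hp'
  rw [mem_base_cylCollar] at hp hp'
  simp only [flipIf, if_true, Bool.false_eq_true, if_false] at hp hp'
  linarith

/-- The family of metrics on the cylinder determined by a family of metrics on its ends. -/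
def cylFamily (a : ℝ) (h : BilinFamily Y) : BilinFamily Y :=
  fun R y => (a ^ 2)⁻¹ • h (-(a * cylX R) ^ 2) y

theorem cylFamily_param_mem {a δ R : ℝ} (ha : a ^ 2 < δ) (hR : R ∈ Ioo (-1 : ℝ) 2) :
    -(a * cylX R) ^ 2 ∈ Ioo (-δ) δ := by
  have h1 : cylX R ^ 2 ≤ 1 := (sq_le_one_iff_abs_le_one _).2 (abs_cylX_le hR)
  have h2 : (a * cylX R) ^ 2 ≤ a ^ 2 := by
    rw [mul_pow]
    exact mul_le_of_le_one_right (sq_nonneg a) h1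
  exact ⟨by linarith, by linarith [sq_nonneg (a * cylX R), sq_nonneg a]⟩

theorem smoothOnSet_cylFamily {a δ : ℝ} {h : BilinFamily Y} (ha : a ^ 2 < δ)
    (hs : h.SmoothOnSet (Ioo (-δ) δ)) : (cylFamily a h).SmoothOnSet (Ioo (-1) 2) := by
  have h1 : ContMDiff 𝓒 𝓒 ∞ (fun q : ℝ × Y => (-(a * cylX q.1) ^ 2, q.2)) :=
    (((contDiff_const.mul contDiff_cylX).pow 2).neg.contMDiff.comp contMDiff_fst).prodMk
      contMDiff_snd
  intro q hq
  exact ContMDiffWithinAt.bilinAlong_smul contMDiffWithinAt_const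
    (ContMDiffOn.comp hs h1.contMDiffOn (fun q hq => ⟨cylFamily_param_mem ha hq.1, trivial⟩) q hq)

theorem isPosDefForm_cylFamily {a δ : ℝ} {h : BilinFamily Y} (ha0 : 0 < a) (ha : a ^ 2 < δ)
    (hpos : ∀ t ∈ Ioo (-δ) δ, ∀ y, IsPosDefForm (h t y)) {R : ℝ} (hR : R ∈ Icc (0 : ℝ) 1)
    (y : Y) : IsPosDefForm (cylFamily a h R y) := by
  obtain ⟨h1, h2⟩ := hpos _ (cylFamily_param_mem (R := R) ha
    ⟨by linarith [hR.1], by linarith [hR.2]⟩) y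
  exact ⟨fun v w => congrArg ((a ^ 2)⁻¹ * ·) (h1 v w),
    fun v hv => mul_pos (by positivity) (h2 v hv)⟩

theorem isEndForm_cylMetric {a δ : ℝ} (ha : 0 < a) (h : BilinFamily Y) (r : Bool)
    (hδ : δ ≤ (a / 3) ^ 2) : IsEndForm (-1) δ (cylCollar Y r ha) (cylMetric (cylFamily a h))
      (fun p => a * cylX (cylR p)) h := by
  intro s hs hsδ y
  have hs3 : s < a / 3 := lt_of_pow_lt_pow_left₀ 2 (by positivity) (hsδ.trans_le hδ)
  have hsa : s / a ≤ 1 / 3 := by rw [div_le_iff₀ ha]; linarith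
  have hs0 : 0 < s / a := by positivity
  have hR : ∀ s' : ℝ, s' ∈ Ioo 0 a → ∀ y' : Y,
      cylR ((cylCollar Y r ha).φ (s', y')) = flipIf r (s' / a) := fun s' hs' y' => by
    rw [cylCollar_apply]
    refine cylR_cylPt (flipIf_mem.2 ⟨?_, ?_⟩)
    · exact (div_pos hs'.1 ha).le
    · exact (div_le_one ha).2 hs'.2.le
  have hmem : s ∈ Ioo 0 a := ⟨hs, by linarith⟩
  have hx : cylX (cylR ((cylCollar Y r ha).φ (s, y))) = s / a := by
    rw [hR s hmem, cylX_flipIf r hsa]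
  refine ⟨by simp only [hx]; field_simp, fun b b' v v' => ?_⟩
  obtain ⟨e, he, hd⟩ : ∃ e : ℝ, e * e = 1 ∧ HasDerivAt (fun s => flipIf r (s / a)) (e / a) s := by
    cases r
    · exact ⟨1, by norm_num, by simpa [flipIf] using (hasDerivAt_id s).div_const a⟩
    · exact ⟨-1, by norm_num, by
        simpa [flipIf, neg_div] using ((hasDerivAt_id s).div_const a).const_sub 1⟩
  have h1 : HasMFDerivAt 𝓒 𝓘(ℝ, ℝ) (Prod.fst : ℝ × Y → ℝ) (s, y)
      (ContinuousLinearMap.fst ℝ ℝ (Eucl m)) := hasMFDerivAt_fst _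
  have h2 : HasMFDerivAt 𝓒 (𝓡 m) (Prod.snd : ℝ × Y → Y) (s, y)
      (ContinuousLinearMap.snd ℝ ℝ (Eucl m)) := hasMFDerivAt_snd _
  have hD := (hd.hasFDerivAt.hasMFDerivAt.comp (s, y) h1).prodMk h2
  have h3 := cylForm_mfderiv (cylFamily a h)
    (((cylCollar Y r ha).contMDiffAt hmem y).mdifferentiableAt (by simp)) (φ := _) (by
    filter_upwards [(isOpen_Ioo.prod isOpen_univ).mem_nhds
      (show (s, y) ∈ Ioo 0 a ×ˢ (univ : Set Y) from ⟨hmem, trivial⟩)] with q hq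
    exact Prod.ext (hR q.1 hq.1 q.2) rfl) hD (b, v) (b', v')
  have h4 : -(a * cylX (flipIf r (s / a))) ^ 2 = -1 * s ^ 2 := by
    rw [cylX_flipIf r hsa]
    field_simp
  change ((cylX (cylR ((cylCollar Y r ha).φ (s, y)))) ^ 2)⁻¹ * _ = _
  refine (congrArg₂ (· * ·) (congrArg (fun t : ℝ => (t ^ 2)⁻¹) hx) h3).trans ?_
  change ((s / a) ^ 2)⁻¹ * (b * (e / a) * (b' * (e / a)) -
    (a ^ 2)⁻¹ * h (-(a * cylX (flipIf r (s / a))) ^ 2) y v v') = _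
  rw [h4]
  generalize h (-1 * s ^ 2) y v v' = H
  have : b * (e / a) * (b' * (e / a)) = b * b' / a ^ 2 := by
    rw [show b * (e / a) * (b' * (e / a)) = (e * e) * (b * b' / a ^ 2) by ring, he, one_mul]
  rw [this]
  field_simp
  ring

theorem IsEndForm.isEvenNear {X : CompactManifoldWithBoundary.{u} m} {c : Collar X Y}
    {g : BilinField X} {x : X → ℝ} {δ : ℝ} {h : BilinFamily Y} (hδ : 0 < δ) (hδ' : δ ≤ c.ε ^ 2)
    (H : IsEndForm (-1) δ c g x h) (hx : ∀ y, x (c.φ (0, y)) = 0)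
    (hs : h.SmoothOnSet (Ioo (-δ) δ)) (hpos : ∀ t ∈ Ioo (-δ) δ, ∀ y, IsPosDefForm (h t y)) :
    IsEvenNear (-1) c g x := by
  have hneg : ∀ t ∈ Ico 0 (√δ ^ 2), -1 * t ∈ Ioo (-δ) δ := fun t ht => by
    rw [Real.sq_sqrt hδ.le] at ht
    exact ⟨by linarith [ht.2], by linarith [ht.1]⟩
  have hlt : ∀ s < √δ, 0 ≤ s → s ^ 2 < δ := fun s hs h0 => by
    rw [← Real.sq_sqrt hδ.le]
    exact pow_lt_pow_left₀ hs h0 two_ne_zero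
  refine ⟨√δ, Real.sqrt_pos.2 hδ, (Real.sqrt_le_left c.ε_pos.le).2 hδ', fun s hs y => ?_,
    fun t => h (-1 * t), ?_, fun t ht => hpos _ (hneg t ht), fun s hs y a a' v v' =>
      (H s hs.1 (hlt s hs.2 hs.1.le) y).2 a a' v v'⟩
  · rcases hs.1.eq_or_lt with rfl | h0
    · exact hx y
    · exact (H s h0 (hlt s hs.2 hs.1) y).1
  · have h1 : ContMDiff 𝓒 𝓒 ∞ (fun q : ℝ × Y => (-1 * q.1, q.2)) :=
      ((contDiff_const.mul contDiff_id : ContDiff ℝ ∞ fun t : ℝ => -1 * t).contMDiff.comp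
        contMDiff_fst).prodMk contMDiff_snd
    exact ContMDiffOn.comp hs h1.contMDiffOn fun q hq => ⟨hneg _ hq.1, trivial⟩

end CylinderSpace

/-! ### Null geodesics of cylinders -/

section CylinderGeodesics

variable {Y : ClosedManifold.{u} m} {k : BilinFamily Y} {S : Set ℝ}

theorem cylMetric_interior (hk : IsMetricFamily k S) :
    (cylMetric k).SmoothInterior ∧ (cylMetric k).NondegInterior ∧
      ∀ p ∈ Y.cylinder.interiorSet, ∀ a b, cylMetric k p a b = cylMetric k p b a := by
  have H := isConformallyCompact_cylMetric one_pos hk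
  refine ⟨H.smoothInterior, H.nondegInterior fun _ _ => IsLorentzForm.nondeg, fun p _ a b => ?_⟩
  exact congrArg (((cylX (cylR p)) ^ 2)⁻¹ * ·)
    ((isLorentzForm_cylForm (k := k) p (hk.pos _ (cylR_mem p) _)).1 a b)

/-- The velocity of a null geodesic along the cross section of the cylinder. -/
theorem IsNullGeodesicOn.exists_velocity (hk : IsMetricFamily k S) {γ : ℝ → Y.cylinder} {J : Set ℝ}
    (hJ : IsOpen J) (h : IsNullGeodesicOn (cylMetric k) γ J) {t : ℝ} (ht : t ∈ J) :
    ∃ V : TangentSpace (𝓡 m) (cylY (γ t)), deriv (cylR ∘ γ) t ≠ 0 ∧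
      deriv (cylR ∘ γ) t ^ 2 = k (cylR (γ t)) (cylY (γ t)) V V ∧
      HasDerivAt (fun t' => ((cylX (cylR (γ t'))) ^ 2)⁻¹ * deriv (cylR ∘ γ) t')
        (-(1 / 2) * ((cylX (cylR (γ t))) ^ 2)⁻¹ *
          deriv (fun s => k s (cylY (γ t)) V V) (cylR (γ t))) t ∧
      ∀ (N : ℕ) (f : Y → Eucl N), ContMDiff (𝓡 m) 𝓘(ℝ, Eucl N) ∞ f →
        HasDerivAt (fun t' => f (cylY (γ t')))
          (mfderiv (𝓡 m) 𝓘(ℝ, Eucl N) f (cylY (γ t)) V : Eucl N) t := by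
  obtain ⟨hg, hnd, hsym⟩ := cylMetric_interior hk
  set Θ := cylCoord (cylY (γ t)) with hΘ
  have hsub := cylCoord_source_subset (cylY (γ t))
  have hIoo : ∀ t ∈ J, cylR (γ t) ∈ Ioo 0 1 := fun t ht => mem_interiorSet_cylinder.1 (h.2 t ht).1
  have hsrc : γ t ∈ Θ.source := ⟨hIoo t ht, mem_extChartAt_source (cylY (γ t))⟩
  have hγ : ContMDiffAt 𝓘(ℝ, ℝ) 𝓑 ∞ γ t := h.1.contMDiffAt (hJ.mem_nhds ht)
  set z : ℝ → ℝ × Eucl m := Θ ∘ γ with hz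
  have hev : ∀ᶠ t' in 𝓝 t, γ t' ∈ Θ.source := hγ.continuousAt.eventually
    (Θ.open_source.mem_nhds hsrc)
  have hzd : ContDiffAt ℝ ∞ z t := by
    rw [← contMDiffAt_iff_contDiffAt]
    exact (Θ.contMDiffOn_toFun.contMDiffAt (Θ.open_source.mem_nhds hsrc)).comp t hγ
  have hev' : ∀ᶠ t' in 𝓝 t, DifferentiableAt ℝ z t' :=
    ((hzd.of_le (m := 1) (by simp)).eventually (by simp)).mono fun t' ht' =>
      ht'.differentiableAt one_ne_zero
  have hR : ∀ t', DifferentiableAt ℝ z t' → deriv (cylR ∘ γ) t' = (deriv z t').1 := fun t' ht' =>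
    ((ContinuousLinearMap.fst ℝ ℝ (Eucl m)).hasFDerivAt.comp_hasDerivAt t' ht'.hasDerivAt).deriv
  have hnull : IsNullAt (coordForm (cylMetric k) Θ) z t := h.isNullAt hg hsym hsub hJ ht hsrc
  have hztgt : z t ∈ Θ.target := Θ.map_source hsrc
  set χ := (extChartAt (𝓡 m) (cylY (γ t))).symm with hχ
  have hχz : χ (z t).2 = cylY (γ t) :=
    (extChartAt (𝓡 m) (cylY (γ t))).left_inv (mem_extChartAt_source _)
  have hdt := hzd.differentiableAt (by simp)
  set R' := deriv (cylR ∘ γ) t with hR'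
  have hR'z : (deriv z t).1 = R' := (hR t hdt).symm
  set V : Eucl m := mfderiv 𝓘(ℝ, Eucl m) (𝓡 m) χ (z t).2 (deriv z t).2 with hV
  have hX : 0 < (cylX (cylR (γ t)) ^ 2)⁻¹ := inv_pos.2 (pow_pos (cylX_pos (hIoo t ht)) 2)
  have hform : ∀ s ∈ Ioo (0 : ℝ) 1, ∀ v w : ℝ × Eucl m, coordForm (cylMetric k) Θ (s, (z t).2) v w =
      ((cylX s) ^ 2)⁻¹ * (v.1 * w.1 - k s (cylY (γ t))
        (mfderiv 𝓘(ℝ, Eucl m) (𝓡 m) χ (z t).2 v.2 : Eucl m)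
        (mfderiv 𝓘(ℝ, Eucl m) (𝓡 m) χ (z t).2 w.2 : Eucl m)) := fun s hs v w => by
    have h1 := coordForm_cylMetric k (cylY (γ t)) (z := (s, (z t).2)) ⟨hs, hztgt.2⟩ v w
    have e : ∀ (y y' : Y) (_ : y = y') (a b : Eucl m), (k s y a b : ℝ) = k s y' a b := by
      rintro y _ rfl a b
      rfl
    exact h1.trans (congrArg (fun a : ℝ => ((cylX s) ^ 2)⁻¹ * (v.1 * w.1 - a)) (e _ _ hχz _ _))
  have hnul : R' * R' - k (cylR (γ t)) (cylY (γ t)) V V = 0 := by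
    have h1 := (hform _ (hIoo t ht) (deriv z t) (deriv z t)).symm.trans hnull.2.1
    rw [hR'z] at h1
    exact (mul_eq_zero.1 h1).resolve_left hX.ne'
  refine ⟨V, fun h0 => hnull.1 ?_, by rw [sq]; linarith, ?_, fun N f hf => ?_⟩
  · have hV0 : V = 0 := by
      by_contra hV0
      have := (hk.pos _ (Ioo_subset_Icc_self (hIoo t ht)) (cylY (γ t))).2 V hV0
      rw [h0] at hnul
      linarith
    refine coordForm_injective hnd hsub hztgt ((ContinuousLinearMap.ext fun w => ?_).trans
      (map_zero _).symm)
    refine (hform _ (hIoo t ht) (deriv z t) w).trans ?_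
    have h1 : k (cylR (γ t)) (cylY (γ t)) V
        (mfderiv 𝓘(ℝ, Eucl m) (𝓡 m) χ (z t).2 w.2 : Eucl m) = 0 := by
      rw [hV0]
      exact congrArg (fun L : TangentSpace (𝓡 m) (cylY (γ t)) →L[ℝ] ℝ =>
        L (mfderiv 𝓘(ℝ, Eucl m) (𝓡 m) χ (z t).2 w.2 : Eucl m))
        (k (cylR (γ t)) (cylY (γ t))).map_zero
    rw [hR'z, h0, zero_mul, zero_sub]
    change _ * -(k (cylR (γ t)) (cylY (γ t)) V _) = 0
    rw [h1, neg_zero, mul_zero]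
  · have h1 := hnull.2.2 ((1, 0) : ℝ × Eucl m)
    have hd : DifferentiableAt ℝ (fun x => coordForm (cylMetric k) Θ x (deriv z t) (deriv z t))
        (z t) := ((((contDiffOn_coordForm hg hsub).contDiffAt
          (Θ.open_target.mem_nhds hztgt)).clm_apply contDiffAt_const).clm_apply
            contDiffAt_const).differentiableAt (by simp)
    have h2 := hd.hasFDerivAt.comp_hasDerivAt (cylR (γ t)) (f := fun s : ℝ => (s, (z t).2))
      ((hasDerivAt_id (cylR (γ t))).prodMk (hasDerivAt_const _ (z t).2))
    obtain ⟨C, -, hC⟩ := exists_deriv_bound hk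
    have h3 := (hC _ (Ioo_subset_Icc_self (hIoo t ht)) (cylY (γ t)) V).1.hasDerivAt
    have h4 : HasDerivAt (fun s => ((cylX s) ^ 2)⁻¹) (deriv (fun s => ((cylX s) ^ 2)⁻¹)
        (cylR (γ t))) (cylR (γ t)) :=
      (((contDiff_cylX.differentiable (by simp) _).pow 2).inv
        (pow_pos (cylX_pos (hIoo t ht)) 2).ne').hasDerivAt
    have h5 := h4.mul (h3.const_sub (R' * R'))
    have h6 : (fun s => coordForm (cylMetric k) Θ (s, (z t).2) (deriv z t) (deriv z t))
        =ᶠ[𝓝 (cylR (γ t))] fun s => ((cylX s) ^ 2)⁻¹ * (R' * R' - k s (cylY (γ t)) V V) := by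
      filter_upwards [isOpen_Ioo.mem_nhds (hIoo t ht)] with s hs
      rw [← hR'z]
      exact hform s hs _ _
    have h7 := h2.unique (h5.congr_of_eventuallyEq h6)
    rw [hnul, mul_zero, zero_add] at h7
    refine (h1.congr_of_eventuallyEq ?_).congr_deriv ?_
    · filter_upwards [hev, hev'] with t' ht' ht''
      have h8 := coordForm_cylMetric k (cylY (γ t)) (z := z t') (Θ.map_source ht') (deriv z t')
        ((1, 0) : ℝ × Eucl m)
      refine Eq.trans ?_ h8.symm
      have h9 : ∀ (y : Y) (s : ℝ) (L : Eucl m →L[ℝ] Eucl m) (a : Eucl m),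
          (k s y a (L 0 : Eucl m) : ℝ) = 0 := fun y s L a => by
        rw [L.map_zero]
        exact (k s y a).map_zero
      rw [hR t' ht'']
      refine congrArg (((cylX (cylR (γ t'))) ^ 2)⁻¹ * ·) ?_
      exact (sub_zero _).symm.trans (congrArg₂ (· - ·) (mul_one _).symm (h9 _ _ _ _).symm)
    · exact (congrArg ((1 / 2 : ℝ) * ·) h7).trans (by ring)
  · have hχd : MDifferentiableAt 𝓘(ℝ, Eucl m) (𝓡 m) χ (z t).2 :=
      ((contMDiffOn_extChartAt_symm (n := ∞) (cylY (γ t))).contMDiffAt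
        ((isOpen_extChartAt_target _).mem_nhds hztgt.2)).mdifferentiableAt (by simp)
    have hf1 := (hf.mdifferentiable (by simp) (χ (z t).2)).hasMFDerivAt.comp (z t).2
      hχd.hasMFDerivAt
    have hf2 := (hasMFDerivAt_iff_hasFDerivAt.1 hf1).comp_hasDerivAt t
      ((ContinuousLinearMap.snd ℝ ℝ (Eucl m)).hasFDerivAt.comp_hasDerivAt t hdt.hasDerivAt)
    have e : ∀ (y y' : Y) (_ : y = y') (a : Eucl m),
        (mfderiv (𝓡 m) 𝓘(ℝ, Eucl N) f y a : Eucl N) = mfderiv (𝓡 m) 𝓘(ℝ, Eucl N) f y' a := by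
      rintro y _ rfl a
      rfl
    refine (hf2.congr_of_eventuallyEq ?_).congr_deriv (e _ _ hχz V)
    filter_upwards [hev] with t' ht'
    exact congrArg f ((extChartAt (𝓡 m) (cylY (γ t))).left_inv ht'.2).symm

end CylinderGeodesics

section Comparison

theorem abs_sub_le_of_abs_deriv_le {J : Set ℝ} (hJ : IsOpen J) (hc : J.OrdConnected)
    {f f' G G' : ℝ → ℝ} (hf : ∀ t ∈ J, HasDerivAt f (f' t) t) (hG : ∀ t ∈ J, HasDerivAt G (G' t) t)
    (h : ∀ t ∈ J, |f' t| ≤ G' t) {s t : ℝ} (hs : s ∈ J) (ht : t ∈ J) : |f t - f s| ≤ |G t - G s| := by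
  have key : ∀ e : ℝ, |e| = 1 → MonotoneOn (fun t => G t + e * f t) J := fun e he => by
    refine monotoneOn_of_hasDerivWithinAt_nonneg hc.convex
      (fun t ht => ((hG t ht).add ((hf t ht).const_mul e)).continuousAt.continuousWithinAt)
      (f' := fun t => G' t + e * f' t) (fun t ht => ?_) fun t ht => ?_
    · rw [hJ.interior_eq] at ht
      exact ((hG t ht).add ((hf t ht).const_mul e)).hasDerivWithinAt
    · rw [hJ.interior_eq] at ht
      have h1 := neg_abs_le (e * f' t)
      rw [abs_mul, he, one_mul] at h1
      linarith [h t ht]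
  have h1 := key 1 (by simp)
  have h2 := key (-1) (by simp)
  rcases le_total s t with hst | hst
  · have h3 := h1 hs ht hst
    have h4 := h2 hs ht hst
    simp only at h3 h4
    exact (abs_le.2 ⟨by linarith, by linarith⟩).trans (le_abs_self _)
  · have h3 := h1 ht hs hst
    have h4 := h2 ht hs hst
    simp only at h3 h4
    exact (abs_le.2 ⟨by linarith, by linarith⟩).trans (neg_le_abs _)

theorem exists_sign {J : Set ℝ} (hc : J.OrdConnected) {f : ℝ → ℝ} (hf : ContinuousOn f J)
    (h : ∀ t ∈ J, f t ≠ 0) : ∃ e : ℝ, |e| = 1 ∧ ∀ t ∈ J, 0 < e * f t := by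
  by_cases h0 : ∃ t ∈ J, f t < 0
  · refine ⟨-1, by simp, fun t ht => ?_⟩
    obtain ⟨s, hs, hs0⟩ := h0
    by_contra! hle
    obtain ⟨r, hr, hr0⟩ := hc.isPreconnected.intermediate_value hs ht hf
      (show (0 : ℝ) ∈ Icc (f s) (f t) from ⟨hs0.le, by linarith⟩)
    exact h r hr hr0
  · push Not at h0
    exact ⟨1, by simp, fun t ht => by rw [one_mul]; exact (h0 t ht).lt_of_ne' (h t ht)⟩

theorem tendsto_one_of_deriv_ge {R R' w : ℝ → ℝ} (hw : Continuous w)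
    (hw0 : ∀ s ∈ Ioo (0 : ℝ) 1, 0 < w s) (hR : ∀ t, HasDerivAt R (R' t) t)
    (hmem : ∀ t, R t ∈ Ioo (0 : ℝ) 1) (h : ∀ t, w (R t) ≤ R' t) : Tendsto R atTop (𝓝 1) := by
  have hmono : Monotone R := monotone_of_hasDerivAt_nonneg hR fun t =>
    (hw0 _ (hmem t)).le.trans (h t)
  have hbd : BddAbove (range R) := ⟨1, by rintro _ ⟨t, rfl⟩; exact (hmem t).2.le⟩
  have hlim := tendsto_atTop_ciSup hmono hbd
  set L := ⨆ t, R t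
  have hL1 : L ≤ 1 := ciSup_le fun t => (hmem t).2.le
  rcases hL1.eq_or_lt with h1 | h1
  · rwa [h1] at hlim
  exfalso
  have hL0 : L ∈ Ioo (0 : ℝ) 1 := ⟨(hmem 0).1.trans_le (le_ciSup hbd 0), h1⟩
  have hw1 : ∀ᶠ t in atTop, w L / 2 < w (R t) :=
    (hw.continuousAt.tendsto.comp hlim).eventually (lt_mem_nhds (half_lt_self (hw0 L hL0)))
  obtain ⟨T, hT⟩ := eventually_atTop.1 hw1
  have hpos : 0 < w L / 2 := half_pos (hw0 L hL0)
  have hgrow : MonotoneOn (fun t => R t - w L / 2 * t) (Ici T) := by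
    have hd : ∀ t, HasDerivAt (fun t => R t - w L / 2 * t) (R' t - w L / 2 * 1) t := fun t =>
      (hR t).sub ((hasDerivAt_id t).const_mul _)
    refine monotoneOn_of_hasDerivWithinAt_nonneg (convex_Ici T)
      (fun t _ => (hd t).continuousAt.continuousWithinAt) (fun t _ => (hd t).hasDerivWithinAt)
      fun t ht => ?_
    rw [interior_Ici] at ht
    linarith [h t, hT t (le_of_lt ht)]
  have h2 := hgrow (self_mem_Ici) (show T + 2 / w L ∈ Ici T from
    le_add_of_nonneg_right (α := ℝ) (by have := hw0 L hL0; positivity))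
    (le_add_of_nonneg_right (α := ℝ) (by have := hw0 L hL0; positivity))
  have h3 : w L / 2 * (T + 2 / w L) = w L / 2 * T + 1 := by
    have := (hw0 L hL0).ne'
    field_simp
  simp only [h3] at h2
  linarith [(hmem T).1, (hmem (T + 2 / w L)).2]

end Comparison

section CylinderGeodesics

variable {Y : ClosedManifold.{u} m} {k : BilinFamily Y} {S : Set ℝ}

theorem exists_vector_differential_bound (hk : IsMetricFamily k S) {N : ℕ} {f : Y → Eucl N}
    (hf : ContMDiff (𝓡 m) 𝓘(ℝ, Eucl N) ∞ f) : ∃ C ≥ 0, ∀ R ∈ Icc (0 : ℝ) 1, ∀ (y : Y)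
      (v : TangentSpace (𝓡 m) y),
      norm (E := Eucl N) (mfderiv (𝓡 m) 𝓘(ℝ, Eucl N) f y v) ^ 2 ≤ C * k R y v v := by
  have hfi : ∀ i, ContMDiff (𝓡 m) 𝓘(ℝ, ℝ) ∞ fun y => f y i := fun i =>
    (EuclideanSpace.proj (𝕜 := ℝ) i).contDiff.contMDiff.comp hf
  choose C hC h using fun i => exists_differential_bound hk (hfi i)
  refine ⟨∑ i, C i, Finset.sum_nonneg fun i _ => hC i, fun R hR y v => ?_⟩
  refine (EuclideanSpace.norm_sq_eq (𝕜 := ℝ) (n := Fin N) _).trans_le ?_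
  rw [sum_mul]
  refine Finset.sum_le_sum fun i _ => le_of_eq_of_le ?_ (h i R hR y v)
  have h1 : HasMFDerivAt (𝓡 m) 𝓘(ℝ, ℝ) (fun y => f y i) y _ :=
    (EuclideanSpace.proj (𝕜 := ℝ) i : Eucl N →L[ℝ] ℝ).hasFDerivAt.hasMFDerivAt.comp y
      (hf.mdifferentiable (by simp) y).hasMFDerivAt
  rw [diffAt, h1.mfderiv, Real.norm_eq_abs, sq_abs]
  rfl

variable {γ : ℝ → Y.cylinder} {J : Set ℝ}

theorem IsNullGeodesicOn.cylR_mem (h : IsNullGeodesicOn (cylMetric k) γ J) {t : ℝ} (ht : t ∈ J) :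
    cylR (γ t) ∈ Ioo (0 : ℝ) 1 := mem_interiorSet_cylinder.1 (h.2 t ht).1

theorem IsNullGeodesicOn.contDiffAt_cylR (h : IsNullGeodesicOn (cylMetric k) γ J) (hJ : IsOpen J)
    {t : ℝ} (ht : t ∈ J) : ContDiffAt ℝ ∞ (cylR ∘ γ) t :=
  contMDiffAt_iff_contDiffAt.1 ((contMDiff_cylR (γ t)).comp t (h.1.contMDiffAt (hJ.mem_nhds ht)))

theorem IsNullGeodesicOn.hasDerivAt_cylR (h : IsNullGeodesicOn (cylMetric k) γ J) (hJ : IsOpen J)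
    {t : ℝ} (ht : t ∈ J) : HasDerivAt (fun t => cylR (γ t)) (deriv (cylR ∘ γ) t) t :=
  ((h.contDiffAt_cylR hJ ht).differentiableAt (by simp)).hasDerivAt

/-- The velocity of the projection to the interval is comparable to the square of `x`. -/
theorem IsNullGeodesicOn.exists_speed_bound (hk : IsMetricFamily k S) (hJ : IsOpen J)
    (hc : J.OrdConnected) (h : IsNullGeodesicOn (cylMetric k) γ J) {t₀ : ℝ} (ht₀ : t₀ ∈ J) :
    ∃ e : ℝ, |e| = 1 ∧ ∃ c > 0, ∃ C, ∀ t ∈ J, c * cylX (cylR (γ t)) ^ 2 ≤ e * deriv (cylR ∘ γ) t ∧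
      e * deriv (cylR ∘ γ) t ≤ C * cylX (cylR (γ t)) ^ 2 := by
  obtain ⟨B, hB, hb⟩ := exists_deriv_bound hk
  choose! V h0 hV hu _hf using fun t ht => h.exists_velocity hk hJ (t := t) ht
  obtain ⟨e, he, hsign⟩ := exists_sign hc (f := deriv (cylR ∘ γ)) (fun t ht =>
    ((h.contDiffAt_cylR hJ ht).deriv_right (k := 0) (by simp)).continuousAt.continuousWithinAt) h0
  have hX : ∀ t ∈ J, 0 < cylX (cylR (γ t)) ^ 2 := fun t ht => pow_pos (cylX_pos (h.cylR_mem ht)) 2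
  set u : ℝ → ℝ := fun t => e * ((cylX (cylR (γ t)) ^ 2)⁻¹ * deriv (cylR ∘ γ) t) with hu_def
  have hupos : ∀ t ∈ J, 0 < u t := fun t ht => by
    have := mul_pos (inv_pos.2 (hX t ht)) (hsign t ht)
    simp only [hu_def]
    linarith
  have hud := fun t ht => ((hu t ht).const_mul e).log (hupos t ht).ne'
  have hRd : ∀ t ∈ J, HasDerivAt (fun t => B / 2 * (e * cylR (γ t)))
      (B / 2 * (e * deriv (cylR ∘ γ) t)) t := fun t ht =>
    ((h.hasDerivAt_cylR hJ ht).const_mul e).const_mul (B / 2)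
  have hlog : ∀ t ∈ J, |Real.log (u t) - Real.log (u t₀)| ≤ B / 2 := fun t ht => by
    refine (abs_sub_le_of_abs_deriv_le hJ hc hud hRd (fun t ht => ?_) ht₀ ht).trans ?_
    · have h1 := (hb _ (Ioo_subset_Icc_self (h.cylR_mem ht)) (cylY (γ t)) (V t)).2
      rw [← hV t ht] at h1
      rw [abs_div, abs_of_pos (hupos t ht), div_le_iff₀ (hupos t ht), abs_mul, he, one_mul, abs_mul,
        abs_mul, abs_neg, abs_of_pos (inv_pos.2 (hX t ht)), abs_of_pos (one_half_pos (α := ℝ))]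
      have h2 : e * e = 1 := by rw [← abs_mul_abs_self, he, one_mul]
      have h3 : B / 2 * (e * deriv (cylR ∘ γ) t) * u t =
          1 / 2 * (cylX (cylR (γ t)) ^ 2)⁻¹ * (B * deriv (cylR ∘ γ) t ^ 2) * (e * e) := by
        simp only [hu_def]
        ring
      rw [h3, h2, mul_one]
      exact mul_le_mul_of_nonneg_left h1 (mul_nonneg (by norm_num) (inv_pos.2 (hX t ht)).le)
    · rw [← mul_sub, ← mul_sub, abs_mul, abs_mul, he, one_mul, abs_of_nonneg (by positivity)]
      refine mul_le_of_le_one_right (by positivity) (abs_le.2 ?_)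
      have h1 := h.cylR_mem ht
      have h2 := h.cylR_mem ht₀
      exact ⟨by linarith [h1.1, h2.2], by linarith [h1.2, h2.1]⟩
  refine ⟨e, he, Real.exp (Real.log (u t₀) - B / 2), Real.exp_pos _,
    Real.exp (Real.log (u t₀) + B / 2), fun t ht => ?_⟩
  have h1 := abs_le.1 (hlog t ht)
  have h2 : e * deriv (cylR ∘ γ) t = u t * cylX (cylR (γ t)) ^ 2 := by
    simp only [hu_def]
    rw [mul_assoc, mul_right_comm, inv_mul_cancel₀ (hX t ht).ne', one_mul]
  rw [h2]
  constructor <;> refine mul_le_mul_of_nonneg_right ?_ (hX t ht).le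
  · rw [← Real.le_log_iff_exp_le (hupos t ht)]
    linarith
  · rw [← Real.log_le_iff_le_exp (hupos t ht)]
    linarith

/-- In finite time null geodesics stay away from the ends of the cylinder. -/
theorem IsNullGeodesicOn.inv_cylX_le (hJ : IsOpen J) (hc : J.OrdConnected)
    (h : IsNullGeodesicOn (cylMetric k) γ J) {C : ℝ}
    (hC : ∀ t ∈ J, |deriv (cylR ∘ γ) t| ≤ C * cylX (cylR (γ t)) ^ 2) {t₀ : ℝ} (ht₀ : t₀ ∈ J) :
    ∃ L, ∀ t ∈ J, (cylX (cylR (γ t)))⁻¹ ≤ (cylX (cylR (γ t₀)))⁻¹ + L * |t - t₀| := by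
  obtain ⟨B, hB⟩ := isCompact_Icc.exists_bound_of_continuousOn (s := Icc (0 : ℝ) 1)
    (contDiff_cylX.continuous_deriv (by simp)).continuousOn
  have hX : ∀ t ∈ J, 0 < cylX (cylR (γ t)) := fun t ht => cylX_pos (h.cylR_mem ht)
  refine ⟨|B * C|, fun t ht => ?_⟩
  have h1 : ∀ t ∈ J, HasDerivAt (fun t => (cylX (cylR (γ t)))⁻¹)
      (-(deriv cylX (cylR (γ t)) * deriv (cylR ∘ γ) t) / cylX (cylR (γ t)) ^ 2) t := fun t ht =>
    ((contDiff_cylX.differentiable (by simp) _).hasDerivAt.comp t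
      (h.hasDerivAt_cylR hJ ht)).inv (hX t ht).ne'
  have h2 := abs_sub_le_of_abs_deriv_le hJ hc h1
    (G := fun t => B * C * t) (G' := fun _ => B * C * 1)
    (fun t _ => (hasDerivAt_id t).const_mul _) (fun t ht => by
      have h3 := hB _ (Ioo_subset_Icc_self (h.cylR_mem ht))
      rw [Real.norm_eq_abs] at h3
      have h4 : 0 < cylX (cylR (γ t)) ^ 2 := pow_pos (hX t ht) 2
      rw [abs_div, abs_neg, abs_mul, abs_of_pos h4, div_le_iff₀ h4, mul_one, mul_assoc]
      exact mul_le_mul h3 (hC t ht) (abs_nonneg _) ((abs_nonneg _).trans h3)) ht₀ ht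
  rw [← mul_sub, abs_mul] at h2
  linarith [le_abs_self ((cylX (cylR (γ t)))⁻¹ - (cylX (cylR (γ t₀)))⁻¹)]

theorem IsNullGeodesicOn.exists_section_bound (hk : IsMetricFamily k S) (hJ : IsOpen J)
    (h : IsNullGeodesicOn (cylMetric k) γ J) {N : ℕ} {f : Y → Eucl N}
    (hf : ContMDiff (𝓡 m) 𝓘(ℝ, Eucl N) ∞ f) : ∃ C ≥ 0, ∀ t ∈ J,
      HasDerivAt (fun t => f (cylY (γ t))) (deriv (fun t => f (cylY (γ t))) t) t ∧
      ‖deriv (fun t => f (cylY (γ t))) t‖ ≤ C * |deriv (cylR ∘ γ) t| := by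
  obtain ⟨C, hC, hb⟩ := exists_vector_differential_bound hk hf
  refine ⟨√C, Real.sqrt_nonneg _, fun t ht => ?_⟩
  obtain ⟨V, -, hV, -, hd⟩ := h.exists_velocity hk hJ ht
  have h1 := hd N f hf
  refine ⟨h1.differentiableAt.hasDerivAt, ?_⟩
  rw [h1.deriv]
  refine le_of_sq_le_sq ?_ (by positivity)
  rw [mul_pow, Real.sq_sqrt hC, sq_abs, hV]
  exact hb _ (Ioo_subset_Icc_self (h.cylR_mem ht)) _ V

end CylinderGeodesics

section CylinderDynamics

variable {Y : ClosedManifold.{u} m} {k : BilinFamily Y} {S : Set ℝ} {γ : ℝ → Y.cylinder} {J : Set ℝ}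

theorem ClosedManifold.exists_chart_extension (y₀ : Y) : ∃ f : Y → Eucl m,
    ContMDiff (𝓡 m) 𝓘(ℝ, Eucl m) ∞ f ∧ f =ᶠ[𝓝 y₀] extChartAt (𝓡 m) y₀ := by
  obtain ⟨ρ⟩ : Nonempty (SmoothBumpFunction (𝓡 m) y₀) := inferInstance
  refine ⟨fun y => ρ y • extChartAt (𝓡 m) y₀ y, ρ.contMDiff_smul contMDiffOn_extChartAt, ?_⟩
  filter_upwards [ρ.eventuallyEq_one] with y hy
  rw [hy, Pi.one_apply, one_smul]

theorem IsNullGeodesicOn.exists_limit (hk : IsMetricFamily k S) (hJ : IsOpen J)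
    (hc : J.OrdConnected) (h : IsNullGeodesicOn (cylMetric k) γ J) {a b : ℝ} (hab : a < b)
    (hsub : Ico a b ⊆ J) : ∃ R ∈ Ioo (0 : ℝ) 1, ∃ y : Y,
      Tendsto (fun t => cylR (γ t)) (𝓝[<] b) (𝓝 R) ∧ Tendsto (fun t => cylY (γ t)) (𝓝[<] b) (𝓝 y) ∧
      ∃ c > 0, ∃ C, ∀ t ∈ Ico a b, c ≤ |deriv (cylR ∘ γ) t| ∧ |deriv (cylR ∘ γ) t| ≤ C := by
  have ha : a ∈ J := hsub ⟨le_rfl, hab⟩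
  obtain ⟨e, he, c, hc0, C, hb⟩ := h.exists_speed_bound hk hJ hc ha
  have hX : ∀ t ∈ J, 0 < cylX (cylR (γ t)) := fun t ht => cylX_pos (h.cylR_mem ht)
  have habs : ∀ t ∈ J, |deriv (cylR ∘ γ) t| = e * deriv (cylR ∘ γ) t := fun t ht => by
    rw [← abs_of_nonneg ((mul_pos hc0 (pow_pos (hX t ht) 2)).le.trans (hb t ht).1), abs_mul, he,
      one_mul]
  obtain ⟨L, hL⟩ := h.inv_cylX_le hJ hc (fun t ht => (habs t ht).trans_le (hb t ht).2) ha
  have hC0 : 0 ≤ C := by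
    have h1 := (mul_pos hc0 (pow_pos (hX a ha) 2)).trans_le ((hb a ha).1.trans (hb a ha).2)
    exact (pos_of_mul_pos_left h1 (sq_nonneg _)).le
  set B := (cylX (cylR (γ a)))⁻¹ + |L| * (b - a) with hB_def
  have hB : 0 < B := add_pos_of_pos_of_nonneg (inv_pos.2 (hX a ha))
    (mul_nonneg (abs_nonneg L) (sub_pos.2 hab).le)
  have hlow : ∀ t ∈ Ico a b, B⁻¹ ≤ cylX (cylR (γ t)) := fun t ht => by
    rw [inv_le_comm₀ hB (hX t (hsub ht))]
    refine (hL t (hsub ht)).trans (add_le_add_right ?_ _)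
    rw [abs_of_nonneg (sub_nonneg.2 ht.1)]
    exact mul_le_mul (le_abs_self L) (by linarith [ht.2]) (sub_nonneg.2 ht.1) (abs_nonneg L)
  have hspeed : ∀ t ∈ Ico a b, c * B⁻¹ ^ 2 ≤ |deriv (cylR ∘ γ) t| ∧
      |deriv (cylR ∘ γ) t| ≤ C := fun t ht => by
    rw [habs t (hsub ht)]
    have h1 := h.cylR_mem (hsub ht)
    have h2 := abs_cylX_le (t := cylR (γ t)) ⟨by linarith [h1.1], by linarith [h1.2]⟩
    rw [← sq_le_one_iff_abs_le_one] at h2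
    exact ⟨(mul_le_mul_of_nonneg_left (pow_le_pow_left₀ (inv_pos.2 hB).le (hlow t ht) 2)
      hc0.le).trans (hb t (hsub ht)).1, (hb t (hsub ht)).2.trans (mul_le_of_le_one_right hC0 h2)⟩
  have hmem : ∀ᶠ t in 𝓝[<] b, t ∈ Ico a b := mem_of_superset (Ioo_mem_nhdsLT hab)
    Ioo_subset_Ico_self
  obtain ⟨R, hR⟩ := exists_limit_of_bound hab
    (fun t ht => h.hasDerivAt_cylR hJ (hsub (Ioo_subset_Ico_self ht)))
    (fun t ht => (hspeed t (Ioo_subset_Ico_self ht)).2)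
  have hR0 : R ∈ Icc (0 : ℝ) 1 := isClosed_Icc.mem_of_tendsto hR
    (Eventually.of_forall fun t => _root_.cylR_mem _)
  have hRX : B⁻¹ ≤ cylX R := ge_of_tendsto ((contDiff_cylX.continuous.tendsto R).comp hR)
    (hmem.mono hlow)
  have hRX0 := (inv_pos.2 hB).trans_le hRX
  have hR1 : R ∈ Ioo (0 : ℝ) 1 := by
    have e0 : cylX 0 = 0 := cylX_flipIf false (by norm_num)
    have e1 : cylX (1 - 0) = 0 := cylX_flipIf true (by norm_num)
    rw [sub_zero] at e1
    refine ⟨hR0.1.lt_of_ne' ?_, hR0.2.lt_of_ne ?_⟩ <;> rintro rfl <;> linarith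
  obtain ⟨N, f, hf, hemb, -⟩ := exists_embedding_euclidean_of_compact (I := 𝓡 m) (M := Y)
  obtain ⟨D, hD, hfb⟩ := h.exists_section_bound hk hJ hf
  obtain ⟨l, hl⟩ := exists_limit_of_bound (C := D * C) hab
    (fun t ht => (hfb t (hsub (Ioo_subset_Ico_self ht))).1)
    (fun t ht => (hfb t (hsub (Ioo_subset_Ico_self ht))).2.trans
      (mul_le_mul_of_nonneg_left (hspeed t (Ioo_subset_Ico_self ht)).2 hD))
  obtain ⟨y, rfl⟩ := hemb.isClosed_range.mem_of_tendsto hl (Eventually.of_forall fun t => ⟨_, rfl⟩)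
  exact ⟨R, hR1, y, hR, hemb.isInducing.tendsto_nhds_iff.2 hl, c * B⁻¹ ^ 2, by positivity, C,
    hspeed⟩

theorem IsMaximalNullGeodesic.not_bddAbove (hk : IsMetricFamily k S)
    (H : IsMaximalNullGeodesic (cylMetric k) γ J) : ¬ BddAbove J := by
  intro hbdd
  obtain ⟨hg, hnd, hsym⟩ := cylMetric_interior hk
  obtain ⟨⟨a, ha⟩, hJ, hc, h, hmax⟩ := H
  set b := sSup J
  have hlt : ∀ t ∈ J, t < b := fun t ht => by
    obtain ⟨d, hd, hsub⟩ := mem_nhdsGE_iff_exists_Ico_subset.1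
      (mem_nhdsWithin_of_mem_nhds (s := J) (t := Ici t) (hJ.mem_nhds ht))
    have hd : t < d := hd
    have : (t + d) / 2 ∈ J := hsub ⟨by linarith, by linarith⟩
    linarith [le_csSup hbdd this]
  have hsub : Ico a b ⊆ J := fun t ht => by
    obtain ⟨s, hs, hts⟩ := exists_lt_of_lt_csSup ⟨a, ha⟩ ht.2
    exact hc.out ha hs ⟨ht.1, hts.le⟩
  have hab := hlt a ha
  obtain ⟨R, hR, y, hRlim, hylim, c, hc0, C, hspeed⟩ :=
    h.exists_limit hk hJ hc hab hsub
  set Θ := cylCoord y with hΘ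
  have hΘsub := cylCoord_source_subset y
  obtain ⟨f, hf, hfeq⟩ := Y.exists_chart_extension y
  obtain ⟨D, hD, hfb⟩ := h.exists_section_bound hk hJ hf
  have hmem : ∀ᶠ t in 𝓝[<] b, t ∈ Ico a b := mem_of_superset (Ioo_mem_nhdsLT hab)
    Ioo_subset_Ico_self
  have hsrc : ∀ᶠ t in 𝓝[<] b, γ t ∈ Θ.source := by
    filter_upwards [hmem, hylim.eventually ((isOpen_extChartAt_source (I := 𝓡 m) y).mem_nhds
      (mem_extChartAt_source y))] with t h1 h2
    exact ⟨h.cylR_mem (hsub h1), h2⟩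
  have hγ : ∀ t ∈ J, ContMDiffAt 𝓘(ℝ, ℝ) 𝓑 ∞ γ t := fun t ht =>
    h.1.contMDiffAt (hJ.mem_nhds ht)
  obtain ⟨z', hz', hev⟩ := exists_null_extension (V := ℝ × Eucl m) Θ.open_target
    (contDiffOn_coordForm hg hΘsub) (fun x hx v w => hsym _ (hΘsub (Θ.map_target hx)) _ _)
    (fun x hx => coordForm_injective hnd hΘsub hx) (z := Θ ∘ γ)
    (x := ((R, extChartAt (𝓡 m) y y) : ℝ × Eucl m))
    ⟨hR, mem_extChartAt_target y⟩ (b := b) (C := max C (D * C)) hc0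
    (ContinuousLinearMap.fst ℝ ℝ (Eucl m))
    (hRlim.prodMk_nhds ((continuousAt_extChartAt y).tendsto.comp hylim)) (by
      filter_upwards [hmem, hsrc, hylim.eventually hfeq.eventually_nhds] with t h1 h2 h3
      have h4 : ContDiffAt ℝ ∞ (Θ ∘ γ) t := by
        rw [← contMDiffAt_iff_contDiffAt]
        exact (Θ.contMDiffOn_toFun.contMDiffAt (Θ.open_source.mem_nhds h2)).comp t (hγ t (hsub h1))
      have h5 := (h4.differentiableAt (by simp)).hasDerivAt
      have h6 : (deriv (Θ ∘ γ) t).1 = deriv (cylR ∘ γ) t :=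
        ((ContinuousLinearMap.fst ℝ ℝ (Eucl m)).hasFDerivAt.comp_hasDerivAt t h5).deriv.symm
      have hyc : ContinuousAt (fun t => cylY (γ t)) t :=
        contMDiff_cylY.continuous.continuousAt.comp (hγ t (hsub h1)).continuousAt
      have h7 : (deriv (Θ ∘ γ) t).2 = deriv (fun t => f (cylY (γ t))) t := by
        have h8 : (fun t => f (cylY (γ t))) =ᶠ[𝓝 t] fun t => extChartAt (𝓡 m) y (cylY (γ t)) :=
          hyc.eventually h3
        rw [h8.deriv_eq]
        exact ((ContinuousLinearMap.snd ℝ ℝ (Eucl m)).hasFDerivAt.comp_hasDerivAt t h5).deriv.symm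
      refine ⟨h4, h.isNullAt hg hsym hΘsub hJ (hsub h1) h2, ?_, ?_⟩
      · rw [Prod.norm_def, h6, h7]
        exact max_le_max (hspeed t h1).2 ((hfb t (hsub h1)).2.trans
          (mul_le_mul_of_nonneg_left (hspeed t h1).2 hD))
      · rw [ContinuousLinearMap.coe_fst', h6]
        exact (hspeed t h1).1)
  obtain ⟨a', ha', hsrc'⟩ := (mem_nhdsLT_iff_exists_Ioo_subset (α := ℝ)).1 (hmem.and hsrc)
  obtain ⟨r, hr, hball⟩ := Metric.eventually_nhds_iff_ball.1
    (hev.and (eventually_gt_nhds (show a' < b from ha')))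
  rw [Real.ball_eq_Ioo] at hball
  set γ' : ℝ → Y.cylinder := fun t => if t < b then γ t else Θ.symm (z' t) with hγ'
  have hγ'J : ∀ t < b, γ' t = γ t := fun t ht => if_pos ht
  have hγ'I : ∀ t ∈ Ioo (b - r) (b + r), γ' t = Θ.symm (z' t) := fun t ht => by
    by_cases htb : t < b
    · rw [hγ'J t htb, hz' t htb]
      exact (Θ.left_inv (hsrc' ⟨(hball t ht).2, htb⟩).2).symm
    · exact if_neg htb
  have hJ' : IsOpen (J ∪ Ioo (b - r) (b + r)) := hJ.union isOpen_Ioo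
  have hord : (J ∪ Ioo (b - r) (b + r)).OrdConnected := by
    have h1 : max a (b - r / 2) < b := max_lt hab (by linarith)
    refine (IsPreconnected.union (max a (b - r / 2)) (hsub ⟨le_max_left _ _, h1⟩)
      (show _ ∈ Ioo (b - r) (b + r) from
        ⟨lt_of_lt_of_le (by linarith) (le_max_right _ _), by linarith⟩) hc.isPreconnected
      isPreconnected_Ioo).ordConnected
  have hnull : IsNullGeodesicOn (cylMetric k) γ' (J ∪ Ioo (b - r) (b + r)) := by
    refine isNullGeodesicOn_of_isNullAt (V := ℝ × Eucl m) hg hsym fun t ht => ?_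
    by_cases htJ : t ∈ J
    · have heq : γ' =ᶠ[𝓝 t] γ := (gt_mem_nhds (hlt t htJ)).mono hγ'J
      have hs : γ t ∈ (cylCoord (cylY (γ t))).source :=
        ⟨h.cylR_mem htJ, mem_extChartAt_source (cylY (γ t))⟩
      refine ⟨(hγ t htJ).congr_of_eventuallyEq heq, cylCoord (cylY (γ t)),
        cylCoord_source_subset _, by rwa [heq.self_of_nhds], ?_⟩
      refine (h.isNullAt hg hsym (cylCoord_source_subset _) hJ htJ hs).congr
        (Eventually.of_forall fun _ => rfl) (heq.symm.fun_comp (cylCoord (cylY (γ t)))) ?_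
      exact ContinuousAt.comp (f := γ) ((cylCoord (cylY (γ t))).contMDiffOn_toFun.contMDiffAt
        ((cylCoord (cylY (γ t))).open_source.mem_nhds hs)).continuousAt (hγ t htJ).continuousAt
    · have ht := ht.resolve_left htJ
      obtain ⟨⟨h1, h2, h3⟩, -⟩ := hball t ht
      have heq : γ' =ᶠ[𝓝 t] Θ.symm ∘ z' := by
        filter_upwards [isOpen_Ioo.mem_nhds ht] with s hs using hγ'I s hs
      have hs : γ' t ∈ Θ.source := by
        rw [hγ'I t ht]
        exact Θ.map_target h1
      refine ⟨ContMDiffAt.congr_of_eventuallyEq ?_ heq, Θ, hΘsub, hs, ?_⟩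
      · exact (Θ.contMDiffOn_invFun.contMDiffAt (Θ.open_target.mem_nhds h1)).comp t h2.contMDiffAt
      · refine h3.congr (Eventually.of_forall fun _ => rfl) ?_ h2.continuousAt
        filter_upwards [isOpen_Ioo.mem_nhds ht] with s hs
        rw [Function.comp_apply, hγ'I s hs]
        exact (Θ.right_inv (hball s hs).1.1).symm
  have hfin := hmax _ γ' hJ' hord subset_union_left hnull fun t ht => (hγ'J t (hlt t ht)).symm
  have hb : b ∈ J := by
    rw [← hfin]
    exact Or.inr ⟨by linarith, by linarith⟩
  exact lt_irrefl b (hlt b hb)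

end CylinderDynamics

section CylinderConnect

variable {Y : ClosedManifold.{u} m} {k : BilinFamily Y} {S : Set ℝ} {γ : ℝ → Y.cylinder} {J : Set ℝ}

theorem tendsto_nhdsSet_base {l : Filter ℝ} {r : Bool} {a : ℝ} (ha : 0 < a)
    (h : Tendsto (fun t => flipIf r (cylR (γ t))) l (𝓝 0)) :
    Tendsto γ l (𝓝ˢ (cylCollar Y r ha).base) := by
  rw [(hasBasis_nhdsSet _).tendsto_right_iff]
  rintro U ⟨hU, hsub⟩
  obtain ⟨d, hd, hmem⟩ := (cylCollar Y r ha).exists_forall_mem hU hsub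
  have h1 : ∀ᶠ t in l, a * flipIf r (cylR (γ t)) < min a d := by
    have h2 := h.const_mul a
    rw [mul_zero] at h2
    exact h2.eventually (gt_mem_nhds (lt_min ha hd))
  filter_upwards [h1] with t ht
  have h2 := hmem (a * flipIf r (cylR (γ t))) ⟨mul_nonneg ha.le (flipIf_mem.2 (cylR_mem _)).1,
    ht.trans_le (min_le_left _ _)⟩ (ht.trans_le (min_le_right _ _)) (cylY (γ t))
  rwa [cylCollar_apply, mul_div_cancel_left₀ _ ha.ne', flipIf_flipIf, cylPt_eta] at h2

theorem IsMaximalNullGeodesic.eq_univ (hk : IsMetricFamily k S)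
    (H : IsMaximalNullGeodesic (cylMetric k) γ J) : J = univ := by
  have h1 := H.not_bddAbove hk
  have h2 := H.comp_neg.not_bddAbove hk
  rw [not_bddAbove_iff] at h1 h2
  refine eq_univ_of_forall fun t => ?_
  obtain ⟨b, hb, htb⟩ := h1 t
  obtain ⟨a, ha, hta⟩ := h2 (-t)
  exact H.2.2.1.out ha hb ⟨by linarith, htb.le⟩

theorem IsNullGeodesicOn.tendsto_of_deriv_ge (h : IsNullGeodesicOn (cylMetric k) γ univ) {c : ℝ}
    (hc : 0 < c) (hb : ∀ t, c * cylX (cylR (γ t)) ^ 2 ≤ deriv (cylR ∘ γ) t) :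
    Tendsto (fun t => cylR (γ t)) atTop (𝓝 1) ∧ Tendsto (fun t => cylR (γ t)) atBot (𝓝 0) := by
  have hd : ∀ t, HasDerivAt (fun t => cylR (γ t)) (deriv (cylR ∘ γ) t) t := fun t =>
    h.hasDerivAt_cylR isOpen_univ (mem_univ t)
  have hmem : ∀ t, cylR (γ t) ∈ Ioo (0 : ℝ) 1 := fun t => h.cylR_mem (mem_univ t)
  have hX : Continuous cylX := contDiff_cylX.continuous
  refine ⟨tendsto_one_of_deriv_ge (w := fun s => c * cylX s ^ 2) (by fun_prop)
    (fun s hs => mul_pos hc (pow_pos (cylX_pos hs) 2)) hd hmem hb, ?_⟩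
  have h1 := tendsto_one_of_deriv_ge (R := fun t => 1 - cylR (γ (-t)))
    (R' := fun t => deriv (cylR ∘ γ) (-t)) (w := fun s => c * cylX (1 - s) ^ 2) (by fun_prop)
    (fun s hs => mul_pos hc (pow_pos (cylX_pos ⟨by linarith [hs.2], by linarith [hs.1]⟩) 2))
    (fun t => by simpa using ((hd (-t)).scomp t (hasDerivAt_neg t)).const_sub 1)
    (fun t => ⟨by linarith [(hmem (-t)).2], by linarith [(hmem (-t)).1]⟩)
    (fun t => by rw [sub_sub_cancel]; exact hb (-t))
  have h2 := (h1.const_sub 1).comp tendsto_neg_atBot_atTop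
  simpa [Function.comp_def] using h2

theorem nullGeodesicsConnect_cylMetric (hk : IsMetricFamily k S) {a b : ℝ} (ha : 0 < a) (hb : 0 < b) :
    NullGeodesicsConnect (cylMetric k) (cylCollar Y false ha).base (cylCollar Y true hb).base := by
  have key : ∀ {γ : ℝ → Y.cylinder}, Tendsto (fun t => cylR (γ t)) atTop (𝓝 1) ∧
      Tendsto (fun t => cylR (γ t)) atBot (𝓝 0) →
      Tendsto γ atTop (𝓝ˢ (cylCollar Y true hb).base) ∧
      Tendsto γ atBot (𝓝ˢ (cylCollar Y false ha).base) := fun {γ} h =>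
    ⟨tendsto_nhdsSet_base hb (by simpa [flipIf] using h.1.const_sub 1),
      tendsto_nhdsSet_base ha (by simpa [flipIf] using h.2)⟩
  intro J γ H
  obtain rfl := H.eq_univ hk
  refine ⟨rfl, ?_⟩
  obtain ⟨e, he, c, hc, C, hbd⟩ := H.2.2.2.1.exists_speed_bound hk isOpen_univ
    ordConnected_univ (mem_univ (0 : ℝ))
  rcases (abs_eq zero_le_one).1 he with rfl | rfl
  · exact Or.inr (key (H.2.2.2.1.tendsto_of_deriv_ge hc fun t => by
      simpa using (hbd t (mem_univ t)).1))
  · obtain ⟨h1, h2⟩ := key (γ := fun t => γ (-t))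
      (IsNullGeodesicOn.tendsto_of_deriv_ge (c := c) (k := k) H.comp_neg.2.2.2.1 hc fun t => by
        rw [show cylR ∘ (fun t => γ (-t)) = fun t => (cylR ∘ γ) (-t) from rfl, deriv_comp_neg]
        simpa using (hbd (-t) (mem_univ _)).1)
    refine Or.inl ⟨?_, ?_⟩
    · simpa [Function.comp_def] using h2.comp tendsto_neg_atTop_atBot
    · simpa [Function.comp_def] using h1.comp tendsto_neg_atBot_atTop

theorem IsEvenAsymptoticallyHyperbolic.exists_deSitter {X : CompactManifoldWithBoundary.{u} m}
    {c : Collar X Y} {g : BilinField X} {x : X → ℝ} (H : IsEvenAsymptoticallyHyperbolic c g x) :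
    ∃ (X0 : CompactManifoldWithBoundary.{u} m) (c0P c0M : Collar X0 Y) (g0 : BilinField X0)
      (x0 : X0 → ℝ), IsEvenAsymptoticallyDeSitter c0P c0M g0 x0 ∧
      HasGlobalOperator c g x c0P c0M g0 x0 c g x := by
  obtain ⟨δ, hδ, hδε, h, hs, hpos, hend⟩ := H.even.isEvenEnd (one_mul 1)
  set a := √(δ / 2) with ha_def
  have ha : 0 < a := Real.sqrt_pos.2 (half_pos hδ)
  have ha2 : a ^ 2 < δ := by
    rw [ha_def, Real.sq_sqrt (half_pos hδ).le]
    linarith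
  set k := cylFamily a h
  have hk : IsMetricFamily k (Ioo (-1) 2) := ⟨isOpen_Ioo, smoothOnSet_cylFamily ha2 hs,
    Icc_subset_Ioo (by norm_num) (by norm_num), fun R hR y =>
      isPosDefForm_cylFamily ha ha2 hpos hR y⟩
  have hd0 : 0 < (a / 3) ^ 2 := by positivity
  have hda : (a / 3) ^ 2 ≤ a ^ 2 := pow_le_pow_left₀ (by positivity) (by linarith) 2
  have hsub : Ioo (-(a / 3) ^ 2) ((a / 3) ^ 2) ⊆ Ioo (-δ) δ :=
    Ioo_subset_Ioo (by linarith) (by linarith)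
  have hs' : h.SmoothOnSet (Ioo (-(a / 3) ^ 2) ((a / 3) ^ 2)) := hs.mono (prod_mono hsub subset_rfl)
  have hpos' := fun t ht => hpos t (hsub ht)
  have hcc := isConformallyCompact_cylMetric ha hk
  have hnear : ∀ r : Bool, IsEvenNear (-1) (cylCollar Y r ha) (cylMetric k)
      (fun p => a * cylX (cylR p)) := fun r =>
    IsEndForm.isEvenNear hd0 hda (isEndForm_cylMetric ha h r le_rfl) (fun y => by
      have h1 : (cylCollar Y r ha).φ (0, y) ∈ (cylCollar Y r ha).base :=
        Collar.mem_base.2 ⟨y, rfl⟩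
      rw [mem_base_cylCollar] at h1
      have h2 : cylX (flipIf r (flipIf r (cylR ((cylCollar Y r ha).φ (0, y))))) = 0 := by
        rw [h1, cylX_flipIf r (by norm_num)]
      rw [flipIf_flipIf] at h2
      rw [h2, mul_zero]) hs' hpos'
  have hmatch : ∀ r : Bool, IsMatchedEnd c (cylCollar Y r ha) g x (cylMetric k)
      (fun p => a * cylX (cylR p)) ((a / 3) ^ 2) h := fun r =>
    ⟨hd0, by linarith, hda, hs', hpos', fun s h0 hsd => hend s h0 (by linarith),
      isEndForm_cylMetric ha h r le_rfl⟩
  exact ⟨Y.cylinder, cylCollar Y false ha, cylCollar Y true ha, cylMetric k, _,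
    ⟨hcc, boundarySet_cylinder ha ha, disjoint_cylinder ha ha, hnear false, hnear true,
      nullGeodesicsConnect_cylMetric hk ha ha⟩,
    hasGlobalOperator_of_matched H.conformallyCompact H.boundary_eq hcc
      (boundarySet_cylinder ha ha) (disjoint_cylinder ha ha) H.conformallyCompact H.boundary_eq
      (hmatch false) (hmatch true)⟩

end CylinderConnect

end

theorem mainTheorem5 (m : ℕ) :
    -- Starting from an even asymptotically hyperbolic space `(X₊, g₊)`.
    (∀ (XP : CompactManifoldWithBoundary.{u} m) (YP : ClosedManifold.{u} m) (cP : Collar XP YP)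
      (gP : BilinField XP) (xP : XP → ℝ), IsEvenAsymptoticallyHyperbolic cP gP xP →
      ∃ (X0 XM : CompactManifoldWithBoundary.{u} m) (YM : ClosedManifold.{u} m)
        (c0P : Collar X0 YP) (c0M : Collar X0 YM) (g0 : BilinField X0) (x0 : X0 → ℝ)
        (cM : Collar XM YM) (gM : BilinField XM) (xM : XM → ℝ),
        IsEvenAsymptoticallyDeSitter c0P c0M g0 x0 ∧
        IsEvenAsymptoticallyHyperbolic cM gM xM ∧
        HasGlobalOperator cP gP xP c0P c0M g0 x0 cM gM xM) ∧
    -- Starting from an even asymptotically de Sitter space `(X₀, g₀)`.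
    (∀ (X0 : CompactManifoldWithBoundary.{u} m) (YP YM : ClosedManifold.{u} m)
      (c0P : Collar X0 YP) (c0M : Collar X0 YM) (g0 : BilinField X0) (x0 : X0 → ℝ),
      IsEvenAsymptoticallyDeSitter c0P c0M g0 x0 →
      -- If `Y₊` and `Y₋` bound, then `X₀` itself and any manifolds that they bound can be used.
      (∀ (XP XM : CompactManifoldWithBoundary.{u} m) (cP : Collar XP YP) (cM : Collar XM YM),
        XP.boundarySet = cP.base → XM.boundarySet = cM.base →
        ∃ (gP : BilinField XP) (xP : XP → ℝ) (gM : BilinField XM) (xM : XM → ℝ),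
          IsEvenAsymptoticallyHyperbolic cP gP xP ∧
          IsEvenAsymptoticallyHyperbolic cM gM xM ∧
          HasGlobalOperator cP gP xP c0P c0M g0 x0 cM gM xM) ∧
      -- In any case two copies of `X₀` can be used.
      ∃ (XP XM : CompactManifoldWithBoundary.{u} m)
        (cP : Collar XP YP.double) (gP : BilinField XP) (xP : XP → ℝ)
        (cM : Collar XM YM.double) (gM : BilinField XM) (xM : XM → ℝ),
        IsEvenAsymptoticallyHyperbolic cP gP xP ∧
        IsEvenAsymptoticallyHyperbolic cM gM xM ∧
        HasGlobalOperator cP gP xP c0P.double c0M.double g0.double (x0 ∘ X0.fold) cM gM xM) := by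
  refine ⟨fun XP YP cP gP xP H => ?_, fun X0 YP YM c0P c0M g0 x0 H =>
    ⟨fun XP XM cP cM hP hM => H.isEvenLorentzian.exists_hyperbolic cP cM hP hM, ?_⟩⟩
  · obtain ⟨X0, c0P, c0M, g0, x0, h0, hop⟩ := H.exists_deSitter
    exact ⟨X0, XP, YP, c0P, c0M, g0, x0, cP, gP, xP, h0, H, hop⟩
  · obtain ⟨gP, xP, gM, xM, h⟩ := H.isEvenLorentzian.double.exists_hyperbolic (cylDoubleCollar YP)
      (cylDoubleCollar YM) boundarySet_eq_base_cylDoubleCollar boundarySet_eq_base_cylDoubleCollar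
    exact ⟨YP.cylinder, YM.cylinder, cylDoubleCollar YP, gP, xP, cylDoubleCollar YM, gM, xM, h⟩
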